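/- Let $n=3$ or let $n\ge 4$ be even, and consider $n$-dimensional Minkowski space with metric $\eta=\mathrm{diag}(-1,1,\dots,1)$. Local functions are functions of a symmetric tensor field $h_{\mu\nu}$, of the antifields $h^{*\mu\nu}=h^{*\nu\mu}$ (anticommuting, antifield number $1$), $C^{*\mu}$ and $\xi^*$ (commuting, antifield number $2$), and of finitely many of their derivatives; they are polynomial in all these variables except that the dependence on the undifferentiated $h_{\mu\nu}$ may be an arbitrary smooth one, and they do not depend explicitly on the spacetime point. (No ghosts are involved.) Local $p$-forms have local functions as coefficients, and $d=dx^\mu\partial_\mu$ with the total derivatives $\partial_\mu$. Let $\mathcal L_0$ be the free Lagrangian of linearized conformal gravity: $\mathcal L_0=\tfrac12\,\mathcal W_{\alpha\beta\gamma\delta}\,\Box^{(n-4)/2}\,\mathcal W^{\alpha\beta\gamma\delta}$ for even $n\ge4$, where $\mathcal W$ is the linearized Weyl tensor of $h$ (so $\mathcal L_0=\tfrac12\mathcal W^2$ for $n=4$), and $\mathcal L_0=\tfrac12\,\varepsilon_{\mu\alpha\beta}\,G^{\alpha\nu}\,\partial^\mu h^\beta{}_\nu$ for $n=3$, where $G$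 is the linearized Einstein tensor. Let $\delta$ be the Koszul--Tate differential, that is the graded derivation commuting with $\partial_\mu$, acting on the coefficients of forms, with $$\delta h_{\mu\nu}=0,\qquad \delta h^{*\mu\nu}=\frac{\delta\mathcal L_0}{\delta h_{\mu\nu}},\qquad \delta C^{*\mu}=-2\,\partial_\nu h^{*\mu\nu},\qquad \delta\xi^*=2\,\eta_{\mu\nu}h^{*\mu\nu}.$$ **Theorem.** The forms $\lambda_\mu C^{*\mu}\,dx^0\wedge\dots\wedge dx^{n-1}$ with constant $\lambda_\mu\in\mathbb R$ are a complete set of representatives of $H^n_2(\delta|d)$. Explicitly: 1. for all constants $\lambda_\mu$ there is a local $(n-1)$-form $a^{n-1}_1$ of antifield number $1$ with $\delta(\lambda_\mu C^{*\mu}\,dx^0\wedge\dots\wedge dx^{n-1})+d a^{n-1}_1=0$; 2. if $a^n_2$ is a local $n$-form of antifield number $2$ and $\delta a^n_2+d a^{n-1}_1=0$ for some local $(n-1)$-form $a^{n-1}_1$ of antifield number $1$, then there are constants $\lambda_\mu$, a local $n$-form $b^n_3$ of antifield number $3$ and a local $(n-1)$-form $b^{n-1}_2$ of antifield number $2$ such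 that $$a^n_2=\lambda_\mu C^{*\mu}\,dx^0\wedge\dots\wedge dx^{n-1}+\delta b^n_3+d b^{n-1}_2;$$ 3. if $\lambda_\mu C^{*\mu}\,dx^0\wedge\dots\wedge dx^{n-1}=\delta b^n_3+d b^{n-1}_2$ for such $b^n_3$, $b^{n-1}_2$ and constants $\lambda_\mu$, then $\lambda_\mu=0$ for all $\mu$. -/

import Mathlib

open scoped TensorProduct ContDiff

noncomputable section

namespace ConformalGravity

/-! ### The algebra of local functions

Spacetime is `ℝⁿ` with coordinates indexed by `Fin n` (`0` is the time direction).  The symmetric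
tensors `h_{μν}` and `h^{*μν}` have their independent components indexed by `Sym2 (Fin n)`.
The local functions without ghosts are polynomials in the derivatives of `h_{μν}` of positive
order and in all the antifields and their derivatives, whose coefficients are smooth functions
of the undifferentiated `h_{μν}`.  They do not depend explicitly on the spacetime point. -/

/-- `J μ` is the number of derivatives in the direction `μ`. -/
abbrev MultiIndex (n : ℕ) : Type := Fin n → ℕ

/-- One more derivative, in the direction `μ`. -/
def raise {n : ℕ} (J : MultiIndex n) (μ : Fin n) : MultiIndex n := J + Pi.single μ 1

lemma raise_ne_zero {n : ℕ} (J : MultiIndex n) (μ : Fin n) : raise J μ ≠ 0 := by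
  intro h
  have := congrFun h μ
  simp [raise] at this

/-- The algebra of smooth functions of the undifferentiated field `h_{μν}`. -/
def smoothSubalgebra (n : ℕ) : Subalgebra ℝ ((Sym2 (Fin n) → ℝ) → ℝ) where
  carrier := {f | ContDiff ℝ ∞ f}
  mul_mem' {f g} hf hg := ContDiff.mul (show ContDiff ℝ ∞ f from hf) (show ContDiff ℝ ∞ g from hg)
  add_mem' {f g} hf hg := ContDiff.add (show ContDiff ℝ ∞ f from hf) (show ContDiff ℝ ∞ g from hg)
  algebraMap_mem' c := show ContDiff ℝ ∞ (fun _ => c) from contDiff_const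

/-- Smooth functions of the undifferentiated field `h_{μν}`. -/
def SmoothFun (n : ℕ) : Type := smoothSubalgebra n

instance (n : ℕ) : CommRing (SmoothFun n) := inferInstanceAs (CommRing (smoothSubalgebra n))

instance (n : ℕ) : Algebra ℝ (SmoothFun n) := inferInstanceAs (Algebra ℝ (smoothSubalgebra n))

/-- The coordinate function `h_s` on the space of undifferentiated fields. -/
def smoothCoord {n : ℕ} (s : Sym2 (Fin n)) : SmoothFun n :=
  ⟨fun x => x s, show ContDiff ℝ ∞ (fun x : Sym2 (Fin n) → ℝ => x s) from contDiff_apply ℝ ℝ s⟩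

lemma SmoothFun.contDiff {n : ℕ} (f : SmoothFun n) : ContDiff ℝ ∞ f.1 := f.2

/-- The partial derivative `∂/∂h_s` on smooth functions of the undifferentiated field. -/
def smoothPartial {n : ℕ} (s : Sym2 (Fin n)) : SmoothFun n →ₗ[ℝ] SmoothFun n where
  toFun f := ⟨fun x => fderiv ℝ f.1 x (Pi.single s 1),
    show ContDiff ℝ ∞ (fun x => fderiv ℝ f.1 x (Pi.single s 1)) from
      (f.contDiff.fderiv_right (m := ∞) le_rfl).clm_apply contDiff_const⟩
  map_add' f g := by
    apply Subtype.ext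
    funext x
    have hf : DifferentiableAt ℝ f.1 x := f.contDiff.differentiable (by simp) x
    have hg : DifferentiableAt ℝ g.1 x := g.contDiff.differentiable (by simp) x
    change fderiv ℝ (f.1 + g.1) x (Pi.single s 1) =
      fderiv ℝ f.1 x (Pi.single s 1) + fderiv ℝ g.1 x (Pi.single s 1)
    rw [fderiv_add hf hg]
    rfl
  map_smul' c f := by
    apply Subtype.ext
    funext x
    have hf : DifferentiableAt ℝ f.1 x := f.contDiff.differentiable (by simp) x
    change fderiv ℝ (c • f.1) x (Pi.single s 1) = c • fderiv ℝ f.1 x (Pi.single s 1)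
    rw [fderiv_const_smul hf]
    rfl

/-- The commuting generators other than the undifferentiated `h`: the derivatives
`∂_J h_s` with `J ≠ 0`, and `∂_J C^{*μ}`, `∂_J ξ^*` with arbitrary `J`. -/
inductive EvenVar (n : ℕ) : Type
  | h (s : Sym2 (Fin n)) (J : MultiIndex n) (hJ : J ≠ 0) : EvenVar n
  | Cstar (μ : Fin n) (J : MultiIndex n) : EvenVar n
  | xistar (J : MultiIndex n) : EvenVar n

/-- The anticommuting generators `∂_J h^{*s}`. -/
abbrev OddVar (n : ℕ) : Type := Sym2 (Fin n) × MultiIndex n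

/-- Local functions of the commuting variables `h`, `C^*`, `ξ^*`. -/
abbrev EvenAlg (n : ℕ) : Type := MvPolynomial (EvenVar n) (SmoothFun n)

/-- The Grassmann algebra on the anticommuting variables. -/
abbrev OddAlg (n : ℕ) : Type := ExteriorAlgebra ℝ (OddVar n →₀ ℝ)

/-- Local functions of the field `h` and of the antifields `h^*`, `C^*`, `ξ^*`. -/
def LocalFun (n : ℕ) : Type := EvenAlg n ⊗[ℝ] OddAlg n

instance (n : ℕ) : Ring (LocalFun n) := inferInstanceAs (Ring (EvenAlg n ⊗[ℝ] OddAlg n))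

instance (n : ℕ) : Algebra ℝ (LocalFun n) :=
  inferInstanceAs (Algebra ℝ (EvenAlg n ⊗[ℝ] OddAlg n))

instance (n : ℕ) : Module (EvenAlg n) (LocalFun n) :=
  inferInstanceAs (Module (EvenAlg n) (EvenAlg n ⊗[ℝ] OddAlg n))

instance (n : ℕ) : Module (SmoothFun n) (LocalFun n) :=
  inferInstanceAs (Module (SmoothFun n) (EvenAlg n ⊗[ℝ] OddAlg n))

instance (n : ℕ) : IsScalarTower (SmoothFun n) (EvenAlg n) (LocalFun n) :=
  inferInstanceAs (IsScalarTower (SmoothFun n) (EvenAlg n) (EvenAlg n ⊗[ℝ] OddAlg n))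

instance (n : ℕ) : IsScalarTower ℝ (SmoothFun n) (LocalFun n) :=
  inferInstanceAs (IsScalarTower ℝ (SmoothFun n) (EvenAlg n ⊗[ℝ] OddAlg n))

/-- The commuting variables as local functions. -/
def ofEven (n : ℕ) : EvenAlg n →ₐ[ℝ] LocalFun n :=
  (Algebra.TensorProduct.includeLeft : EvenAlg n →ₐ[ℝ] EvenAlg n ⊗[ℝ] OddAlg n)

/-- The anticommuting variables as local functions. -/
def ofOdd (n : ℕ) : OddAlg n →ₐ[ℝ] LocalFun n :=
  (Algebra.TensorProduct.includeRight : OddAlg n →ₐ[ℝ] EvenAlg n ⊗[ℝ] OddAlg n)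

lemma ofOdd_mul_ofEven {n : ℕ} (w : OddAlg n) (r : EvenAlg n) :
    ofOdd n w * ofEven n r = ofEven n r * ofOdd n w := by
  have h : ((1 : EvenAlg n) ⊗ₜ[ℝ] w) * (r ⊗ₜ[ℝ] (1 : OddAlg n)) =
      (r ⊗ₜ[ℝ] (1 : OddAlg n)) * ((1 : EvenAlg n) ⊗ₜ[ℝ] w) := by
    rw [Algebra.TensorProduct.tmul_mul_tmul, Algebra.TensorProduct.tmul_mul_tmul]
    simp
  exact h

/-- The linear map on local functions determined by its values on the products `r w` of a
function `r` of the commuting variables and a function `w` of the anticommuting ones. -/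
def localLift {n : ℕ} (φ : EvenAlg n →ₗ[ℝ] OddAlg n →ₗ[ℝ] LocalFun n) :
    LocalFun n →ₗ[ℝ] LocalFun n :=
  (TensorProduct.lift φ : EvenAlg n ⊗[ℝ] OddAlg n →ₗ[ℝ] LocalFun n)

lemma localLift_mul {n : ℕ} (φ : EvenAlg n →ₗ[ℝ] OddAlg n →ₗ[ℝ] LocalFun n) (r : EvenAlg n)
    (w : OddAlg n) : localLift φ (ofEven n r * ofOdd n w) = φ r w := by
  have h : ofEven n r * ofOdd n w = (r ⊗ₜ[ℝ] w : EvenAlg n ⊗[ℝ] OddAlg n) := by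
    have h1 : (r ⊗ₜ[ℝ] (1 : OddAlg n)) * ((1 : EvenAlg n) ⊗ₜ[ℝ] w) = r ⊗ₜ[ℝ] w := by
      rw [Algebra.TensorProduct.tmul_mul_tmul, one_mul, mul_one]
    exact h1
  rw [h]
  exact TensorProduct.lift.tmul r w

/-- The map `r w ↦ (D r) w + r (E w)` on local functions, for `r` in the commuting and `w` in the
anticommuting variables. -/
def extendLocal {n : ℕ} (D : EvenAlg n →ₗ[ℝ] LocalFun n) (E : OddAlg n →ₗ[ℝ] LocalFun n) :
    LocalFun n →ₗ[ℝ] LocalFun n :=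
  localLift ((LinearMap.mul ℝ (LocalFun n)).compl₁₂ D (ofOdd n).toLinearMap +
    (LinearMap.mul ℝ (LocalFun n)).compl₁₂ (ofEven n).toLinearMap E)

lemma extendLocal_mul {n : ℕ} (D : EvenAlg n →ₗ[ℝ] LocalFun n)
    (E : OddAlg n →ₗ[ℝ] LocalFun n) (r : EvenAlg n) (w : OddAlg n) :
    extendLocal D E (ofEven n r * ofOdd n w) = D r * ofOdd n w + ofEven n r * E w := by
  simp [extendLocal, localLift_mul]

variable {n : ℕ}

/-- The jet variable `∂_J h_s`. -/
def hJet (s : Sym2 (Fin n)) (J : MultiIndex n) : EvenAlg n :=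
  open Classical in
  if hJ : J = 0 then MvPolynomial.C (smoothCoord s) else MvPolynomial.X (EvenVar.h s J hJ)

/-- The jet variable `∂_J h^{*s}` in the Grassmann algebra. -/
def hstarOdd (s : Sym2 (Fin n)) (J : MultiIndex n) : OddAlg n :=
  ExteriorAlgebra.ι ℝ (Finsupp.single (s, J) 1)

/-- The jet variable `∂_J h^{*s}` as a local function. -/
def hstar (s : Sym2 (Fin n)) (J : MultiIndex n) : LocalFun n :=
  ofOdd n (hstarOdd s J)

/-- The antifield `C^{*μ}`. -/
def Cstar (μ : Fin n) : LocalFun n :=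
  ofEven n (MvPolynomial.X (EvenVar.Cstar μ 0))

/-! ### Derivations of the Grassmann algebra -/

/-- Extension of a linear map on the anticommuting generators to the Grassmann algebra, along the
algebra map `j`, by the rule `D (v w) = (D v) (j w) + e (j v) (D w)` for generators `v`; thus
`e = 1` gives a derivation and `e = -1` an antiderivation. -/
def extendOdd {B : Type*} [Ring B] [Algebra ℝ B] (j : OddAlg n →ₐ[ℝ] B) (e : ℝ)
    (L : (OddVar n →₀ ℝ) →ₗ[ℝ] B)
    (hL : ∀ v, e • (j (ExteriorAlgebra.ι ℝ v) * L v) + L v * j (ExteriorAlgebra.ι ℝ v) = 0) :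
    OddAlg n →ₗ[ℝ] B :=
  (LinearMap.proj (R := ℝ) (φ := fun _ : Fin 2 => B) 1 ∘ₗ
      LinearMap.proj (R := ℝ) (φ := fun _ : Fin 2 => Fin 2 → B) 0) ∘ₗ
    (Matrix.ofLinearEquiv ℝ).symm.toLinearMap ∘ₗ
    (ExteriorAlgebra.lift ℝ
      ⟨{ toFun := fun v => !![e • j (ExteriorAlgebra.ι ℝ v), L v; 0, j (ExteriorAlgebra.ι ℝ v)]
         map_add' := fun v w => by
           ext i k
           fin_cases i <;> fin_cases k <;> simp
         map_smul' := fun c v => by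
           ext i k
           fin_cases i <;> fin_cases k <;> simp [smul_comm c e] },
        fun v => by
          have h0 : j (ExteriorAlgebra.ι ℝ v) * j (ExteriorAlgebra.ι ℝ v) = 0 := by
            rw [← map_mul, ExteriorAlgebra.ι_sq_zero, map_zero]
          have h1 := hL v
          ext i k
          fin_cases i <;> fin_cases k <;>
            simp [Matrix.mul_apply, Fin.sum_univ_two, h0, h1]⟩).toLinearMap

/-- The derivation of the Grassmann algebra that extends a linear map of its generators. -/
def oddDerivation (L : (OddVar n →₀ ℝ) →ₗ[ℝ] (OddVar n →₀ ℝ)) : OddAlg n →ₗ[ℝ] OddAlg n :=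
  extendOdd (AlgHom.id ℝ (OddAlg n)) 1 (ExteriorAlgebra.ι ℝ ∘ₗ L) (fun v => by
    rw [one_smul]
    exact ExteriorAlgebra.ι_add_mul_swap v (L v))

/-! ### Total derivatives -/

/-- The partial derivative `∂/∂h_s` with respect to the undifferentiated field, acting on the
coefficients of the monomials. -/
def coeffPartial (s : Sym2 (Fin n)) : EvenAlg n →ₗ[ℝ] EvenAlg n :=
  ((MvPolynomial.basisMonomials (EvenVar n) (SmoothFun n)).repr.symm.restrictScalars
      ℝ).toLinearMap ∘ₗ Finsupp.mapRange.linearMap (smoothPartial s) ∘ₗ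
    ((MvPolynomial.basisMonomials (EvenVar n) (SmoothFun n)).repr.restrictScalars ℝ).toLinearMap

lemma coeffPartial_monomial (s : Sym2 (Fin n)) (k : EvenVar n →₀ ℕ) (f : SmoothFun n) :
    coeffPartial s (MvPolynomial.monomial k f) = MvPolynomial.monomial k (smoothPartial s f) := by
  have h1 : MvPolynomial.monomial k f =
      f • MvPolynomial.basisMonomials (EvenVar n) (SmoothFun n) k := by
    simp [MvPolynomial.smul_monomial]
  have h2 : (MvPolynomial.basisMonomials (EvenVar n) (SmoothFun n)).repr
      (MvPolynomial.monomial k f) = Finsupp.single k f := by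
    rw [h1, map_smul, Module.Basis.repr_self, Finsupp.smul_single, smul_eq_mul, mul_one]
  simp only [coeffPartial, LinearMap.comp_apply, LinearEquiv.coe_coe,
    LinearEquiv.restrictScalars_apply]
  rw [h2, Finsupp.mapRange.linearMap_apply, Finsupp.mapRange_single,
    Module.Basis.repr_symm_single]
  simp [MvPolynomial.smul_monomial]

/-- The partial derivative `∂/∂(∂_J h_s)`. -/
def hPartial (s : Sym2 (Fin n)) (J : MultiIndex n) : EvenAlg n →ₗ[ℝ] EvenAlg n :=
  open Classical in
  if hJ : J = 0 then coeffPartial s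
  else (MvPolynomial.pderiv (EvenVar.h s J hJ)).toLinearMap.restrictScalars ℝ

/-- Total derivative of the commuting generators. -/
def EvenVar.shift (μ : Fin n) : EvenVar n → EvenVar n
  | .h s J _ => .h s (raise J μ) (raise_ne_zero J μ)
  | .Cstar ν J => .Cstar ν (raise J μ)
  | .xistar J => .xistar (raise J μ)

/-- The total derivative `∂_μ` on local functions of the commuting variables. -/
def evenTotalDeriv (μ : Fin n) : EvenAlg n →ₗ[ℝ] EvenAlg n :=
  (∑ s : Sym2 (Fin n), LinearMap.mulLeft ℝ (hJet s (raise 0 μ)) ∘ₗ coeffPartial s) +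
    (MvPolynomial.mkDerivation (SmoothFun n)
      (fun v : EvenVar n => (MvPolynomial.X (v.shift μ) : EvenAlg n))).toLinearMap.restrictScalars ℝ

/-- The total derivative `∂_μ` on the Grassmann algebra. -/
def oddTotalDeriv (μ : Fin n) : OddAlg n →ₗ[ℝ] OddAlg n :=
  oddDerivation (Finsupp.lmapDomain ℝ ℝ (fun v : OddVar n => (v.1, raise v.2 μ)))

/-- The total derivative `∂_μ` on local functions. -/
def totalDeriv (μ : Fin n) : LocalFun n →ₗ[ℝ] LocalFun n :=
  extendLocal ((ofEven n).toLinearMap ∘ₗ evenTotalDeriv μ)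
    ((ofOdd n).toLinearMap ∘ₗ oddTotalDeriv μ)

/-- The iterated total derivative `∂_J` on local functions of the commuting variables. -/
def evenTotalDerivIter (J : MultiIndex n) : Module.End ℝ (EvenAlg n) :=
  (List.ofFn fun μ : Fin n => (evenTotalDeriv μ : Module.End ℝ (EvenAlg n)) ^ J μ).prod

/-! ### The free Lagrangian -/

/-- The Minkowski metric `diag(-1, 1, …, 1)`; it is its own inverse. -/
def eta (μ ν : Fin n) : ℝ := if μ = ν then (if (μ : ℕ) = 0 then -1 else 1) else 0

/-- `∂_μ ∂_ν h_{αβ}`. -/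
def ddh (μ ν α β : Fin n) : EvenAlg n := hJet s(α, β) (raise (raise 0 μ) ν)

/-- The linearized Riemann tensor, all indices down. -/
def riemann (α β μ ν : Fin n) : EvenAlg n :=
  (-(1 / 2) : ℝ) • (ddh α μ β ν + ddh β ν α μ - ddh α ν β μ - ddh β μ α ν)

/-- The linearized Ricci tensor `R_{βν} = η^{αμ} R_{αβμν}`. -/
def ricci (β ν : Fin n) : EvenAlg n := ∑ α, ∑ μ, eta α μ • riemann α β μ ν

/-- The linearized scalar curvature. -/
def scalarCurv (n : ℕ) : EvenAlg n := ∑ μ : Fin n, ∑ ν, eta μ ν • ricci μ ν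

/-- The linearized Weyl tensor, all indices down. -/
def weyl (α β γ δ : Fin n) : EvenAlg n :=
  riemann α β γ δ
    - (1 / ((n : ℝ) - 2)) • (eta α γ • ricci δ β - eta α δ • ricci γ β
        - eta β γ • ricci δ α + eta β δ • ricci γ α)
    + ((1 / (((n : ℝ) - 2) * ((n : ℝ) - 1))) * (eta α γ * eta δ β - eta α δ * eta γ β)) •
        scalarCurv n

/-- The linearized Einstein tensor, indices down. -/
def einstein (μ ν : Fin n) : EvenAlg n := ricci μ ν - ((1 / 2 : ℝ) * eta μ ν) • scalarCurv n

/-- The d'Alembertian. -/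
def box (n : ℕ) : Module.End ℝ (EvenAlg n) :=
  ∑ μ : Fin n, eta μ μ • ((evenTotalDeriv μ : Module.End ℝ (EvenAlg n)) ^ 2)

/-- For indices in `{0, 1, 2}` this is the Levi-Civita symbol, `ε_{012} = 1`. -/
def epsilon3 (μ α β : Fin n) : ℝ :=
  (((α : ℕ) : ℝ) - (μ : ℕ)) * (((β : ℕ) : ℝ) - (μ : ℕ)) * (((β : ℕ) : ℝ) - (α : ℕ)) / 2

/-- The Lagrangian `½ ε_{μαβ} G^{αν} ∂^μ h^β_ν` (meant for `n = 3`). -/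
def chernSimonsLagrangian (n : ℕ) : EvenAlg n :=
  (1 / 2 : ℝ) • ∑ μ : Fin n, ∑ α : Fin n, ∑ β : Fin n, ∑ ν : Fin n,
    (epsilon3 μ α β * (eta α α * eta ν ν * eta μ μ * eta β β)) •
      (einstein α ν * hJet s(β, ν) (raise 0 μ))

/-- The Lagrangian `½ W_{αβγδ} □^{(n-4)/2} W^{αβγδ}` (meant for even `n ≥ 4`). -/
def weylLagrangian (n : ℕ) : EvenAlg n :=
  (1 / 2 : ℝ) • ∑ α : Fin n, ∑ β : Fin n, ∑ γ : Fin n, ∑ δ : Fin n,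
    (eta α α * eta β β * eta γ γ * eta δ δ) •
      (weyl α β γ δ * (box n ^ ((n - 4) / 2)) (weyl α β γ δ))

/-- The Lagrangian of linearized conformal gravity in dimension `n = 3` or `n ≥ 4` even. -/
def freeLagrangian (n : ℕ) : EvenAlg n :=
  if n = 3 then chernSimonsLagrangian n else weylLagrangian n

/-- The variational derivative `δL/δh_s = ∑_J (-1)^{|J|} ∂_J (∂L/∂(∂_J h_s))` with respect to the
independent component `h_s`.  Only finitely many `J` contribute. -/
def componentEL (L : EvenAlg n) (s : Sym2 (Fin n)) : EvenAlg n :=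
  ∑ᶠ J : MultiIndex n, ((-1 : ℝ) ^ (∑ μ, J μ)) • evenTotalDerivIter J (hPartial s J L)

/-- The tensor `δL/δh_{μν}`, normalized by `δL = ∑_{μ,ν} (δL/δh_{μν}) δh_{μν}` up to a total
divergence, the sum being over all `μ` and `ν`: an off-diagonal independent component occurs
twice in it. -/
def tensorEL (L : EvenAlg n) (s : Sym2 (Fin n)) : EvenAlg n :=
  open Classical in (if s.IsDiag then (1 : ℝ) else 1 / 2) • componentEL L s

/-! ### The Koszul-Tate differential -/

/-- The value of `δ` on the commuting generators: `δh = 0`, `δC^{*μ} = -2 ∂_ν h^{*μν}`,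
`δξ^* = 2 η_{μν} h^{*μν}`, and correspondingly on the derivatives. -/
def deltaEvenVar : EvenVar n → LocalFun n
  | .h _ _ _ => 0
  | .Cstar μ J => (-2 : ℝ) • ∑ ν : Fin n, hstar s(μ, ν) (raise J ν)
  | .xistar J => (2 : ℝ) • ∑ μ : Fin n, ∑ ν : Fin n, eta μ ν • hstar s(μ, ν) J

/-- `δ` on the commuting variables, as a derivation. -/
def deltaEven : Derivation (SmoothFun n) (EvenAlg n) (LocalFun n) :=
  MvPolynomial.mkDerivation (SmoothFun n) deltaEvenVar

/-- `δ (∂_J h^{*s}) = ∂_J (δL₀/δh_s)`. -/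
def deltaOddVar : (OddVar n →₀ ℝ) →ₗ[ℝ] LocalFun n :=
  Finsupp.linearCombination ℝ (fun v : OddVar n =>
    ofEven n (evenTotalDerivIter v.2 (tensorEL (freeLagrangian n) v.1)))

lemma ofOdd_mul_deltaOddVar (w : OddAlg n) (v : OddVar n →₀ ℝ) :
    ofOdd n w * deltaOddVar v = deltaOddVar v * ofOdd n w := by
  induction v using Finsupp.induction_linear with
  | zero => simp
  | add f g hf hg => rw [map_add, mul_add, add_mul, hf, hg]
  | single i c =>
    simp only [deltaOddVar, Finsupp.linearCombination_single]
    rw [mul_smul_comm, smul_mul_assoc, ofOdd_mul_ofEven]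

/-- `δ` on the Grassmann algebra, as an antiderivation. -/
def deltaOdd : OddAlg n →ₗ[ℝ] LocalFun n :=
  extendOdd (ofOdd n) (-1) deltaOddVar (fun v => by
    rw [ofOdd_mul_deltaOddVar, neg_one_smul, neg_add_cancel])

/-- The Koszul-Tate differential `δ (r w) = (δ r) w + r (δ w)`, where `r` involves the commuting
variables only and `w` the anticommuting ones only. -/
def koszulTate : LocalFun n →ₗ[ℝ] LocalFun n :=
  extendLocal ((deltaEven (n := n)).toLinearMap.restrictScalars ℝ) deltaOdd

/-! ### The antifield number -/

/-- The antifield number of the commuting generators. -/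
def EvenVar.antifieldNumber : EvenVar n → ℕ
  | .h _ _ _ => 0
  | .Cstar _ _ => 2
  | .xistar _ => 2

/-- The derivation that multiplies every generator by its antifield number, which is `1` for
`h^*` and its derivatives.  It multiplies a monomial by the antifield number of the monomial. -/
def antifieldCount : LocalFun n →ₗ[ℝ] LocalFun n :=
  extendLocal
    ((ofEven n).toLinearMap ∘ₗ (MvPolynomial.mkDerivation (SmoothFun n) (fun v : EvenVar n =>
      v.antifieldNumber • (MvPolynomial.X v : EvenAlg n))).toLinearMap.restrictScalars ℝ)
    ((ofOdd n).toLinearMap ∘ₗ oddDerivation LinearMap.id)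

/-! ### Local forms -/

/-- Local `p`-forms: alternating `p`-linear maps on the translation vectors with values in local
functions, that is `∑ w_{μ₁…μ_p} dx^{μ₁} ∧ … ∧ dx^{μ_p}` with coefficients in local functions. -/
abbrev LocalForm (n p : ℕ) : Type := (Fin n → ℝ) [⋀^Fin p]→ₗ[ℝ] LocalFun n

/-- The horizontal differential `d = dx^μ ∂_μ`. -/
def horizontalD {p : ℕ} (w : LocalForm n p) : LocalForm n (p + 1) :=
  AlternatingMap.alternatizeUncurryFin
    (∑ μ : Fin n, (LinearMap.proj μ : (Fin n → ℝ) →ₗ[ℝ] ℝ).smulRight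
      ((totalDeriv μ).compAlternatingMap w))

/-- The Koszul-Tate differential acts on the coefficients of a form. -/
def formDelta {p : ℕ} (w : LocalForm n p) : LocalForm n p := koszulTate.compAlternatingMap w

/-- The form is homogeneous of antifield number `k`. -/
def HasAntifieldNumber {p : ℕ} (k : ℕ) (w : LocalForm n p) : Prop :=
  antifieldCount.compAlternatingMap w = (k : ℝ) • w

/-- The top form `f dx^0 ∧ … ∧ dx^{n-1}`. -/
def topForm (f : LocalFun n) : LocalForm n n :=
  (LinearMap.toSpanSingleton ℝ (LocalFun n) f).compAlternatingMap (Pi.basisFun ℝ (Fin n)).det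

/-- The form `a` of top degree `m + 1` and antifield number `2` is a `δ`-cocycle modulo `d`:
`δ a + d V = 0` for some local `m`-form `V` of antifield number `1`. -/
def IsCocycle2 {m : ℕ} (a : LocalForm (m + 1) (m + 1)) : Prop :=
  HasAntifieldNumber 2 a ∧
    ∃ V : LocalForm (m + 1) m, HasAntifieldNumber 1 V ∧ formDelta a + horizontalD V = 0

/-- The form `a` of top degree `m + 1` and antifield number `2` is a `δ`-coboundary modulo `d`:
`a = δ b + d c` with local forms `b`, `c` of antifield numbers `3` and `2`. -/
def IsCoboundary2 {m : ℕ} (a : LocalForm (m + 1) (m + 1)) : Prop :=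
  ∃ (b : LocalForm (m + 1) (m + 1)) (c : LocalForm (m + 1) m),
    HasAntifieldNumber 3 b ∧ HasAntifieldNumber 2 c ∧ a = formDelta b + horizontalD c

end ConformalGravity

end

open scoped TensorProduct ContDiff

noncomputable section

namespace ConformalGravity

variable {n : ℕ}

/-! ### Generators of the algebra of local functions -/

/-! The field equations are linear with constant coefficients. On generators, δ is therefore given
by two maps of free modules over the ring of polynomials in the derivatives: `D`, which sends `h^*`
to the field equations, and `noetherMap`, written K below, which sends `C^*`, `ξ^*` to combinations
of `h^*`. All that is needed of the Lagrangian is recorded in `IsRegularSystem`,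
`IsHomogeneousSystem` and `IsTorsionFree`: K is injective, ker D = im K, D raises the order of jets
by a fixed positive amount, and each `∂_μ` acts injectively on coker D.

Cohomology. Exactness makes δ acyclic in positive antifield number (`IsRegularSystem.acyclic`). Let
δa + dj = 0. Euler–Lagrange derivatives annihilate divergences. Hence the derivatives f, X, Y of a
with respect to the ghost antifields, `h^*` and `h` satisfy K†f = δX and δY + D†X = 0, where † is
formal transposition. The first equation says that f is a conformal Killing vector modulo δ-exact
terms. In dimension at least three its third derivatives along one direction are then δ-exact
(`conformalKilling_quadratic`). By torsion-freeness a function of antifield number zero with δ-exact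
derivative is constant up to δ-exact terms (`exists_const_of_totalDeriv_mem_range`). A total
derivative has no constant part, since nothing depends explicitly on the point. So among the
conformal Killing vectors only the translations survive: the `C^*` part of f is λ + δg, and the
`ξ^*` part is δ-exact.

Acyclicity then gives X = K†g + δx and Y + D†x = δy. Integrating by parts yields Na = λC^* + δb +
divergence, where N is the polynomial degree. N commutes with δ and with total derivatives, and it
is bijective in positive antifield number. On coefficients that are smooth in `h` it is inverted by
integrals ∫ tᵏ g(tx) dt. Removing N proves completeness (`exists_eq_add_linKT_add_divergence`). For
independence, the `C^{*μ}`-derivative of a trivial combination shows that λ_μ is δ-exact, and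
δ-exact functions vanish at the zero of all variables (`eq_zero_of_sum_Cstar_eq`).

Symbols. It remains to verify the three properties of D, where derivatives become commuting
variables x. For n ≥ 4 the operator is `□^m` times the double divergence of the Weyl tensor. That
double divergence is a multiple of □²h, with factor proportional to n - 3, plus a gauge
transformation (`exists_gaugeR_of_bachR`). For n = 3, a vanishing Cotton tensor makes x_α S_βν
symmetric in α and β for the Schouten tensor S, and then □³h is pure gauge
(`exists_gaugeR_of_schoutenR`). In both cases Dh = 0 implies that some □ᵏh is pure gauge. The factor
□ᵏ can be divided out: the gauge parameters are recovered from the transformed tensor up to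
variables and units, and no variable divides □ᵏ. This gives exactness. The kernel statement holds
for arbitrary values of x, so it can also be used with one variable set to zero, and this gives
torsion-freeness. -/

/-- Finite linear combinations of the symbols `∂_J φ^i`, for fields indexed by `ι`. -/
abbrev JetSpace (n : ℕ) (ι : Type) : Type := (ι × MultiIndex n) →₀ ℝ

/-- The formal derivative `∂_μ` on linear combinations of jets. -/
def jetShift {ι : Type} (μ : Fin n) : JetSpace n ι →ₗ[ℝ] JetSpace n ι :=
  Finsupp.lmapDomain ℝ ℝ (fun v => (v.1, raise v.2 μ))

@[simp] lemma jetShift_single {ι : Type} (μ : Fin n) (i : ι) (J : MultiIndex n) (c : ℝ) :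
    jetShift μ (Finsupp.single (i, J) c) = Finsupp.single (i, raise J μ) c := by
  simp [jetShift]

lemma raise_comm (J : MultiIndex n) (μ ν : Fin n) :
    raise (raise J μ) ν = raise (raise J ν) μ := by
  simp only [raise]; abel

/-- A smooth function of the undifferentiated field as a local function. -/
def sm (g : SmoothFun n) : LocalFun n := ofEven n (MvPolynomial.C g)

/-- A commuting generator as a local function. -/
def ev (v : EvenVar n) : LocalFun n := ofEven n (MvPolynomial.X v)

/-- Linear combinations of the jets of `h^*`. -/
def hs : JetSpace n (Sym2 (Fin n)) →ₗ[ℝ] LocalFun n :=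
  (ofOdd n).toLinearMap ∘ₗ ExteriorAlgebra.ι ℝ

lemma hs_apply (y : JetSpace n (Sym2 (Fin n))) : hs y = ofOdd n (ExteriorAlgebra.ι ℝ y) := rfl

lemma hs_single (s : Sym2 (Fin n)) (J : MultiIndex n) :
    hs (Finsupp.single (s, J) 1) = hstar s J := rfl

lemma tmul_eq_mul (r : EvenAlg n) (w : OddAlg n) :
    (r ⊗ₜ[ℝ] w : EvenAlg n ⊗[ℝ] OddAlg n) = (ofEven n r * ofOdd n w : LocalFun n) := by
  have h1 : (r ⊗ₜ[ℝ] (1 : OddAlg n)) * ((1 : EvenAlg n) ⊗ₜ[ℝ] w) = r ⊗ₜ[ℝ] w := by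
    rw [Algebra.TensorProduct.tmul_mul_tmul, one_mul, mul_one]
  exact h1.symm

/-- Local functions are sums of products `r w`. -/
lemma LocalFun.induction_mul {p : LocalFun n → Prop} (a : LocalFun n)
    (mul : ∀ r w, p (ofEven n r * ofOdd n w)) (add : ∀ a b, p a → p b → p (a + b)) : p a := by
  refine TensorProduct.induction_on (R := ℝ) (motive := p) a ?_ ?_ add
  · have := mul 0 0
    rw [map_zero, zero_mul] at this
    exact this
  · intro r w
    have := mul r w
    rwa [← tmul_eq_mul] at this

lemma ofEven_mul_comm (r : EvenAlg n) (a : LocalFun n) : ofEven n r * a = a * ofEven n r := by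
  induction a using LocalFun.induction_mul with
  | mul r' w =>
    rw [← mul_assoc, ← map_mul, mul_comm, map_mul, mul_assoc, mul_assoc, ofOdd_mul_ofEven]
  | add a b ha hb => rw [mul_add, add_mul, ha, hb]

lemma smul_eq_ofEven_mul (r : EvenAlg n) (a : LocalFun n) : r • a = ofEven n r * a := by
  induction a using LocalFun.induction_mul with
  | mul r' w =>
    rw [← mul_assoc, ← map_mul, ← tmul_eq_mul, ← tmul_eq_mul]
    exact TensorProduct.smul_tmul' r r' w
  | add a b ha hb => rw [smul_add, mul_add, ha, hb]

/-- Every set of local functions that contains `1` and is stable under addition and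
multiplication by generators from the left is everything. -/
lemma LocalFun.induction {p : LocalFun n → Prop} (a : LocalFun n) (one : p 1)
    (add : ∀ a b, p a → p b → p (a + b)) (sm : ∀ g a, p a → p (sm g * a))
    (ev : ∀ v a, p a → p (ev v * a)) (hs : ∀ y a, p a → p (hs y * a)) : p a := by
  have hEven : ∀ (r : EvenAlg n) a, p a → p (ofEven n r * a) := by
    intro r
    induction r using MvPolynomial.induction_on with
    | C g => exact sm g
    | add r s hr hs =>
      intro a ha
      rw [map_add, add_mul]
      exact add _ _ (hr a ha) (hs a ha)
    | mul_X r v hr =>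
      intro a ha
      rw [map_mul, mul_assoc]
      exact hr _ (ev v a ha)
  induction a using LocalFun.induction_mul with
  | mul r w =>
    apply hEven
    induction w using CliffordAlgebra.left_induction with
    | algebraMap c =>
      have := hEven (algebraMap ℝ _ c) 1 one
      rw [mul_one, AlgHom.commutes] at this
      have h2 : (ofOdd n) (algebraMap ℝ (OddAlg n) c) = algebraMap ℝ _ c := AlgHom.commutes _ _
      exact h2 ▸ this
    | add x y hx hy =>
      rw [map_add]
      exact add _ _ hx hy
    | ι_mul x m hx =>
      rw [map_mul]
      exact hs m _ hx
  | add a b ha hb => exact add _ _ ha hb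

lemma sm_mul_comm (g : SmoothFun n) (a : LocalFun n) : sm g * a = a * sm g := ofEven_mul_comm _ _

lemma hs_mul_hs (x y : JetSpace n (Sym2 (Fin n))) : hs x * hs y = -(hs y * hs x) := by
  rw [hs_apply, hs_apply, ← map_mul (ofOdd n), ← map_mul (ofOdd n), ← map_neg]
  congr 1
  exact eq_neg_of_add_eq_zero_left (ExteriorAlgebra.ι_add_mul_swap x y)

/-! ### Leibniz rules -/

section extendOdd

variable {B : Type*} [Ring B] [Algebra ℝ B] (j : OddAlg n →ₐ[ℝ] B) (e : ℝ)
  (L : (OddVar n →₀ ℝ) →ₗ[ℝ] B)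
  (hL : ∀ v, e • (j (ExteriorAlgebra.ι ℝ v) * L v) + L v * j (ExteriorAlgebra.ι ℝ v) = 0)

lemma extendOdd_one : extendOdd j e L hL 1 = 0 := by
  simp [extendOdd]

/-- The Leibniz rule is matrix multiplication. `extendOdd` is the upper right entry of a
representation by upper triangular 2×2 matrices, whose lower right entry (`h11`) is `j` itself and
whose upper left entry on a generator is `e • j`. -/
lemma extendOdd_ι_mul (v : OddVar n →₀ ℝ) (w : OddAlg n) :
    extendOdd j e L hL (ExteriorAlgebra.ι ℝ v * w) =
      e • (j (ExteriorAlgebra.ι ℝ v) * extendOdd j e L hL w) + L v * j w := by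
  unfold extendOdd
  generalize_proofs h1 h2 h3 h4
  set φ := ExteriorAlgebra.lift ℝ (A := Matrix (Fin 2) (Fin 2) B) (⟨_, h4⟩) with hφ
  have h11 : ∀ w, φ w 1 1 = j w := by
    intro w
    induction w using CliffordAlgebra.left_induction with
    | algebraMap c =>
      have : φ (algebraMap ℝ (OddAlg n) c) = algebraMap ℝ _ c := AlgHom.commutes _ _
      have h' : j (algebraMap ℝ (OddAlg n) c) = algebraMap ℝ _ c := AlgHom.commutes _ _
      change φ (algebraMap ℝ (OddAlg n) c) 1 1 = j (algebraMap ℝ (OddAlg n) c)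
      rw [this, h', Matrix.algebraMap_matrix_apply]
      simp
    | add x y hx hy => simp only [map_add, Matrix.add_apply, hx, hy]
    | ι_mul x m hx =>
      have : φ (ExteriorAlgebra.ι ℝ m * x) 1 1 = j (ExteriorAlgebra.ι ℝ m * x) := by
        rw [map_mul, hφ, ExteriorAlgebra.lift_ι_apply, ← hφ]
        simp [Matrix.mul_apply, Fin.sum_univ_two, hx]
      exact this
  have : φ (ExteriorAlgebra.ι ℝ v * w) 0 1 =
      e • (j (ExteriorAlgebra.ι ℝ v) * φ w 0 1) + L v * j w := by
    rw [map_mul, hφ, ExteriorAlgebra.lift_ι_apply, ← hφ]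
    simp [Matrix.mul_apply, Fin.sum_univ_two, h11]
  exact this

end extendOdd

/-- The antiderivation of local functions with `v ↦ h^*(f v)` on the commuting generators and
`h^*(y) ↦ L y` on the anticommuting ones, linear over the smooth functions of `h`. -/
def antiDer (f : EvenVar n → JetSpace n (Sym2 (Fin n)))
    (L : JetSpace n (Sym2 (Fin n)) →ₗ[ℝ] EvenAlg n) : LocalFun n →ₗ[ℝ] LocalFun n :=
  extendLocal ((MvPolynomial.mkDerivation (SmoothFun n)
      (fun v => hs (f v))).toLinearMap.restrictScalars ℝ)
    (extendOdd (ofOdd n) (-1) ((ofEven n).toLinearMap ∘ₗ L) (fun v => by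
      rw [LinearMap.comp_apply, AlgHom.toLinearMap_apply, ofOdd_mul_ofEven, neg_one_smul,
        neg_add_cancel]))

section antiDer

variable (f : EvenVar n → JetSpace n (Sym2 (Fin n)))
  (L : JetSpace n (Sym2 (Fin n)) →ₗ[ℝ] EvenAlg n)

lemma antiDer_one : antiDer f L 1 = 0 := by
  have := extendLocal_mul ((MvPolynomial.mkDerivation (SmoothFun n)
      (fun v => hs (f v))).toLinearMap.restrictScalars ℝ) (extendOdd (ofOdd n) (-1)
      ((ofEven n).toLinearMap ∘ₗ L) (fun v => by
        rw [LinearMap.comp_apply, AlgHom.toLinearMap_apply, ofOdd_mul_ofEven, neg_one_smul,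
          neg_add_cancel])) 1 1
  rw [map_one, map_one, mul_one] at this
  rw [antiDer, this, extendOdd_one]
  simp

lemma antiDer_ofEven_mul (r : EvenAlg n) (a : LocalFun n) :
    antiDer f L (ofEven n r * a) =
      MvPolynomial.mkDerivation (SmoothFun n) (fun v => hs (f v)) r * a +
        ofEven n r * antiDer f L a := by
  induction a using LocalFun.induction_mul with
  | mul r' w =>
    rw [← mul_assoc, ← map_mul, antiDer, extendLocal_mul, extendLocal_mul]
    simp only [LinearMap.coe_restrictScalars, Derivation.coeFn_coe,
      Derivation.leibniz, smul_eq_ofEven_mul, map_mul]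
    rw [ofEven_mul_comm r' (MvPolynomial.mkDerivation _ _ r)]
    noncomm_ring
  | add a b ha hb => rw [mul_add, map_add, ha, hb, map_add]; noncomm_ring

@[simp] lemma antiDer_sm_mul (g : SmoothFun n) (a : LocalFun n) :
    antiDer f L (sm g * a) = sm g * antiDer f L a := by
  rw [sm, antiDer_ofEven_mul]
  simp

@[simp] lemma antiDer_ev_mul (v : EvenVar n) (a : LocalFun n) :
    antiDer f L (ev v * a) = hs (f v) * a + ev v * antiDer f L a := by
  rw [ev, antiDer_ofEven_mul]
  simp

@[simp] lemma antiDer_hs_mul (y : JetSpace n (Sym2 (Fin n))) (a : LocalFun n) :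
    antiDer f L (hs y * a) = ofEven n (L y) * a - hs y * antiDer f L a := by
  -- Commuting generators are sent to odd elements, which anticommute with `hs y`. This produces the
  -- sign of an antiderivation.
  have key : ∀ r : EvenAlg n, MvPolynomial.mkDerivation (SmoothFun n) (fun v => hs (f v)) r * hs y =
      -(hs y * MvPolynomial.mkDerivation (SmoothFun n) (fun v => hs (f v)) r) := by
    intro r
    induction r using MvPolynomial.induction_on with
    | C g => simp
    | add r s hr hs => rw [map_add, add_mul, mul_add, hr, hs]; abel
    | mul_X r v hr =>
      simp only [Derivation.leibniz, smul_eq_ofEven_mul, MvPolynomial.mkDerivation_X]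
      rw [add_mul, mul_add, mul_assoc, mul_assoc, hr, hs_mul_hs, mul_neg, mul_neg,
        ← mul_assoc, ← mul_assoc, ofEven_mul_comm r, ofEven_mul_comm _ (hs y)]
      noncomm_ring
  induction a using LocalFun.induction_mul with
  | mul r w =>
    have h1 : hs y * (ofEven n r * ofOdd n w) =
        ofEven n r * ofOdd n (ExteriorAlgebra.ι ℝ y * w) := by
      rw [← mul_assoc, ← ofEven_mul_comm, mul_assoc, map_mul, hs_apply]
    rw [h1, antiDer, extendLocal_mul, extendLocal_mul, extendOdd_ι_mul]
    simp only [LinearMap.coe_restrictScalars, Derivation.coeFn_coe,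
      map_mul, ← hs_apply, LinearMap.comp_apply, AlgHom.toLinearMap_apply]
    rw [← mul_assoc, key, mul_add, mul_add, neg_one_smul, mul_neg, ← mul_assoc, ← mul_assoc,
      ofEven_mul_comm r (hs y), ← mul_assoc, ← map_mul, mul_comm, map_mul]
    noncomm_ring
  | add a b ha hb => rw [mul_add, map_add, ha, hb, map_add]; noncomm_ring

end antiDer

/-! ### Total derivatives -/

lemma smoothPartial_mul (s : Sym2 (Fin n)) (f g : SmoothFun n) :
    smoothPartial s (f * g) = f * smoothPartial s g + smoothPartial s f * g := by
  apply Subtype.ext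
  funext x
  have hf : DifferentiableAt ℝ f.1 x := f.contDiff.differentiable (by simp) x
  have hg : DifferentiableAt ℝ g.1 x := g.contDiff.differentiable (by simp) x
  change fderiv ℝ (f.1 * g.1) x (Pi.single s 1) =
    f.1 x * fderiv ℝ g.1 x (Pi.single s 1) + fderiv ℝ f.1 x (Pi.single s 1) * g.1 x
  rw [fderiv_mul hf hg]
  simp [mul_comm]

lemma smoothPartial_one (s : Sym2 (Fin n)) : smoothPartial s (1 : SmoothFun n) = 0 := by
  have := smoothPartial_mul s (1 : SmoothFun n) 1
  simpa using this

lemma smoothPartial_comm (s t : Sym2 (Fin n)) (f : SmoothFun n) :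
    smoothPartial s (smoothPartial t f) = smoothPartial t (smoothPartial s f) := by
  apply Subtype.ext
  funext x
  have hd : DifferentiableAt ℝ (fderiv ℝ f.1) x :=
    (f.contDiff.fderiv_right (m := ∞) le_rfl).differentiable (by simp) x
  change fderiv ℝ (fun x => fderiv ℝ f.1 x (Pi.single t 1)) x (Pi.single s 1) =
    fderiv ℝ (fun x => fderiv ℝ f.1 x (Pi.single s 1)) x (Pi.single t 1)
  rw [fderiv_clm_apply hd (differentiableAt_const _), fderiv_clm_apply hd (differentiableAt_const _)]
  have hs := (f.contDiff.contDiffAt (x := x)).isSymmSndFDerivAt (by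
    rw [minSmoothness_of_isRCLikeNormedField]
    exact WithTop.coe_le_coe.2 (by exact_mod_cast le_top))
  simpa using hs (Pi.single s 1) (Pi.single t 1)

@[simp] lemma coeffPartial_C (s : Sym2 (Fin n)) (g : SmoothFun n) :
    coeffPartial s (MvPolynomial.C g) = MvPolynomial.C (smoothPartial s g) :=
  coeffPartial_monomial s 0 g

@[simp] lemma coeffPartial_X (s : Sym2 (Fin n)) (v : EvenVar n) :
    coeffPartial s (MvPolynomial.X v) = 0 := by
  rw [MvPolynomial.X, coeffPartial_monomial, smoothPartial_one, map_zero]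

lemma coeffPartial_mul (s : Sym2 (Fin n)) (p q : EvenAlg n) :
    coeffPartial s (p * q) = p * coeffPartial s q + coeffPartial s p * q := by
  induction p using MvPolynomial.induction_on' with
  | monomial k f =>
    induction q using MvPolynomial.induction_on' with
    | monomial l g =>
      rw [MvPolynomial.monomial_mul, coeffPartial_monomial, coeffPartial_monomial,
        coeffPartial_monomial, MvPolynomial.monomial_mul, MvPolynomial.monomial_mul, ← map_add,
        smoothPartial_mul]
    | add p q hp hq => simp only [mul_add, map_add, hp, hq]; ring
  | add p q hp hq => simp only [add_mul, map_add, hp, hq]; ring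

@[simp] lemma evenTotalDeriv_X (μ : Fin n) (v : EvenVar n) :
    evenTotalDeriv μ (MvPolynomial.X v) = MvPolynomial.X (v.shift μ) := by
  simp [evenTotalDeriv]

@[simp] lemma evenTotalDeriv_C (μ : Fin n) (g : SmoothFun n) :
    evenTotalDeriv μ (MvPolynomial.C g) =
      ∑ s, hJet s (raise 0 μ) * MvPolynomial.C (smoothPartial s g) := by
  simp [evenTotalDeriv]

lemma evenTotalDeriv_mul (μ : Fin n) (p q : EvenAlg n) :
    evenTotalDeriv μ (p * q) = p * evenTotalDeriv μ q + evenTotalDeriv μ p * q := by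
  simp only [evenTotalDeriv, LinearMap.add_apply, LinearMap.sum_apply, LinearMap.comp_apply,
    LinearMap.mulLeft_apply, coeffPartial_mul, LinearMap.coe_restrictScalars,
    Derivation.coeFn_coe, Derivation.leibniz, smul_eq_mul,
    mul_add, Finset.sum_add_distrib, add_mul, Finset.mul_sum, Finset.sum_mul]
  have h1 : ∀ s, hJet s (raise 0 μ) * (p * coeffPartial s q) =
      p * (hJet s (raise 0 μ) * coeffPartial s q) := fun s => by ring
  have h2 : ∀ s, hJet s (raise 0 μ) * (coeffPartial s p * q) =
      hJet s (raise 0 μ) * coeffPartial s p * q := fun s => by ring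
  simp only [h1, h2]
  ring

lemma totalDeriv_ofEven_mul (μ : Fin n) (r : EvenAlg n) (a : LocalFun n) :
    totalDeriv μ (ofEven n r * a) =
      ofEven n (evenTotalDeriv μ r) * a + ofEven n r * totalDeriv μ a := by
  induction a using LocalFun.induction_mul with
  | mul r' w =>
    rw [← mul_assoc, ← map_mul, totalDeriv, extendLocal_mul, extendLocal_mul]
    simp only [LinearMap.comp_apply, AlgHom.toLinearMap_apply, evenTotalDeriv_mul, map_add,
      map_mul]
    noncomm_ring
  | add a b ha hb => rw [mul_add, map_add, ha, hb, map_add]; noncomm_ring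

lemma oddTotalDeriv_ι_mul (μ : Fin n) (y : JetSpace n (Sym2 (Fin n))) (w : OddAlg n) :
    oddTotalDeriv μ (ExteriorAlgebra.ι ℝ y * w) =
      ExteriorAlgebra.ι ℝ y * oddTotalDeriv μ w + ExteriorAlgebra.ι ℝ (jetShift μ y) * w := by
  rw [oddTotalDeriv, oddDerivation, extendOdd_ι_mul, one_smul]
  rfl

@[simp] lemma totalDeriv_hs_mul (μ : Fin n) (y : JetSpace n (Sym2 (Fin n))) (a : LocalFun n) :
    totalDeriv μ (hs y * a) = hs (jetShift μ y) * a + hs y * totalDeriv μ a := by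
  induction a using LocalFun.induction_mul with
  | mul r w =>
    have h1 : ∀ y, hs y * (ofEven n r * ofOdd n w) =
        ofEven n r * ofOdd n (ExteriorAlgebra.ι ℝ y * w) := by
      intro y
      rw [← mul_assoc, ← ofEven_mul_comm, mul_assoc, map_mul, hs_apply]
    rw [h1, totalDeriv, extendLocal_mul, extendLocal_mul, h1]
    simp only [LinearMap.comp_apply, AlgHom.toLinearMap_apply, oddTotalDeriv_ι_mul, map_add,
      map_mul, hs_apply]
    rw [mul_add (ofOdd n _), ← mul_assoc (ofOdd n _), ← mul_assoc (ofOdd n _), ← ofEven_mul_comm,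
      ← ofEven_mul_comm]
    noncomm_ring
  | add a b ha hb => rw [mul_add, map_add, ha, hb, map_add]; noncomm_ring

lemma totalDeriv_one (μ : Fin n) : totalDeriv μ (1 : LocalFun n) = 0 := by
  have := totalDeriv_ofEven_mul μ (1 : EvenAlg n) 1
  rw [map_one, one_mul, one_mul, mul_one] at this
  have h2 : evenTotalDeriv μ (1 : EvenAlg n) = 0 := by
    have := evenTotalDeriv_mul μ (1 : EvenAlg n) 1
    simpa using this
  have h3 := extendLocal_mul ((ofEven n).toLinearMap ∘ₗ evenTotalDeriv μ)
    ((ofOdd n).toLinearMap ∘ₗ oddTotalDeriv μ) 1 1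
  rw [map_one, map_one, mul_one] at h3
  rw [totalDeriv, h3]
  simp [h2, oddTotalDeriv, oddDerivation, extendOdd_one]

@[simp] lemma totalDeriv_ev_mul (μ : Fin n) (v : EvenVar n) (a : LocalFun n) :
    totalDeriv μ (ev v * a) = ev (v.shift μ) * a + ev v * totalDeriv μ a := by
  rw [ev, totalDeriv_ofEven_mul, evenTotalDeriv_X]
  rfl

/-- Linear combinations of the jets of `h` in the commuting algebra. -/
def hlinEven : JetSpace n (Sym2 (Fin n)) →ₗ[ℝ] EvenAlg n :=
  Finsupp.linearCombination ℝ (fun v => hJet v.1 v.2)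

/-- Linear combinations of the jets of `h`. -/
def hlin : JetSpace n (Sym2 (Fin n)) →ₗ[ℝ] LocalFun n := (ofEven n).toLinearMap ∘ₗ hlinEven

lemma hlin_apply (p : JetSpace n (Sym2 (Fin n))) : hlin p = ofEven n (hlinEven p) := rfl

@[simp] lemma hlinEven_single (s : Sym2 (Fin n)) (J : MultiIndex n) (c : ℝ) :
    hlinEven (Finsupp.single (s, J) c) = c • hJet s J := by
  simp [hlinEven]

lemma smoothPartial_smoothCoord (s t : Sym2 (Fin n)) :
    smoothPartial s (smoothCoord t) = if s = t then 1 else 0 := by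
  apply Subtype.ext
  funext x
  change fderiv ℝ (fun x : Sym2 (Fin n) → ℝ => x t) x (Pi.single s 1) = _
  have : fderiv ℝ (fun x : Sym2 (Fin n) → ℝ => x t) x = ContinuousLinearMap.proj t :=
    (ContinuousLinearMap.proj (R := ℝ) (φ := fun _ : Sym2 (Fin n) => ℝ) t).hasFDerivAt.fderiv
  rw [this]
  by_cases h : s = t
  · subst h; simp; rfl
  · simp [h, Ne.symm h]; rfl

/-- For J = 0 the jet is a smooth coordinate and the chain rule applies; for J ≠ 0 it is a
polynomial generator and is shifted. Since both cases follow the same rule, `hlin` can treat all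
jets of `h` uniformly as linear objects. -/
lemma evenTotalDeriv_hJet (μ : Fin n) (s : Sym2 (Fin n)) (J : MultiIndex n) :
    evenTotalDeriv μ (hJet s J) = hJet s (raise J μ) := by
  classical
  by_cases hJ : J = 0
  · subst hJ
    simp only [hJet, dif_pos]
    rw [evenTotalDeriv_C]
    simp [smoothPartial_smoothCoord, hJet, raise_ne_zero]
  · simp [hJet, hJ, raise_ne_zero, EvenVar.shift]

lemma evenTotalDeriv_hlinEven (μ : Fin n) (p : JetSpace n (Sym2 (Fin n))) :
    evenTotalDeriv μ (hlinEven p) = hlinEven (jetShift μ p) := by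
  induction p using Finsupp.induction_linear with
  | zero => simp
  | add f g hf hg => simp [hf, hg]
  | single i c => obtain ⟨s, J⟩ := i; simp [evenTotalDeriv_hJet]

@[simp] lemma totalDeriv_sm_mul (μ : Fin n) (g : SmoothFun n) (a : LocalFun n) :
    totalDeriv μ (sm g * a) =
      ∑ s, hlin (Finsupp.single (s, raise 0 μ) 1) * (sm (smoothPartial s g) * a) +
        sm g * totalDeriv μ a := by
  rw [sm, totalDeriv_ofEven_mul]
  simp only [evenTotalDeriv_C, map_sum, map_mul, hlin_apply, hlinEven_single, one_smul,
    Finset.sum_mul, mul_assoc, sm]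

@[simp] lemma totalDeriv_hlin_mul (μ : Fin n) (p : JetSpace n (Sym2 (Fin n))) (a : LocalFun n) :
    totalDeriv μ (hlin p * a) = hlin (jetShift μ p) * a + hlin p * totalDeriv μ a := by
  rw [hlin_apply, totalDeriv_ofEven_mul, evenTotalDeriv_hlinEven]
  rfl

/-! ### The jets of the ghost antifields -/

/-- The generator `∂_J C^{*μ}` (index `some μ`) or `∂_J ξ^*` (index `none`). -/
def gaugeVar : Option (Fin n) × MultiIndex n → EvenVar n
  | (some μ, J) => .Cstar μ J
  | (none, J) => .xistar J

/-- Linear combinations of the jets of `C^*` and `ξ^*` in the commuting algebra. -/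
def gsEven : JetSpace n (Option (Fin n)) →ₗ[ℝ] EvenAlg n :=
  Finsupp.linearCombination ℝ (fun v => MvPolynomial.X (gaugeVar v))

/-- Linear combinations of the jets of `C^*` and `ξ^*`. -/
def gs : JetSpace n (Option (Fin n)) →ₗ[ℝ] LocalFun n := (ofEven n).toLinearMap ∘ₗ gsEven

lemma gs_apply (g : JetSpace n (Option (Fin n))) : gs g = ofEven n (gsEven g) := rfl

lemma gs_single (v : Option (Fin n) × MultiIndex n) (c : ℝ) :
    gs (Finsupp.single v c) = c • ev (gaugeVar v) := by
  simp [gs_apply, gsEven, ev]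

lemma hlin_single_zero (s : Sym2 (Fin n)) (c : ℝ) :
    hlin (Finsupp.single (s, 0) c) = c • sm (smoothCoord s) := by
  simp [hlin_apply, hJet, sm]

lemma hlin_single_of_ne (s : Sym2 (Fin n)) (J : MultiIndex n) (hJ : J ≠ 0) (c : ℝ) :
    hlin (Finsupp.single (s, J) c) = c • ev (.h s J hJ) := by
  simp [hlin_apply, hJet, ev, hJ]

/-- Generators are phrased through the linear maps `hlin`, `gs`, `hs`, for which all operators below
have Leibniz rules. Undifferentiated jets of `h` belong to the smooth coefficients, hence J ≠ 0. -/
lemma LocalFun.induction_gen {p : LocalFun n → Prop} (a : LocalFun n) (one : p 1)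
    (add : ∀ a b, p a → p b → p (a + b)) (sm : ∀ g a, p a → p (sm g * a))
    (hlin : ∀ s J a, J ≠ 0 → p a → p (hlin (Finsupp.single (s, J) 1) * a))
    (gs : ∀ v a, p a → p (gs (Finsupp.single v 1) * a))
    (hs : ∀ y a, p a → p (hs y * a)) : p a := by
  induction a using LocalFun.induction with
  | one => exact one
  | add a b ha hb => exact add a b ha hb
  | sm g a ha => exact sm g a ha
  | hs y a ha => exact hs y a ha
  | ev v a ha =>
    cases v with
    | h s J hJ =>
      have := hlin s J a hJ ha
      rwa [hlin_single_of_ne s J hJ, one_smul] at this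
    | Cstar μ J =>
      have := gs (some μ, J) a ha
      rwa [gs_single, one_smul] at this
    | xistar J =>
      have := gs (none, J) a ha
      rwa [gs_single, one_smul] at this

lemma hlin_mul_comm (p : JetSpace n (Sym2 (Fin n))) (a : LocalFun n) : hlin p * a = a * hlin p :=
  ofEven_mul_comm _ _

lemma gs_mul_comm (g : JetSpace n (Option (Fin n))) (a : LocalFun n) : gs g * a = a * gs g :=
  ofEven_mul_comm _ _

@[simp] lemma totalDeriv_gs_mul (μ : Fin n) (g : JetSpace n (Option (Fin n))) (a : LocalFun n) :
    totalDeriv μ (gs g * a) = gs (jetShift μ g) * a + gs g * totalDeriv μ a := by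
  induction g using Finsupp.induction_linear with
  | zero => simp
  | add f g hf hg => simp only [map_add, add_mul, hf, hg]; abel
  | single v c =>
    obtain ⟨i, J⟩ := v
    rw [jetShift_single, gs_single, gs_single, smul_mul_assoc, map_smul, totalDeriv_ev_mul,
      smul_add, smul_mul_assoc, smul_mul_assoc]
    cases i <;> rfl

/-! ### The Koszul-Tate differential of a linear system of field equations -/

/-- `C^{*μ} ↦ -2 ∂_ν h^{*μν}` and `ξ^* ↦ 2 η_{μν} h^{*μν}` on jets. -/
def noetherMap : JetSpace n (Option (Fin n)) →ₗ[ℝ] JetSpace n (Sym2 (Fin n)) :=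
  Finsupp.linearCombination ℝ (fun v => match v with
    | (some μ, J) => (-2 : ℝ) • ∑ ν : Fin n, Finsupp.single (s(μ, ν), raise J ν) 1
    | (none, J) => (2 : ℝ) • ∑ μ : Fin n, ∑ ν : Fin n, eta μ ν • Finsupp.single (s(μ, ν), J) 1)

/-- The part of `noetherMap` seen by the commuting generators. -/
def noetherVar : EvenVar n → JetSpace n (Sym2 (Fin n))
  | .h _ _ _ => 0
  | .Cstar μ J => noetherMap (Finsupp.single (some μ, J) 1)
  | .xistar J => noetherMap (Finsupp.single (none, J) 1)

/-- The Koszul-Tate differential with `h^*(y) ↦ h(D y)`. -/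
def linKT (D : JetSpace n (Sym2 (Fin n)) →ₗ[ℝ] JetSpace n (Sym2 (Fin n))) :
    LocalFun n →ₗ[ℝ] LocalFun n := antiDer noetherVar (hlinEven ∘ₗ D)

section linKT

variable (D : JetSpace n (Sym2 (Fin n)) →ₗ[ℝ] JetSpace n (Sym2 (Fin n)))

@[simp] lemma linKT_one : linKT D 1 = 0 := antiDer_one _ _

@[simp] lemma linKT_sm_mul (g : SmoothFun n) (a : LocalFun n) :
    linKT D (sm g * a) = sm g * linKT D a := antiDer_sm_mul _ _ _ _

@[simp] lemma linKT_hs_mul (y : JetSpace n (Sym2 (Fin n))) (a : LocalFun n) :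
    linKT D (hs y * a) = hlin (D y) * a - hs y * linKT D a := antiDer_hs_mul _ _ _ _

@[simp] lemma linKT_hlin_mul (p : JetSpace n (Sym2 (Fin n))) (a : LocalFun n) :
    linKT D (hlin p * a) = hlin p * linKT D a := by
  induction p using Finsupp.induction_linear with
  | zero => simp
  | add f g hf hg => simp only [map_add, add_mul, hf, hg]
  | single v c =>
    obtain ⟨s, J⟩ := v
    by_cases hJ : J = 0
    · subst hJ
      simp only [hlin_single_zero, smul_mul_assoc, map_smul, linKT_sm_mul]
    · simp only [hlin_single_of_ne s J hJ, smul_mul_assoc, map_smul]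
      rw [linKT, antiDer_ev_mul]
      simp [noetherVar]

@[simp] lemma linKT_gs_mul (g : JetSpace n (Option (Fin n))) (a : LocalFun n) :
    linKT D (gs g * a) = hs (noetherMap g) * a + gs g * linKT D a := by
  induction g using Finsupp.induction_linear with
  | zero => simp
  | add f g hf hg => simp only [map_add, add_mul, hf, hg]; abel
  | single v c =>
    rw [← Finsupp.smul_single_one]
    simp only [map_smul, smul_mul_assoc, ← smul_add]
    congr 1
    rw [gs_single, one_smul, linKT, antiDer_ev_mul]
    obtain ⟨i, J⟩ := v
    cases i <;> rfl

end linKT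

/-! ### Vertical derivatives -/

section vertical

variable {ι : Type}

/-- Left multiplication on the coefficients. -/
abbrev coefMul (a : LocalFun n) : LocalFun n ⊗[ℝ] JetSpace n ι →ₗ[ℝ] LocalFun n ⊗[ℝ] JetSpace n ι :=
  (LinearMap.mulLeft ℝ a).rTensor _

/-- Extension of a derivation of the commuting algebra to local functions. -/
def vertEven (D : EvenAlg n →ₗ[ℝ] EvenAlg n ⊗[ℝ] JetSpace n ι) :
    LocalFun n →ₗ[ℝ] LocalFun n ⊗[ℝ] JetSpace n ι :=
  ((TensorProduct.rightComm ℝ (EvenAlg n) (JetSpace n ι) (OddAlg n)).toLinearMap ∘ₗ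
    D.rTensor (OddAlg n) : EvenAlg n ⊗[ℝ] OddAlg n →ₗ[ℝ]
      (EvenAlg n ⊗[ℝ] OddAlg n) ⊗[ℝ] JetSpace n ι)

lemma vertEven_mul (D : EvenAlg n →ₗ[ℝ] EvenAlg n ⊗[ℝ] JetSpace n ι) (r : EvenAlg n)
    (w : OddAlg n) : vertEven D (ofEven n r * ofOdd n w) =
      (LinearMap.mulRight ℝ (ofOdd n w) ∘ₗ (ofEven n).toLinearMap).rTensor (JetSpace n ι) (D r) := by
  rw [← tmul_eq_mul]
  have : ∀ z : EvenAlg n ⊗[ℝ] JetSpace n ι,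
      (TensorProduct.rightComm ℝ (EvenAlg n) (JetSpace n ι) (OddAlg n)) (z ⊗ₜ w) =
      (LinearMap.mulRight ℝ (ofOdd n w) ∘ₗ (ofEven n).toLinearMap).rTensor (JetSpace n ι) z := by
    intro z
    induction z using TensorProduct.induction_on with
    | zero => rw [TensorProduct.zero_tmul, map_zero, map_zero]; rfl
    | tmul x v =>
      rw [TensorProduct.rightComm_tmul, LinearMap.rTensor_tmul, LinearMap.comp_apply,
        LinearMap.mulRight_apply, AlgHom.toLinearMap_apply, ← tmul_eq_mul]
      rfl
    | add x y hx hy => rw [TensorProduct.add_tmul, map_add, map_add, hx, hy]; rfl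
  exact this (D r)

lemma vertEven_ofEven_mul (D : EvenAlg n →ₗ[ℝ] EvenAlg n ⊗[ℝ] JetSpace n ι)
    (hD : ∀ r r', D (r * r') = (LinearMap.mulLeft ℝ r).rTensor _ (D r') +
      (LinearMap.mulLeft ℝ r').rTensor _ (D r)) (r : EvenAlg n) (a : LocalFun n) :
    vertEven D (ofEven n r * a) =
      (LinearMap.mulRight ℝ a ∘ₗ (ofEven n).toLinearMap).rTensor _ (D r) +
        coefMul (ofEven n r) (vertEven D a) := by
  induction a using LocalFun.induction_mul with
  | mul r' w =>
    rw [← mul_assoc, ← map_mul, vertEven_mul, vertEven_mul, hD, map_add, add_comm]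
    congr 1
    · rw [← LinearMap.rTensor_comp_apply]
      congr 2
      ext x
      simp only [LinearMap.comp_apply, LinearMap.mulLeft_apply, AlgHom.toLinearMap_apply,
        LinearMap.mulRight_apply, map_mul]
      rw [ofEven_mul_comm r', mul_assoc]
    · rw [← LinearMap.rTensor_comp_apply, ← LinearMap.rTensor_comp_apply]
      congr 2
      ext x
      simp [mul_assoc]
  | add a b ha hb =>
    rw [mul_add, map_add, ha, hb, map_add, map_add]
    have : (LinearMap.mulRight ℝ (a + b) ∘ₗ (ofEven n).toLinearMap) =
      (LinearMap.mulRight ℝ a ∘ₗ (ofEven n).toLinearMap) +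
      (LinearMap.mulRight ℝ b ∘ₗ (ofEven n).toLinearMap) := by
        ext x; simp [mul_add]
    rw [this, LinearMap.rTensor_add, LinearMap.add_apply]
    abel

lemma vertEven_hs_mul (D : EvenAlg n →ₗ[ℝ] EvenAlg n ⊗[ℝ] JetSpace n ι)
    (y : JetSpace n (Sym2 (Fin n))) (a : LocalFun n) :
    vertEven D (hs y * a) = coefMul (hs y) (vertEven D a) := by
  induction a using LocalFun.induction_mul with
  | mul r w =>
    have h1 : hs y * (ofEven n r * ofOdd n w) =
        ofEven n r * ofOdd n (ExteriorAlgebra.ι ℝ y * w) := by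
      rw [← mul_assoc, ← ofEven_mul_comm, mul_assoc, map_mul, hs_apply]
    rw [h1, vertEven_mul, vertEven_mul, ← LinearMap.rTensor_comp_apply]
    congr 2
    ext x
    simp only [LinearMap.comp_apply, LinearMap.mulLeft_apply, AlgHom.toLinearMap_apply,
      LinearMap.mulRight_apply, map_mul, hs_apply, ← mul_assoc]
    rw [ofEven_mul_comm]
  | add a b ha hb => rw [mul_add, map_add, ha, hb, map_add, map_add]

lemma mulLeft_rTensor_eq_smul (r : EvenAlg n) (z : EvenAlg n ⊗[ℝ] JetSpace n ι) :
    (LinearMap.mulLeft ℝ r).rTensor _ z = r • z := by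
  induction z using TensorProduct.induction_on with
  | zero => simp
  | tmul x v => simp [TensorProduct.smul_tmul']
  | add x y hx hy => rw [map_add, hx, hy, smul_add]

/-- The jet of `h` represented by a generator. -/
def hVarJet : EvenVar n → JetSpace n (Sym2 (Fin n))
  | .h s J _ => Finsupp.single (s, J) 1
  | .Cstar _ _ => 0
  | .xistar _ => 0

/-- The jet of `C^*` or `ξ^*` represented by a generator. -/
def gVarJet : EvenVar n → JetSpace n (Option (Fin n))
  | .h _ _ _ => 0
  | .Cstar μ J => Finsupp.single (some μ, J) 1
  | .xistar J => Finsupp.single (none, J) 1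

/-- The vertical derivative with respect to `h` on the commuting algebra. -/
def vertHEven : EvenAlg n →ₗ[ℝ] EvenAlg n ⊗[ℝ] JetSpace n (Sym2 (Fin n)) :=
  (∑ s, (TensorProduct.mk ℝ (EvenAlg n) (JetSpace n (Sym2 (Fin n)))).flip
      (Finsupp.single (s, 0) 1) ∘ₗ coeffPartial s) +
    (MvPolynomial.mkDerivation (SmoothFun n)
      (fun v : EvenVar n => (1 : EvenAlg n) ⊗ₜ[ℝ] hVarJet v)).toLinearMap.restrictScalars ℝ

lemma vertHEven_mul (r r' : EvenAlg n) :
    vertHEven (r * r') = (LinearMap.mulLeft ℝ r).rTensor _ (vertHEven r') +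
      (LinearMap.mulLeft ℝ r').rTensor _ (vertHEven r) := by
  simp only [vertHEven, LinearMap.add_apply, LinearMap.sum_apply, LinearMap.comp_apply,
    LinearMap.coe_restrictScalars, Derivation.coeFn_coe, Derivation.leibniz,
    mulLeft_rTensor_eq_smul, Finset.smul_sum, coeffPartial_mul, map_add,
    Finset.sum_add_distrib, LinearMap.flip_apply, TensorProduct.mk_apply,
    TensorProduct.smul_tmul', smul_eq_mul]
  simp only [mul_comm r']
  abel

/-- The vertical derivative with respect to `C^*` and `ξ^*` on the commuting algebra. -/
def vertGEven : EvenAlg n →ₗ[ℝ] EvenAlg n ⊗[ℝ] JetSpace n (Option (Fin n)) :=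
  (MvPolynomial.mkDerivation (SmoothFun n)
      (fun v : EvenVar n => (1 : EvenAlg n) ⊗ₜ[ℝ] gVarJet v)).toLinearMap.restrictScalars ℝ

lemma vertGEven_mul (r r' : EvenAlg n) :
    vertGEven (r * r') = (LinearMap.mulLeft ℝ r).rTensor _ (vertGEven r') +
      (LinearMap.mulLeft ℝ r').rTensor _ (vertGEven r) := by
  simp only [vertGEven, LinearMap.coe_restrictScalars, Derivation.coeFn_coe, Derivation.leibniz,
    mulLeft_rTensor_eq_smul]

/-- The vertical derivative with respect to `h`. -/
def vertH : LocalFun n →ₗ[ℝ] LocalFun n ⊗[ℝ] JetSpace n (Sym2 (Fin n)) := vertEven vertHEven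

/-- The vertical derivative with respect to `C^*` and `ξ^*`. -/
def vertG : LocalFun n →ₗ[ℝ] LocalFun n ⊗[ℝ] JetSpace n (Option (Fin n)) := vertEven vertGEven

@[simp] lemma vertH_hs_mul (y : JetSpace n (Sym2 (Fin n))) (a : LocalFun n) :
    vertH (hs y * a) = coefMul (hs y) (vertH a) := vertEven_hs_mul _ _ _

@[simp] lemma vertG_hs_mul (y : JetSpace n (Sym2 (Fin n))) (a : LocalFun n) :
    vertG (hs y * a) = coefMul (hs y) (vertG a) := vertEven_hs_mul _ _ _

lemma vertH_one : vertH (1 : LocalFun n) = 0 := by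
  have := vertEven_mul (vertHEven (n := n)) 1 1
  rw [map_one, map_one, mul_one] at this
  have h1 : vertHEven (1 : EvenAlg n) = 0 := by
    have := vertHEven_mul (1 : EvenAlg n) 1
    simpa [LinearMap.mulLeft_one] using this
  rw [vertH, this, h1, map_zero]

lemma vertG_one : vertG (1 : LocalFun n) = 0 := by
  have := vertEven_mul (vertGEven (n := n)) 1 1
  rw [map_one, map_one, mul_one] at this
  have h1 : vertGEven (1 : EvenAlg n) = 0 := by simp [vertGEven]
  rw [vertG, this, h1, map_zero]

@[simp] lemma vertH_sm_mul (g : SmoothFun n) (a : LocalFun n) :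
    vertH (sm g * a) = ∑ s, (sm (smoothPartial s g) * a) ⊗ₜ[ℝ] Finsupp.single (s, 0) 1 +
      coefMul (sm g) (vertH a) := by
  rw [sm, vertH, vertEven_ofEven_mul _ vertHEven_mul]
  congr 1
  simp [vertHEven, sm]

@[simp] lemma vertG_sm_mul (g : SmoothFun n) (a : LocalFun n) :
    vertG (sm g * a) = coefMul (sm g) (vertG a) := by
  rw [sm, vertG, vertEven_ofEven_mul _ vertGEven_mul]
  simp [vertGEven]

lemma vertH_ev_mul (v : EvenVar n) (a : LocalFun n) :
    vertH (ev v * a) = a ⊗ₜ[ℝ] hVarJet v + coefMul (ev v) (vertH a) := by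
  rw [ev, vertH, vertEven_ofEven_mul _ vertHEven_mul]
  congr 1
  simp [vertHEven]

lemma vertG_ev_mul (v : EvenVar n) (a : LocalFun n) :
    vertG (ev v * a) = a ⊗ₜ[ℝ] gVarJet v + coefMul (ev v) (vertG a) := by
  rw [ev, vertG, vertEven_ofEven_mul _ vertGEven_mul]
  congr 1
  simp [vertGEven]

lemma coefMul_add (a b : LocalFun n) (z : LocalFun n ⊗[ℝ] JetSpace n ι) :
    coefMul (a + b) z = coefMul a z + coefMul b z := by
  have : LinearMap.mulLeft ℝ (a + b) = LinearMap.mulLeft ℝ a + LinearMap.mulLeft ℝ b := by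
    ext x; simp [add_mul]
  rw [coefMul, this, LinearMap.rTensor_add, LinearMap.add_apply]

lemma coefMul_smul (c : ℝ) (a : LocalFun n) (z : LocalFun n ⊗[ℝ] JetSpace n ι) :
    coefMul (c • a) z = c • coefMul a z := by
  have : LinearMap.mulLeft ℝ (c • a) = c • LinearMap.mulLeft ℝ a := by
    ext x; simp
  rw [coefMul, this, LinearMap.rTensor_smul, LinearMap.smul_apply]

lemma coefMul_mul (a b : LocalFun n) (z : LocalFun n ⊗[ℝ] JetSpace n ι) :
    coefMul (a * b) z = coefMul a (coefMul b z) := by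
  have : LinearMap.mulLeft ℝ (a * b) = LinearMap.mulLeft ℝ a ∘ₗ LinearMap.mulLeft ℝ b := by
    ext x; simp
  rw [coefMul, this, LinearMap.rTensor_comp, LinearMap.comp_apply]

@[simp] lemma coefMul_tmul (a b : LocalFun n) (w : JetSpace n ι) :
    coefMul a (b ⊗ₜ[ℝ] w) = (a * b) ⊗ₜ[ℝ] w := rfl

lemma coefMul_zero (z : LocalFun n ⊗[ℝ] JetSpace n ι) : coefMul 0 z = 0 := by
  rw [coefMul, LinearMap.mulLeft_zero_eq_zero, LinearMap.rTensor_zero, LinearMap.zero_apply]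

@[simp] lemma vertH_hlin_mul (p : JetSpace n (Sym2 (Fin n))) (a : LocalFun n) :
    vertH (hlin p * a) = a ⊗ₜ[ℝ] p + coefMul (hlin p) (vertH a) := by
  induction p using Finsupp.induction_linear with
  | zero => simp [coefMul_zero]
  | add f g hf hg =>
    simp only [map_add, add_mul, hf, hg, coefMul_add, TensorProduct.tmul_add]; abel
  | single v c =>
    obtain ⟨s, J⟩ := v
    by_cases hJ : J = 0
    · subst hJ
      simp only [hlin_single_zero, smul_mul_assoc, map_smul, vertH_sm_mul, coefMul_smul,
        smoothPartial_smoothCoord, smul_add]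
      congr 1
      rw [Finset.sum_eq_single s]
      · rw [if_pos rfl, ← TensorProduct.tmul_smul]
        simp [sm]
      · intro t _ ht
        simp [ht, sm]
      · simp
    · rw [hlin_single_of_ne s J hJ, smul_mul_assoc, map_smul, vertH_ev_mul, coefMul_smul, smul_add,
        ← TensorProduct.tmul_smul]
      simp [hVarJet]

@[simp] lemma vertG_hlin_mul (p : JetSpace n (Sym2 (Fin n))) (a : LocalFun n) :
    vertG (hlin p * a) = coefMul (hlin p) (vertG a) := by
  induction p using Finsupp.induction_linear with
  | zero => simp [coefMul_zero]
  | add f g hf hg =>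
    simp only [map_add, add_mul, hf, hg, coefMul_add]
  | single v c =>
    obtain ⟨s, J⟩ := v
    by_cases hJ : J = 0
    · subst hJ
      simp only [hlin_single_zero, smul_mul_assoc, map_smul, vertG_sm_mul, coefMul_smul]
    · rw [hlin_single_of_ne s J hJ, smul_mul_assoc, map_smul, vertG_ev_mul, coefMul_smul]
      simp [gVarJet]

@[simp] lemma vertG_gs_mul (g : JetSpace n (Option (Fin n))) (a : LocalFun n) :
    vertG (gs g * a) = a ⊗ₜ[ℝ] g + coefMul (gs g) (vertG a) := by
  induction g using Finsupp.induction_linear with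
  | zero => simp [coefMul_zero]
  | add f g hf hg =>
    simp only [map_add, add_mul, hf, hg, coefMul_add, TensorProduct.tmul_add]; abel
  | single v c =>
    rw [gs_single, smul_mul_assoc, map_smul, vertG_ev_mul, coefMul_smul, smul_add,
      ← TensorProduct.tmul_smul]
    obtain ⟨i, J⟩ := v
    cases i <;> simp [gVarJet, gaugeVar]

@[simp] lemma vertH_gs_mul (g : JetSpace n (Option (Fin n))) (a : LocalFun n) :
    vertH (gs g * a) = coefMul (gs g) (vertH a) := by
  induction g using Finsupp.induction_linear with
  | zero => simp [coefMul_zero]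
  | add f g hf hg =>
    simp only [map_add, add_mul, hf, hg, coefMul_add]
  | single v c =>
    rw [gs_single, smul_mul_assoc, map_smul, vertH_ev_mul, coefMul_smul]
    obtain ⟨i, J⟩ := v
    cases i <;> simp [hVarJet, gaugeVar]

/-- The step `(w, z) ↦ (v w, w ⊗ v - v z)` in the construction of the left derivative. -/
def vertOddStep : JetSpace n (Sym2 (Fin n)) →ₗ[ℝ]
    Module.End ℝ (OddAlg n × OddAlg n ⊗[ℝ] JetSpace n (Sym2 (Fin n))) where
  toFun v :=
    { toFun := fun z => (ExteriorAlgebra.ι ℝ v * z.1, z.1 ⊗ₜ[ℝ] v -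
        (LinearMap.mulLeft ℝ (ExteriorAlgebra.ι ℝ v)).rTensor _ z.2)
      map_add' := fun x y => by
        refine Prod.ext (mul_add _ _ _) ?_
        simp only [Prod.fst_add, Prod.snd_add, TensorProduct.add_tmul, map_add]
        abel
      map_smul' := fun c x => by
        refine Prod.ext (mul_smul_comm _ _ _) ?_
        simp only [Prod.smul_fst, Prod.smul_snd, map_smul, TensorProduct.smul_tmul', smul_sub,
          RingHom.id_apply] }
  map_add' v w := by
    have : LinearMap.mulLeft ℝ (ExteriorAlgebra.ι ℝ v + ExteriorAlgebra.ι ℝ w : OddAlg n) =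
      LinearMap.mulLeft ℝ (ExteriorAlgebra.ι ℝ v) + LinearMap.mulLeft ℝ (ExteriorAlgebra.ι ℝ w) :=
      LinearMap.ext fun x => add_mul _ _ _
    refine LinearMap.ext fun z => Prod.ext ?_ ?_
    · simp [add_mul]
    · simp only [map_add, LinearMap.coe_mk, AddHom.coe_mk, LinearMap.add_apply, Prod.snd_add,
        this, LinearMap.rTensor_add, TensorProduct.tmul_add]
      abel
  map_smul' c v := by
    have : LinearMap.mulLeft ℝ (c • ExteriorAlgebra.ι ℝ v : OddAlg n) =
      c • LinearMap.mulLeft ℝ (ExteriorAlgebra.ι ℝ v) :=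
      LinearMap.ext fun x => smul_mul_assoc _ _ _
    refine LinearMap.ext fun z => Prod.ext ?_ ?_
    · simp
    · simp only [map_smul, LinearMap.coe_mk, AddHom.coe_mk, LinearMap.smul_apply, Prod.smul_snd,
        this, LinearMap.rTensor_smul, TensorProduct.tmul_smul, smul_sub, RingHom.id_apply]

/-- The algebra map that encodes the left derivative of the Grassmann algebra. -/
def vertOddHom : OddAlg n →ₐ[ℝ]
    Module.End ℝ (OddAlg n × OddAlg n ⊗[ℝ] JetSpace n (Sym2 (Fin n))) :=
  ExteriorAlgebra.lift ℝ ⟨vertOddStep, fun v => by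
    refine LinearMap.ext fun z => Prod.ext ?_ ?_
    · simp [vertOddStep, ← mul_assoc]
    · have : ∀ x : OddAlg n ⊗[ℝ] JetSpace n (Sym2 (Fin n)),
        (LinearMap.mulLeft ℝ (ExteriorAlgebra.ι ℝ v)).rTensor _
          ((LinearMap.mulLeft ℝ (ExteriorAlgebra.ι ℝ v)).rTensor _ x) = 0 := by
        intro x
        rw [← LinearMap.comp_apply, ← LinearMap.rTensor_comp, ← LinearMap.mulLeft_mul]
        simp
      simp [vertOddStep, this]⟩

/-- The left derivative of the Grassmann algebra. -/
def vertOdd : OddAlg n →ₗ[ℝ] OddAlg n ⊗[ℝ] JetSpace n (Sym2 (Fin n)) :=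
  LinearMap.snd ℝ _ _ ∘ₗ (LinearMap.applyₗ (1, 0)) ∘ₗ vertOddHom.toLinearMap

lemma vertOdd_one : vertOdd (1 : OddAlg n) = 0 := by simp [vertOdd]

lemma vertOdd_ι_mul (y : JetSpace n (Sym2 (Fin n))) (w : OddAlg n) :
    vertOdd (ExteriorAlgebra.ι ℝ y * w) = w ⊗ₜ[ℝ] y -
      (LinearMap.mulLeft ℝ (ExteriorAlgebra.ι ℝ y)).rTensor _ (vertOdd w) := by
  -- The first component just rebuilds w. The second component of each step then reads w ⊗ y minus y
  -- times the old derivative, which is the signed Leibniz rule.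
  have h1 : ∀ w : OddAlg n, (vertOddHom w (1, 0)).1 = w := by
    intro w
    induction w using CliffordAlgebra.left_induction with
    | algebraMap c =>
      have : vertOddHom (algebraMap ℝ (OddAlg n) c) = algebraMap ℝ _ c := AlgHom.commutes _ _
      have h2 : (vertOddHom (algebraMap ℝ (OddAlg n) c) (1, 0)).1 = algebraMap ℝ (OddAlg n) c := by
        rw [this]
        simp [Algebra.algebraMap_eq_smul_one]
      exact h2
    | add x y hx hy => rw [map_add, LinearMap.add_apply, Prod.fst_add, hx, hy]
    | ι_mul x m hx =>
      have : (vertOddHom (ExteriorAlgebra.ι ℝ m * x) (1, 0)).1 = ExteriorAlgebra.ι ℝ m * x := by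
        rw [map_mul, vertOddHom, ExteriorAlgebra.lift_ι_apply, ← vertOddHom]
        simp [vertOddStep, hx]
      exact this
  have : (vertOddHom (ExteriorAlgebra.ι ℝ y * w) (1, 0)).2 = w ⊗ₜ[ℝ] y -
      (LinearMap.mulLeft ℝ (ExteriorAlgebra.ι ℝ y)).rTensor _ (vertOddHom w (1, 0)).2 := by
    rw [map_mul, vertOddHom, ExteriorAlgebra.lift_ι_apply, ← vertOddHom]
    simp [vertOddStep, h1]
  exact this

/-- The left vertical derivative with respect to `h^*`. -/
def vertHs : LocalFun n →ₗ[ℝ] LocalFun n ⊗[ℝ] JetSpace n (Sym2 (Fin n)) :=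
  ((TensorProduct.assoc ℝ (EvenAlg n) (OddAlg n) (JetSpace n (Sym2 (Fin n)))).symm.toLinearMap ∘ₗ
    vertOdd.lTensor (EvenAlg n) : EvenAlg n ⊗[ℝ] OddAlg n →ₗ[ℝ]
      (EvenAlg n ⊗[ℝ] OddAlg n) ⊗[ℝ] JetSpace n (Sym2 (Fin n)))

lemma vertHs_mul (r : EvenAlg n) (w : OddAlg n) : vertHs (ofEven n r * ofOdd n w) =
      (LinearMap.mulLeft ℝ (ofEven n r) ∘ₗ (ofOdd n).toLinearMap).rTensor _ (vertOdd w) := by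
  rw [← tmul_eq_mul]
  have : ∀ z : OddAlg n ⊗[ℝ] JetSpace n (Sym2 (Fin n)),
      (TensorProduct.assoc ℝ (EvenAlg n) (OddAlg n) (JetSpace n (Sym2 (Fin n)))).symm (r ⊗ₜ z) =
      (LinearMap.mulLeft ℝ (ofEven n r) ∘ₗ (ofOdd n).toLinearMap).rTensor _ z := by
    intro z
    induction z using TensorProduct.induction_on with
    | zero => rw [TensorProduct.tmul_zero, map_zero, map_zero]; rfl
    | tmul x v =>
      rw [TensorProduct.assoc_symm_tmul, LinearMap.rTensor_tmul, LinearMap.comp_apply,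
        LinearMap.mulLeft_apply, AlgHom.toLinearMap_apply, ← tmul_eq_mul]
      rfl
    | add x y hx hy => rw [TensorProduct.tmul_add, map_add, map_add, hx, hy]; rfl
  exact this (vertOdd w)

lemma vertHs_one : vertHs (1 : LocalFun n) = 0 := by
  have := vertHs_mul (n := n) 1 1
  rwa [map_one, map_one, mul_one, vertOdd_one, map_zero] at this

lemma vertHs_ofEven_mul (r : EvenAlg n) (a : LocalFun n) :
    vertHs (ofEven n r * a) = coefMul (ofEven n r) (vertHs a) := by
  induction a using LocalFun.induction_mul with
  | mul r' w =>
    rw [← mul_assoc, ← map_mul, vertHs_mul, vertHs_mul, ← LinearMap.rTensor_comp_apply, map_mul,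
      LinearMap.mulLeft_mul]
    rfl
  | add a b ha hb => rw [mul_add, map_add, ha, hb, map_add, map_add]

@[simp] lemma vertHs_sm_mul (g : SmoothFun n) (a : LocalFun n) :
    vertHs (sm g * a) = coefMul (sm g) (vertHs a) := vertHs_ofEven_mul _ _

@[simp] lemma vertHs_hlin_mul (p : JetSpace n (Sym2 (Fin n))) (a : LocalFun n) :
    vertHs (hlin p * a) = coefMul (hlin p) (vertHs a) := vertHs_ofEven_mul _ _

@[simp] lemma vertHs_gs_mul (g : JetSpace n (Option (Fin n))) (a : LocalFun n) :
    vertHs (gs g * a) = coefMul (gs g) (vertHs a) := vertHs_ofEven_mul _ _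

@[simp] lemma vertHs_hs_mul (y : JetSpace n (Sym2 (Fin n))) (a : LocalFun n) :
    vertHs (hs y * a) = a ⊗ₜ[ℝ] y - coefMul (hs y) (vertHs a) := by
  induction a using LocalFun.induction_mul with
  | mul r w =>
    have h1 : hs y * (ofEven n r * ofOdd n w) =
        ofEven n r * ofOdd n (ExteriorAlgebra.ι ℝ y * w) := by
      rw [← mul_assoc, ← ofEven_mul_comm, mul_assoc, map_mul, hs_apply]
    rw [h1, vertHs_mul, vertHs_mul, vertOdd_ι_mul, map_sub]
    congr 1
    rw [← LinearMap.rTensor_comp_apply, ← LinearMap.rTensor_comp_apply]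
    congr 2
    refine LinearMap.ext fun x => ?_
    simp only [LinearMap.comp_apply, LinearMap.mulLeft_apply, AlgHom.toLinearMap_apply,
      map_mul, hs_apply, ← mul_assoc]
    rw [ofEven_mul_comm]
  | add a b ha hb =>
    rw [mul_add, map_add, ha, hb, map_add, map_add, TensorProduct.add_tmul]
    abel

end vertical

/-! ### Commutation of the basic operators -/

section operators

variable {ι : Type}

/-- Transfers the Leibniz rule of an operator from local functions to the coefficients of one-forms.
The next two lemmas do the same for antiderivations and for operators commuting with the
multiplication. -/
lemma rTensor_coefMul {T : LocalFun n →ₗ[ℝ] LocalFun n} {x x' : LocalFun n}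
    (h : ∀ a, T (x * a) = x' * a + x * T a) (z : LocalFun n ⊗[ℝ] JetSpace n ι) :
    T.rTensor _ (coefMul x z) = coefMul x' z + coefMul x (T.rTensor _ z) := by
  induction z using TensorProduct.induction_on with
  | zero => simp
  | tmul a w => simp [h, TensorProduct.add_tmul]
  | add y z hy hz => simp only [map_add, hy, hz]; abel

lemma rTensor_coefMul_neg {T : LocalFun n →ₗ[ℝ] LocalFun n} {x x' : LocalFun n}
    (h : ∀ a, T (x * a) = x' * a - x * T a) (z : LocalFun n ⊗[ℝ] JetSpace n ι) :
    T.rTensor _ (coefMul x z) = coefMul x' z - coefMul x (T.rTensor _ z) := by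
  induction z using TensorProduct.induction_on with
  | zero => simp
  | tmul a w => simp [h, TensorProduct.sub_tmul]
  | add y z hy hz => simp only [map_add, hy, hz]; abel

lemma rTensor_coefMul_comm {T : LocalFun n →ₗ[ℝ] LocalFun n} {x : LocalFun n}
    (h : ∀ a, T (x * a) = x * T a) (z : LocalFun n ⊗[ℝ] JetSpace n ι) :
    T.rTensor _ (coefMul x z) = coefMul x (T.rTensor _ z) := by
  have := rTensor_coefMul (x' := 0) (T := T) (x := x) (by simpa using h) z
  rwa [coefMul_zero, zero_add] at this

@[simp] lemma lTensor_coefMul {κ : Type} (U : JetSpace n ι →ₗ[ℝ] JetSpace n κ) (x : LocalFun n)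
    (z : LocalFun n ⊗[ℝ] JetSpace n ι) :
    U.lTensor _ (coefMul x z) = coefMul x (U.lTensor _ z) := by
  induction z using TensorProduct.induction_on with
  | zero => simp
  | tmul a w => simp
  | add y z hy hz => simp only [map_add, hy, hz]

lemma coefMul_sum {κ : Type*} (t : Finset κ) (f : κ → LocalFun n)
    (z : LocalFun n ⊗[ℝ] JetSpace n ι) : coefMul (∑ i ∈ t, f i) z = ∑ i ∈ t, coefMul (f i) z := by
  classical
  induction t using Finset.induction_on with
  | empty => simp [coefMul_zero]
  | insert i t hi ih => rw [Finset.sum_insert hi, Finset.sum_insert hi, coefMul_add, ih]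

/-- The total derivative of vertical one-forms. -/
def srcDeriv (μ : Fin n) : LocalFun n ⊗[ℝ] JetSpace n ι →ₗ[ℝ] LocalFun n ⊗[ℝ] JetSpace n ι :=
  (totalDeriv μ).rTensor _ + (jetShift μ).lTensor _

@[simp] lemma srcDeriv_tmul (μ : Fin n) (a : LocalFun n) (w : JetSpace n ι) :
    srcDeriv μ (a ⊗ₜ[ℝ] w) = totalDeriv μ a ⊗ₜ[ℝ] w + a ⊗ₜ[ℝ] jetShift μ w := rfl

lemma srcDeriv_coefMul (μ : Fin n) {x x' : LocalFun n}
    (h : ∀ a, totalDeriv μ (x * a) = x' * a + x * totalDeriv μ a)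
    (z : LocalFun n ⊗[ℝ] JetSpace n ι) :
    srcDeriv μ (coefMul x z) = coefMul x' z + coefMul x (srcDeriv μ z) := by
  rw [srcDeriv, LinearMap.add_apply, LinearMap.add_apply, rTensor_coefMul h, lTensor_coefMul,
    map_add]
  abel

lemma totalDeriv_sm_mul' (μ : Fin n) (g : SmoothFun n) (a : LocalFun n) :
    totalDeriv μ (sm g * a) =
      (∑ s, hlin (Finsupp.single (s, raise 0 μ) 1) * sm (smoothPartial s g)) * a +
        sm g * totalDeriv μ a := by
  rw [totalDeriv_sm_mul, Finset.sum_mul]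
  simp only [mul_assoc]

lemma totalDeriv_comm (μ ν : Fin n) (a : LocalFun n) :
    totalDeriv μ (totalDeriv ν a) = totalDeriv ν (totalDeriv μ a) := by
  have hc : ∀ {ι : Type} (w : JetSpace n ι), jetShift μ (jetShift ν w) =
      jetShift ν (jetShift μ w) := by
    intro ι w
    induction w using Finsupp.induction_linear with
    | zero => simp
    | add f g hf hg => simp only [map_add, hf, hg]
    | single v c => obtain ⟨i, J⟩ := v; simp [raise_comm J]
  induction a using LocalFun.induction_gen with
  | one => simp [totalDeriv_one]
  | add a b ha hb => simp only [map_add, ha, hb]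
  | sm g a ha =>
    simp only [totalDeriv_sm_mul, map_add, map_sum, totalDeriv_hlin_mul, jetShift_single, ha,
      mul_add, Finset.sum_add_distrib, Finset.mul_sum, raise_comm 0 μ ν]
    -- The terms with second derivatives of the smooth coefficient match after exchanging the
    -- summation indices, by symmetry of second derivatives.
    rw [Finset.sum_comm (s := Finset.univ) (t := Finset.univ)
      (f := fun s t => hlin (Finsupp.single (s, raise 0 ν) 1) *
        (hlin (Finsupp.single (t, raise 0 μ) 1) * (sm (smoothPartial t (smoothPartial s g)) * a)))]
    have : ∀ s t, hlin (Finsupp.single (s, raise 0 ν) 1) *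
        (hlin (Finsupp.single (t, raise 0 μ) 1) * (sm (smoothPartial t (smoothPartial s g)) * a)) =
        hlin (Finsupp.single (t, raise 0 μ) 1) *
        (hlin (Finsupp.single (s, raise 0 ν) 1) *
          (sm (smoothPartial s (smoothPartial t g)) * a)) := by
      intro s t
      rw [smoothPartial_comm t s, ← mul_assoc, ← mul_assoc, hlin_mul_comm (Finsupp.single (s, _) 1)]
      simp only [mul_assoc]
    simp only [this]
    abel
  | hlin s J a _ ha => simp only [totalDeriv_hlin_mul, map_add, ha, hc]; abel
  | gs v a ha => simp only [totalDeriv_gs_mul, map_add, ha, hc]; abel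
  | hs y a ha => simp only [totalDeriv_hs_mul, map_add, ha, hc]; abel

/-- With its analogues for the other variables, this is why Euler–Lagrange derivatives annihilate
divergences: the vertical derivative of a total derivative is a total derivative of a one-form. -/
lemma vertH_totalDeriv (μ : Fin n) (a : LocalFun n) :
    vertH (totalDeriv μ a) = srcDeriv μ (vertH a) := by
  induction a using LocalFun.induction_gen with
  | one => simp [totalDeriv_one, vertH_one]
  | add a b ha hb => simp only [map_add, ha, hb]
  | sm g a ha =>
    simp only [totalDeriv_sm_mul, vertH_sm_mul, vertH_hlin_mul, map_add, map_sum, srcDeriv_tmul,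
      srcDeriv_coefMul μ (totalDeriv_sm_mul' μ g), ha, coefMul_tmul, Finset.sum_add_distrib,
      jetShift_single, TensorProduct.add_tmul, TensorProduct.sum_tmul, coefMul_sum, coefMul_mul]
    rw [Finset.sum_comm]
    simp only [smoothPartial_comm]
    abel
  | hlin s J a _ ha =>
    simp only [totalDeriv_hlin_mul, vertH_hlin_mul, map_add, ha, srcDeriv_tmul,
      srcDeriv_coefMul μ (totalDeriv_hlin_mul μ _)]
    abel
  | gs v a ha =>
    simp only [totalDeriv_gs_mul, vertH_gs_mul, map_add, ha,
      srcDeriv_coefMul μ (totalDeriv_gs_mul μ _)]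
  | hs y a ha =>
    simp only [totalDeriv_hs_mul, vertH_hs_mul, map_add, ha,
      srcDeriv_coefMul μ (totalDeriv_hs_mul μ _)]

lemma vertG_totalDeriv (μ : Fin n) (a : LocalFun n) :
    vertG (totalDeriv μ a) = srcDeriv μ (vertG a) := by
  induction a using LocalFun.induction_gen with
  | one => simp [totalDeriv_one, vertG_one]
  | add a b ha hb => simp only [map_add, ha, hb]
  | sm g a ha =>
    simp only [totalDeriv_sm_mul, vertG_sm_mul, vertG_hlin_mul, map_add, map_sum,
      srcDeriv_coefMul μ (totalDeriv_sm_mul' μ g), ha, coefMul_sum, coefMul_mul]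
  | hlin s J a _ ha =>
    simp only [totalDeriv_hlin_mul, vertG_hlin_mul, map_add, ha,
      srcDeriv_coefMul μ (totalDeriv_hlin_mul μ _)]
  | gs v a ha =>
    simp only [totalDeriv_gs_mul, vertG_gs_mul, map_add, ha, srcDeriv_tmul,
      srcDeriv_coefMul μ (totalDeriv_gs_mul μ _)]
    abel
  | hs y a ha =>
    simp only [totalDeriv_hs_mul, vertG_hs_mul, map_add, ha,
      srcDeriv_coefMul μ (totalDeriv_hs_mul μ _)]

lemma vertHs_totalDeriv (μ : Fin n) (a : LocalFun n) :
    vertHs (totalDeriv μ a) = srcDeriv μ (vertHs a) := by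
  induction a using LocalFun.induction_gen with
  | one => simp [totalDeriv_one, vertHs_one]
  | add a b ha hb => simp only [map_add, ha, hb]
  | sm g a ha =>
    simp only [totalDeriv_sm_mul, vertHs_sm_mul, vertHs_hlin_mul, map_add, map_sum,
      srcDeriv_coefMul μ (totalDeriv_sm_mul' μ g), ha, coefMul_sum, coefMul_mul]
  | hlin s J a _ ha =>
    simp only [totalDeriv_hlin_mul, vertHs_hlin_mul, map_add, ha,
      srcDeriv_coefMul μ (totalDeriv_hlin_mul μ _)]
  | gs v a ha =>
    simp only [totalDeriv_gs_mul, vertHs_gs_mul, map_add, ha,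
      srcDeriv_coefMul μ (totalDeriv_gs_mul μ _)]
  | hs y a ha =>
    simp only [totalDeriv_hs_mul, vertHs_hs_mul, map_add, map_sub, ha, srcDeriv_tmul,
      srcDeriv_coefMul μ (totalDeriv_hs_mul μ _)]
    abel

lemma noetherMap_jetShift (μ : Fin n) (g : JetSpace n (Option (Fin n))) :
    noetherMap (jetShift μ g) = jetShift μ (noetherMap g) := by
  induction g using Finsupp.induction_linear with
  | zero => simp
  | add f g hf hg => simp only [map_add, hf, hg]
  | single v c =>
    obtain ⟨i, J⟩ := v
    rw [jetShift_single]
    cases i <;> simp [noetherMap, raise_comm J]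

end operators

/-! ### The Koszul–Tate differential and its vertical derivatives. -/

section differential

variable (D : JetSpace n (Sym2 (Fin n)) →ₗ[ℝ] JetSpace n (Sym2 (Fin n)))

lemma linKT_totalDeriv (hD : ∀ μ w, D (jetShift μ w) = jetShift μ (D w)) (μ : Fin n)
    (a : LocalFun n) : linKT D (totalDeriv μ a) = totalDeriv μ (linKT D a) := by
  induction a using LocalFun.induction_gen with
  | one => simp [totalDeriv_one]
  | add a b ha hb => simp only [map_add, ha, hb]
  | sm g a ha => simp only [totalDeriv_sm_mul, linKT_sm_mul, linKT_hlin_mul, map_add, map_sum, ha]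
  | hlin s J a _ ha => simp only [totalDeriv_hlin_mul, linKT_hlin_mul, map_add, ha]
  | gs v a ha =>
    simp only [totalDeriv_gs_mul, totalDeriv_hs_mul, linKT_gs_mul, map_add, ha,
      noetherMap_jetShift]
    abel
  | hs y a ha =>
    simp only [totalDeriv_hs_mul, totalDeriv_hlin_mul, linKT_hs_mul, map_add, map_sub, ha, hD]
    abel

/-- The square of an odd antiderivation is a derivation, so only generators matter. The only
nontrivial one is a ghost antifield, where D ∘ K = 0 enters. -/
lemma linKT_linKT (hDK : ∀ g, D (noetherMap g) = 0) (a : LocalFun n) :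
    linKT D (linKT D a) = 0 := by
  induction a using LocalFun.induction_gen with
  | one => simp
  | add a b ha hb => simp only [map_add, ha, hb, add_zero]
  | sm g a ha => simp only [linKT_sm_mul, ha, mul_zero]
  | hlin s J a _ ha => simp only [linKT_hlin_mul, ha, mul_zero]
  | gs v a ha => simp [ha, hDK]
  | hs y a ha => simp [ha]

/-- Chain rule: δ creates jets of `h` only from `h^*`, through D. Applying Euler operators to this
identity and to the next one turns a cocycle condition into equations between its Euler–Lagrange
derivatives. -/
lemma vertH_linKT (a : LocalFun n) :
    vertH (linKT D a) = (linKT D).rTensor _ (vertH a) + D.lTensor _ (vertHs a) := by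
  induction a using LocalFun.induction_gen with
  | one => simp [vertH_one, vertHs_one]
  | add a b ha hb => simp only [map_add, ha, hb]; abel
  | sm g a ha =>
    simp only [linKT_sm_mul, vertH_sm_mul, vertHs_sm_mul, map_add, map_sum, ha, lTensor_coefMul,
      rTensor_coefMul_comm (linKT_sm_mul D g), LinearMap.rTensor_tmul]
    abel
  | hlin s J a _ ha =>
    simp only [linKT_hlin_mul, vertH_hlin_mul, vertHs_hlin_mul, map_add, ha, lTensor_coefMul,
      rTensor_coefMul_comm (linKT_hlin_mul D _), LinearMap.rTensor_tmul]
    abel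
  | gs v a ha =>
    simp only [linKT_gs_mul, vertH_gs_mul, vertHs_gs_mul, vertH_hs_mul, map_add, ha,
      lTensor_coefMul, rTensor_coefMul (linKT_gs_mul D _)]
    abel
  | hs y a ha =>
    simp only [linKT_hs_mul, vertH_hs_mul, vertHs_hs_mul, vertH_hlin_mul, map_add, map_sub, ha,
      lTensor_coefMul, rTensor_coefMul_neg (linKT_hs_mul D _), LinearMap.lTensor_tmul]
    abel

/-- The minus sign appears because the left derivative by `h^*` is itself odd. The second term
records that δ of a ghost antifield is `h^*` applied to K. -/
lemma vertHs_linKT (a : LocalFun n) :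
    vertHs (linKT D a) = -(linKT D).rTensor _ (vertHs a) + noetherMap.lTensor _ (vertG a) := by
  induction a using LocalFun.induction_gen with
  | one => simp [vertG_one, vertHs_one]
  | add a b ha hb => simp only [map_add, ha, hb]; abel
  | sm g a ha =>
    simp only [linKT_sm_mul, vertG_sm_mul, vertHs_sm_mul, map_add, map_neg, ha, lTensor_coefMul,
      rTensor_coefMul_comm (linKT_sm_mul D g)]
  | hlin s J a _ ha =>
    simp only [linKT_hlin_mul, vertG_hlin_mul, vertHs_hlin_mul, map_add, map_neg, ha,
      lTensor_coefMul, rTensor_coefMul_comm (linKT_hlin_mul D _)]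
  | gs v a ha =>
    simp only [linKT_gs_mul, vertG_gs_mul, vertHs_gs_mul, vertHs_hs_mul, map_add, map_neg, ha,
      lTensor_coefMul, rTensor_coefMul (linKT_gs_mul D _), LinearMap.lTensor_tmul]
    abel
  | hs y a ha =>
    simp only [linKT_hs_mul, vertG_hs_mul, vertHs_hs_mul, vertHs_hlin_mul, map_add, map_sub,
      map_neg, ha, lTensor_coefMul, rTensor_coefMul_neg (linKT_hs_mul D _), LinearMap.rTensor_tmul]
    abel

lemma vertG_linKT (a : LocalFun n) :
    vertG (linKT D a) = (linKT D).rTensor _ (vertG a) := by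
  induction a using LocalFun.induction_gen with
  | one => simp [vertG_one]
  | add a b ha hb => simp only [map_add, ha, hb]
  | sm g a ha =>
    simp only [linKT_sm_mul, vertG_sm_mul, ha, rTensor_coefMul_comm (linKT_sm_mul D g)]
  | hlin s J a _ ha =>
    simp only [linKT_hlin_mul, vertG_hlin_mul, ha, rTensor_coefMul_comm (linKT_hlin_mul D _)]
  | gs v a ha =>
    simp only [linKT_gs_mul, vertG_gs_mul, vertG_hs_mul, map_add, ha,
      rTensor_coefMul (linKT_gs_mul D _), LinearMap.rTensor_tmul]
    abel
  | hs y a ha =>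
    simp only [linKT_hs_mul, vertG_hs_mul, vertG_hlin_mul, map_sub, ha,
      rTensor_coefMul_neg (linKT_hs_mul D _)]

end differential

/-! ### Contractions and counting operators -/

section contraction

variable {ι : Type}

/-- The contraction `a ⊗ w ↦ λ(w) a`. -/
def contract (l : JetSpace n ι →ₗ[ℝ] LocalFun n) :
    LocalFun n ⊗[ℝ] JetSpace n ι →ₗ[ℝ] LocalFun n :=
  TensorProduct.lift ((LinearMap.mul ℝ (LocalFun n) ∘ₗ l).flip)

@[simp] lemma contract_tmul (l : JetSpace n ι →ₗ[ℝ] LocalFun n) (a : LocalFun n)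
    (w : JetSpace n ι) : contract l (a ⊗ₜ[ℝ] w) = l w * a := by
  simp [contract]

lemma contract_coefMul {l : JetSpace n ι →ₗ[ℝ] LocalFun n} {x : LocalFun n}
    (h : ∀ w, l w * x = x * l w) (z : LocalFun n ⊗[ℝ] JetSpace n ι) :
    contract l (coefMul x z) = x * contract l z := by
  induction z using TensorProduct.induction_on with
  | zero => simp
  | tmul a w => simp [← mul_assoc, h]
  | add y z hy hz => simp only [map_add, hy, hz, mul_add]

@[simp] lemma contract_hlin_coefMul (x : LocalFun n) (z) :
    contract hlin (coefMul x z) = x * contract hlin z :=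
  contract_coefMul (fun _ => hlin_mul_comm _ _) z

@[simp] lemma contract_gs_coefMul (x : LocalFun n) (z) :
    contract gs (coefMul x z) = x * contract gs z :=
  contract_coefMul (fun _ => gs_mul_comm _ _) z

@[simp] lemma contract_hs_coefMul_sm (g : SmoothFun n) (z) :
    contract hs (coefMul (sm g) z) = sm g * contract hs z :=
  contract_coefMul (fun _ => (sm_mul_comm _ _).symm) z

@[simp] lemma contract_hs_coefMul_hlin (p : JetSpace n (Sym2 (Fin n))) (z) :
    contract hs (coefMul (hlin p) z) = hlin p * contract hs z :=
  contract_coefMul (fun _ => (hlin_mul_comm _ _).symm) z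

@[simp] lemma contract_hs_coefMul_gs (p : JetSpace n (Option (Fin n))) (z) :
    contract hs (coefMul (gs p) z) = gs p * contract hs z :=
  contract_coefMul (fun _ => (gs_mul_comm _ _).symm) z

@[simp] lemma contract_hs_coefMul_hs (y : JetSpace n (Sym2 (Fin n))) (z) :
    contract hs (coefMul (hs y) z) = -(hs y * contract hs z) := by
  induction z using TensorProduct.induction_on with
  | zero => simp
  | tmul a w => simp [← mul_assoc, hs_mul_hs w y]
  | add y z hy hz => simp only [map_add, hy, hz, mul_add]; abel

/-- The derivation that multiplies the jets of `h`, `h^*` and the ghost antifields by the given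
weights. -/
def weightCount (p q r : ℝ) : LocalFun n →ₗ[ℝ] LocalFun n :=
  p • (contract hlin ∘ₗ vertH) + q • (contract hs ∘ₗ vertHs) + r • (contract gs ∘ₗ vertG)

variable (p q r : ℝ)

lemma weightCount_one : weightCount p q r (1 : LocalFun n) = 0 := by
  simp [weightCount, vertH_one, vertHs_one, vertG_one]

/-- The Euler vector field `∑ h_s ∂/∂h_s` on smooth functions. -/
def smoothEuler : SmoothFun n →ₗ[ℝ] SmoothFun n :=
  ∑ s, LinearMap.mulLeft ℝ (smoothCoord s) ∘ₗ smoothPartial s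

lemma sm_mul_sm (f g : SmoothFun n) : sm (f * g) = sm f * sm g := by simp [sm]

lemma sm_add (f g : SmoothFun n) : sm (f + g) = sm f + sm g := by simp [sm]

lemma sm_sum {κ : Type*} (t : Finset κ) (f : κ → SmoothFun n) :
    sm (∑ i ∈ t, f i) = ∑ i ∈ t, sm (f i) := by simp [sm]

lemma sm_smoothEuler (g : SmoothFun n) :
    sm (smoothEuler g) = ∑ s, hlin (Finsupp.single (s, 0) 1) * sm (smoothPartial s g) := by
  simp [smoothEuler, sm_sum, sm_mul_sm, hlin_single_zero]

@[simp] lemma weightCount_sm_mul (g : SmoothFun n) (a : LocalFun n) :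
    weightCount p q r (sm g * a) = p • (sm (smoothEuler g) * a) + sm g * weightCount p q r a := by
  simp only [weightCount, LinearMap.add_apply, LinearMap.smul_apply, LinearMap.comp_apply,
    vertH_sm_mul, vertHs_sm_mul, vertG_sm_mul, map_add, map_sum, contract_tmul,
    contract_hlin_coefMul, contract_hs_coefMul_sm, contract_gs_coefMul, mul_add, mul_smul_comm,
    sm_smoothEuler, smul_add, Finset.sum_mul, mul_assoc]
  abel

@[simp] lemma weightCount_hlin_mul (w : JetSpace n (Sym2 (Fin n))) (a : LocalFun n) :
    weightCount p q r (hlin w * a) = p • (hlin w * a) + hlin w * weightCount p q r a := by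
  simp only [weightCount, LinearMap.add_apply, LinearMap.smul_apply, LinearMap.comp_apply,
    vertH_hlin_mul, vertHs_hlin_mul, vertG_hlin_mul, map_add, contract_tmul,
    contract_hlin_coefMul, contract_hs_coefMul_hlin, contract_gs_coefMul, mul_add, mul_smul_comm,
    smul_add]
  abel

@[simp] lemma weightCount_hs_mul (w : JetSpace n (Sym2 (Fin n))) (a : LocalFun n) :
    weightCount p q r (hs w * a) = q • (hs w * a) + hs w * weightCount p q r a := by
  simp only [weightCount, LinearMap.add_apply, LinearMap.smul_apply, LinearMap.comp_apply,
    vertH_hs_mul, vertHs_hs_mul, vertG_hs_mul, map_sub, contract_tmul,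
    contract_hlin_coefMul, contract_hs_coefMul_hs, contract_gs_coefMul, mul_add, mul_smul_comm,
    smul_sub, smul_neg]
  abel

@[simp] lemma weightCount_gs_mul (w : JetSpace n (Option (Fin n))) (a : LocalFun n) :
    weightCount p q r (gs w * a) = r • (gs w * a) + gs w * weightCount p q r a := by
  simp only [weightCount, LinearMap.add_apply, LinearMap.smul_apply, LinearMap.comp_apply,
    vertH_gs_mul, vertHs_gs_mul, vertG_gs_mul, map_add, contract_tmul,
    contract_hlin_coefMul, contract_hs_coefMul_gs, contract_gs_coefMul, mul_add, mul_smul_comm,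
    smul_add]
  abel

end contraction

/-! ### Commutators with the counting operators. -/

section counting

variable (p q r : ℝ)

lemma smoothPartial_smoothEuler (s : Sym2 (Fin n)) (g : SmoothFun n) :
    smoothPartial s (smoothEuler g) = smoothPartial s g + smoothEuler (smoothPartial s g) := by
  classical
  simp [smoothEuler, smoothPartial_mul, smoothPartial_smoothCoord, Finset.sum_add_distrib,
    smoothPartial_comm s, add_comm]

lemma weightCount_totalDeriv (μ : Fin n) (a : LocalFun n) :
    weightCount p q r (totalDeriv μ a) = totalDeriv μ (weightCount p q r a) := by
  induction a using LocalFun.induction_gen with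
  | one => simp [totalDeriv_one, weightCount_one]
  | add a b ha hb => simp only [map_add, ha, hb]
  | sm g a ha =>
    simp only [totalDeriv_sm_mul, weightCount_sm_mul, weightCount_hlin_mul, map_add, map_sum, ha,
      map_smul, smoothPartial_smoothEuler, sm_add, add_mul, mul_add, smul_add,
      Finset.sum_add_distrib, Finset.smul_sum, mul_smul_comm]
    abel
  | hlin s J a _ ha =>
    simp only [totalDeriv_hlin_mul, weightCount_hlin_mul, map_add, map_smul, ha, smul_add]; abel
  | gs v a ha =>
    simp only [totalDeriv_gs_mul, weightCount_gs_mul, map_add, map_smul, ha, smul_add]; abel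
  | hs y a ha =>
    simp only [totalDeriv_hs_mul, weightCount_hs_mul, map_add, map_smul, ha, smul_add]; abel

/-- The weights form an arithmetic progression, so δ lowers the weight by its step t. Two cases are
used: weights 0, 1, 2 with t = 1 give the antifield number, and weights 1, 1, 1 with t = 0 say that
δ preserves the polynomial degree because the equations are linear. -/
lemma weightCount_linKT (D : JetSpace n (Sym2 (Fin n)) →ₗ[ℝ] JetSpace n (Sym2 (Fin n)))
    (t : ℝ) (hq : q = p + t) (hr : r = q + t) (a : LocalFun n) :
    weightCount p q r (linKT D a) = linKT D (weightCount p q r a) - t • linKT D a := by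
  have hr' : ∀ x : LocalFun n, r • x = q • x + t • x := fun x => by rw [hr, add_smul]
  have hp' : ∀ x : LocalFun n, p • x = q • x - t • x := fun x => by rw [hq, add_smul]; abel
  induction a using LocalFun.induction_gen with
  | one => simp [weightCount_one]
  | add a b ha hb => simp only [map_add, ha, hb, smul_add]; abel
  | sm g a ha =>
    simp only [weightCount_sm_mul, linKT_sm_mul, map_add, map_smul, ha, mul_sub, mul_smul_comm]
    abel
  | hlin s J a _ ha =>
    simp only [weightCount_hlin_mul, linKT_hlin_mul, map_add, map_smul, ha, mul_sub,
      mul_smul_comm]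
    abel
  | gs v a ha =>
    simp only [weightCount_gs_mul, weightCount_hs_mul, linKT_gs_mul, map_add, map_smul, ha,
      mul_sub, mul_smul_comm, smul_add, hr']
    abel
  | hs y a ha =>
    simp only [weightCount_hlin_mul, weightCount_hs_mul, linKT_hs_mul, map_add, map_sub, map_smul,
      ha, mul_sub, mul_smul_comm, smul_sub, hp']
    abel

lemma weightCount_weightCount (p' q' r' : ℝ) (a : LocalFun n) :
    weightCount p q r (weightCount p' q' r' a) = weightCount p' q' r' (weightCount p q r a) := by
  induction a using LocalFun.induction_gen with
  | one => simp [weightCount_one]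
  | add a b ha hb => simp only [map_add, ha, hb]
  | sm g a ha =>
    simp only [weightCount_sm_mul, map_add, map_smul, ha, smul_add, smul_smul, mul_comm p p']
    abel
  | hlin s J a _ ha =>
    simp only [weightCount_hlin_mul, map_add, map_smul, ha, smul_add, smul_smul, mul_comm p p']
    abel
  | gs v a ha =>
    simp only [weightCount_gs_mul, map_add, map_smul, ha, smul_add, smul_smul, mul_comm r r']
    abel
  | hs y a ha =>
    simp only [weightCount_hs_mul, map_add, map_smul, ha, smul_add, smul_smul, mul_comm q q']
    abel

lemma rTensor_coefMul_smul {ι : Type} {T : LocalFun n →ₗ[ℝ] LocalFun n} {x : LocalFun n} {c : ℝ}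
    (h : ∀ a, T (x * a) = c • (x * a) + x * T a) (z : LocalFun n ⊗[ℝ] JetSpace n ι) :
    T.rTensor _ (coefMul x z) = c • coefMul x z + coefMul x (T.rTensor _ z) := by
  rw [rTensor_coefMul (x' := c • x) (by simpa using h), coefMul_smul]

/-- Differentiating by a variable lowers the count by the weight of that variable. The versions for
`h^*` and the ghost antifields drive inductions on the antifield number. -/
lemma vertH_weightCount (a : LocalFun n) :
    vertH (weightCount p q r a) = (weightCount p q r).rTensor _ (vertH a) + p • vertH a := by
  induction a using LocalFun.induction_gen with
  | one => simp [vertH_one, weightCount_one]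
  | add a b ha hb => simp only [map_add, ha, hb, smul_add]; abel
  | sm g a ha =>
    have h := fun a => weightCount_sm_mul p q r g a
    simp only [← smul_mul_assoc] at h
    simp only [weightCount_sm_mul, vertH_sm_mul, map_add, map_sum, map_smul, ha, smul_add,
      rTensor_coefMul h, LinearMap.rTensor_tmul, TensorProduct.add_tmul, smoothPartial_smoothEuler,
      sm_add, add_mul, Finset.sum_add_distrib, TensorProduct.smul_tmul', Finset.smul_sum,
      coefMul_smul]
    abel
  | hlin s J a _ ha =>
    simp only [weightCount_hlin_mul, vertH_hlin_mul, map_add, map_smul, ha, smul_add,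
      rTensor_coefMul_smul (weightCount_hlin_mul p q r _), LinearMap.rTensor_tmul,
      TensorProduct.smul_tmul']
    abel
  | gs v a ha =>
    simp only [weightCount_gs_mul, vertH_gs_mul, map_add, map_smul, ha,
      rTensor_coefMul_smul (weightCount_gs_mul p q r _)]
    abel
  | hs y a ha =>
    simp only [weightCount_hs_mul, vertH_hs_mul, map_add, map_smul, ha,
      rTensor_coefMul_smul (weightCount_hs_mul p q r _)]
    abel

lemma vertHs_weightCount (a : LocalFun n) :
    vertHs (weightCount p q r a) = (weightCount p q r).rTensor _ (vertHs a) + q • vertHs a := by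
  induction a using LocalFun.induction_gen with
  | one => simp [vertHs_one, weightCount_one]
  | add a b ha hb => simp only [map_add, ha, hb, smul_add]; abel
  | sm g a ha =>
    have h := fun a => weightCount_sm_mul p q r g a
    simp only [← smul_mul_assoc] at h
    simp only [weightCount_sm_mul, vertHs_sm_mul, map_add, map_smul, ha,
      rTensor_coefMul h, coefMul_smul]
    abel
  | hlin s J a _ ha =>
    simp only [weightCount_hlin_mul, vertHs_hlin_mul, map_add, map_smul, ha,
      rTensor_coefMul_smul (weightCount_hlin_mul p q r _)]
    abel
  | gs v a ha =>
    simp only [weightCount_gs_mul, vertHs_gs_mul, map_add, map_smul, ha,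
      rTensor_coefMul_smul (weightCount_gs_mul p q r _)]
    abel
  | hs y a ha =>
    simp only [weightCount_hs_mul, vertHs_hs_mul, map_add, map_sub, map_smul, ha, smul_sub,
      rTensor_coefMul_smul (weightCount_hs_mul p q r _), LinearMap.rTensor_tmul,
      TensorProduct.smul_tmul']
    abel

lemma vertG_weightCount (a : LocalFun n) :
    vertG (weightCount p q r a) = (weightCount p q r).rTensor _ (vertG a) + r • vertG a := by
  induction a using LocalFun.induction_gen with
  | one => simp [vertG_one, weightCount_one]
  | add a b ha hb => simp only [map_add, ha, hb, smul_add]; abel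
  | sm g a ha =>
    have h := fun a => weightCount_sm_mul p q r g a
    simp only [← smul_mul_assoc] at h
    simp only [weightCount_sm_mul, vertG_sm_mul, map_add, map_smul, ha,
      rTensor_coefMul h, coefMul_smul]
    abel
  | hlin s J a _ ha =>
    simp only [weightCount_hlin_mul, vertG_hlin_mul, map_add, map_smul, ha,
      rTensor_coefMul_smul (weightCount_hlin_mul p q r _)]
    abel
  | gs v a ha =>
    simp only [weightCount_gs_mul, vertG_gs_mul, map_add, map_smul, ha, smul_add,
      rTensor_coefMul_smul (weightCount_gs_mul p q r _), LinearMap.rTensor_tmul,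
      TensorProduct.smul_tmul']
    abel
  | hs y a ha =>
    simp only [weightCount_hs_mul, vertG_hs_mul, map_add, map_smul, ha,
      rTensor_coefMul_smul (weightCount_hs_mul p q r _)]
    abel

end counting

/-! ### The antifield number -/

lemma antifieldCount_ofEven_mul (f : EvenAlg n) (a : LocalFun n) :
    antifieldCount (ofEven n f * a) =
      ofEven n (MvPolynomial.mkDerivation (SmoothFun n) (fun v : EvenVar n =>
        v.antifieldNumber • (MvPolynomial.X v : EvenAlg n)) f) * a +
        ofEven n f * antifieldCount a := by
  induction a using LocalFun.induction_mul with
  | mul f' w =>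
    rw [← mul_assoc, ← map_mul, antifieldCount, extendLocal_mul, extendLocal_mul]
    simp only [LinearMap.comp_apply, AlgHom.toLinearMap_apply, LinearMap.coe_restrictScalars,
      Derivation.coeFn_coe, Derivation.leibniz, map_add, map_mul, smul_eq_mul]
    rw [ofEven_mul_comm f' (ofEven n (MvPolynomial.mkDerivation _ _ f))]
    noncomm_ring
  | add a b ha hb => rw [mul_add, map_add, ha, hb, map_add]; noncomm_ring

lemma antifieldCount_hs_mul (y : JetSpace n (Sym2 (Fin n))) (a : LocalFun n) :
    antifieldCount (hs y * a) = hs y * a + hs y * antifieldCount a := by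
  induction a using LocalFun.induction_mul with
  | mul f w =>
    have h1 : ∀ y, hs y * (ofEven n f * ofOdd n w) =
        ofEven n f * ofOdd n (ExteriorAlgebra.ι ℝ y * w) := by
      intro y
      rw [← mul_assoc, ← ofEven_mul_comm, mul_assoc, map_mul, hs_apply]
    have h2 : oddDerivation LinearMap.id (ExteriorAlgebra.ι ℝ y * w) =
        ExteriorAlgebra.ι ℝ y * oddDerivation LinearMap.id w + ExteriorAlgebra.ι ℝ y * w := by
      rw [oddDerivation, extendOdd_ι_mul, one_smul]
      rfl
    rw [h1, antifieldCount, extendLocal_mul, extendLocal_mul]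
    simp only [LinearMap.comp_apply, AlgHom.toLinearMap_apply, h2, map_add, map_mul, hs_apply]
    rw [mul_add (ofOdd n _), ← mul_assoc (ofOdd n _), ← mul_assoc (ofOdd n _), ← ofEven_mul_comm,
      ← ofEven_mul_comm]
    noncomm_ring
  | add a b ha hb => rw [mul_add, map_add, ha, hb, map_add]; noncomm_ring

/-- Brings the antifield number into the family of counting operators, whose commutators with all
other operators are known. -/
lemma antifieldCount_eq : antifieldCount (n := n) = weightCount 0 1 2 := by
  ext a
  induction a using LocalFun.induction with
  | one =>
    have h := extendLocal_mul ((ofEven n).toLinearMap ∘ₗ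
      (MvPolynomial.mkDerivation (SmoothFun n) (fun v : EvenVar n =>
      v.antifieldNumber • (MvPolynomial.X v : EvenAlg n))).toLinearMap.restrictScalars ℝ)
      ((ofOdd n).toLinearMap ∘ₗ oddDerivation LinearMap.id) 1 1
    rw [map_one, map_one, mul_one] at h
    rw [weightCount_one, antifieldCount, h]
    simp [oddDerivation, extendOdd_one]
  | add a b ha hb => rw [map_add, map_add, ha, hb]
  | sm g a ha =>
    rw [weightCount_sm_mul, zero_smul, zero_add, ← ha]
    rw [sm, antifieldCount_ofEven_mul]
    simp
  | ev v a ha =>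
    rw [ev, antifieldCount_ofEven_mul, MvPolynomial.mkDerivation_X, ← ev, ha]
    cases v with
    | h s J hJ =>
      have := weightCount_hlin_mul 0 1 2 (Finsupp.single (s, J) 1) a
      rw [hlin_single_of_ne s J hJ, one_smul, zero_smul, zero_add] at this
      rw [this]
      simp [EvenVar.antifieldNumber]
    | Cstar μ J =>
      have := weightCount_gs_mul 0 1 2 (Finsupp.single (some μ, J) 1) a
      rw [gs_single, one_smul] at this
      change _ = weightCount 0 1 2 (ev (gaugeVar (some μ, J)) * a)
      rw [this]
      simp [EvenVar.antifieldNumber, gaugeVar, ev, two_smul, add_mul]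
    | xistar J =>
      have := weightCount_gs_mul 0 1 2 (Finsupp.single (none, J) 1) a
      rw [gs_single, one_smul] at this
      change _ = weightCount 0 1 2 (ev (gaugeVar (none, J)) * a)
      rw [this]
      simp [EvenVar.antifieldNumber, gaugeVar, ev, two_smul, add_mul]
  | hs y a ha => rw [antifieldCount_hs_mul, weightCount_hs_mul, one_smul, ha]

/-! ### Euler operators -/

lemma MultiIndex.induction {p : MultiIndex n → Prop} (zero : p 0)
    (raise : ∀ J μ, p J → p (raise J μ)) (J : MultiIndex n) : p J := by
  generalize hk : ∑ μ, J μ = k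
  induction k generalizing J with
  | zero =>
    have : J = 0 := by
      funext μ
      simpa using (Finset.sum_eq_zero_iff.1 hk) μ (Finset.mem_univ μ)
    rwa [this]
  | succ k ih =>
    obtain ⟨μ, hμ⟩ : ∃ μ, J μ ≠ 0 := by
      by_contra! h
      simp [h] at hk
    have hJ : J = ConformalGravity.raise (J - Pi.single μ 1) μ := by
      funext ν
      by_cases h : ν = μ
      · subst h; simp [ConformalGravity.raise]; omega
      · simp [ConformalGravity.raise, h]
    rw [hJ] at hk ⊢
    apply raise
    apply ih
    simp only [ConformalGravity.raise, Pi.add_apply, Finset.sum_add_distrib] at hk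
    rw [Finset.sum_pi_single'] at hk
    simpa using hk

lemma prod_ofFn_pow_zero {M : Type*} [Monoid M] (f : Fin n → M) :
    (List.ofFn fun i => f i ^ (0 : MultiIndex n) i).prod = 1 := by
  apply List.prod_eq_one
  intro x hx
  rw [List.mem_ofFn] at hx
  obtain ⟨i, rfl⟩ := hx
  simp

lemma prod_ofFn_pow_raise {M : Type*} [Monoid M] (f : Fin n → M)
    (hf : ∀ i j, f i * f j = f j * f i) (J : MultiIndex n) (μ : Fin n) :
    (List.ofFn fun i => f i ^ raise J μ i).prod = f μ * (List.ofFn fun i => f i ^ J i).prod := by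
  induction n with
  | zero => exact μ.elim0
  | succ k ih =>
    rw [List.ofFn_succ, List.ofFn_succ, List.prod_cons, List.prod_cons]
    refine Fin.cases ?_ (fun ν => ?_) μ
    · have : ∀ i : Fin k, raise J 0 i.succ = J i.succ := by
        intro i; simp [raise]
      simp only [this]
      simp [raise, pow_succ', mul_assoc]
    · have h2 := ih (fun i => f i.succ) (fun i j => hf _ _) (fun i => J i.succ) ν
      have h3 : ∀ i : Fin k, raise J ν.succ i.succ = raise (fun i => J i.succ) ν i := by
        intro i; simp [raise, Pi.single_apply]
      have h4 : raise J ν.succ 0 = J 0 := by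
        simp [raise]
      simp only [h3, h4]
      rw [h2, ← mul_assoc, ← mul_assoc]
      congr 1
      exact (Commute.pow_left (hf _ _) _)

/-- `(-1)^{|J|} ∂_J` on local functions. -/
def negDerivIter (J : MultiIndex n) : Module.End ℝ (LocalFun n) :=
  (List.ofFn fun μ : Fin n => (-totalDeriv μ : Module.End ℝ (LocalFun n)) ^ J μ).prod

lemma negDerivIter_zero : negDerivIter (0 : MultiIndex n) = 1 := prod_ofFn_pow_zero _

lemma negDerivIter_raise (J : MultiIndex n) (μ : Fin n) (a : LocalFun n) :
    negDerivIter (raise J μ) a = -totalDeriv μ (negDerivIter J a) := by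
  rw [negDerivIter, prod_ofFn_pow_raise]
  · rfl
  · intro i j
    ext a
    simp [totalDeriv_comm i j]

lemma negDerivIter_comm {T : LocalFun n →ₗ[ℝ] LocalFun n}
    (hT : ∀ μ a, T (totalDeriv μ a) = totalDeriv μ (T a)) (J : MultiIndex n) (a : LocalFun n) :
    T (negDerivIter J a) = negDerivIter J (T a) := by
  induction J using MultiIndex.induction with
  | zero => simp [negDerivIter_zero]
  | raise J μ ih => rw [negDerivIter_raise, negDerivIter_raise, map_neg, hT, ih]

section euler

variable {ι : Type}

/-- `∑ a_J ⊗ ∂_J φ^i ↦ ∑ (-1)^{|J|} ∂_J a_J`. -/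
def eulerOp (i : ι) : LocalFun n ⊗[ℝ] JetSpace n ι →ₗ[ℝ] LocalFun n :=
  open Classical in
  TensorProduct.lift (Finsupp.linearCombination ℝ
    (fun v : ι × MultiIndex n => if v.1 = i then negDerivIter v.2 else 0)).flip

lemma eulerOp_tmul_single [DecidableEq ι] (i j : ι) (J : MultiIndex n) (a : LocalFun n) :
    eulerOp i (a ⊗ₜ[ℝ] Finsupp.single (j, J) 1) = if j = i then negDerivIter J a else 0 := by
  simp only [eulerOp, TensorProduct.lift.tmul, LinearMap.flip_apply,
    Finsupp.linearCombination_single, one_smul]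
  by_cases h : j = i <;> simp [h]

lemma tensor_single_induction {p : LocalFun n ⊗[ℝ] JetSpace n ι → Prop}
    (z : LocalFun n ⊗[ℝ] JetSpace n ι)
    (add : ∀ x y, p x → p y → p (x + y))
    (tmul : ∀ a i J, p (a ⊗ₜ[ℝ] Finsupp.single (i, J) 1)) (zero : p 0) : p z := by
  induction z using TensorProduct.induction_on with
  | zero => exact zero
  | tmul a w =>
    induction w using Finsupp.induction_linear with
    | zero => rwa [TensorProduct.tmul_zero]
    | add f g hf hg => rw [TensorProduct.tmul_add]; exact add _ _ hf hg
    | single v c =>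
      rw [← Finsupp.smul_single_one, ← TensorProduct.smul_tmul]
      exact tmul _ _ _
  | add x y hx hy => exact add _ _ hx hy

/-- Differentiating the coefficient and raising the jet contribute the same expression with opposite
signs, the sign coming from one additional transposed derivative. -/
lemma eulerOp_srcDeriv (i : ι) (μ : Fin n) (z : LocalFun n ⊗[ℝ] JetSpace n ι) :
    eulerOp i (srcDeriv μ z) = 0 := by
  classical
  induction z using tensor_single_induction with
  | zero => simp
  | add x y hx hy => rw [map_add, map_add, hx, hy, add_zero]
  | tmul a j J =>
    rw [srcDeriv_tmul, jetShift_single, map_add, eulerOp_tmul_single, eulerOp_tmul_single]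
    by_cases h : j = i
    · rw [if_pos h, if_pos h, negDerivIter_raise,
        negDerivIter_comm (T := totalDeriv μ) (fun ν a => totalDeriv_comm μ ν a)]
      abel
    · rw [if_neg h, if_neg h, add_zero]

lemma eulerOp_rTensor {T : LocalFun n →ₗ[ℝ] LocalFun n}
    (hT : ∀ μ a, T (totalDeriv μ a) = totalDeriv μ (T a)) (i : ι)
    (z : LocalFun n ⊗[ℝ] JetSpace n ι) : eulerOp i (T.rTensor _ z) = T (eulerOp i z) := by
  classical
  induction z using tensor_single_induction with
  | zero => simp
  | add x y hx hy => simp only [map_add, hx, hy]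
  | tmul a j J =>
    rw [LinearMap.rTensor_tmul, eulerOp_tmul_single, eulerOp_tmul_single]
    by_cases h : j = i
    · rw [if_pos h, if_pos h, negDerivIter_comm hT]
    · rw [if_neg h, if_neg h, map_zero]

/-- Maps that vanish on total derivatives are determined by the terms without derivatives. -/
lemma eq_of_srcDeriv {M : Type*} [AddCommGroup M] [Module ℝ M]
    (F G : LocalFun n ⊗[ℝ] JetSpace n ι →ₗ[ℝ] M) (hF : ∀ μ z, F (srcDeriv μ z) = 0)
    (hG : ∀ μ z, G (srcDeriv μ z) = 0)
    (h : ∀ a i, F (a ⊗ₜ[ℝ] Finsupp.single (i, 0) 1) = G (a ⊗ₜ[ℝ] Finsupp.single (i, 0) 1))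
    (z : LocalFun n ⊗[ℝ] JetSpace n ι) : F z = G z := by
  induction z using tensor_single_induction with
  | zero => simp
  | add x y hx hy => simp only [map_add, hx, hy]
  | tmul a i J =>
    induction J using MultiIndex.induction generalizing a with
    | zero => exact h a i
    | raise J μ ih =>
      have h1 := hF μ (a ⊗ₜ[ℝ] Finsupp.single (i, J) 1)
      have h2 := hG μ (a ⊗ₜ[ℝ] Finsupp.single (i, J) 1)
      rw [srcDeriv_tmul, jetShift_single, map_add] at h1 h2
      rw [eq_neg_of_add_eq_zero_right h1, eq_neg_of_add_eq_zero_right h2, ih]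

/-- The adjoint of a linear differential operator with constant coefficients. -/
def adjointOp {κ : Type} [Fintype ι] (U : JetSpace n ι →ₗ[ℝ] JetSpace n κ) :
    (ι → LocalFun n) →ₗ[ℝ] (κ → LocalFun n) :=
  LinearMap.pi fun k => ∑ i, eulerOp k ∘ₗ
    (TensorProduct.mk ℝ (LocalFun n) (JetSpace n κ)).flip (U (Finsupp.single (i, 0) 1)) ∘ₗ
      LinearMap.proj i

lemma adjointOp_apply {κ : Type} [Fintype ι] (U : JetSpace n ι →ₗ[ℝ] JetSpace n κ)
    (f : ι → LocalFun n) (k : κ) : adjointOp U f k =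
      ∑ i, eulerOp k (f i ⊗ₜ[ℝ] U (Finsupp.single (i, 0) 1)) := by
  simp [adjointOp]

lemma lTensor_srcDeriv {κ : Type} {U : JetSpace n ι →ₗ[ℝ] JetSpace n κ}
    (hU : ∀ μ w, U (jetShift μ w) = jetShift μ (U w)) (μ : Fin n)
    (z : LocalFun n ⊗[ℝ] JetSpace n ι) :
    U.lTensor _ (srcDeriv μ z) = srcDeriv μ (U.lTensor _ z) := by
  induction z using TensorProduct.induction_on with
  | zero => simp
  | tmul a w => simp [hU]
  | add y z hy hz => simp only [map_add, hy, hz]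

/-- Both sides vanish on total derivatives of one-forms. By integration by parts it is enough to
compare them on jets without derivatives, where the right side is the definition of the adjoint. -/
lemma eulerOp_lTensor {κ : Type} [Fintype ι] {U : JetSpace n ι →ₗ[ℝ] JetSpace n κ}
    (hU : ∀ μ w, U (jetShift μ w) = jetShift μ (U w)) (k : κ)
    (z : LocalFun n ⊗[ℝ] JetSpace n ι) :
    eulerOp k (U.lTensor _ z) = adjointOp U (fun i => eulerOp i z) k := by
  classical
  refine eq_of_srcDeriv (eulerOp k ∘ₗ U.lTensor _)
    (LinearMap.proj k ∘ₗ adjointOp U ∘ₗ LinearMap.pi eulerOp) ?_ ?_ ?_ z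
  · intro μ z
    rw [LinearMap.comp_apply, lTensor_srcDeriv hU, eulerOp_srcDeriv]
  · intro μ z
    have : LinearMap.pi (eulerOp (ι := ι)) (srcDeriv μ z) = 0 := by
      funext i
      simp [eulerOp_srcDeriv]
    rw [LinearMap.comp_apply, LinearMap.comp_apply, this, map_zero, map_zero]
  · intro a i
    simp [adjointOp_apply, eulerOp_tmul_single, negDerivIter_zero, TensorProduct.ite_tmul]
    rw [Finset.sum_eq_single i] <;> simp +contextual [eq_comm]

/-- Transposed form of V ∘ U = 0. Applied to D ∘ K = 0, it removes K†g from the equation for Y in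
the descent. -/
lemma adjointOp_adjointOp {κ lam : Type} [Fintype ι] [Fintype κ]
    {U : JetSpace n ι →ₗ[ℝ] JetSpace n κ} {V : JetSpace n κ →ₗ[ℝ] JetSpace n lam}
    (hV : ∀ μ w, V (jetShift μ w) = jetShift μ (V w))
    (hVU : ∀ w, V (U w) = 0) (f : ι → LocalFun n) : adjointOp V (adjointOp U f) = 0 := by
  funext k
  have h : adjointOp U f = ∑ i, fun j => eulerOp j (f i ⊗ₜ[ℝ] U (Finsupp.single (i, 0) 1)) := by
    funext j
    simp [adjointOp_apply]
  rw [h, map_sum, Finset.sum_apply]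
  refine Finset.sum_eq_zero fun i _ => ?_
  rw [← eulerOp_lTensor hV]
  simp [hVU]

lemma adjointOp_comm {κ : Type} [Fintype ι] (U : JetSpace n ι →ₗ[ℝ] JetSpace n κ)
    {T : LocalFun n →ₗ[ℝ] LocalFun n}
    (hT : ∀ μ a, T (totalDeriv μ a) = totalDeriv μ (T a)) (f : ι → LocalFun n) (k : κ) :
    adjointOp U (fun i => T (f i)) k = T (adjointOp U f k) := by
  rw [adjointOp_apply, adjointOp_apply, map_sum]
  refine Finset.sum_congr rfl fun i _ => ?_
  rw [← eulerOp_rTensor hT]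
  rfl

/-- The divergence of a current. -/
def divergence : (Fin n → LocalFun n) →ₗ[ℝ] LocalFun n :=
  ∑ μ, totalDeriv μ ∘ₗ LinearMap.proj μ

lemma divergence_apply (j : Fin n → LocalFun n) : divergence j = ∑ μ, totalDeriv μ (j μ) := by
  simp [divergence]

lemma totalDeriv_mem_range (μ : Fin n) (a : LocalFun n) :
    totalDeriv μ a ∈ LinearMap.range (divergence (n := n)) := by
  classical
  refine ⟨Pi.single μ a, ?_⟩
  rw [divergence_apply, Finset.sum_eq_single μ] <;> simp +contextual

/-- Integration by parts: modulo divergences, `∑ λ(w) a = ∑_i λ(φ^i) E_i`. -/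
lemma contract_sub_mem [Fintype ι] {l : JetSpace n ι →ₗ[ℝ] LocalFun n}
    (hl : ∀ μ w a, totalDeriv μ (l w * a) = l (jetShift μ w) * a + l w * totalDeriv μ a)
    (z : LocalFun n ⊗[ℝ] JetSpace n ι) :
    contract l z - ∑ i, l (Finsupp.single (i, 0) 1) * eulerOp i z ∈
      LinearMap.range (divergence (n := n)) := by
  classical
  -- In the quotient by divergences both sides become linear maps that vanish on total derivatives,
  -- so only jets without derivatives have to be compared.
  rw [← Submodule.Quotient.eq, ← Submodule.mkQ_apply, ← Submodule.mkQ_apply]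
  set π := (LinearMap.range (divergence (n := n))).mkQ
  refine eq_of_srcDeriv (π ∘ₗ contract l) (π ∘ₗ ∑ i, LinearMap.mulLeft ℝ
    (l (Finsupp.single (i, 0) 1)) ∘ₗ eulerOp i) ?_ ?_ ?_ z |>.trans ?_
  · intro μ z
    have : contract l (srcDeriv μ z) = totalDeriv μ (contract l z) := by
      induction z using TensorProduct.induction_on with
      | zero => simp
      | tmul a w => simp [hl]; abel
      | add y z hy hz => simp only [map_add, hy, hz]
    rw [LinearMap.comp_apply, this]
    exact (Submodule.Quotient.mk_eq_zero _).2 (totalDeriv_mem_range _ _)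
  · intro μ z
    simp [eulerOp_srcDeriv]
  · intro a i
    simp [eulerOp_tmul_single, negDerivIter_zero]
  · simp

end euler

/-! ### Projections to the antifield numbers -/

/-- Eigenspaces are always independent; when those with natural eigenvalues span, the space is their
direct sum. -/
lemma exists_eigenspace_projections {V : Type*} [AddCommGroup V] [Module ℝ V] (f : Module.End ℝ V)
    (h : ⨆ k : ℕ, f.eigenspace (k : ℝ) = ⊤) :
    ∃ P : ℕ → Module.End ℝ V, (∀ k : ℕ, ∀ v ∈ f.eigenspace (k : ℝ), P k v = v) ∧
      ∀ k l : ℕ, l ≠ k → ∀ v ∈ f.eigenspace (l : ℝ), P k v = 0 := by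
  have hind : iSupIndep (fun k : ℕ => f.eigenspace (k : ℝ)) :=
    f.eigenspaces_iSupIndep.comp Nat.cast_injective
  have hc : ∀ k : ℕ, IsCompl (f.eigenspace (k : ℝ)) (⨆ (l : ℕ) (_ : l ≠ k), f.eigenspace (l : ℝ)) := by
    intro k
    refine ⟨hind k, ?_⟩
    rw [codisjoint_iff, eq_top_iff, ← h]
    refine iSup_le fun l => ?_
    by_cases hl : l = k
    · subst hl; exact le_sup_left
    · exact le_trans (le_iSup₂_of_le l hl le_rfl) le_sup_right
  refine ⟨fun k : ℕ => (f.eigenspace (k : ℝ)).subtype ∘ₗ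
    Submodule.projectionOnto _ _ (hc k), ?_, ?_⟩
  · intro k v hv
    have := Submodule.projectionOnto_apply_left (hc k) ⟨v, hv⟩
    exact congrArg Subtype.val this
  · intro k l hl v hv
    have hv' : v ∈ ⨆ (l : ℕ) (_ : l ≠ k), f.eigenspace (l : ℝ) :=
      (le_iSup₂_of_le l hl le_rfl : f.eigenspace (l : ℝ) ≤ _) hv
    exact congrArg Subtype.val (Submodule.projectionOnto_apply_right (hc k) ⟨v, hv'⟩)

/-- The local functions of antifield number `k`. -/
def afSpace (n k : ℕ) : Submodule ℝ (LocalFun n) :=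
  Module.End.eigenspace (weightCount 0 1 2) (k : ℝ)

lemma mem_afSpace {k : ℕ} {a : LocalFun n} :
    a ∈ afSpace n k ↔ weightCount 0 1 2 a = (k : ℝ) • a := Module.End.mem_eigenspace_iff

lemma one_mem_afSpace : (1 : LocalFun n) ∈ afSpace n 0 := by
  simp [mem_afSpace, weightCount_one]

lemma sm_mul_mem_afSpace {k : ℕ} (g : SmoothFun n) {a : LocalFun n} (ha : a ∈ afSpace n k) :
    sm g * a ∈ afSpace n k := by
  rw [mem_afSpace] at *
  simp [ha]

lemma hlin_mul_mem_afSpace {k : ℕ} (p : JetSpace n (Sym2 (Fin n))) {a : LocalFun n}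
    (ha : a ∈ afSpace n k) : hlin p * a ∈ afSpace n k := by
  rw [mem_afSpace] at *
  simp [ha]

lemma hs_mul_mem_afSpace {k : ℕ} (p : JetSpace n (Sym2 (Fin n))) {a : LocalFun n}
    (ha : a ∈ afSpace n k) : hs p * a ∈ afSpace n (k + 1) := by
  rw [mem_afSpace] at *
  simp [ha, add_smul, add_comm]

lemma gs_mul_mem_afSpace {k : ℕ} (p : JetSpace n (Option (Fin n))) {a : LocalFun n}
    (ha : a ∈ afSpace n k) : gs p * a ∈ afSpace n (k + 2) := by
  rw [mem_afSpace] at *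
  simp [ha, add_smul, add_comm]

lemma iSup_afSpace : ⨆ k, afSpace n k = ⊤ := by
  rw [eq_top_iff]
  intro a _
  have closed : ∀ (x : LocalFun n) (c : ℕ),
      (∀ k, ∀ a ∈ afSpace n k, x * a ∈ afSpace n (k + c)) →
      ∀ a ∈ ⨆ k, afSpace n k, x * a ∈ ⨆ k, afSpace n k := by
    intro x c hx a ha
    refine Submodule.iSup_induction _ (motive := fun a => x * a ∈ ⨆ k, afSpace n k) ha ?_ ?_ ?_
    · intro k a ha
      exact Submodule.mem_iSup_of_mem (k + c) (hx k a ha)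
    · simp
    · intro a b ha hb
      rw [mul_add]
      exact add_mem ha hb
  induction a using LocalFun.induction_gen with
  | one => exact Submodule.mem_iSup_of_mem 0 one_mem_afSpace
  | add a b ha hb => exact add_mem (ha trivial) (hb trivial)
  | sm g a ha => exact closed _ 0 (fun k a => sm_mul_mem_afSpace g) a (ha trivial)
  | hlin s J a _ ha => exact closed _ 0 (fun k a => hlin_mul_mem_afSpace _) a (ha trivial)
  | gs v a ha => exact closed _ 2 (fun k a => gs_mul_mem_afSpace _) a (ha trivial)
  | hs y a ha => exact closed _ 1 (fun k a => hs_mul_mem_afSpace _) a (ha trivial)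

/-- The projection to antifield number `k`. -/
def afProj (k : ℕ) : LocalFun n →ₗ[ℝ] LocalFun n :=
  (exists_eigenspace_projections _ (iSup_afSpace (n := n))).choose k

lemma afProj_of_mem {k : ℕ} {a : LocalFun n} (ha : a ∈ afSpace n k) : afProj k a = a :=
  (exists_eigenspace_projections _ (iSup_afSpace (n := n))).choose_spec.1 k a ha

lemma afProj_of_mem_ne {k l : ℕ} (h : l ≠ k) {a : LocalFun n} (ha : a ∈ afSpace n l) :
    afProj k a = 0 :=
  (exists_eigenspace_projections _ (iSup_afSpace (n := n))).choose_spec.2 k l h a ha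

lemma afSpace_induction {p : LocalFun n → Prop} (a : LocalFun n)
    (mem : ∀ k, ∀ a ∈ afSpace n k, p a) (add : ∀ a b, p a → p b → p (a + b)) : p a := by
  have ha : a ∈ ⨆ k, afSpace n k := by rw [iSup_afSpace]; trivial
  exact Submodule.iSup_induction _ (motive := p) ha mem (mem 0 0 (zero_mem _)) add

lemma afProj_mem (k : ℕ) (a : LocalFun n) : afProj k a ∈ afSpace n k := by
  induction a using afSpace_induction with
  | mem l a ha =>
    by_cases h : l = k
    · subst h; rwa [afProj_of_mem ha]
    · rw [afProj_of_mem_ne h ha]; exact zero_mem _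
  | add a b ha hb => rw [map_add]; exact add_mem ha hb

lemma afProj_comm {T : LocalFun n →ₗ[ℝ] LocalFun n}
    (hT : ∀ a, weightCount 0 1 2 (T a) = T (weightCount 0 1 2 a)) (k : ℕ) (a : LocalFun n) :
    afProj k (T a) = T (afProj k a) := by
  induction a using afSpace_induction with
  | mem l a ha =>
    have hTa : T a ∈ afSpace n l := by
      rw [mem_afSpace] at *
      rw [hT, ha, map_smul]
    by_cases h : l = k
    · subst h; rw [afProj_of_mem ha, afProj_of_mem hTa]
    · rw [afProj_of_mem_ne h ha, afProj_of_mem_ne h hTa, map_zero]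
  | add a b ha hb => simp only [map_add, ha, hb]

/-- Antifield numbers are natural numbers. -/
lemma eq_zero_of_weightCount_eq {a : LocalFun n} {c : ℝ} (hc : ∀ k : ℕ, (k : ℝ) ≠ c)
    (ha : weightCount 0 1 2 a = c • a) : a = 0 := by
  have hdis := (Module.End.eigenspaces_iSupIndep (weightCount (n := n) 0 1 2)) c
  refine Submodule.disjoint_def.1 hdis a (Module.End.mem_eigenspace_iff.2 ha) ?_
  have : a ∈ ⨆ k, afSpace n k := by rw [iSup_afSpace]; trivial
  exact (iSup_le fun k => le_iSup₂_of_le (k : ℝ) (hc k) le_rfl : (⨆ k, afSpace n k) ≤ _) this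

section

variable {D : JetSpace n (Sym2 (Fin n)) →ₗ[ℝ] JetSpace n (Sym2 (Fin n))}

lemma linKT_mem_afSpace {k : ℕ} {a : LocalFun n} (ha : a ∈ afSpace n (k + 1)) :
    linKT D a ∈ afSpace n k := by
  rw [mem_afSpace] at *
  rw [weightCount_linKT 0 1 2 D 1 (by norm_num) (by norm_num), ha, map_smul, one_smul]
  push_cast
  rw [add_smul, one_smul, add_sub_cancel_right]

/-- The result would be an eigenvector of antifield number -1, and antifield numbers are natural. -/
lemma linKT_eq_zero_of_mem {a : LocalFun n} (ha : a ∈ afSpace n 0) : linKT D a = 0 := by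
  have h1 := weightCount_linKT 0 1 2 D 1 (by norm_num) (by norm_num) a
  rw [mem_afSpace] at ha
  rw [ha, map_smul, Nat.cast_zero, zero_smul, zero_sub, one_smul, ← neg_one_smul ℝ] at h1
  refine eq_zero_of_weightCount_eq (fun k hk => ?_) h1
  have : (0 : ℝ) ≤ k := by positivity
  linarith

lemma afProj_linKT (k : ℕ) (a : LocalFun n) :
    afProj k (linKT D a) = linKT D (afProj (k + 1) a) := by
  induction a using afSpace_induction with
  | mem l a ha =>
    cases l with
    | zero => rw [linKT_eq_zero_of_mem ha, map_zero, afProj_of_mem_ne (by omega) ha, map_zero]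
    | succ l =>
      by_cases h : l = k
      · subst h
        rw [afProj_of_mem ha, afProj_of_mem (linKT_mem_afSpace ha)]
      · rw [afProj_of_mem_ne h (linKT_mem_afSpace ha), afProj_of_mem_ne (by omega) ha, map_zero]
  | add a b ha hb => simp only [map_add, ha, hb]

lemma afProj_totalDeriv (k : ℕ) (μ : Fin n) (a : LocalFun n) :
    afProj k (totalDeriv μ a) = totalDeriv μ (afProj k a) :=
  afProj_comm (fun a => weightCount_totalDeriv 0 1 2 μ a) k a

end

/-! ### Acyclicity of the Koszul-Tate differential -/

/-- The conditions on the field equations `D` that make the Koszul-Tate differential acyclic: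
the Noether identities of `D` are those of linearized conformal gravity, and they are
irreducible. -/
structure IsRegularSystem (D : JetSpace n (Sym2 (Fin n)) →ₗ[ℝ] JetSpace n (Sym2 (Fin n))) :
    Prop where
  shift : ∀ μ w, D (jetShift μ w) = jetShift μ (D w)
  pos : ∀ w s, D w (s, 0) = 0
  noether : ∀ g, D (noetherMap g) = 0
  exact : ∀ y, D y = 0 → ∃ g, noetherMap g = y
  inj : ∀ g : JetSpace n (Option (Fin n)), noetherMap g = 0 → g = 0

variable {D : JetSpace n (Sym2 (Fin n)) →ₗ[ℝ] JetSpace n (Sym2 (Fin n))}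

/-- A linear section of D over its range, extended arbitrarily to all of W. -/
lemma exists_generalized_inverse {V W : Type*} [AddCommGroup V] [Module ℝ V] [AddCommGroup W]
    [Module ℝ W] (D : V →ₗ[ℝ] W) : ∃ τ : W →ₗ[ℝ] V, ∀ y, D (τ (D y)) = D y := by
  obtain ⟨r, hr⟩ := D.rangeRestrict.exists_rightInverse_of_surjective D.range_rangeRestrict
  obtain ⟨τ, hτ⟩ := LinearMap.exists_extend r
  refine ⟨τ, fun y => ?_⟩
  have h2 : τ (D y) = r ⟨D y, LinearMap.mem_range_self D y⟩ := by rw [← hτ]; rfl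
  rw [h2]
  exact congrArg Subtype.val (LinearMap.congr_fun hr ⟨D y, LinearMap.mem_range_self D y⟩)

/-- σ₀ is a generalized inverse of D made to vanish on undifferentiated jets. This costs nothing
because D has no such components in its image, and it makes the later homotopy linear over the
smooth functions of `h`. The defect 1 - σ₀D maps into ker D = im K, so σ₁ is this defect followed by
a left inverse of K. -/
lemma IsRegularSystem.exists_homotopy (hD : IsRegularSystem D) :
    ∃ (σ₀ : JetSpace n (Sym2 (Fin n)) →ₗ[ℝ] JetSpace n (Sym2 (Fin n)))
      (σ₁ : JetSpace n (Sym2 (Fin n)) →ₗ[ℝ] JetSpace n (Option (Fin n))),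
      (∀ s, σ₀ (Finsupp.single (s, 0) 1) = 0) ∧ (∀ y, D (σ₀ (D y)) = D y) ∧
      (∀ y, noetherMap (σ₁ y) + σ₀ (D y) = y) ∧ ∀ g, σ₁ (noetherMap g) = g := by
  obtain ⟨τ, hτ⟩ := exists_generalized_inverse D
  obtain ⟨L, hL⟩ := LinearMap.exists_leftInverse_of_injective (noetherMap (n := n))
    (LinearMap.ker_eq_bot'.2 hD.inj)
  classical
  let pr : JetSpace n (Sym2 (Fin n)) →ₗ[ℝ] JetSpace n (Sym2 (Fin n)) :=
    Finsupp.linearCombination ℝ (fun v => if v.2 = 0 then 0 else Finsupp.single v 1)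
  have hpr : ∀ w : JetSpace n (Sym2 (Fin n)), (∀ s, w (s, 0) = 0) → pr w = w := by
    intro w hw
    conv_rhs => rw [← Finsupp.sum_single w]
    rw [Finsupp.linearCombination_apply]
    refine Finsupp.sum_congr fun v hv => ?_
    have : v.2 ≠ 0 := by
      intro h
      obtain ⟨s, J⟩ := v
      simp only at h
      subst h
      exact (Finsupp.mem_support_iff.1 hv) (hw s)
    simp [this]
  have h1 : ∀ y, D (τ (pr (D y))) = D y := by
    intro y
    rw [hpr _ (hD.pos y), hτ]
  have hL' : ∀ g, L (noetherMap g) = g := fun g => LinearMap.congr_fun hL g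
  refine ⟨τ ∘ₗ pr, L ∘ₗ (LinearMap.id - (τ ∘ₗ pr) ∘ₗ D), ?_, h1, ?_, ?_⟩
  · intro s
    simp [pr]
  · intro y
    have h3 : D (y - τ (pr (D y))) = 0 := by rw [map_sub, h1, sub_self]
    obtain ⟨g, hg⟩ := hD.exact _ h3
    have : (L ∘ₗ (LinearMap.id - (τ ∘ₗ pr) ∘ₗ D)) y = g := by
      simp only [LinearMap.comp_apply, LinearMap.sub_apply, LinearMap.id_apply, ← hg, hL']
    rw [this, hg]
    simp
  · intro g
    simp [hD.noether, hL']

/-- The contracting homotopy on generators. -/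
def homotopyVar (σ₀ : JetSpace n (Sym2 (Fin n)) →ₗ[ℝ] JetSpace n (Sym2 (Fin n))) :
    EvenVar n → JetSpace n (Sym2 (Fin n))
  | .h s J _ => σ₀ (Finsupp.single (s, J) 1)
  | .Cstar _ _ => 0
  | .xistar _ => 0

/-- The contracting homotopy as an antiderivation. -/
def homotopyOp (σ₀ : JetSpace n (Sym2 (Fin n)) →ₗ[ℝ] JetSpace n (Sym2 (Fin n)))
    (σ₁ : JetSpace n (Sym2 (Fin n)) →ₗ[ℝ] JetSpace n (Option (Fin n))) :
    LocalFun n →ₗ[ℝ] LocalFun n := antiDer (homotopyVar σ₀) (gsEven ∘ₗ σ₁)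

section homotopy

variable {σ₀ : JetSpace n (Sym2 (Fin n)) →ₗ[ℝ] JetSpace n (Sym2 (Fin n))}
  {σ₁ : JetSpace n (Sym2 (Fin n)) →ₗ[ℝ] JetSpace n (Option (Fin n))}

lemma homotopyOp_one : homotopyOp σ₀ σ₁ 1 = 0 := antiDer_one _ _

lemma homotopyOp_sm_mul (g : SmoothFun n) (a : LocalFun n) :
    homotopyOp σ₀ σ₁ (sm g * a) = sm g * homotopyOp σ₀ σ₁ a := antiDer_sm_mul _ _ _ _

lemma homotopyOp_hs_mul (y : JetSpace n (Sym2 (Fin n))) (a : LocalFun n) :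
    homotopyOp σ₀ σ₁ (hs y * a) = gs (σ₁ y) * a - hs y * homotopyOp σ₀ σ₁ a :=
  antiDer_hs_mul _ _ _ _

lemma homotopyOp_gs_mul (g : JetSpace n (Option (Fin n))) (a : LocalFun n) :
    homotopyOp σ₀ σ₁ (gs g * a) = gs g * homotopyOp σ₀ σ₁ a := by
  induction g using Finsupp.induction_linear with
  | zero => simp
  | add f g hf hg => simp only [map_add, add_mul, hf, hg]
  | single v c =>
    rw [gs_single, smul_mul_assoc, map_smul, homotopyOp, antiDer_ev_mul, smul_mul_assoc]
    obtain ⟨i, J⟩ := v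
    cases i <;> simp [homotopyVar, gaugeVar]

lemma homotopyOp_hlin_mul (h0 : ∀ s, σ₀ (Finsupp.single (s, 0) 1) = 0)
    (p : JetSpace n (Sym2 (Fin n))) (a : LocalFun n) :
    homotopyOp σ₀ σ₁ (hlin p * a) = hs (σ₀ p) * a + hlin p * homotopyOp σ₀ σ₁ a := by
  induction p using Finsupp.induction_linear with
  | zero => simp
  | add f g hf hg => simp only [map_add, add_mul, hf, hg]; abel
  | single v c =>
    obtain ⟨s, J⟩ := v
    rw [← Finsupp.smul_single_one]
    simp only [map_smul, smul_mul_assoc, ← smul_add]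
    congr 1
    by_cases hJ : J = 0
    · subst hJ
      rw [h0, hlin_single_zero, one_smul, homotopyOp_sm_mul]
      simp
    · rw [hlin_single_of_ne s J hJ, one_smul, homotopyOp, antiDer_ev_mul]
      rfl

end homotopy

/-- The sum of the eigenspaces of positive integral eigenvalues. -/
def posEigen {V : Type*} [AddCommGroup V] [Module ℝ V] (f : Module.End ℝ V) : Submodule ℝ V :=
  ⨆ k : ℕ, f.eigenspace ((k + 1 : ℕ) : ℝ)

section posEigen

variable {V : Type*} [AddCommGroup V] [Module ℝ V] {f : Module.End ℝ V}

lemma eq_zero_of_mem_posEigen {v : V} (hv : v ∈ posEigen f) (h : f v = 0) : v = 0 := by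
  have hdis := f.eigenspaces_iSupIndep (0 : ℝ)
  refine Submodule.disjoint_def.1 hdis v (by simpa [Module.End.mem_eigenspace_iff] using h) ?_
  refine (iSup_le fun k => ?_ : posEigen f ≤ _) hv
  exact le_iSup₂_of_le ((k + 1 : ℕ) : ℝ) (by positivity) le_rfl

lemma posEigen_induction {p : V → Prop} {v : V} (hv : v ∈ posEigen f)
    (mem : ∀ k : ℕ, ∀ v, f v = ((k + 1 : ℕ) : ℝ) • v → p v) (add : ∀ a b, p a → p b → p (a + b)) :
    p v :=
  Submodule.iSup_induction (fun k : ℕ => f.eigenspace ((k + 1 : ℕ) : ℝ)) (motive := p) hv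
    (fun k v hv => mem k v (Module.End.mem_eigenspace_iff.1 hv)) (mem 0 0 (by simp)) add

lemma mem_posEigen {v : V} (k : ℕ) (hv : f v = ((k + 1 : ℕ) : ℝ) • v) : v ∈ posEigen f :=
  Submodule.mem_iSup_of_mem k (Module.End.mem_eigenspace_iff.2 hv)

/-- The hypothesis says that g raises eigenvalues by c, so positivity is preserved. -/
lemma map_mem_posEigen {g : V →ₗ[ℝ] V} (c : ℕ)
    (hg : ∀ v, f (g v) = (c : ℝ) • g v + g (f v)) {v : V} (hv : v ∈ posEigen f) :
    g v ∈ posEigen f := by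
  refine posEigen_induction (p := fun v => g v ∈ posEigen f) hv (fun k v hv => ?_)
    (fun a b ha hb => ?_)
  · refine mem_posEigen (k + c) ?_
    rw [hg, hv, map_smul, ← add_smul]
    push_cast
    ring_nf
  · rw [map_add]; exact add_mem ha hb

lemma exists_preimage_posEigen {v : V} (hv : v ∈ posEigen f) : ∃ w ∈ posEigen f, f w = v := by
  refine posEigen_induction (p := fun v => ∃ w ∈ posEigen f, f w = v) hv (fun k v hv => ?_) ?_
  · refine ⟨((k + 1 : ℕ) : ℝ)⁻¹ • v, Submodule.smul_mem _ _ (mem_posEigen k hv), ?_⟩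
    rw [map_smul, hv, smul_smul, inv_mul_cancel₀ (by positivity), one_smul]
  · rintro a b ⟨w, hw, rfl⟩ ⟨w', hw', rfl⟩
    exact ⟨w + w', add_mem hw hw', map_add _ _ _⟩

lemma mem_posEigen_of_zero {v : V} {g : V →ₗ[ℝ] V} {c : ℕ}
    (hg : ∀ v, f (g v) = ((c + 1 : ℕ) : ℝ) • g v + g (f v)) (hv : f v = 0) :
    g v ∈ posEigen f := by
  refine mem_posEigen c ?_
  rw [hg, hv, map_zero, add_zero]

end posEigen

/-- The homology of the Koszul-Tate differential vanishes in positive antifield number. -/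
theorem IsRegularSystem.acyclic (hD : IsRegularSystem D) {k : ℕ} {a : LocalFun n}
    (ha : a ∈ afSpace n (k + 1)) (hδ : linKT D a = 0) :
    ∃ b ∈ afSpace n (k + 2), linKT D b = a := by
  obtain ⟨σ₀, σ₁, h0, h1, h2, h3⟩ := hD.exists_homotopy
  set σ := homotopyOp σ₀ σ₁ with hσ
  -- The anticommutator of two odd antiderivations is an even derivation. On generators it
  -- multiplies `h^*`, `C^*`, `ξ^*` by one and acts on the jets of `h` as the projection Dσ₀.
  set T : Module.End ℝ (LocalFun n) := linKT D ∘ₗ σ + σ ∘ₗ linKT D with hT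
  have T_apply : ∀ a, T a = linKT D (σ a) + σ (linKT D a) := fun a => rfl
  have T_sm : ∀ g a, T (sm g * a) = sm g * T a := by
    intro g a
    simp only [T_apply, hσ, homotopyOp_sm_mul, linKT_sm_mul, mul_add]
  have T_gs : ∀ g a, T (gs g * a) = gs g * a + gs g * T a := by
    intro g a
    simp only [T_apply, hσ, homotopyOp_gs_mul, linKT_gs_mul, homotopyOp_hs_mul, map_add, mul_add,
      h3]
    abel
  have T_hs : ∀ y a, T (hs y * a) = hs y * a + hs y * T a := by
    intro y a
    simp only [T_apply, hσ, homotopyOp_hs_mul, linKT_hs_mul, homotopyOp_hlin_mul h0, linKT_gs_mul,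
      map_sub, mul_add]
    -- This is where K σ₁ + σ₀ D = 1 is used: the two contributions to T on `h^*` add up to the
    -- identity.
    have : hs y * a = hs (noetherMap (σ₁ y)) * a + hs (σ₀ (D y)) * a := by
      rw [← add_mul, ← map_add, h2]
    rw [this]
    abel
  have T_hlin : ∀ p a, T (hlin p * a) = hlin (D (σ₀ p)) * a + hlin p * T a := by
    intro p a
    simp only [T_apply, hσ, homotopyOp_hlin_mul h0, linKT_hs_mul, linKT_hlin_mul, map_add, mul_add]
    abel
  -- A jet p of `h` splits into p - Dσ₀p, of T-weight zero, and Dσ₀p, of T-weight one, because Dσ₀D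
  -- = D.
  have T_hlin0 : ∀ p a, T (hlin (p - D (σ₀ p)) * a) = hlin (p - D (σ₀ p)) * T a := by
    intro p a
    rw [T_hlin]
    simp [h1]
  have T_hlin1 : ∀ p a, T (hlin (D (σ₀ p)) * a) =
      hlin (D (σ₀ p)) * a + hlin (D (σ₀ p)) * T a := by
    intro p a
    rw [T_hlin, h1]
  have T_af : ∀ a, weightCount 0 1 2 (T a) = T (weightCount 0 1 2 a) := by
    intro a
    induction a using LocalFun.induction_gen with
    | one => simp [T_apply, hσ, homotopyOp_one, weightCount_one]
    | add a b ha hb => simp only [map_add, ha, hb]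
    | sm g a ha => simp only [T_sm, weightCount_sm_mul, ha, zero_smul, zero_add]
    | hlin s J a _ ha =>
      simp only [T_hlin, weightCount_hlin_mul, map_add, ha, zero_smul, zero_add]
    | gs v a ha =>
      simp only [T_gs, weightCount_gs_mul, map_add, map_smul, ha, smul_add]
      abel
    | hs y a ha =>
      simp only [T_hs, weightCount_hs_mul, map_add, map_smul, ha, smul_add]
      abel
  -- Everything is a sum of an element killed by T, which contains no antifields, and of
  -- eigenvectors with positive integral eigenvalue. The class of such elements is stable under
  -- multiplication by each generator.
  have key : ∀ a, ∃ z ∈ afSpace n 0, T z = 0 ∧ a - z ∈ posEigen T := by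
    intro a
    have mulL : ∀ x : LocalFun n, ∀ c : ℕ, (∀ a, T (x * a) = (c : ℝ) • (x * a) + x * T a) →
        ∀ v, T (LinearMap.mulLeft ℝ x v) =
          (c : ℝ) • LinearMap.mulLeft ℝ x v + LinearMap.mulLeft ℝ x (T v) := fun x c h v => h v
    induction a using LocalFun.induction_gen with
    | one =>
      refine ⟨1, one_mem_afSpace, ?_, by simp⟩
      simp [T_apply, hσ, homotopyOp_one]
    | add a b ha hb =>
      obtain ⟨z, hz, hz', hz''⟩ := ha
      obtain ⟨w, hw, hw', hw''⟩ := hb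
      refine ⟨z + w, add_mem hz hw, by rw [map_add, hz', hw', add_zero], ?_⟩
      rw [add_sub_add_comm]
      exact add_mem hz'' hw''
    | sm g a ha =>
      obtain ⟨z, hz, hz', hz''⟩ := ha
      refine ⟨sm g * z, sm_mul_mem_afSpace g hz, by rw [T_sm, hz', mul_zero], ?_⟩
      rw [← mul_sub]
      exact map_mem_posEigen 0 (mulL (sm g) 0 (by simp [T_sm])) hz''
    | gs v a ha =>
      obtain ⟨z, hz, hz', hz''⟩ := ha
      have h := mulL (gs (Finsupp.single v 1)) 1 (by simp [T_gs])
      refine ⟨0, zero_mem _, map_zero _, ?_⟩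
      rw [sub_zero, ← sub_add_cancel a z, mul_add]
      exact add_mem (map_mem_posEigen 1 h hz'') (mem_posEigen_of_zero (c := 0) h hz')
    | hs y a ha =>
      obtain ⟨z, hz, hz', hz''⟩ := ha
      have h := mulL (hs y) 1 (by simp [T_hs])
      refine ⟨0, zero_mem _, map_zero _, ?_⟩
      rw [sub_zero, ← sub_add_cancel a z, mul_add]
      exact add_mem (map_mem_posEigen 1 h hz'') (mem_posEigen_of_zero (c := 0) h hz')
    | hlin s J a _ ha =>
      obtain ⟨z, hz, hz', hz''⟩ := ha
      set p : JetSpace n (Sym2 (Fin n)) := Finsupp.single (s, J) 1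
      have h := mulL (hlin (D (σ₀ p))) 1 (by simp [T_hlin1])
      refine ⟨hlin (p - D (σ₀ p)) * z, hlin_mul_mem_afSpace _ hz, by rw [T_hlin0, hz', mul_zero], ?_⟩
      have : hlin p * a - hlin (p - D (σ₀ p)) * z =
          hlin (p - D (σ₀ p)) * (a - z) +
            (hlin (D (σ₀ p)) * (a - z) + hlin (D (σ₀ p)) * z) := by
        rw [map_sub]; noncomm_ring
      rw [this]
      exact add_mem (map_mem_posEigen 0 (mulL _ 0 (by simpa using T_hlin0 p)) hz'')
        (add_mem (map_mem_posEigen 1 h hz'') (mem_posEigen_of_zero (c := 0) h hz'))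
  -- T commutes with the projection to antifield number k + 1, and that projection removes the
  -- T-null part because it has antifield number zero.
  have ha' : a ∈ posEigen T := by
    obtain ⟨z, hz, -, hz'⟩ := key a
    have := map_mem_posEigen (g := afProj (k + 1)) 0
      (fun v => by rw [Nat.cast_zero, zero_smul, zero_add, afProj_comm T_af]) hz'
    rwa [map_sub, afProj_of_mem ha, afProj_of_mem_ne (by omega) hz, sub_zero] at this
  obtain ⟨c, hc, hca⟩ := exists_preimage_posEigen ha'
  have hTδ : ∀ v, T (linKT D v) = linKT D (T v) := by
    intro v
    simp only [T_apply, linKT_linKT D hD.noether, map_zero, map_add, add_zero, zero_add]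
  -- T commutes with δ, so δc is again a sum of positive eigenvectors, while T(δc) = δa = 0.
  have hδc : linKT D c = 0 := by
    refine eq_zero_of_mem_posEigen (f := T) (map_mem_posEigen (g := linKT D) 0 ?_ hc) ?_
    · intro v
      rw [Nat.cast_zero, zero_smul, zero_add, hTδ]
    · rw [hTδ, hca, hδ]
  -- From a = Tc and δc = 0 it follows that a = δσc; projecting σc to the expected antifield number
  -- does not disturb this.
  refine ⟨afProj (k + 2) (σ c), afProj_mem _ _, ?_⟩
  rw [← afProj_linKT, ← afProj_of_mem ha, ← hca, T_apply, hδc, map_zero, add_zero]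

/-! ### The Euler vector field on smooth functions -/

/-- Differentiation under the integral sign. The integrand's derivative is bounded on the compact
product of [0, 1] with a closed ball around x. -/
lemma hasFDerivAt_integral_pow_smul {E F : Type*} [NormedAddCommGroup E] [NormedSpace ℝ E]
    [ProperSpace E] [NormedAddCommGroup F] [NormedSpace ℝ F] {g : E → F}
    (hg : ContDiff ℝ 1 g) (j : ℕ) (x : E) :
    HasFDerivAt (fun x => ∫ t in (0 : ℝ)..1, t ^ j • g (t • x))
      (∫ t in (0 : ℝ)..1, t ^ (j + 1) • fderiv ℝ g (t • x)) x := by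
  have hg' : Continuous (fderiv ℝ g) := hg.continuous_fderiv one_ne_zero
  have hgc : Continuous g := hg.continuous
  have hcont : Continuous (fun p : ℝ × E => ‖p.1 ^ (j + 1) • fderiv ℝ g (p.1 • p.2)‖) :=
    ((continuous_fst.pow _).smul (hg'.comp (continuous_fst.smul continuous_snd))).norm
  obtain ⟨C, hC⟩ := ((isCompact_Icc (a := (0 : ℝ)) (b := 1)).prod
    (isCompact_closedBall x 1)).bddAbove_image hcont.continuousOn
  refine intervalIntegral.hasFDerivAt_integral_of_dominated_of_fderiv_le
    (𝕜 := ℝ) (F := fun x t => t ^ j • g (t • x))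
    (F' := fun x t => t ^ (j + 1) • fderiv ℝ g (t • x)) (bound := fun _ => C)
    (Metric.closedBall_mem_nhds x one_pos) ?_ ?_ ?_ ?_ ?_ ?_
  · refine Filter.Eventually.of_forall fun y => ?_
    exact (by fun_prop : Continuous fun t : ℝ => t ^ j • g (t • y)).aestronglyMeasurable
  · exact (by fun_prop : Continuous fun t : ℝ => t ^ j • g (t • x)).intervalIntegrable _ _
  · exact (by fun_prop : Continuous fun t : ℝ =>
      t ^ (j + 1) • fderiv ℝ g (t • x)).aestronglyMeasurable
  · refine Filter.Eventually.of_forall fun t ht y hy => ?_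
    rw [Set.uIoc_of_le zero_le_one] at ht
    exact hC ⟨(t, y), ⟨⟨ht.1.le, ht.2⟩, hy⟩, rfl⟩
  · exact intervalIntegrable_const
  · refine Filter.Eventually.of_forall fun t _ y _ => ?_
    have h1 : HasFDerivAt g (fderiv ℝ g (t • y)) (t • y) :=
      (hg.differentiable one_ne_zero _).hasFDerivAt
    have h2 : HasFDerivAt (fun y : E => t • y) (t • ContinuousLinearMap.id ℝ E) y :=
      (hasFDerivAt_id y).const_smul t
    have h3 := (h1.comp y h2).const_smul (t ^ j)
    refine h3.congr_fderiv (ContinuousLinearMap.ext fun v => ?_)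
    simp [pow_succ, mul_smul]

/-- The derivative is an integral of the same shape, with g replaced by its derivative and j by j +
1. The induction on N therefore runs over all target spaces F and all exponents j at once. -/
lemma contDiff_integral_pow_smul {E : Type} [NormedAddCommGroup E] [NormedSpace ℝ E]
    [FiniteDimensional ℝ E] (N : ℕ) {F : Type} [NormedAddCommGroup F] [NormedSpace ℝ F]
    {g : E → F} (hg : ContDiff ℝ ∞ g) (j : ℕ) :
    ContDiff ℝ N (fun x => ∫ t in (0 : ℝ)..1, t ^ j • g (t • x)) := by
  have : ProperSpace E := FiniteDimensional.proper ℝ E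
  have h1 : ContDiff ℝ 1 g := hg.of_le (by exact_mod_cast le_top)
  induction N generalizing F j with
  | zero =>
    rw [Nat.cast_zero, contDiff_zero]
    exact continuous_iff_continuousAt.2 fun x =>
      (hasFDerivAt_integral_pow_smul h1 j x).continuousAt
  | succ N ih =>
    rw [Nat.cast_add, Nat.cast_one, contDiff_succ_iff_fderiv]
    refine ⟨fun x => (hasFDerivAt_integral_pow_smul h1 j x).differentiableAt, by simp, ?_⟩
    have h2 : fderiv ℝ (fun x => ∫ t in (0 : ℝ)..1, t ^ j • g (t • x)) =
        fun x => ∫ t in (0 : ℝ)..1, t ^ (j + 1) • fderiv ℝ g (t • x) :=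
      funext fun x => (hasFDerivAt_integral_pow_smul h1 j x).fderiv
    rw [h2]
    have h3 : ContDiff ℝ ∞ (fderiv ℝ g) := hg.fderiv_right (m := ∞) le_rfl
    exact ih h3 (j + 1) (h3.of_le (by exact_mod_cast le_top))

/-- Along a ray, the Euler operator plus j + 1 becomes an ordinary derivative. Both solvability and
uniqueness for that operator follow from this. -/
lemma hasDerivAt_pow_mul_comp_smul {E : Type*} [NormedAddCommGroup E] [NormedSpace ℝ E]
    {g : E → ℝ} (hg : Differentiable ℝ g) (j : ℕ) (x : E) (t : ℝ) :
    HasDerivAt (fun t : ℝ => t ^ (j + 1) * g (t • x))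
      (t ^ j * (((j + 1 : ℕ) : ℝ) * g (t • x) + fderiv ℝ g (t • x) (t • x))) t := by
  have h1 : HasDerivAt (fun t : ℝ => t • x) x t := by
    simpa using (hasDerivAt_id t).smul_const x
  have h2 : HasDerivAt (fun t : ℝ => g (t • x)) (fderiv ℝ g (t • x) x) t :=
    (hg _).hasFDerivAt.comp_hasDerivAt t h1
  refine ((hasDerivAt_pow (j + 1) t).mul h2).congr_deriv ?_
  simp only [Nat.add_sub_cancel, map_smul, smul_eq_mul]
  ring

lemma smoothEuler_apply (f : SmoothFun n) (x : Sym2 (Fin n) → ℝ) :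
    (smoothEuler f).1 x = fderiv ℝ f.1 x x := by
  classical
  have h1 : (smoothEuler f).1 = ∑ s, (smoothCoord s * smoothPartial s f).1 := by
    have : ∀ t : Finset (Sym2 (Fin n)), (∑ s ∈ t, smoothCoord s * smoothPartial s f).1 =
        ∑ s ∈ t, (smoothCoord s * smoothPartial s f).1 := by
      intro t
      induction t using Finset.induction_on with
      | empty => rfl
      | insert i t hi ih => rw [Finset.sum_insert hi, Finset.sum_insert hi, ← ih]; rfl
    rw [← this]
    simp [smoothEuler]
  rw [h1, Finset.sum_apply]
  rw [(congrArg (fderiv ℝ f.1 x) (pi_eq_sum_univ' x)).trans (map_sum _ _ _)]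
  refine Finset.sum_congr rfl fun s _ => ?_
  rw [map_smul, smul_eq_mul]
  rfl

lemma SmoothFun.ext_apply {f g : SmoothFun n} (h : ∀ x, f.1 x = g.1 x) : f = g :=
  Subtype.ext (funext h)

lemma fderiv_integral_pow_smul_add {E : Type*} [NormedAddCommGroup E] [NormedSpace ℝ E]
    [ProperSpace E] {g : E → ℝ} (hg : ContDiff ℝ 1 g) (k : ℕ) (x : E) :
    fderiv ℝ (fun x => ∫ t in (0 : ℝ)..1, t ^ k • g (t • x)) x x +
      ((k + 1 : ℕ) : ℝ) * (∫ t in (0 : ℝ)..1, t ^ k • g (t • x)) = g x := by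
  have hg' : Continuous (fderiv ℝ g) := hg.continuous_fderiv one_ne_zero
  have hgc : Continuous g := hg.continuous
  have hint : IntervalIntegrable (fun t : ℝ => t ^ (k + 1) • fderiv ℝ g (t • x))
      MeasureTheory.volume 0 1 :=
    (by fun_prop : Continuous fun t : ℝ => t ^ (k + 1) • fderiv ℝ g (t • x)).intervalIntegrable _ _
  rw [(hasFDerivAt_integral_pow_smul hg k x).fderiv,
    ContinuousLinearMap.intervalIntegral_apply hint, ← intervalIntegral.integral_const_mul,
    ← intervalIntegral.integral_add]
  · have h3 := intervalIntegral.integral_eq_sub_of_hasDerivAt (a := 0) (b := 1)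
      (fun t _ => hasDerivAt_pow_mul_comp_smul (hg.differentiable one_ne_zero) k x t)
      ((by fun_prop : Continuous fun t : ℝ => t ^ k * (((k + 1 : ℕ) : ℝ) * g (t • x) +
        fderiv ℝ g (t • x) (t • x))).intervalIntegrable _ _)
    simp only [one_pow, one_smul, one_mul, ne_eq, Nat.add_eq_zero_iff, one_ne_zero, and_false,
      not_false_eq_true, zero_pow, zero_smul, zero_mul, sub_zero] at h3
    rw [← h3]
    congr 1
    funext t
    simp only [smul_apply, smul_eq_mul, map_smul]
    ring
  · exact (by fun_prop : Continuous fun t : ℝ =>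
      (t ^ (k + 1) • fderiv ℝ g (t • x)) x).intervalIntegrable _ _
  · exact (by fun_prop : Continuous fun t : ℝ =>
      ((k + 1 : ℕ) : ℝ) * (t ^ k • g (t • x))).intervalIntegrable _ _

/-- The solution is f(x) = ∫₀¹ tᵏ g(tx) dt, by the fundamental theorem of calculus applied to tᵏ⁺¹
g(tx). -/
lemma smoothEuler_add_surjective (k : ℕ) (g : SmoothFun n) :
    ∃ f : SmoothFun n, smoothEuler f + ((k + 1 : ℕ) : ℝ) • f = g := by
  let F : (Sym2 (Fin n) → ℝ) → ℝ := fun x => ∫ t in (0 : ℝ)..1, t ^ k • g.1 (t • x)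
  have hF : ContDiff ℝ ∞ F := contDiff_infty.2 fun N => contDiff_integral_pow_smul N g.contDiff k
  obtain ⟨f, hf⟩ : ∃ f : SmoothFun n, f.1 = F := ⟨⟨F, hF⟩, rfl⟩
  refine ⟨f, SmoothFun.ext_apply fun x => ?_⟩
  have h2 : (smoothEuler f + ((k + 1 : ℕ) : ℝ) • f).1 x =
      fderiv ℝ F x x + ((k + 1 : ℕ) : ℝ) * F x := by
    rw [← hf, ← smoothEuler_apply f]
    rfl
  rw [h2]
  exact fderiv_integral_pow_smul_add (g.contDiff.of_le (by exact_mod_cast le_top)) k x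

/-- tᵏ⁺¹ f(tx) is constant in t and vanishes at t = 0, so it vanishes at t = 1. -/
lemma eq_zero_of_smoothEuler_add (k : ℕ) (f : SmoothFun n)
    (hf : smoothEuler f + ((k + 1 : ℕ) : ℝ) • f = 0) : f = 0 := by
  refine SmoothFun.ext_apply fun x => ?_
  have hd : Differentiable ℝ f.1 := f.contDiff.differentiable (by simp)
  have h0 : ∀ y, ((k + 1 : ℕ) : ℝ) * f.1 y + fderiv ℝ f.1 y y = 0 := by
    intro y
    have := congrArg (fun g : SmoothFun n => g.1 y) hf
    rw [← smoothEuler_apply, add_comm]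
    exact this
  have h1 : ∀ t : ℝ, HasDerivAt (fun t : ℝ => t ^ (k + 1) * f.1 (t • x)) 0 t := by
    intro t
    have := hasDerivAt_pow_mul_comp_smul hd k x t
    rwa [h0, mul_zero] at this
  have h2 := is_const_of_deriv_eq_zero (fun t => (h1 t).differentiableAt) (fun t => (h1 t).deriv) 1 0
  have : f.1 x = 0 := by simpa using h2
  exact this

/-- The commutator of ∂_s with the Euler field is ∂_s, so each partial derivative is annihilated by
the Euler field plus one and therefore vanishes. -/
lemma exists_const_of_smoothEuler_eq_zero (f : SmoothFun n) (hf : smoothEuler f = 0) :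
    ∃ c : ℝ, f = algebraMap ℝ (SmoothFun n) c := by
  have h1 : ∀ s, smoothPartial s f = 0 := by
    intro s
    refine eq_zero_of_smoothEuler_add 0 _ ?_
    have := smoothPartial_smoothEuler s f
    rw [hf, map_zero] at this
    rw [Nat.zero_add, Nat.cast_one, one_smul, add_comm, ← this]
  have hd : Differentiable ℝ f.1 := f.contDiff.differentiable (by simp)
  have h2 : ∀ x, fderiv ℝ f.1 x = 0 := by
    classical
    intro x
    refine ContinuousLinearMap.coe_injective (LinearMap.pi_ext' fun s => LinearMap.ext_ring ?_)
    exact congrArg (fun g : SmoothFun n => g.1 x) (h1 s)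
  refine ⟨f.1 0, SmoothFun.ext_apply fun x => ?_⟩
  exact is_const_of_fderiv_eq_zero hd h2 x 0

/-! ### Coordinates of a tensor product with a jet space -/

section tensorCoord

variable {ι : Type}

/-- The coefficient of a jet in an element of the tensor product. -/
def tensorCoord (v : ι × MultiIndex n) : LocalFun n ⊗[ℝ] JetSpace n ι →ₗ[ℝ] LocalFun n :=
  open Classical in
  Finsupp.lapply v ∘ₗ
    (TensorProduct.finsuppScalarRight ℝ ℝ (LocalFun n) (ι × MultiIndex n)).toLinearMap

@[simp] lemma tensorCoord_tmul (v : ι × MultiIndex n) (a : LocalFun n) (w : JetSpace n ι) :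
    tensorCoord v (a ⊗ₜ[ℝ] w) = w v • a := by
  classical
  exact TensorProduct.finsuppScalarRight_apply_tmul_apply _ _ _

lemma tensorCoord_rTensor (v : ι × MultiIndex n) (T : LocalFun n →ₗ[ℝ] LocalFun n)
    (z : LocalFun n ⊗[ℝ] JetSpace n ι) : tensorCoord v (T.rTensor _ z) = T (tensorCoord v z) := by
  induction z using TensorProduct.induction_on with
  | zero => simp
  | tmul a w => simp
  | add x y hx hy => simp only [map_add, hx, hy]

lemma eq_zero_of_tensorCoord {z : LocalFun n ⊗[ℝ] JetSpace n ι}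
    (h : ∀ v, tensorCoord v z = 0) : z = 0 := by
  classical
  refine (TensorProduct.finsuppScalarRight ℝ ℝ (LocalFun n) (ι × MultiIndex n)).injective ?_
  rw [map_zero]
  refine Finsupp.ext fun v => Eq.trans ?_ (h v)
  rw [tensorCoord]
  congr!

end tensorCoord

/-! ### Antifield number of the coefficients of vertical derivatives. -/

lemma tensorCoord_vertHs_mem {k : ℕ} {a : LocalFun n} (ha : a ∈ afSpace n (k + 1))
    (v : Sym2 (Fin n) × MultiIndex n) : tensorCoord v (vertHs a) ∈ afSpace n k := by
  rw [mem_afSpace] at *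
  have h := congrArg (tensorCoord v) (vertHs_weightCount 0 1 2 a)
  rw [ha, map_smul, map_smul, map_add, map_smul, tensorCoord_rTensor, one_smul] at h
  rw [← sub_eq_iff_eq_add] at h
  rw [← h]
  push_cast
  rw [add_smul, one_smul, add_sub_cancel_right]

lemma tensorCoord_vertG_mem {k : ℕ} {a : LocalFun n} (ha : a ∈ afSpace n (k + 2))
    (v : Option (Fin n) × MultiIndex n) : tensorCoord v (vertG a) ∈ afSpace n k := by
  rw [mem_afSpace] at *
  have h := congrArg (tensorCoord v) (vertG_weightCount 0 1 2 a)
  rw [ha, map_smul, map_smul, map_add, map_smul, tensorCoord_rTensor] at h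
  rw [← sub_eq_iff_eq_add] at h
  rw [← h]
  push_cast
  rw [← sub_smul, add_sub_cancel_right]

/-- The coefficients would have antifield number k - 2 < 0. -/
lemma vertG_eq_zero_of_mem {k : ℕ} (hk : k < 2) {a : LocalFun n} (ha : a ∈ afSpace n k) :
    vertG a = 0 := by
  refine eq_zero_of_tensorCoord fun v => ?_
  have h := congrArg (tensorCoord v) (vertG_weightCount 0 1 2 a)
  rw [mem_afSpace] at ha
  rw [ha, map_smul, map_smul, map_add, map_smul, tensorCoord_rTensor, ← sub_eq_iff_eq_add,
    ← sub_smul] at h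
  refine eq_zero_of_weightCount_eq (fun l hl => ?_) h.symm
  have : ((l + 2 : ℕ) : ℝ) = k := by push_cast; linarith
  have := Nat.cast_injective this
  omega

lemma vertHs_eq_zero_of_mem {a : LocalFun n} (ha : a ∈ afSpace n 0) :
    vertHs a = 0 := by
  refine eq_zero_of_tensorCoord fun v => ?_
  have h := congrArg (tensorCoord v) (vertHs_weightCount 0 1 2 a)
  rw [mem_afSpace] at ha
  rw [ha, map_smul, map_smul, map_add, map_smul, tensorCoord_rTensor, ← sub_eq_iff_eq_add,
    ← sub_smul] at h
  refine eq_zero_of_weightCount_eq (fun l hl => ?_) h.symm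
  have : ((l + 1 : ℕ) : ℝ) = 0 := by push_cast; simp at hl; linarith
  exact Nat.succ_ne_zero l (by exact_mod_cast this)

/-! ### The projection to the commuting variables -/

/-- Setting the jets of `h^*` to zero. -/
def evenPart : LocalFun n →ₐ[ℝ] EvenAlg n :=
  (Algebra.TensorProduct.lift (AlgHom.id ℝ (EvenAlg n))
    ((Algebra.ofId ℝ (EvenAlg n)).comp ExteriorAlgebra.algebraMapInv)
    (fun _ _ => Commute.all _ _) : EvenAlg n ⊗[ℝ] OddAlg n →ₐ[ℝ] EvenAlg n)

lemma evenPart_ofEven (r : EvenAlg n) : evenPart (ofEven n r) = r :=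
  Algebra.TensorProduct.lift_tmul _ _ _ r 1 |>.trans (by simp)

lemma evenPart_hs (y : JetSpace n (Sym2 (Fin n))) : evenPart (hs y) = 0 :=
  Algebra.TensorProduct.lift_tmul _ _ _ 1 (ExteriorAlgebra.ι ℝ y) |>.trans (by
    simp [ExteriorAlgebra.algebraMapInv])

lemma smoothEuler_mul (f g : SmoothFun n) :
    smoothEuler (f * g) = f * smoothEuler g + smoothEuler f * g := by
  simp only [smoothEuler, LinearMap.sum_apply, LinearMap.comp_apply, LinearMap.mulLeft_apply,
    smoothPartial_mul, Finset.mul_sum, Finset.sum_mul, ← Finset.sum_add_distrib]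
  exact Finset.sum_congr rfl fun _ _ => by ring

lemma weightCount_ev_mul (v : EvenVar n) (a : LocalFun n) :
    weightCount 1 1 1 (ev v * a) = ev v * a + ev v * weightCount 1 1 1 a := by
  have : (∃ w, ev v = hlin (n := n) w) ∨ ∃ w, ev v = gs (n := n) w := by
    cases v with
    | h s J hJ => exact Or.inl ⟨Finsupp.single (s, J) 1, by simp [hlin_single_of_ne s J hJ]⟩
    | Cstar μ J => exact Or.inr ⟨Finsupp.single (some μ, J) 1, by simp [gs_single, gaugeVar]⟩
    | xistar J => exact Or.inr ⟨Finsupp.single (none, J) 1, by simp [gs_single, gaugeVar]⟩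
  obtain ⟨w, hw⟩ | ⟨w, hw⟩ := this <;> simp [hw]

lemma smoothEuler_one : smoothEuler (1 : SmoothFun n) = 0 := by
  simp [smoothEuler, smoothPartial_one]

/-- On the coefficient of a monomial the polynomial degree operator is the Euler field plus the
degree of the monomial. This reduces its inversion to the previous analysis on smooth functions. -/
lemma coeff_evenPart_weightCount (a : LocalFun n) (k : EvenVar n →₀ ℕ) :
    MvPolynomial.coeff k (evenPart (weightCount 1 1 1 a)) =
      smoothEuler (MvPolynomial.coeff k (evenPart a)) +
        (k.degree : ℝ) • MvPolynomial.coeff k (evenPart a) := by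
  classical
  induction a using LocalFun.induction generalizing k with
  | one =>
    rw [weightCount_one, map_zero, map_one, MvPolynomial.coeff_zero, MvPolynomial.coeff_one]
    split_ifs with h
    · subst h; simp [smoothEuler_one]
    · simp
  | add a b ha hb => simp only [map_add, MvPolynomial.coeff_add, ha, hb, smul_add]; abel
  | sm g a ha =>
    rw [weightCount_sm_mul, one_smul]
    simp only [map_add, map_mul, sm, evenPart_ofEven,
      MvPolynomial.coeff_add, MvPolynomial.coeff_C_mul, ha, smoothEuler_mul, mul_add,
      mul_smul_comm]
    abel
  | ev v a ha =>
    rw [weightCount_ev_mul, map_add, map_mul, map_mul, ev, evenPart_ofEven,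
      MvPolynomial.coeff_add, MvPolynomial.coeff_X_mul', MvPolynomial.coeff_X_mul']
    split_ifs with h
    · have h1 : k = (k - Finsupp.single v 1) + Finsupp.single v 1 := by
        rw [tsub_add_cancel_of_le]
        rw [Finsupp.single_le_iff]
        exact Nat.one_le_iff_ne_zero.2 (Finsupp.mem_support_iff.1 h)
      have h2 : (k.degree : ℝ) = ((k - Finsupp.single v 1).degree : ℝ) + 1 := by
        conv_lhs => rw [h1]
        simp
      rw [ha, h2, add_smul, one_smul]
      abel
    · simp
  | hs y a ha =>
    simp [evenPart_hs, map_mul]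

lemma afProj_zero_hs_mul (y : JetSpace n (Sym2 (Fin n))) (a : LocalFun n) :
    afProj 0 (hs y * a) = 0 := by
  induction a using afSpace_induction with
  | mem k a ha => exact afProj_of_mem_ne (Nat.succ_ne_zero k) (hs_mul_mem_afSpace y ha)
  | add a b ha hb => rw [mul_add, map_add, ha, hb, add_zero]

lemma afProj_zero_gs_mul (y : JetSpace n (Option (Fin n))) (a : LocalFun n) :
    afProj 0 (gs y * a) = 0 := by
  induction a using afSpace_induction with
  | mem k a ha => exact afProj_of_mem_ne (Nat.succ_ne_zero _) (gs_mul_mem_afSpace y ha)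
  | add a b ha hb => rw [mul_add, map_add, ha, hb, add_zero]

/-- Terms containing `h^*` have positive antifield number, so dropping them is invisible after
projection to antifield number zero. -/
lemma afProj_zero_ofEven_evenPart (a : LocalFun n) :
    afProj 0 (ofEven n (evenPart a)) = afProj 0 a := by
  have key : ∀ (x : LocalFun n) (a : LocalFun n),
      (∀ a, weightCount 0 1 2 (x * a) = x * weightCount 0 1 2 a) →
      afProj 0 (x * a) = x * afProj 0 a := fun x a hx =>
    afProj_comm (T := LinearMap.mulLeft ℝ x) (fun a => hx a) 0 a
  induction a using LocalFun.induction_gen with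
  | one => simp
  | add a b ha hb => simp only [map_add, ha, hb]
  | sm g a ha =>
    rw [map_mul, map_mul, sm, evenPart_ofEven, ← sm, key _ _ (by simp), key _ _ (by simp), ha]
  | hlin s J a _ ha =>
    rw [map_mul, map_mul, hlin_apply, evenPart_ofEven, ← hlin_apply, key _ _ (by simp),
      key _ _ (by simp), ha]
  | gs v a ha =>
    rw [map_mul, map_mul, gs_apply, evenPart_ofEven, ← gs_apply, afProj_zero_gs_mul,
      afProj_zero_gs_mul]
  | hs y a ha => rw [map_mul, evenPart_hs, zero_mul, map_zero, map_zero, afProj_zero_hs_mul]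

/-! ### Inversion of the polynomial degree operator -/

/-- Coefficients of monomials of positive degree vanish by uniqueness for the Euler field plus that
degree. The remaining smooth function is annihilated by the Euler field itself. -/
lemma exists_const_of_weightCount_eq_zero {a : LocalFun n} (ha : a ∈ afSpace n 0)
    (h : weightCount 1 1 1 a = 0) : ∃ c : ℝ, a = algebraMap ℝ (LocalFun n) c := by
  have h1 : ∀ k : EvenVar n →₀ ℕ, smoothEuler (MvPolynomial.coeff k (evenPart a)) +
      (k.degree : ℝ) • MvPolynomial.coeff k (evenPart a) = 0 := fun k => by
    rw [← coeff_evenPart_weightCount, h, map_zero, MvPolynomial.coeff_zero]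
  classical
  obtain ⟨c, hc⟩ := exists_const_of_smoothEuler_eq_zero (MvPolynomial.coeff 0 (evenPart a))
    (by simpa using h1 0)
  have h2 : evenPart a = algebraMap ℝ (EvenAlg n) c := by
    refine MvPolynomial.ext _ _ fun k => ?_
    by_cases hk : k = 0
    · subst hk
      rw [hc, IsScalarTower.algebraMap_apply ℝ (SmoothFun n) (EvenAlg n),
        MvPolynomial.algebraMap_eq, MvPolynomial.coeff_zero_C]
    · rw [IsScalarTower.algebraMap_apply ℝ (SmoothFun n) (EvenAlg n),
        MvPolynomial.algebraMap_eq, MvPolynomial.coeff_C, if_neg (Ne.symm hk)]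
      obtain ⟨d, hd⟩ : ∃ d, k.degree = d + 1 :=
        Nat.exists_eq_succ_of_ne_zero (by simpa [Finsupp.degree_eq_zero_iff] using hk)
      exact eq_zero_of_smoothEuler_add d _ (by rw [← hd]; exact h1 k)
  have h3 := afProj_zero_ofEven_evenPart a
  rw [afProj_of_mem ha, h2, AlgHom.commutes, Algebra.algebraMap_eq_smul_one,
    afProj_of_mem (Submodule.smul_mem _ c one_mem_afSpace)] at h3
  exact ⟨c, by rw [← h3, Algebra.algebraMap_eq_smul_one]⟩

/-- Strong induction on the antifield number. Derivatives by `h^*` and by the ghost antifields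
satisfy the same equation with q + 1 in place of q, and they have lower antifield number, so they
vanish. But then the antifield count of a is zero. At antifield number zero the equation is solved
coefficient by coefficient. The shift q is needed for this induction; the application has q = 0. -/
lemma eq_zero_of_weightCount_add (q : ℕ) {k : ℕ} (hq : 0 < q + k) {a : LocalFun n}
    (ha : a ∈ afSpace n k) (h : weightCount 1 1 1 a + (q : ℝ) • a = 0) : a = 0 := by
  induction k using Nat.strong_induction_on generalizing q a with
  | _ k ih =>
    have hHs : ∀ l v, k = l + 1 → tensorCoord v (vertHs a) = 0 := by
      rintro l v rfl
      refine ih l (Nat.lt_succ_self l) (q + 1) (by omega) (tensorCoord_vertHs_mem ha v) ?_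
      have := congrArg (fun x => tensorCoord v (vertHs x)) h
      simp only [map_add, map_smul, vertHs_weightCount, tensorCoord_rTensor, map_zero] at this
      rw [← this]
      push_cast
      simp only [add_smul, one_smul]
      abel
    have hG : ∀ l v, k = l + 2 → tensorCoord v (vertG a) = 0 := by
      rintro l v rfl
      refine ih l (by omega) (q + 1) (by omega) (tensorCoord_vertG_mem ha v) ?_
      have := congrArg (fun x => tensorCoord v (vertG x)) h
      simp only [map_add, map_smul, vertG_weightCount, tensorCoord_rTensor, map_zero] at this
      rw [← this]
      push_cast
      simp only [add_smul, one_smul]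
      abel
    cases k with
    | zero =>
      have h1 : evenPart a = 0 := by
        refine MvPolynomial.ext _ _ fun k => ?_
        obtain ⟨d, hd⟩ : ∃ d, k.degree + q = d + 1 :=
          Nat.exists_eq_succ_of_ne_zero (by omega)
        have h2 := coeff_evenPart_weightCount a k
        rw [eq_neg_of_add_eq_zero_left h, map_neg, map_smul, MvPolynomial.coeff_neg,
          MvPolynomial.coeff_smul] at h2
        refine eq_zero_of_smoothEuler_add d _ ?_
        rw [← hd, Nat.cast_add, add_smul, ← add_assoc, ← h2, neg_add_cancel]
      rw [← afProj_of_mem ha, ← afProj_zero_ofEven_evenPart, h1, map_zero, map_zero]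
    | succ l =>
      have h1 : vertHs a = 0 := eq_zero_of_tensorCoord fun v => hHs l v rfl
      have h2 : vertG a = 0 := by
        cases l with
        | zero => exact vertG_eq_zero_of_mem (by norm_num) ha
        | succ l => exact eq_zero_of_tensorCoord fun v => hG l v rfl
      have h3 : weightCount 0 1 2 a = 0 := by simp [weightCount, h1, h2]
      rw [mem_afSpace.1 ha, smul_eq_zero] at h3
      exact h3.resolve_left (by positivity)

lemma sm_smul (c : ℝ) (f : SmoothFun n) : sm (c • f) = c • sm f := by
  rw [sm, sm, ← map_smul, ← MvPolynomial.algebraMap_eq, Algebra.algebraMap_eq_smul_one,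
    Algebra.algebraMap_eq_smul_one, smul_assoc]

/-- Products of a smooth function of the undifferentiated field and an eigenvector. -/
def homogeneousProducts (n : ℕ) : Set (LocalFun n) :=
  {y | ∃ (g : SmoothFun n) (x : LocalFun n) (d j : ℕ), x ∈ afSpace n j ∧
    weightCount 1 1 1 x = (d : ℝ) • x ∧ (d = 0 → j = 0) ∧ y = sm g * x}

/-- The span is stable under left multiplication by every generator. Smooth coefficients are kept
apart because, unlike polynomials, they are not sums of eigenvectors of the degree. -/
lemma mem_span_homogeneousProducts (a : LocalFun n) :
    a ∈ Submodule.span ℝ (homogeneousProducts n) := by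
  have key : ∀ (z : LocalFun n), (∀ y ∈ homogeneousProducts n, z * y ∈ homogeneousProducts n) →
      ∀ a ∈ Submodule.span ℝ (homogeneousProducts n),
        z * a ∈ Submodule.span ℝ (homogeneousProducts n) := by
    intro z hz a ha
    induction ha using Submodule.span_induction with
    | mem y hy => exact Submodule.subset_span (hz y hy)
    | zero => simp
    | add x y _ _ hx hy => rw [mul_add]; exact add_mem hx hy
    | smul c x _ hx => rw [mul_smul_comm]; exact Submodule.smul_mem _ c hx
  have succ_smul : ∀ (d : ℕ) (x : LocalFun n), ((d + 1 : ℕ) : ℝ) • x = x + (d : ℝ) • x := by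
    intro d x
    rw [Nat.cast_add, Nat.cast_one, add_smul, one_smul, add_comm]
  induction a using LocalFun.induction_gen with
  | one => exact Submodule.subset_span ⟨1, 1, 0, 0, one_mem_afSpace, by simp [weightCount_one],
      fun _ => rfl, by simp [sm]⟩
  | add a b ha hb => exact add_mem ha hb
  | sm g a ha =>
    refine key _ ?_ a ha
    rintro _ ⟨g', x, d, j, hx, hN, hd, rfl⟩
    exact ⟨g * g', x, d, j, hx, hN, hd, by rw [sm_mul_sm, mul_assoc]⟩
  | hlin s J a _ ha =>
    refine key _ ?_ a ha
    rintro _ ⟨g', x, d, j, hx, hN, hd, rfl⟩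
    refine ⟨g', _, d + 1, j, hlin_mul_mem_afSpace (Finsupp.single (s, J) 1) hx, ?_, by simp, ?_⟩
    · rw [weightCount_hlin_mul, hN, succ_smul, one_smul, mul_smul_comm]
    · rw [← mul_assoc, ← mul_assoc, sm_mul_comm g']
  | gs v a ha =>
    refine key _ ?_ a ha
    rintro _ ⟨g', x, d, j, hx, hN, hd, rfl⟩
    refine ⟨g', _, d + 1, _, gs_mul_mem_afSpace (Finsupp.single v 1) hx, ?_, by simp, ?_⟩
    · rw [weightCount_gs_mul, hN, succ_smul, one_smul, mul_smul_comm]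
    · rw [← mul_assoc, ← mul_assoc, sm_mul_comm g']
  | hs y a ha =>
    refine key _ ?_ a ha
    rintro _ ⟨g', x, d, j, hx, hN, hd, rfl⟩
    refine ⟨g', _, d + 1, _, hs_mul_mem_afSpace y hx, ?_, by simp, ?_⟩
    · rw [weightCount_hs_mul, hN, succ_smul, one_smul, mul_smul_comm]
    · rw [← mul_assoc, ← mul_assoc, sm_mul_comm g']

/-- On a product of a smooth g with an eigenvector of degree d + 1, it suffices to solve the Euler
equation with constant d + 1 for g. Degree zero is not invertible, but there no antifields occur, so
the remainder c has antifield number zero. -/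
lemma exists_weightCount_add_eq (a : LocalFun n) :
    ∃ b c : LocalFun n, c ∈ afSpace n 0 ∧ weightCount 1 1 1 b + c = a := by
  have ha := mem_span_homogeneousProducts a
  induction ha using Submodule.span_induction with
  | mem y hy =>
    obtain ⟨g, x, d, j, hx, hN, hd, rfl⟩ := hy
    cases d with
    | zero =>
      obtain rfl := hd rfl
      exact ⟨0, _, sm_mul_mem_afSpace g hx, by simp⟩
    | succ d =>
      obtain ⟨f, hf⟩ := smoothEuler_add_surjective d g
      refine ⟨sm f * x, 0, zero_mem _, ?_⟩
      rw [weightCount_sm_mul, hN, add_zero, one_smul, mul_smul_comm, ← smul_mul_assoc, ← add_mul,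
        ← hf, sm_add, sm_smul]
  | zero => exact ⟨0, 0, zero_mem _, by simp⟩
  | add x y _ _ hx hy =>
    obtain ⟨b, c, hc, rfl⟩ := hx
    obtain ⟨b', c', hc', rfl⟩ := hy
    exact ⟨b + b', c + c', add_mem hc hc', by rw [map_add]; abel⟩
  | smul t x _ hx =>
    obtain ⟨b, c, hc, rfl⟩ := hx
    exact ⟨t • b, t • c, Submodule.smul_mem _ t hc, by rw [map_smul, smul_add]⟩

lemma weightCount_mem_afSpace (p q r : ℝ) {k : ℕ} {a : LocalFun n} (ha : a ∈ afSpace n k) :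
    weightCount p q r a ∈ afSpace n k := by
  rw [mem_afSpace] at *
  rw [weightCount_weightCount, ha, map_smul]

lemma exists_weightCount_eq {k : ℕ} {a : LocalFun n} (ha : a ∈ afSpace n (k + 1)) :
    ∃ b ∈ afSpace n (k + 1), weightCount 1 1 1 b = a := by
  obtain ⟨b, c, hc, h⟩ := exists_weightCount_add_eq a
  refine ⟨afProj (k + 1) b, afProj_mem _ _, ?_⟩
  have h1 := congrArg (afProj (k + 1)) h
  rwa [map_add, afProj_of_mem_ne (Nat.succ_ne_zero k).symm hc, afProj_of_mem ha, add_zero,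
    afProj_comm (fun a => weightCount_weightCount 0 1 2 1 1 1 a)] at h1

/-! ### The degree of a jet -/

section degree

variable {ι : Type}

/-- The projection to the jets of order `d`. -/
def degProj (d : ℕ) : JetSpace n ι →ₗ[ℝ] JetSpace n ι :=
  Finsupp.linearCombination ℝ (fun v => if ∑ μ, v.2 μ = d then Finsupp.single v 1 else 0)

lemma degProj_single (d : ℕ) (i : ι) (J : MultiIndex n) (c : ℝ) :
    degProj d (Finsupp.single (i, J) c) =
      if ∑ μ, J μ = d then Finsupp.single (i, J) c else 0 := by
  rw [degProj, Finsupp.linearCombination_single]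
  split_ifs <;> simp

lemma sum_raise (J : MultiIndex n) (μ : Fin n) : ∑ ν, raise J μ ν = ∑ ν, J ν + 1 := by
  simp [raise, Finset.sum_add_distrib]

lemma degProj_jetShift (d : ℕ) (μ : Fin n) (w : JetSpace n ι) :
    degProj (d + 1) (jetShift μ w) = jetShift μ (degProj d w) := by
  induction w using Finsupp.induction_linear with
  | zero => simp
  | add f g hf hg => simp only [map_add, hf, hg]
  | single v c =>
    obtain ⟨i, J⟩ := v
    rw [jetShift_single, degProj_single, degProj_single, sum_raise]
    split_ifs with h1 h2 h2
    · rw [jetShift_single]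
    · omega
    · omega
    · simp

lemma exists_sum_degProj (w : JetSpace n ι) : ∃ B, ∀ C, B ≤ C →
    degProj C w = 0 ∧ ∑ d ∈ Finset.range C, degProj d w = w := by
  induction w using Finsupp.induction_linear with
  | zero => exact ⟨0, fun C _ => by simp⟩
  | add f g hf hg =>
    obtain ⟨B, hB⟩ := hf
    obtain ⟨B', hB'⟩ := hg
    refine ⟨max B B', fun C hC => ?_⟩
    obtain ⟨h1, h2⟩ := hB C (le_trans (le_max_left _ _) hC)
    obtain ⟨h3, h4⟩ := hB' C (le_trans (le_max_right _ _) hC)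
    simp only [map_add, Finset.sum_add_distrib, h1, h2, h3, h4, add_zero, and_self]
  | single v c =>
    obtain ⟨i, J⟩ := v
    refine ⟨∑ μ, J μ + 1, fun C hC => ?_⟩
    simp only [degProj_single]
    rw [if_neg (by omega), Finset.sum_ite_eq, if_pos (Finset.mem_range.2 (by omega))]
    exact ⟨rfl, rfl⟩

lemma exists_sum_degProj_lTensor (z : LocalFun n ⊗[ℝ] JetSpace n ι) : ∃ B, ∀ C, B ≤ C →
    (degProj C).lTensor _ z = 0 ∧ ∑ d ∈ Finset.range C, (degProj d).lTensor _ z = z := by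
  induction z using TensorProduct.induction_on with
  | zero => exact ⟨0, fun C _ => by simp⟩
  | add f g hf hg =>
    obtain ⟨B, hB⟩ := hf
    obtain ⟨B', hB'⟩ := hg
    refine ⟨max B B', fun C hC => ?_⟩
    obtain ⟨h1, h2⟩ := hB C (le_trans (le_max_left _ _) hC)
    obtain ⟨h3, h4⟩ := hB' C (le_trans (le_max_right _ _) hC)
    simp only [map_add, Finset.sum_add_distrib, h1, h2, h3, h4, add_zero, and_self]
  | tmul a w =>
    obtain ⟨B, hB⟩ := exists_sum_degProj w
    refine ⟨B, fun C hC => ?_⟩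
    obtain ⟨h1, h2⟩ := hB C hC
    simp only [LinearMap.lTensor_tmul, ← TensorProduct.tmul_sum, h1, h2, TensorProduct.tmul_zero,
      and_self]

end degree

/-! ### Local functions that are constant modulo the field equations -/

section weaklyConstant

variable {D : JetSpace n (Sym2 (Fin n)) →ₗ[ℝ] JetSpace n (Sym2 (Fin n))}

/-- The variational one-forms that vanish modulo the field equations. -/
def onShellZero (D : JetSpace n (Sym2 (Fin n)) →ₗ[ℝ] JetSpace n (Sym2 (Fin n))) :
    Submodule ℝ (LocalFun n ⊗[ℝ] JetSpace n (Sym2 (Fin n))) :=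
  LinearMap.range ((linKT D).rTensor _) ⊔ LinearMap.range (D.lTensor _)

lemma lTensor_mem_range {T : JetSpace n (Sym2 (Fin n)) →ₗ[ℝ] JetSpace n (Sym2 (Fin n))}
    (hT : ∀ w, T w ∈ LinearMap.range D) (z : LocalFun n ⊗[ℝ] JetSpace n (Sym2 (Fin n))) :
    T.lTensor _ z ∈ LinearMap.range (D.lTensor (LocalFun n)) := by
  induction z using TensorProduct.induction_on with
  | zero => simp
  | add x y hx hy => rw [map_add]; exact add_mem hx hy
  | tmul a w =>
    obtain ⟨y, hy⟩ := hT w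
    exact ⟨a ⊗ₜ y, by simp [hy]⟩

lemma lTensor_mem_onShellZero {T : JetSpace n (Sym2 (Fin n)) →ₗ[ℝ] JetSpace n (Sym2 (Fin n))}
    (hT : ∀ w, T (D w) ∈ LinearMap.range D) {z : LocalFun n ⊗[ℝ] JetSpace n (Sym2 (Fin n))}
    (hz : z ∈ onShellZero D) : T.lTensor _ z ∈ onShellZero D := by
  obtain ⟨_, ⟨x, rfl⟩, _, ⟨y, rfl⟩, rfl⟩ := Submodule.mem_sup.1 hz
  rw [map_add]
  refine add_mem (Submodule.mem_sup_left ⟨T.lTensor _ x, ?_⟩) (Submodule.mem_sup_right ?_)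
  · rw [← LinearMap.comp_apply, ← LinearMap.comp_apply, LinearMap.rTensor_comp_lTensor,
      LinearMap.lTensor_comp_rTensor]
  · rw [← LinearMap.lTensor_comp_apply]
    exact lTensor_mem_range (T := T ∘ₗ D) (fun w => hT w) y

lemma rTensor_totalDeriv_mem_onShellZero
    (hD : ∀ μ w, D (jetShift μ w) = jetShift μ (D w)) (μ : Fin n)
    {z : LocalFun n ⊗[ℝ] JetSpace n (Sym2 (Fin n))}
    (hz : z ∈ onShellZero D) : (totalDeriv μ).rTensor _ z ∈ onShellZero D := by
  obtain ⟨_, ⟨x, rfl⟩, _, ⟨y, rfl⟩, rfl⟩ := Submodule.mem_sup.1 hz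
  rw [map_add]
  refine add_mem (Submodule.mem_sup_left ⟨(totalDeriv μ).rTensor _ x, ?_⟩)
    (Submodule.mem_sup_right ⟨(totalDeriv μ).rTensor _ y, ?_⟩)
  · rw [← LinearMap.rTensor_comp_apply, ← LinearMap.rTensor_comp_apply]
    congr 2
    ext a
    exact linKT_totalDeriv D hD μ a
  · rw [← LinearMap.comp_apply, ← LinearMap.comp_apply, LinearMap.rTensor_comp_lTensor,
      LinearMap.lTensor_comp_rTensor]

/-- The derivative `∂_μ` is injective on the linear functions of the solutions. -/
def IsTorsionFree (D : JetSpace n (Sym2 (Fin n)) →ₗ[ℝ] JetSpace n (Sym2 (Fin n))) (μ : Fin n) :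
    Prop :=
  ∀ w, jetShift μ w ∈ LinearMap.range D → w ∈ LinearMap.range D

/-- The field equations have constant order. -/
def IsHomogeneousSystem (D : JetSpace n (Sym2 (Fin n)) →ₗ[ℝ] JetSpace n (Sym2 (Fin n))) : Prop :=
  ∀ d w, degProj d (D w) ∈ LinearMap.range D

/-- Torsion-freeness makes `∂_μ` injective on the quotient by the range of D, so it has a linear
left inverse there. Lifting this to a map T of jets, 1 - T ∂_μ takes values in the range of D, and
both facts can be tensored with the coefficients. -/
lemma mem_onShellZero_of_jetShift (hD : ∀ μ w, D (jetShift μ w) = jetShift μ (D w)) {μ : Fin n}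
    (hμ : IsTorsionFree D μ) {z : LocalFun n ⊗[ℝ] JetSpace n (Sym2 (Fin n))}
    (hz : (jetShift μ).lTensor _ z ∈ onShellZero D) : z ∈ onShellZero D := by
  let K : (JetSpace n (Sym2 (Fin n)) ⧸ LinearMap.range D) →ₗ[ℝ]
      (JetSpace n (Sym2 (Fin n)) ⧸ LinearMap.range D) :=
    Submodule.mapQ _ _ (jetShift μ) (by
      rintro _ ⟨y, rfl⟩
      exact ⟨jetShift μ y, hD μ y⟩)
  have hK : LinearMap.ker K = ⊥ := by
    refine LinearMap.ker_eq_bot'.2 fun q hq => ?_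
    induction q using Submodule.Quotient.induction_on with
    | H w =>
      rw [Submodule.Quotient.mk_eq_zero]
      exact hμ w ((Submodule.Quotient.mk_eq_zero _).1 hq)
  obtain ⟨r, hr⟩ := K.exists_leftInverse_of_injective hK
  obtain ⟨s, hs⟩ := (LinearMap.range D).mkQ.exists_rightInverse_of_surjective
    (Submodule.range_mkQ _)
  let T := s ∘ₗ r ∘ₗ (LinearMap.range D).mkQ
  have hT0 : ∀ w, T (D w) ∈ LinearMap.range D := fun w => by
    have : (LinearMap.range D).mkQ (D w) = 0 :=
      (Submodule.Quotient.mk_eq_zero _).2 (LinearMap.mem_range_self D w)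
    simp only [T, LinearMap.comp_apply, this, map_zero, zero_mem]
  have hT1 : ∀ w, (LinearMap.id - T ∘ₗ jetShift μ : JetSpace n (Sym2 (Fin n)) →ₗ[ℝ]
      JetSpace n (Sym2 (Fin n))) w ∈ LinearMap.range D := fun w => by
    rw [← Submodule.Quotient.mk_eq_zero, ← Submodule.mkQ_apply]
    have h1 : (LinearMap.range D).mkQ (jetShift μ w) = K ((LinearMap.range D).mkQ w) := rfl
    have h2 : ∀ q, (LinearMap.range D).mkQ (s q) = q := fun q => LinearMap.congr_fun hs q
    have h3 : ∀ q, r (K q) = q := fun q => LinearMap.congr_fun hr q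
    simp only [T, LinearMap.sub_apply, LinearMap.comp_apply, LinearMap.id_apply, h1, h3, map_sub,
      h2, sub_self]
  have h1 := lTensor_mem_onShellZero hT0 hz
  rw [← LinearMap.lTensor_comp_apply] at h1
  have h2 := add_mem (Submodule.mem_sup_right (lTensor_mem_range hT1 z) :
    _ ∈ onShellZero D) h1
  rwa [LinearMap.lTensor_sub, LinearMap.sub_apply, sub_add_cancel, LinearMap.lTensor_id,
    LinearMap.id_apply] at h2

/-- Descending induction on the order of jets. The component of order d + 1 of the total derivative
is the shift of the component of order d, plus a term from the component of order d + 1, which is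
already known to vanish on the solutions. -/
lemma mem_onShellZero_of_srcDeriv (hD : ∀ μ w, D (jetShift μ w) = jetShift μ (D w))
    (hh : IsHomogeneousSystem D) {μ : Fin n} (hμ : IsTorsionFree D μ)
    {z : LocalFun n ⊗[ℝ] JetSpace n (Sym2 (Fin n))}
    (hz : srcDeriv μ z ∈ onShellZero D) : z ∈ onShellZero D := by
  obtain ⟨B, hB⟩ := exists_sum_degProj_lTensor z
  -- Above order B there is nothing to prove; e bounds the distance of d to B.
  have key : ∀ e d, B ≤ d + e → (degProj d).lTensor _ z ∈ onShellZero D := by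
    intro e
    induction e with
    | zero => intro d hd; rw [(hB d hd).1]; exact zero_mem _
    | succ e ih =>
      intro d hd
      refine mem_onShellZero_of_jetShift hD hμ ?_
      have h1 := rTensor_totalDeriv_mem_onShellZero hD μ (ih (d + 1) (by omega))
      have h2 := lTensor_mem_onShellZero (hh (d + 1)) hz
      have h3 : (degProj (d + 1)).lTensor _ (srcDeriv μ z) =
          (totalDeriv μ).rTensor _ ((degProj (d + 1)).lTensor _ z) +
            (jetShift μ).lTensor _ ((degProj d).lTensor _ z) := by
        clear hB hz ih h1 h2
        induction z using TensorProduct.induction_on with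
        | zero => simp
        | add x y hx hy => simp only [map_add, hx, hy]; abel
        | tmul a w => simp [degProj_jetShift]
      rw [h3] at h2
      exact (Submodule.add_mem_iff_right _ h1).1 h2
  rw [← (hB B le_rfl).2]
  exact sum_mem fun d _ => key B d (by omega)

lemma linKT_afProj_one_eq {a b : LocalFun n} (ha : a ∈ afSpace n 0) (h : linKT D b = a) :
    linKT D (afProj 1 b) = a := by
  rw [← afProj_linKT, h, afProj_of_mem ha]

/-- A local function of the fields whose derivative `∂_μ` vanishes on the solutions is constant
on the solutions. -/
theorem exists_const_of_totalDeriv_mem_range (hD : ∀ μ w, D (jetShift μ w) = jetShift μ (D w))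
    (hh : IsHomogeneousSystem D) {μ : Fin n} (hμ : IsTorsionFree D μ) {G : LocalFun n}
    (hG : G ∈ afSpace n 0) (h : totalDeriv μ G ∈ LinearMap.range (linKT D)) :
    ∃ c : ℝ, ∃ b ∈ afSpace n 1, G = algebraMap ℝ (LocalFun n) c + linKT D b := by
  obtain ⟨b₀, hb₀⟩ := h
  -- The vertical derivative of δb₀ vanishes on the solutions by the chain rule, so the same holds
  -- for the total derivative of `vertH G`, and the derivative can be cancelled.
  have h1 : vertH G ∈ onShellZero D := by
    refine mem_onShellZero_of_srcDeriv hD hh hμ ?_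
    rw [← vertH_totalDeriv, ← hb₀, vertH_linKT]
    exact add_mem (Submodule.mem_sup_left ⟨_, rfl⟩) (Submodule.mem_sup_right ⟨_, rfl⟩)
  -- Contracting with `h` turns a one-form vanishing on the solutions into a δ-exact function. For a
  -- term a ⊗ Dw the primitive is `h^*(w)` times the part of a of antifield number zero, on which δ
  -- vanishes.
  have h2 : ∀ z ∈ onShellZero D, afProj 0 (contract hlin z) ∈ LinearMap.range (linKT D) := by
    intro z hz
    obtain ⟨_, ⟨x, rfl⟩, _, ⟨y, rfl⟩, rfl⟩ := Submodule.mem_sup.1 hz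
    rw [map_add, map_add]
    refine add_mem ?_ ?_
    · have : contract hlin ((linKT D).rTensor _ x) = linKT D (contract hlin x) := by
        clear hz
        induction x using TensorProduct.induction_on with
        | zero => simp
        | add x y hx hy => simp only [map_add, hx, hy]
        | tmul a w => simp
      rw [this, afProj_linKT]
      exact ⟨_, rfl⟩
    · clear hz
      induction y using TensorProduct.induction_on with
      | zero => simp
      | add x y hx hy => simp only [map_add]; exact add_mem hx hy
      | tmul a w =>
        refine ⟨hs w * afProj 0 a, ?_⟩
        rw [linKT_hs_mul, linKT_eq_zero_of_mem (afProj_mem 0 a), mul_zero, sub_zero,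
          LinearMap.lTensor_tmul, contract_tmul]
        exact (afProj_comm (T := LinearMap.mulLeft ℝ (hlin (D w))) (fun a => by simp) 0 a).symm
  have h3 : weightCount 1 1 1 G = contract hlin (vertH G) := by
    simp [weightCount, vertHs_eq_zero_of_mem hG, vertG_eq_zero_of_mem (by norm_num) hG]
  obtain ⟨b, hb⟩ := h2 _ h1
  rw [← h3, afProj_of_mem (weightCount_mem_afSpace 1 1 1 hG)] at hb
  have hb' := linKT_afProj_one_eq (weightCount_mem_afSpace 1 1 1 hG) hb
  -- The degree of G is now δ-exact. Inverting the degree on the primitive leaves an element of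
  -- degree zero, which is a constant.
  obtain ⟨b', hb'm, hNb'⟩ := exists_weightCount_eq (afProj_mem 1 b)
  have h4 : weightCount 1 1 1 (G - linKT D b') = 0 := by
    rw [map_sub, weightCount_linKT 1 1 1 D 0 (by simp) (by simp), hNb', zero_smul, sub_zero, hb',
      sub_self]
  obtain ⟨c, hc⟩ := exists_const_of_weightCount_eq_zero
    (sub_mem hG (linKT_mem_afSpace hb'm)) h4
  exact ⟨c, b', hb'm, by rw [← hc, sub_add_cancel]⟩

end weaklyConstant

/-! ### The value at the zero field -/

/-- The value of a smooth function of the undifferentiated field at zero. -/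
def smoothValueAtZero : SmoothFun n →ₐ[ℝ] ℝ :=
  ((Pi.evalAlgHom ℝ (fun _ : Sym2 (Fin n) → ℝ => ℝ) 0).comp (smoothSubalgebra n).val :
    smoothSubalgebra n →ₐ[ℝ] ℝ)

/-- The value of a local function at the point where all variables vanish. -/
def valueAtZero : LocalFun n →ₐ[ℝ] ℝ :=
  (smoothValueAtZero).comp
    (((MvPolynomial.aeval (fun _ : EvenVar n => (0 : SmoothFun n))).restrictScalars ℝ).comp evenPart)

lemma valueAtZero_hlin (w : JetSpace n (Sym2 (Fin n))) : valueAtZero (hlin w) = 0 := by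
  induction w using Finsupp.induction_linear with
  | zero => simp
  | add f g hf hg => simp only [map_add, hf, hg, add_zero]
  | single v c =>
    obtain ⟨s, J⟩ := v
    by_cases hJ : J = 0
    · subst hJ
      rw [hlin_single_zero, map_smul]
      have : valueAtZero (sm (smoothCoord s)) = 0 := by
        simp only [valueAtZero, AlgHom.comp_apply, sm, evenPart_ofEven,
          AlgHom.restrictScalars_apply, MvPolynomial.aeval_C]
        rfl
      rw [this, smul_zero]
    · rw [hlin_single_of_ne s J hJ, map_smul]
      simp [valueAtZero, ev, evenPart_ofEven]

lemma valueAtZero_hs (w : JetSpace n (Sym2 (Fin n))) : valueAtZero (hs w) = 0 := by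
  simp [valueAtZero, evenPart_hs]

lemma valueAtZero_gs (w : JetSpace n (Option (Fin n))) : valueAtZero (gs w) = 0 := by
  induction w using Finsupp.induction_linear with
  | zero => simp
  | add f g hf hg => simp only [map_add, hf, hg, add_zero]
  | single v c => simp [gs_single, valueAtZero, ev, evenPart_ofEven]

/-- Every term of a total derivative contains a generator, at least a first jet of `h`. This is
where the absence of explicit dependence on the point enters: a nonzero constant is not a total
derivative. -/
lemma valueAtZero_totalDeriv (μ : Fin n) (a : LocalFun n) : valueAtZero (totalDeriv μ a) = 0 := by
  induction a using LocalFun.induction_gen with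
  | one => simp [totalDeriv_one]
  | add a b ha hb => simp only [map_add, ha, hb, add_zero]
  | sm g a ha => simp [map_mul, valueAtZero_hlin, ha]
  | hlin s J a _ ha => simp [map_mul, valueAtZero_hlin]
  | gs v a ha => simp [map_mul, valueAtZero_gs]
  | hs y a ha => simp [map_mul, valueAtZero_hs]

lemma valueAtZero_linKT (D : JetSpace n (Sym2 (Fin n)) →ₗ[ℝ] JetSpace n (Sym2 (Fin n)))
    (a : LocalFun n) : valueAtZero (linKT D a) = 0 := by
  induction a using LocalFun.induction_gen with
  | one => simp
  | add a b ha hb => simp only [map_add, ha, hb, add_zero]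
  | sm g a ha => simp [map_mul, ha]
  | hlin s J a _ ha => simp [map_mul, valueAtZero_hlin]
  | gs v a ha => simp [map_mul, valueAtZero_gs, valueAtZero_hs]
  | hs y a ha => simp [map_mul, valueAtZero_hs, valueAtZero_hlin]

/-! ### Conformal Killing equations -/

lemma exists_ne_ne (hn : 3 ≤ n) (i j : Fin n) : ∃ k, k ≠ i ∧ k ≠ j := by
  classical
  have h : ({i, j} : Finset (Fin n)).card < (Finset.univ : Finset (Fin n)).card := by
    rw [Finset.card_univ, Fintype.card_fin]
    exact lt_of_le_of_lt Finset.card_le_two (by omega)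
  obtain ⟨k, -, hk⟩ := Finset.exists_mem_notMem_of_card_lt_card h
  simp only [Finset.mem_insert, Finset.mem_singleton, not_or] at hk
  exact ⟨k, hk⟩

/-- The conformal Killing vectors in dimension at least three are quadratic. -/
lemma conformalKilling_quadratic (hn : 3 ≤ n) {Q : Type*} [AddCommGroup Q] [Module ℝ Q]
    {d : Fin n → Q →ₗ[ℝ] Q} (hc : ∀ i j x, d i (d j x) = d j (d i x)) {η : Fin n → ℝ}
    (hη : ∀ i, η i * η i = 1) {f : Fin n → Q} {φ : Q}
    (h1 : ∀ i j, i ≠ j → d j (f i) + d i (f j) = 0)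
    (h2 : ∀ i, d i (f i) + η i • φ = 0) (i α : Fin n) : d i (d i (d i (f α))) = 0 := by
  have two : ∀ x : Q, x = -x → x = 0 := fun x hx => by
    have h := add_eq_zero_iff_eq_neg.2 hx
    rw [← two_smul ℝ] at h
    exact (smul_eq_zero.1 h).resolve_left two_ne_zero
  have h1' : ∀ i j, i ≠ j → d i (f j) = -d j (f i) := fun i j h =>
    eq_neg_of_add_eq_zero_right (h1 i j h)
  have h2' : ∀ i, d i (f i) = -(η i • φ) := fun i => eq_neg_of_add_eq_zero_left (h2 i)
  have hφ : ∀ k, φ = -(η k • d k (f k)) := fun k => by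
    rw [h2', smul_neg, neg_neg, smul_smul, hη, one_smul]
  -- Exchanging the index of f with a derivative three times returns the same expression with the
  -- opposite sign.
  have hA : ∀ i j k, i ≠ j → j ≠ k → i ≠ k → d i (d j (f k)) = 0 := by
    intro i j k hij hjk hik
    refine two _ ?_
    conv_lhs => rw [h1' j k hjk, map_neg, hc, h1' i j hij, map_neg, neg_neg, hc, h1' k i hik.symm,
      map_neg, hc]
  -- A third index k allows φ to be written through d_k f_k, and then `hA` applies.
  have hB : ∀ i j, i ≠ j → d i (d j φ) = 0 := by
    intro i j hij
    obtain ⟨k, hki, hkj⟩ := exists_ne_ne hn i j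
    rw [hφ k, map_neg, map_neg, map_smul, map_smul, hc j k, hc i k, hA i j k hij hkj.symm hki.symm,
      map_zero, smul_zero, neg_zero]
  have hC : ∀ i j, i ≠ j → d i (d i (f j)) = η i • d j φ := by
    intro i j hij
    rw [h1' i j hij, map_neg, hc, h2', map_neg, neg_neg, map_smul]
  -- Computing the derivative twice in direction i and once in direction j of f_j in two orders
  -- relates the pure second derivatives of φ.
  have hE : ∀ i j, i ≠ j → η i • d i (d i φ) = -(η j • d j (d j φ)) := by
    intro i j hij
    have h3 : d j (d i (d i (f j))) = d i (d i (d j (f j))) := by rw [hc j i, hc j i]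
    rw [hC i j hij, h2', map_neg, map_neg, map_smul, map_smul, map_smul] at h3
    have h4 := congrArg (fun x => (η i * η j) • x) h3
    simp only [smul_neg, smul_smul] at h4
    rw [mul_right_comm, hη, one_mul, mul_assoc, hη, mul_one] at h4
    rw [h4, neg_neg]
  -- A sign change between any two of three distinct indices: going around the triangle gives an odd
  -- number of signs, hence zero.
  have hF : ∀ i, d i (d i φ) = 0 := by
    intro i
    obtain ⟨j, hji, -⟩ := exists_ne_ne hn i i
    obtain ⟨k, hki, hkj⟩ := exists_ne_ne hn i j
    have h3 : η i • d i (d i φ) = 0 := by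
      refine two _ ?_
      conv_lhs => rw [hE i j hji.symm, hE j k hkj.symm, hE k i hki, neg_neg]
    have h4 := congrArg (fun x => η i • x) h3
    simpa only [smul_smul, hη, one_smul, smul_zero] using h4
  by_cases h : i = α
  · subst h
    rw [h2', map_neg, map_neg, map_smul, map_smul, hF, smul_zero, neg_zero]
  · rw [hC i α h, map_smul, hB i α h, smul_zero]

/-! ### The adjoint of the Noether operator -/

/-- An off-diagonal independent component of a symmetric tensor sits at two positions, a diagonal
one at a single position. -/
lemma sum_sym2_ite {M : Type*} [AddCommMonoid M] (F : Fin n → Fin n → M) (α β : Fin n) :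
    ∑ μ, ∑ ν, (if s(μ, ν) = s(α, β) then F μ ν else 0) =
      if α = β then F α α else F α β + F β α := by
  have h : ∀ μ ν, (if s(μ, ν) = s(α, β) then F μ ν else 0) =
      if α = β then (if μ = α then if ν = α then F μ ν else 0 else 0) else
        (if μ = α then if ν = β then F μ ν else 0 else 0) +
          (if μ = β then if ν = α then F μ ν else 0 else 0) := by
    intro μ ν
    simp only [Sym2.eq_iff]
    by_cases h1 : α = β
    · subst h1; simp [← ite_and]
    · by_cases h2 : μ = α
      · subst h2; simp [h1]
      · by_cases h3 : μ = β
        · subst h3; simp [h2, h1]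
        · simp [h2, h3]
  simp only [h]
  split_ifs with h1
  · simp
  · simp [Finset.sum_add_distrib]

lemma eta_self_mul_self (μ : Fin n) : eta μ μ * eta μ μ = 1 := by
  unfold eta
  split_ifs <;> simp_all

lemma eta_of_ne {μ ν : Fin n} (h : μ ≠ ν) : eta μ ν = 0 := if_neg h

/-- Transposing the Noether operator gives the conformal Killing operator, with the `ξ^*` component
in the role of the Weyl factor. This is how the conformal algebra enters the cohomology. -/
lemma adjointOp_noetherMap (f : Option (Fin n) → LocalFun n) (α β : Fin n) :
    adjointOp noetherMap f s(α, β) = (2 : ℝ) • (if α = β then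
      totalDeriv α (f (some α)) + eta α α • f none else
      totalDeriv β (f (some α)) + totalDeriv α (f (some β))) := by
  have h := sum_sym2_ite (fun μ ν => totalDeriv ν (f (some μ)) + eta μ ν • f none) α β
  have h2 : adjointOp noetherMap f s(α, β) = (2 : ℝ) • ∑ μ, ∑ ν, (if s(μ, ν) = s(α, β) then
      totalDeriv ν (f (some μ)) + eta μ ν • f none else 0) := by
    classical
    have hn : negDerivIter (0 : MultiIndex n) = 1 := negDerivIter_zero
    rw [adjointOp_apply, Fintype.sum_option]
    simp only [noetherMap, Finsupp.linearCombination_single, one_smul, TensorProduct.tmul_smul,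
      TensorProduct.tmul_sum, map_smul, map_sum, eulerOp_tmul_single]
    rw [← Finset.smul_sum, neg_smul, ← smul_neg, ← smul_add, ← Finset.sum_neg_distrib,
      ← Finset.sum_add_distrib]
    congr 1
    refine Finset.sum_congr rfl fun μ _ => ?_
    rw [← Finset.sum_neg_distrib, ← Finset.sum_add_distrib]
    refine Finset.sum_congr rfl fun ν _ => ?_
    split_ifs with h3
    · rw [negDerivIter_raise, negDerivIter_zero, Module.End.one_apply, Module.End.one_apply,
        neg_neg, add_comm]
    · simp
  rw [h2, h]
  split_ifs with h3
  · rfl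
  · rw [eta_of_ne h3, eta_of_ne (Ne.symm h3), zero_smul, add_zero, add_zero]

lemma adjointOp_noetherMap_const (c : Fin n → ℝ) :
    adjointOp noetherMap (fun i => i.elim 0 fun μ => algebraMap ℝ (LocalFun n) (c μ)) = 0 := by
  funext s
  induction s using Sym2.inductionOn with
  | _ α β =>
    rw [adjointOp_noetherMap]
    simp [Algebra.algebraMap_eq_smul_one, totalDeriv_one]

/-! ### Characteristic cohomology in antifield number two for regular systems. -/

section main

variable {D : JetSpace n (Sym2 (Fin n)) →ₗ[ℝ] JetSpace n (Sym2 (Fin n))}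

/-- A conformal Killing vector of the solutions is constant on the solutions. -/
lemma exists_const_of_adjointOp_noetherMap (hn : 3 ≤ n)
    (hD : ∀ μ w, D (jetShift μ w) = jetShift μ (D w)) (hh : IsHomogeneousSystem D) {μ₀ : Fin n}
    (hμ : IsTorsionFree D μ₀) {f : Option (Fin n) → LocalFun n} (hf : ∀ i, f i ∈ afSpace n 0)
    (h : ∀ s, adjointOp noetherMap f s ∈ LinearMap.range (linKT D)) :
    ∃ (c : Fin n → ℝ) (g : Option (Fin n) → LocalFun n), (∀ i, g i ∈ afSpace n 1) ∧
      ∀ i, f i = i.elim 0 (fun μ => algebraMap ℝ (LocalFun n) (c μ)) + linKT D (g i) := by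
  -- The Killing equations hold only modulo δ-exact functions, so they are studied in the quotient,
  -- where the total derivatives still act and commute.
  set R := LinearMap.range (linKT D) with hR
  have hRd : ∀ μ, R ≤ R.comap (totalDeriv μ) := by
    rintro μ _ ⟨b, rfl⟩
    exact ⟨totalDeriv μ b, linKT_totalDeriv D hD μ b⟩
  let d : Fin n → (LocalFun n ⧸ R) →ₗ[ℝ] (LocalFun n ⧸ R) := fun μ => R.mapQ R _ (hRd μ)
  have hd : ∀ μ a, d μ (R.mkQ a) = R.mkQ (totalDeriv μ a) := fun μ a => rfl
  have hc : ∀ i j x, d i (d j x) = d j (d i x) := by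
    intro i j x
    obtain ⟨a, rfl⟩ := R.mkQ_surjective x
    simp only [hd, totalDeriv_comm i j]
  have mk0 : ∀ {a}, R.mkQ a = 0 ↔ a ∈ R := fun {a} => Submodule.Quotient.mk_eq_zero R
  have hs : ∀ α β, (if α = β then totalDeriv α (f (some α)) + eta α α • f none else
      totalDeriv β (f (some α)) + totalDeriv α (f (some β))) ∈ R := by
    intro α β
    have := h s(α, β)
    rw [adjointOp_noetherMap] at this
    have h2 := R.smul_mem (1 / 2 : ℝ) this
    rwa [smul_smul, one_div, inv_mul_cancel₀ two_ne_zero, one_smul] at h2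
  have hk := conformalKilling_quadratic hn hc eta_self_mul_self (f := fun μ => R.mkQ (f (some μ)))
    (φ := R.mkQ (f none))
    (fun i j hij => by
      have := hs i j
      rw [if_neg hij] at this
      rw [hd, hd, ← map_add, mk0]
      exact this)
    (fun i => by
      have := hs i i
      rw [if_pos rfl] at this
      rw [hd, ← map_smul, ← map_add, mk0]
      exact this)
  have hdm : ∀ {a}, a ∈ afSpace n 0 → totalDeriv μ₀ a ∈ afSpace n 0 := by
    intro a ha
    rw [← afProj_of_mem ha, ← afProj_totalDeriv]
    exact afProj_mem _ _
  -- If the derivative of `∂a` is δ-exact, then `∂a` is a constant up to a δ-exact term. The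
  -- constant is zero because a total derivative vanishes at the zero of all variables. Applied
  -- twice, this lowers the third derivative of f to the first.
  have step : ∀ a ∈ afSpace n 0, totalDeriv μ₀ (totalDeriv μ₀ a) ∈ R → totalDeriv μ₀ a ∈ R := by
    intro a ha h3
    obtain ⟨c, b, -, hb⟩ := exists_const_of_totalDeriv_mem_range hD hh hμ (hdm ha) h3
    have h4 := congrArg valueAtZero hb
    rw [valueAtZero_totalDeriv, map_add, valueAtZero_linKT, AlgHom.commutes, add_zero] at h4
    rw [hb, show c = 0 from h4.symm, map_zero, zero_add]
    exact ⟨b, rfl⟩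
  have h1 : ∀ α, ∃ c : ℝ, ∃ b ∈ afSpace n 1,
      f (some α) = algebraMap ℝ (LocalFun n) c + linKT D b := by
    intro α
    refine exists_const_of_totalDeriv_mem_range hD hh hμ (hf _) (step _ (hf _) ?_)
    refine step _ (hdm (hf _)) ?_
    have := hk μ₀ α
    rwa [hd, hd, hd, mk0] at this
  choose c b hb hfb using h1
  -- The diagonal Killing equation expresses the Weyl factor through a derivative of f, which is
  -- δ-exact now that f is constant up to δ-exact terms.
  have h2 : f none ∈ R := by
    have h3 := hs μ₀ μ₀
    rw [if_pos rfl, hfb, map_add, Algebra.algebraMap_eq_smul_one, map_smul, totalDeriv_one,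
      smul_zero, zero_add] at h3
    have h4 := (R.add_mem_iff_right (Submodule.mem_comap.1 (hRd μ₀ ⟨b μ₀, rfl⟩))).1 h3
    have h5 := R.smul_mem (eta μ₀ μ₀) h4
    rwa [smul_smul, eta_self_mul_self, one_smul] at h5
  obtain ⟨b', hb'⟩ := h2
  refine ⟨c, fun i => i.elim (afProj 1 b') b, ?_, ?_⟩
  · rintro (_ | μ)
    · exact afProj_mem _ _
    · exact hb μ
  · rintro (_ | μ)
    · simpa using (linKT_afProj_one_eq (hf none) hb').symm
    · exact hfb μ

lemma eulerOp_mem_afSpace {ι : Type} {k : ℕ} {z : LocalFun n ⊗[ℝ] JetSpace n ι}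
    (hz : (weightCount 0 1 2).rTensor _ z = (k : ℝ) • z) (i : ι) : eulerOp i z ∈ afSpace n k := by
  rw [mem_afSpace, ← eulerOp_rTensor (fun μ a => weightCount_totalDeriv 0 1 2 μ a), hz, map_smul]

lemma eulerOp_divergence {ι : Type} {v : LocalFun n →ₗ[ℝ] LocalFun n ⊗[ℝ] JetSpace n ι}
    (hv : ∀ μ a, v (totalDeriv μ a) = srcDeriv μ (v a)) (i : ι) (j : Fin n → LocalFun n) :
    eulerOp i (v (divergence j)) = 0 := by
  simp [divergence_apply, hv, eulerOp_srcDeriv]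

lemma afProj_divergence (k : ℕ) (j : Fin n → LocalFun n) :
    afProj k (divergence j) = divergence (fun μ => afProj k (j μ)) := by
  simp [divergence_apply, afProj_totalDeriv]

lemma weightCount_divergence (p q r : ℝ) (j : Fin n → LocalFun n) :
    weightCount p q r (divergence j) = divergence (fun μ => weightCount p q r (j μ)) := by
  simp [divergence_apply, weightCount_totalDeriv]

lemma totalDeriv_hs_mul' (μ : Fin n) (w : JetSpace n (Sym2 (Fin n))) (a : LocalFun n) :
    totalDeriv μ (hs w * a) = hs (jetShift μ w) * a + hs w * totalDeriv μ a := by simp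

/-- Integration by parts of `∑ λ(U φ) f` for a linear differential operator `U`. -/
lemma sum_sub_sum_adjointOp_mem {ι κ : Type} [Fintype ι] [Fintype κ]
    (U : JetSpace n ι →ₗ[ℝ] JetSpace n κ) {l : JetSpace n κ →ₗ[ℝ] LocalFun n}
    (hl : ∀ μ w a, totalDeriv μ (l w * a) = l (jetShift μ w) * a + l w * totalDeriv μ a)
    (f : ι → LocalFun n) :
    (∑ i, l (U (Finsupp.single (i, 0) 1)) * f i) -
      ∑ k, l (Finsupp.single (k, 0) 1) * adjointOp U f k ∈ LinearMap.range (divergence (n := n)) := by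
  have h := contract_sub_mem hl (∑ i, f i ⊗ₜ[ℝ] U (Finsupp.single (i, 0) 1))
  simpa only [map_sum, contract_tmul, adjointOp_apply] using h

/-- The characteristic cohomology of antifield number two, for regular systems without torsion. -/
theorem exists_eq_add_linKT_add_divergence (hn : 3 ≤ n) (hD : IsRegularSystem D)
    (hh : IsHomogeneousSystem D) {μ₀ : Fin n} (hμ : IsTorsionFree D μ₀) {a : LocalFun n}
    (ha : a ∈ afSpace n 2) {j : Fin n → LocalFun n} (haj : linKT D a + divergence j = 0) :
    ∃ (c : Fin n → ℝ), ∃ b ∈ afSpace n 3, ∃ j' : Fin n → LocalFun n, (∀ μ, j' μ ∈ afSpace n 2) ∧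
      a = ∑ μ, c μ • Cstar μ + linKT D b + divergence j' := by
  have hδ : linKT D a = -divergence j := eq_neg_of_add_eq_zero_left haj
  have hcomm := linKT_totalDeriv D hD.shift
  have hwH := vertH_weightCount 0 1 2 a
  have hwHs := vertHs_weightCount 0 1 2 a
  have hwG := vertG_weightCount 0 1 2 a
  rw [mem_afSpace.1 ha, map_smul] at hwH hwHs hwG
  set Y : Sym2 (Fin n) → LocalFun n := fun s => eulerOp s (vertH a) with hY
  set X : Sym2 (Fin n) → LocalFun n := fun s => eulerOp s (vertHs a) with hX
  set f : Option (Fin n) → LocalFun n := fun i => eulerOp i (vertG a) with hf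
  have hYm : ∀ s, Y s ∈ afSpace n 2 := fun s => eulerOp_mem_afSpace (by
    rw [hwH, zero_smul, add_zero]) s
  have hXm : ∀ s, X s ∈ afSpace n 1 := fun s => eulerOp_mem_afSpace (by
    rw [← sub_eq_iff_eq_add] at hwHs
    rw [← hwHs]
    push_cast
    module) s
  have hfm : ∀ i, f i ∈ afSpace n 0 := fun i => eulerOp_mem_afSpace (by
    rw [← sub_eq_iff_eq_add] at hwG
    rw [← hwG]
    push_cast
    module) i
  -- the Euler-Lagrange derivatives of the cocycle condition
  have eX : ∀ s, adjointOp noetherMap f s = linKT D (X s) := by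
    intro s
    have h := congrArg (eulerOp s) (vertHs_linKT D a)
    rw [hδ, map_neg, map_neg, eulerOp_divergence vertHs_totalDeriv, map_add, map_neg,
      eulerOp_rTensor hcomm, eulerOp_lTensor noetherMap_jetShift, neg_zero] at h
    exact (neg_add_eq_zero.1 h.symm).symm
  have eY : ∀ s, linKT D (Y s) + adjointOp D X s = 0 := by
    intro s
    have h := congrArg (eulerOp s) (vertH_linKT D a)
    rw [hδ, map_neg, map_neg, eulerOp_divergence vertH_totalDeriv, map_add,
      eulerOp_rTensor hcomm, eulerOp_lTensor hD.shift, neg_zero] at h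
    exact h.symm
  -- By `eX`, the coefficient f of the ghost antifields is a conformal Killing vector up to δ-exact
  -- terms.
  obtain ⟨c, g, hg, hfg⟩ := exists_const_of_adjointOp_noetherMap hn hD.shift hh hμ hfm
    (fun s => ⟨X s, (eX s).symm⟩)
  have hKf : ∀ s, adjointOp noetherMap f s = linKT D (adjointOp noetherMap g s) := by
    intro s
    have h1 : f = (fun i => i.elim 0 fun μ => algebraMap ℝ (LocalFun n) (c μ)) +
        fun i => linKT D (g i) := funext hfg
    rw [h1, map_add, adjointOp_noetherMap_const, zero_add, adjointOp_comm _ hcomm]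
  have hadj : ∀ {ι κ : Type} [Fintype ι] (U : JetSpace n ι →ₗ[ℝ] JetSpace n κ)
      {u : ι → LocalFun n} {k : ℕ}, (∀ i, u i ∈ afSpace n k) → ∀ s, adjointOp U u s ∈ afSpace n k := by
    intro ι κ _ U u k hu s
    rw [mem_afSpace, ← adjointOp_comm U (fun μ a => weightCount_totalDeriv 0 1 2 μ a)]
    have : (fun i => weightCount 0 1 2 (u i)) = (k : ℝ) • u := funext fun i => mem_afSpace.1 (hu i)
    rw [this, map_smul]
    rfl
  -- Constants are annihilated by K†, so K†f = δK†g. Hence X - K†g is a cocycle of antifield number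
  -- one, which acyclicity makes exact.
  have hx : ∀ s, ∃ x ∈ afSpace n 2, linKT D x = X s - adjointOp noetherMap g s := fun s =>
    hD.acyclic (k := 0) (sub_mem (hXm s) (hadj _ hg s)) (by
      rw [map_sub, ← eX, hKf, sub_self])
  choose x hxm hx using hx
  have hX' : X = adjointOp noetherMap g + fun s => linKT D (x s) := funext fun s => by
    rw [Pi.add_apply, hx, add_sub_cancel]
  -- Inserting X = K†g + δx into `eY`, the term D†K†g drops out by the Noether identities, and Y +
  -- D†x becomes a cocycle.
  have hy : ∀ s, ∃ y ∈ afSpace n 3, linKT D y = Y s + adjointOp D x s := fun s =>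
    hD.acyclic (k := 1) (add_mem (hYm s) (hadj _ hxm s)) (by
      have h1 := eY s
      rw [hX', map_add, adjointOp_adjointOp hD.shift hD.noether, zero_add,
        adjointOp_comm _ hcomm] at h1
      rw [map_add, h1])
  choose y hym hy using hy
  -- reconstruction from the Euler-Lagrange derivatives
  set b : LocalFun n := ∑ s, hlin (Finsupp.single (s, 0) 1) * y s -
    ∑ s, hs (Finsupp.single (s, 0) 1) * x s + ∑ i, gs (Finsupp.single (i, 0) 1) * g i with hb
  -- The degree of a is, modulo divergences, the sum of variables times Euler–Lagrange derivatives.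
  -- In b the middle term carries a minus sign because δ(h^* x) contains -h^* δx; its other part, D
  -- acting on h, is moved onto x by `m4`, just as `m5` moves K onto g.
  have hN : weightCount 1 1 1 a - ∑ μ, c μ • Cstar μ - linKT D b ∈
      LinearMap.range (divergence (n := n)) := by
    have m1 := contract_sub_mem (l := hlin) (fun μ w a => by simp) (vertH a)
    have m2 := contract_sub_mem (l := hs) totalDeriv_hs_mul' (vertHs a)
    have m3 := contract_sub_mem (l := gs) (fun μ w a => by simp) (vertG a)
    have m4 := sum_sub_sum_adjointOp_mem D (l := hlin) (fun μ w a => by simp) x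
    have m5 := sum_sub_sum_adjointOp_mem noetherMap (l := hs) totalDeriv_hs_mul' g
    have m := sub_mem (add_mem (add_mem (add_mem m1 m2) m3) m4) m5
    have e1 : weightCount 1 1 1 a =
        contract hlin (vertH a) + contract hs (vertHs a) + contract gs (vertG a) := by
      simp [weightCount]
    have e2 : ∑ s, hlin (Finsupp.single (s, 0) 1) * eulerOp s (vertH a) =
        ∑ s, hlin (Finsupp.single (s, 0) 1) * linKT D (y s) -
          ∑ s, hlin (Finsupp.single (s, 0) 1) * adjointOp D x s := by
      rw [← Finset.sum_sub_distrib]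
      refine Finset.sum_congr rfl fun s _ => ?_
      rw [hy, ← mul_sub, add_sub_cancel_right]
    have e3 : ∑ s, hs (Finsupp.single (s, 0) 1) * eulerOp s (vertHs a) =
        ∑ s, hs (Finsupp.single (s, 0) 1) * adjointOp noetherMap g s +
          ∑ s, hs (Finsupp.single (s, 0) 1) * linKT D (x s) := by
      rw [← Finset.sum_add_distrib]
      refine Finset.sum_congr rfl fun s _ => ?_
      rw [← mul_add, hx, add_sub_cancel]
    have e4 : ∑ i, gs (Finsupp.single (i, 0) 1) * eulerOp i (vertG a) =
        ∑ μ, c μ • Cstar μ + ∑ i, gs (Finsupp.single (i, 0) 1) * linKT D (g i) := by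
      have h1 : ∀ i, gs (Finsupp.single (i, 0) 1) * eulerOp i (vertG a) =
          gs (Finsupp.single (i, 0) 1) * (i.elim 0 fun μ => algebraMap ℝ (LocalFun n) (c μ)) +
            gs (Finsupp.single (i, 0) 1) * linKT D (g i) := fun i => by
        rw [← mul_add, ← hfg]
      rw [Finset.sum_congr rfl fun i _ => h1 i, Finset.sum_add_distrib, Fintype.sum_option]
      congr 1
      simp only [Option.elim, mul_zero, zero_add]
      refine Finset.sum_congr rfl fun μ _ => ?_
      rw [gs_single, one_smul, Algebra.algebraMap_eq_smul_one, mul_smul_comm, mul_one]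
      rfl
    have e5 : linKT D b = ∑ s, hlin (Finsupp.single (s, 0) 1) * linKT D (y s) -
        (∑ s, hlin (D (Finsupp.single (s, 0) 1)) * x s -
          ∑ s, hs (Finsupp.single (s, 0) 1) * linKT D (x s)) +
        (∑ i, hs (noetherMap (Finsupp.single (i, 0) 1)) * g i +
          ∑ i, gs (Finsupp.single (i, 0) 1) * linKT D (g i)) := by
      simp only [hb, map_add, map_sub, map_sum, linKT_hlin_mul, linKT_hs_mul, linKT_gs_mul,
        Finset.sum_sub_distrib, Finset.sum_add_distrib]
    rw [e2, e3, e4] at m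
    rw [e1, e5]
    convert m using 1
    abel
  obtain ⟨j₁, hj₁⟩ := hN
  have hCm : (∑ μ, c μ • Cstar μ : LocalFun n) ∈ afSpace n 2 := sum_mem fun μ _ =>
    Submodule.smul_mem _ _ (by
      have := gs_mul_mem_afSpace (Finsupp.single (some μ, 0) 1) (one_mem_afSpace (n := n))
      rw [mul_one, gs_single, one_smul] at this
      exact this)
  have hCN : weightCount 1 1 1 (∑ μ, c μ • Cstar μ : LocalFun n) = ∑ μ, c μ • Cstar μ := by
    rw [map_sum]
    refine Finset.sum_congr rfl fun μ _ => ?_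
    have := weightCount_gs_mul 1 1 1 (Finsupp.single (some μ, 0) 1) (1 : LocalFun n)
    rw [mul_one, gs_single, one_smul, one_smul, weightCount_one, mul_zero, add_zero] at this
    rw [map_smul]
    exact congrArg _ this
  -- b and the current need not be homogeneous; projecting the identity selects their parts of
  -- antifield numbers three and two.
  have hN2 := congrArg (afProj 2) hj₁
  rw [afProj_divergence, map_sub, map_sub, afProj_linKT, afProj_of_mem hCm,
    afProj_of_mem (weightCount_mem_afSpace 1 1 1 ha)] at hN2
  obtain ⟨b', hb'm, hb'⟩ := exists_weightCount_eq (afProj_mem 3 b)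
  have hj' : ∀ μ, ∃ j' ∈ afSpace n 2, weightCount 1 1 1 j' = afProj 2 (j₁ μ) := fun μ =>
    exists_weightCount_eq (afProj_mem 2 _)
  choose j' hj'm hj' using hj'
  have hdm : ∀ {μ} {a : LocalFun n}, a ∈ afSpace n 2 → totalDeriv μ a ∈ afSpace n 2 := by
    intro μ a ha
    rw [← afProj_of_mem ha, ← afProj_totalDeriv]
    exact afProj_mem _ _
  refine ⟨c, b', hb'm, j', hj'm, ?_⟩
  -- Both sides of the claim have the same image under the degree operator, which is injective in
  -- antifield number two.
  refine sub_eq_zero.1 (eq_zero_of_weightCount_add 0 (k := 2) (by norm_num) ?_ ?_)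
  · refine sub_mem ha (add_mem (add_mem hCm (linKT_mem_afSpace hb'm)) ?_)
    rw [divergence_apply]
    exact sum_mem fun μ _ => hdm (hj'm μ)
  · rw [Nat.cast_zero, zero_smul, add_zero, map_sub, map_add, map_add, hCN, weightCount_divergence,
      weightCount_linKT 1 1 1 D 0 (by simp) (by simp), zero_smul, sub_zero, hb', funext hj', hN2]
    abel

/-- The antifields `C^{*μ}` are independent in the characteristic cohomology. -/
theorem eq_zero_of_sum_Cstar_eq (hD : ∀ μ w, D (jetShift μ w) = jetShift μ (D w)) {c : Fin n → ℝ}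
    {b : LocalFun n} {j : Fin n → LocalFun n}
    (h : ∑ μ, c μ • Cstar μ = linKT D b + divergence j) : c = 0 := by
  classical
  funext μ
  -- The `C^{*μ}`-derivative kills the divergence, maps the δ-exact term to a δ-exact one and
  -- returns the number c_μ on the left. Evaluation at the zero of all variables then leaves c_μ =
  -- 0.
  have h1 := congrArg (fun a => eulerOp (some μ) (vertG a)) h
  simp only [map_add, eulerOp_divergence vertG_totalDeriv, vertG_linKT,
    eulerOp_rTensor (linKT_totalDeriv D hD), map_sum, map_smul, add_zero] at h1
  have h2 : ∀ ν, vertG (Cstar ν : LocalFun n) = 1 ⊗ₜ Finsupp.single (some ν, 0) 1 := by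
    intro ν
    have := vertG_gs_mul (Finsupp.single (some ν, 0) 1) (1 : LocalFun n)
    rw [mul_one, gs_single, one_smul, vertG_one, map_zero, add_zero] at this
    exact this
  simp only [h2, eulerOp_tmul_single, Option.some.injEq] at h1
  have h3 := congrArg valueAtZero h1
  rw [valueAtZero_linKT] at h3
  simpa [negDerivIter_zero] using h3

end main

/-! ### Jets as polynomials -/

/-- Polynomials in the formal derivatives. -/
abbrev Symbol (n : ℕ) : Type := MvPolynomial (Fin n) ℝ

section jetPoly

variable {ι : Type} [Fintype ι] [DecidableEq ι]

/-- The basis of monomials of the vectors of symbols. -/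
def symbolBasis (n : ℕ) (ι : Type) [Fintype ι] [DecidableEq ι] :
    Module.Basis (ι × MultiIndex n) ℝ (ι → Symbol n) :=
  (Pi.basis fun _ : ι => MvPolynomial.basisMonomials (Fin n) ℝ).reindex
    ((Equiv.sigmaEquivProd ι (Fin n →₀ ℕ)).trans
      (Equiv.prodCongr (Equiv.refl ι) Finsupp.equivFunOnFinite))

/-- The vector of symbols of a linear combination of jets. -/
def jetPoly : JetSpace n ι ≃ₗ[ℝ] (ι → Symbol n) := (symbolBasis n ι).repr.symm

lemma jetPoly_single (i : ι) (J : MultiIndex n) :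
    jetPoly (Finsupp.single (i, J) 1) =
      Pi.single i (MvPolynomial.monomial (Finsupp.equivFunOnFinite.symm J) (1 : ℝ)) := by
  rw [jetPoly, Module.Basis.repr_symm_single, one_smul, symbolBasis, Module.Basis.reindex_apply]
  funext j
  simp [Pi.basis_apply]

lemma jet_induction {p : JetSpace n ι → Prop} (w : JetSpace n ι) (zero : p 0)
    (add : ∀ x y, p x → p y → p (x + y)) (smul : ∀ (c : ℝ) x, p x → p (c • x))
    (single : ∀ i J, p (Finsupp.single (i, J) 1)) : p w := by
  induction w using Finsupp.induction_linear with
  | zero => exact zero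
  | add f g hf hg => exact add f g hf hg
  | single v c =>
    have := smul c _ (single v.1 v.2)
    rwa [Finsupp.smul_single, smul_eq_mul, mul_one] at this

lemma jetPoly_jetShift (μ : Fin n) (w : JetSpace n ι) :
    jetPoly (jetShift μ w) = (MvPolynomial.X μ : Symbol n) • jetPoly w := by
  induction w using jet_induction with
  | zero => simp
  | add f g hf hg => simp only [map_add, hf, hg, smul_add]
  | smul c x hx => rw [map_smul, map_smul, map_smul, hx, smul_comm]
  | single i J =>
    rw [jetShift_single, jetPoly_single, jetPoly_single]
    funext j
    by_cases h : j = i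
    · subst h
      rw [Pi.smul_apply, Pi.single_eq_same, Pi.single_eq_same, smul_eq_mul, MvPolynomial.X,
        MvPolynomial.monomial_mul, one_mul]
      have h2 : Finsupp.equivFunOnFinite.symm (raise J μ) =
          Finsupp.single μ 1 + Finsupp.equivFunOnFinite.symm J := by
        ext ν
        simp [raise, add_comm, Finsupp.single_apply, Pi.single_apply, eq_comm]
      rw [h2]
    · simp [Pi.single_eq_of_ne h]

lemma jetPoly_symm_X_smul (μ : Fin n) (u : ι → Symbol n) :
    jetPoly.symm ((MvPolynomial.X μ : Symbol n) • u) = jetShift μ (jetPoly.symm u) := by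
  rw [LinearEquiv.symm_apply_eq, jetPoly_jetShift, LinearEquiv.apply_symm_apply]

/-- The linear map of jets given by a linear map of vectors of symbols. -/
def ofSymbolMap {κ : Type} [Fintype κ] [DecidableEq κ]
    (U : (ι → Symbol n) →ₗ[Symbol n] (κ → Symbol n)) : JetSpace n ι →ₗ[ℝ] JetSpace n κ :=
  (jetPoly (n := n) (ι := κ)).symm.toLinearMap ∘ₗ U.restrictScalars ℝ ∘ₗ
    (jetPoly (n := n) (ι := ι)).toLinearMap

lemma jetPoly_ofSymbolMap {κ : Type} [Fintype κ] [DecidableEq κ]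
    (U : (ι → Symbol n) →ₗ[Symbol n] (κ → Symbol n)) (w : JetSpace n ι) :
    jetPoly (ofSymbolMap U w) = U (jetPoly w) := by
  simp [ofSymbolMap]

lemma ofSymbolMap_jetShift {κ : Type} [Fintype κ] [DecidableEq κ]
    (U : (ι → Symbol n) →ₗ[Symbol n] (κ → Symbol n)) (μ : Fin n) (w : JetSpace n ι) :
    ofSymbolMap U (jetShift μ w) = jetShift μ (ofSymbolMap U w) := by
  apply jetPoly.injective
  rw [jetPoly_ofSymbolMap, jetPoly_jetShift, jetPoly_jetShift, jetPoly_ofSymbolMap, map_smul]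

/-! ### Scaling of the derivatives -/

/-- The dilation of the derivatives by two. -/
def jetScale : JetSpace n ι →ₗ[ℝ] JetSpace n ι :=
  Finsupp.linearCombination ℝ (fun v => Finsupp.single v ((2 : ℝ) ^ (∑ μ, v.2 μ)))

lemma jetScale_apply (w : JetSpace n ι) (v : ι × MultiIndex n) :
    jetScale w v = (2 : ℝ) ^ (∑ μ, v.2 μ) * w v := by
  induction w using jet_induction with
  | zero => simp
  | add f g hf hg => simp only [map_add, Finsupp.add_apply, hf, hg, mul_add]
  | smul c x hx => simp only [map_smul, Finsupp.smul_apply, hx, smul_eq_mul]; ring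
  | single i J =>
    rw [jetScale, Finsupp.linearCombination_single, one_smul, Finsupp.single_apply,
      Finsupp.single_apply]
    split_ifs with h
    · subst h; simp
    · simp

lemma degProj_apply (d : ℕ) (w : JetSpace n ι) (v : ι × MultiIndex n) :
    degProj d w v = if ∑ μ, v.2 μ = d then w v else 0 := by
  induction w using jet_induction with
  | zero => simp
  | add f g hf hg => simp only [map_add, Finsupp.add_apply, hf, hg]; split_ifs <;> simp
  | smul c x hx => simp only [map_smul, Finsupp.smul_apply, hx]; split_ifs <;> simp
  | single i J =>
    rw [degProj_single, Finsupp.single_apply]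
    by_cases h : (i, J) = v
    · subst h; simp only; split_ifs <;> simp
    · split_ifs <;> simp [h]

lemma jetScale_degProj (d : ℕ) (w : JetSpace n ι) :
    jetScale (degProj d w) = (2 : ℝ) ^ d • degProj d w := by
  ext v
  rw [jetScale_apply, Finsupp.smul_apply, degProj_apply, smul_eq_mul]
  split_ifs with h
  · rw [h]
  · simp

/-- Dilation multiplies jets of order d by 2ᵈ, and distinct orders have distinct eigenvalues. Thus
an eigenvector lives in a single order. -/
lemma eq_zero_of_jetScale {e : ℕ} {w : JetSpace n ι} (hw : jetScale w = (2 : ℝ) ^ e • w)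
    {v : ι × MultiIndex n} (hv : ∑ μ, v.2 μ ≠ e) : w v = 0 := by
  have h := DFunLike.congr_fun hw v
  rw [jetScale_apply, Finsupp.smul_apply, smul_eq_mul, ← sub_eq_zero, ← sub_mul] at h
  refine (mul_eq_zero.1 h).resolve_left fun h2 => hv ?_
  exact pow_right_injective₀ two_pos (by norm_num) (sub_eq_zero.1 h2)

/-- On symbols the dilation is the substitution of 2X for X, an algebra map. Homogeneity of an
operator therefore becomes a scaling identity of its symbol. -/
lemma jetPoly_jetScale (w : JetSpace n ι) (i : ι) :
    jetPoly (jetScale w) i =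
      MvPolynomial.aeval (fun μ => (2 : Symbol n) * MvPolynomial.X μ) (jetPoly w i) := by
  induction w using jet_induction with
  | zero => simp
  | add f g hf hg => simp only [map_add, Pi.add_apply, hf, hg]
  | smul c x hx => simp only [map_smul, Pi.smul_apply, hx]
  | single j J =>
    have h1 : jetScale (Finsupp.single (j, J) (1 : ℝ)) =
        (2 : ℝ) ^ (∑ μ, J μ) • Finsupp.single (j, J) 1 := by
      rw [jetScale, Finsupp.linearCombination_single, one_smul, Finsupp.smul_single, smul_eq_mul,
        mul_one]
    rw [h1, map_smul, jetPoly_single, Pi.smul_apply]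
    by_cases h : i = j
    · subst h
      rw [Pi.single_eq_same, MvPolynomial.aeval_monomial, map_one (algebraMap ℝ _), one_mul,
        Finsupp.prod_fintype _ _ (fun _ => pow_zero _)]
      simp only [mul_pow, Finset.prod_mul_distrib, Finset.prod_pow_eq_pow_sum]
      rw [MvPolynomial.monomial_eq, MvPolynomial.C_1, one_mul, Finsupp.prod_fintype _ _ (fun _ => pow_zero _),
        Algebra.smul_def, map_pow, map_ofNat]
      rfl
    · simp [Pi.single_eq_of_ne h]

end jetPoly

/-! ### Homogeneity of operators -/

section homogeneous

variable {D : JetSpace n (Sym2 (Fin n)) →ₗ[ℝ] JetSpace n (Sym2 (Fin n))} {N : ℕ}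

/-- D raises the order by exactly N, so each homogeneous component of Dw is either zero or D of a
homogeneous component of w. -/
lemma isHomogeneousSystem_of_jetScale
    (hD : ∀ w, jetScale (D w) = (2 : ℝ) ^ N • D (jetScale w)) : IsHomogeneousSystem D := by
  intro d w
  obtain ⟨B, hB⟩ := exists_sum_degProj w
  rw [← (hB B le_rfl).2, map_sum, map_sum]
  refine sum_mem fun e _ => ?_
  have h1 : jetScale (D (degProj e w)) = (2 : ℝ) ^ (N + e) • D (degProj e w) := by
    rw [hD, jetScale_degProj, map_smul, smul_smul, pow_add]
  by_cases h : d = N + e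
  · have : degProj d (D (degProj e w)) = D (degProj e w) := by
      ext v
      rw [degProj_apply]
      split_ifs with h2
      · rfl
      · exact (eq_zero_of_jetScale h1 (h ▸ h2)).symm
    rw [this]
    exact ⟨_, rfl⟩
  · have : degProj d (D (degProj e w)) = 0 := by
      ext v
      rw [degProj_apply]
      split_ifs with h2
      · exact eq_zero_of_jetScale h1 (by omega)
      · rfl
    rw [this]
    exact zero_mem _

lemma apply_zero_of_jetScale (hN : 0 < N)
    (hD : ∀ w, jetScale (D w) = (2 : ℝ) ^ N • D (jetScale w))
    (w : JetSpace n (Sym2 (Fin n))) (s : Sym2 (Fin n)) : D w (s, 0) = 0 := by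
  obtain ⟨B, hB⟩ := exists_sum_degProj w
  rw [← (hB B le_rfl).2, map_sum, Finsupp.finsetSum_apply]
  refine Finset.sum_eq_zero fun e _ => ?_
  have h1 : jetScale (D (degProj e w)) = (2 : ℝ) ^ (N + e) • D (degProj e w) := by
    rw [hD, jetScale_degProj, map_smul, smul_smul, pow_add]
  refine eq_zero_of_jetScale h1 ?_
  simp
  omega

end homogeneous

/-! ### Variational derivatives of quadratic functions -/

/-- The linear function of the jets of `h` with a given symbol. -/
def hSymbol : (Sym2 (Fin n) → Symbol n) →ₗ[ℝ] EvenAlg n :=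
  hlinEven ∘ₗ (jetPoly (n := n) (ι := Sym2 (Fin n))).symm.toLinearMap

lemma hSymbol_jetPoly (w : JetSpace n (Sym2 (Fin n))) : hSymbol (jetPoly w) = hlinEven w := by
  simp [hSymbol]

lemma hlinEven_eq_hSymbol (w : JetSpace n (Sym2 (Fin n))) : hlinEven w = hSymbol (jetPoly w) :=
  (hSymbol_jetPoly w).symm

lemma evenTotalDeriv_hSymbol (μ : Fin n) (u : Sym2 (Fin n) → Symbol n) :
    evenTotalDeriv μ (hSymbol u) = hSymbol ((MvPolynomial.X μ : Symbol n) • u) := by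
  simp [hSymbol, jetPoly_symm_X_smul, evenTotalDeriv_hlinEven]

lemma evenTotalDeriv_comm (μ ν : Fin n) (r : EvenAlg n) :
    evenTotalDeriv μ (evenTotalDeriv ν r) = evenTotalDeriv ν (evenTotalDeriv μ r) := by
  have h : ∀ (μ : Fin n) (r : EvenAlg n),
      totalDeriv μ (ofEven n r) = ofEven n (evenTotalDeriv μ r) := fun μ r => by
    have := totalDeriv_ofEven_mul μ r 1
    rwa [mul_one, mul_one, totalDeriv_one, mul_zero, add_zero] at this
  have h1 := totalDeriv_comm μ ν (ofEven n r)
  rw [h, h, h, h] at h1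
  have := congrArg evenPart h1
  rwa [evenPart_ofEven, evenPart_ofEven] at this

lemma evenTotalDerivIter_zero : evenTotalDerivIter (0 : MultiIndex n) = 1 := prod_ofFn_pow_zero _

lemma evenTotalDerivIter_raise (J : MultiIndex n) (μ : Fin n) (r : EvenAlg n) :
    evenTotalDerivIter (raise J μ) r = evenTotalDeriv μ (evenTotalDerivIter J r) := by
  rw [evenTotalDerivIter, prod_ofFn_pow_raise]
  · rfl
  · intro i j
    exact LinearMap.ext fun a => evenTotalDeriv_comm i j a

lemma monomial_raise (J : MultiIndex n) (μ : Fin n) :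
    (MvPolynomial.monomial (Finsupp.equivFunOnFinite.symm (raise J μ)) 1 : Symbol n) =
      MvPolynomial.X μ * MvPolynomial.monomial (Finsupp.equivFunOnFinite.symm J) 1 := by
  rw [MvPolynomial.X, MvPolynomial.monomial_mul, one_mul]
  have h2 : Finsupp.equivFunOnFinite.symm (raise J μ) =
      Finsupp.single μ 1 + Finsupp.equivFunOnFinite.symm J := by
    ext ν
    simp [raise, add_comm, Finsupp.single_apply, Pi.single_apply, eq_comm]
  rw [h2]

lemma monomial_zero_eq_one :
    (MvPolynomial.monomial (Finsupp.equivFunOnFinite.symm (0 : MultiIndex n)) 1 : Symbol n) = 1 := by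
  have : Finsupp.equivFunOnFinite.symm (0 : MultiIndex n) = 0 := by ext; rfl
  rw [this]
  rfl

lemma evenTotalDerivIter_hSymbol (J : MultiIndex n) (u : Sym2 (Fin n) → Symbol n) :
    evenTotalDerivIter J (hSymbol u) =
      hSymbol ((MvPolynomial.monomial (Finsupp.equivFunOnFinite.symm J) 1 : Symbol n) • u) := by
  induction J using MultiIndex.induction with
  | zero => rw [evenTotalDerivIter_zero, monomial_zero_eq_one, one_smul, Module.End.one_apply]
  | raise J μ ih =>
    rw [evenTotalDerivIter_raise, ih, evenTotalDeriv_hSymbol, monomial_raise, mul_smul]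

/-- The formal adjoint of a symbol. -/
def symbolConj : Symbol n →ₐ[ℝ] Symbol n := MvPolynomial.aeval (fun μ => -MvPolynomial.X μ)

@[simp] lemma symbolConj_X (μ : Fin n) :
    symbolConj (MvPolynomial.X μ : Symbol n) = -MvPolynomial.X μ := by
  simp [symbolConj]

lemma symbolConj_monomial (J : MultiIndex n) :
    symbolConj (MvPolynomial.monomial (Finsupp.equivFunOnFinite.symm J) 1 : Symbol n) =
      (-1 : ℝ) ^ (∑ μ, J μ) • MvPolynomial.monomial (Finsupp.equivFunOnFinite.symm J) 1 := by
  induction J using MultiIndex.induction with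
  | zero => simp [monomial_zero_eq_one]
  | raise J μ ih =>
    rw [monomial_raise, map_mul, ih, sum_raise, pow_succ, symbolConj_X, mul_neg_one, neg_smul,
      neg_mul, mul_smul_comm]

lemma hPartial_mul (s : Sym2 (Fin n)) (J : MultiIndex n) (f g : EvenAlg n) :
    hPartial s J (f * g) = hPartial s J f * g + f * hPartial s J g := by
  by_cases hJ : J = 0
  · simp only [hPartial, hJ, dite_true, coeffPartial_mul]
    ring
  · simp only [hPartial, hJ, dite_false, LinearMap.coe_restrictScalars, Derivation.coeFn_coe,
      Derivation.leibniz, smul_eq_mul]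
    ring

lemma hPartial_hJet (s t : Sym2 (Fin n)) (J K : MultiIndex n) :
    hPartial s J (hJet t K) = if (t, K) = (s, J) then 1 else 0 := by
  classical
  by_cases hJ : J = 0
  · subst hJ
    by_cases hK : K = 0
    · subst hK
      simp only [hPartial, hJet, dite_true, coeffPartial_C, smoothPartial_smoothCoord]
      by_cases h : t = s
      · simp [h]
      · simp [h, Ne.symm h]
    · simp [hPartial, hJet, hK, coeffPartial_X]
  · by_cases hK : K = 0
    · subst hK
      simp [hPartial, hJet, hJ, Ne.symm hJ]
    · simp only [hPartial, hJet, hJ, hK, dite_false, LinearMap.coe_restrictScalars,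
        Derivation.coeFn_coe, MvPolynomial.pderiv_X]
      by_cases h : (t, K) = (s, J)
      · obtain ⟨rfl, rfl⟩ := Prod.mk.inj h
        simp
      · rw [if_neg h, Pi.single_eq_of_ne]
        intro h2
        injection h2 with h3 h4
        exact h (by rw [h3, h4])

lemma hPartial_hlinEven (s : Sym2 (Fin n)) (J : MultiIndex n) (w : JetSpace n (Sym2 (Fin n))) :
    hPartial s J (hlinEven w) = w (s, J) • (1 : EvenAlg n) := by
  classical
  induction w using jet_induction with
  | zero => simp
  | add f g hf hg => simp only [map_add, hf, hg, Finsupp.add_apply, add_smul]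
  | smul c x hx => rw [map_smul, map_smul, hx, Finsupp.smul_apply, smul_assoc]
  | single t K =>
    rw [hlinEven_single, one_smul, hPartial_hJet, Finsupp.single_apply]
    split_ifs <;> simp

/-- The function `E` is the variational derivative of `L` with respect to `h_s`, where `L` depends
on finitely many jets. -/
structure HasVariation (s : Sym2 (Fin n)) (L E : EvenAlg n) : Prop where
  finite : (Function.support fun J => hPartial s J L).Finite
  eq : componentEL L s = E

lemma finite_support_variation {s : Sym2 (Fin n)} {L : EvenAlg n}
    (h : (Function.support fun J => hPartial s J L).Finite) : (Function.support fun J =>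
      ((-1 : ℝ) ^ (∑ μ, J μ)) • evenTotalDerivIter J (hPartial s J L)).Finite :=
  h.subset fun J hJ h0 => hJ (by
    change ((-1 : ℝ) ^ (∑ μ, J μ)) • evenTotalDerivIter J (hPartial s J L) = 0
    rw [show hPartial s J L = 0 from h0, map_zero, smul_zero])

lemma HasVariation.add {s : Sym2 (Fin n)} {L E L' E' : EvenAlg n} (h : HasVariation s L E)
    (h' : HasVariation s L' E') : HasVariation s (L + L') (E + E') where
  finite := by
    simp only [map_add]
    exact (h.finite.union h'.finite).subset (Function.support_add _ _)
  eq := by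
    rw [← h.eq, ← h'.eq, componentEL, componentEL, componentEL, ← finsum_add_distrib
      (finite_support_variation h.finite) (finite_support_variation h'.finite)]
    simp only [map_add, smul_add]

lemma HasVariation.smul {s : Sym2 (Fin n)} {L E : EvenAlg n} (c : ℝ) (h : HasVariation s L E) :
    HasVariation s (c • L) (c • E) where
  finite := h.finite.subset fun J hJ h0 => hJ (by
    simp only [map_smul]
    rw [show hPartial s J L = 0 from h0, smul_zero])
  eq := by
    rw [← h.eq, componentEL, componentEL, smul_finsum' c (finite_support_variation h.finite)]
    refine finsum_congr fun J => ?_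
    rw [map_smul, map_smul, smul_comm]

lemma HasVariation.zero (s : Sym2 (Fin n)) : HasVariation s (0 : EvenAlg n) 0 where
  finite := by simp
  eq := by simp [componentEL]

lemma HasVariation.sum {κ : Type*} {s : Sym2 (Fin n)} {L E : κ → EvenAlg n} (t : Finset κ)
    (h : ∀ i ∈ t, HasVariation s (L i) (E i)) : HasVariation s (∑ i ∈ t, L i) (∑ i ∈ t, E i) := by
  classical
  induction t using Finset.induction_on with
  | empty => exact HasVariation.zero s
  | insert i t hi ih =>
    rw [Finset.sum_insert hi, Finset.sum_insert hi]
    exact (h i (Finset.mem_insert_self i t)).add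
      (ih fun j hj => h j (Finset.mem_insert_of_mem hj))

lemma finite_support_jet (s : Sym2 (Fin n)) (w : JetSpace n (Sym2 (Fin n))) (E : EvenAlg n) :
    (Function.support fun J : MultiIndex n => w (s, J) • E).Finite := by
  refine (w.support.finite_toSet.image Prod.snd).subset fun J hJ => ⟨(s, J), ?_, rfl⟩
  refine Finsupp.mem_support_iff.2 fun h => hJ ?_
  change w (s, J) • E = 0
  rw [h, zero_smul]

/-- Each derivative becomes multiplication by a variable, and the alternating signs amount to
reversing the sign of all variables. -/
lemma finsum_adjoint_hSymbol (s : Sym2 (Fin n)) (w : JetSpace n (Sym2 (Fin n)))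
    (v : Sym2 (Fin n) → Symbol n) :
    ∑ᶠ J : MultiIndex n, ((-1 : ℝ) ^ (∑ μ, J μ)) •
        evenTotalDerivIter J (w (s, J) • hSymbol v) =
      hSymbol (symbolConj (jetPoly w s) • v) := by
  classical
  have hfin : ∀ w : JetSpace n (Sym2 (Fin n)), (Function.support fun J : MultiIndex n =>
      ((-1 : ℝ) ^ (∑ μ, J μ)) • evenTotalDerivIter J (w (s, J) • hSymbol v)).Finite := fun w =>
    (finite_support_jet s w (hSymbol v)).subset fun J hJ h0 => hJ (by
      change _ • evenTotalDerivIter J (w (s, J) • hSymbol v) = 0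
      rw [show w (s, J) • hSymbol v = 0 from h0, map_zero, smul_zero])
  induction w using jet_induction with
  | zero => simp
  | add f g hf hg =>
    simp only [map_add, Pi.add_apply, Finsupp.add_apply, add_smul, smul_add]
    rw [finsum_add_distrib (hfin f) (hfin g), hf, hg]
  | smul c x hx =>
    simp only [map_smul, Pi.smul_apply, smul_assoc]
    rw [← hx, smul_finsum' c (hfin x)]
    refine finsum_congr fun J => ?_
    rw [Finsupp.smul_apply, smul_assoc, map_smul, smul_comm]
  | single t K =>
    rw [finsum_eq_single _ K]
    · rw [jetPoly_single]
      by_cases h : s = t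
      · subst h
        rw [Finsupp.single_eq_same, one_smul, Pi.single_eq_same, symbolConj_monomial,
          evenTotalDerivIter_hSymbol, smul_assoc, (hSymbol (n := n)).map_smul]
      · rw [Pi.single_eq_of_ne h, Finsupp.single_eq_of_ne (by simp [h])]
        simp
    · intro J hJ
      rw [Finsupp.single_eq_of_ne (by simp [hJ])]
      simp

/-- Varying a product of two linear functions differentiates one factor at a time. Integration by
parts puts the conjugate symbol of that factor on the other one. -/
lemma HasVariation.hSymbol_mul (s : Sym2 (Fin n)) (u v : Sym2 (Fin n) → Symbol n) :
    HasVariation s (hSymbol u * hSymbol v)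
      (hSymbol (symbolConj (u s) • v + symbolConj (v s) • u)) := by
  have h : ∀ J, hPartial s J (hSymbol u * hSymbol v) =
      jetPoly.symm u (s, J) • hSymbol v + jetPoly.symm v (s, J) • hSymbol u := fun J => by
    have hu : hPartial s J (hSymbol u) = jetPoly.symm u (s, J) • (1 : EvenAlg n) :=
      hPartial_hlinEven s J _
    have hv : hPartial s J (hSymbol v) = jetPoly.symm v (s, J) • (1 : EvenAlg n) :=
      hPartial_hlinEven s J _
    rw [hPartial_mul, hu, hv, smul_mul_assoc, one_mul, mul_smul_comm, mul_one]
  have fin1 : ∀ w v : Sym2 (Fin n) → Symbol n, (Function.support fun J : MultiIndex n =>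
      ((-1 : ℝ) ^ (∑ μ, J μ)) • evenTotalDerivIter J (jetPoly.symm w (s, J) • hSymbol v)).Finite :=
    fun w v => (finite_support_jet s (jetPoly.symm w) (hSymbol v)).subset fun J hJ h0 => hJ (by
      change _ • evenTotalDerivIter J (jetPoly.symm w (s, J) • hSymbol v) = 0
      rw [show jetPoly.symm w (s, J) • hSymbol v = 0 from h0, map_zero, smul_zero])
  constructor
  · simp only [h]
    exact ((finite_support_jet s _ _).union (finite_support_jet s _ _)).subset
      (Function.support_add _ _)
  · rw [componentEL]
    simp only [h, map_add, smul_add]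
    rw [finsum_add_distrib (fin1 u v) (fin1 v u), finsum_adjoint_hSymbol, finsum_adjoint_hSymbol,
      LinearEquiv.apply_symm_apply, LinearEquiv.apply_symm_apply]

/-! ### The Koszul-Tate differential of a quadratic Lagrangian -/

lemma deltaEvenVar_eq (v : EvenVar n) : deltaEvenVar v = hs (noetherVar v) := by
  cases v with
  | h s J hJ => simp [deltaEvenVar, noetherVar]
  | Cstar μ J => simp [deltaEvenVar, noetherVar, noetherMap, hs_single]
  | xistar J =>
    simp only [deltaEvenVar, noetherVar, noetherMap, Finsupp.linearCombination_single, one_smul,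
      map_smul, map_sum, hs_single]

/-- When the field equations are linear with symbol U, the given differential and `linKT` agree on
generators and satisfy the same extension rules. -/
lemma koszulTate_eq_linKT {U : (Sym2 (Fin n) → Symbol n) →ₗ[Symbol n] (Sym2 (Fin n) → Symbol n)}
    (hU : ∀ s, tensorEL (freeLagrangian n) s = hSymbol (U (Pi.single s 1))) :
    koszulTate = linKT (ofSymbolMap U) := by
  have h1 : deltaOddVar (n := n) = (ofEven n).toLinearMap ∘ₗ (hlinEven ∘ₗ ofSymbolMap U) := by
    refine LinearMap.ext fun w => ?_
    induction w using jet_induction with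
    | zero => simp
    | add f g hf hg => simp only [map_add, hf, hg]
    | smul c x hx => simp only [map_smul, hx]
    | single s J =>
      rw [deltaOddVar, Finsupp.linearCombination_single, one_smul, hU, evenTotalDerivIter_hSymbol,
        LinearMap.comp_apply, LinearMap.comp_apply, hlinEven_eq_hSymbol, jetPoly_ofSymbolMap,
        ← map_smul, jetPoly_single, AlgHom.toLinearMap_apply]
      congr 4
      funext t
      by_cases h : t = s
      · subst h; simp
      · simp [Pi.single_eq_of_ne h]
  have h2 : deltaEven (n := n) =
      MvPolynomial.mkDerivation (SmoothFun n) (fun v => hs (noetherVar v)) := by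
    rw [deltaEven]
    congr 1
    exact funext deltaEvenVar_eq
  rw [koszulTate, linKT, antiDer, h2]
  congr 1
  unfold deltaOdd
  congr 1

/-! ### Linearized curvatures over a commutative algebra -/

section curvature

variable {R : Type*} [CommRing R] [Algebra ℝ R]

/-- The Minkowski metric in a commutative algebra. -/
def etaR (R : Type*) [CommRing R] [Algebra ℝ R] (μ ν : Fin n) : R := algebraMap ℝ R (eta μ ν)

lemma etaR_comm (μ ν : Fin n) : etaR R μ ν = etaR R ν μ := by
  unfold etaR eta
  by_cases h : μ = ν
  · subst h; rfl
  · rw [if_neg h, if_neg (Ne.symm h)]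

lemma etaR_of_ne {μ ν : Fin n} (h : μ ≠ ν) : etaR R μ ν = 0 := by
  rw [etaR, eta_of_ne h, map_zero]

lemma etaR_mul_self (μ : Fin n) : etaR R μ μ * etaR R μ μ = 1 := by
  rw [etaR, ← map_mul, eta_self_mul_self, map_one]

lemma sum_etaR_mul_etaR (β : Fin n) (f : Fin n → R) :
    ∑ α, etaR R α α * (etaR R α β * f α) = f β := by
  rw [Finset.sum_eq_single β (fun μ _ h => by rw [etaR_of_ne h, zero_mul, mul_zero]) (by simp),
    ← mul_assoc, etaR_mul_self, one_mul]

lemma sum_etaR_mul_self : ∑ α : Fin n, etaR R α α * etaR R α α = (n : R) := by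
  simp [etaR_mul_self]

variable (R) in
lemma algebraMap_half_mul_two : algebraMap ℝ R (1 / 2) * 2 = 1 := by
  rw [← map_ofNat (algebraMap ℝ R) 2, ← map_mul, ← map_one (algebraMap ℝ R)]
  norm_num

/-- The symbol of the d'Alembertian. -/
def boxR (x : Fin n → R) : R := ∑ α, etaR R α α * (x α * x α)

/-- The linearized Riemann tensor of `h` with derivatives `x`. -/
def riemannR (x : Fin n → R) (h : Fin n → Fin n → R) (α β μ ν : Fin n) : R :=
  algebraMap ℝ R (-(1 / 2)) *
    (x α * x μ * h β ν + x β * x ν * h α μ - x α * x ν * h β μ - x β * x μ * h α ν)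

/-- The linearized Ricci tensor. -/
def ricciR (x : Fin n → R) (h : Fin n → Fin n → R) (β ν : Fin n) : R :=
  ∑ α, etaR R α α * riemannR x h α β α ν

/-- The linearized scalar curvature. -/
def scalarR (x : Fin n → R) (h : Fin n → Fin n → R) : R := ∑ β, etaR R β β * ricciR x h β β

/-- The linearized Weyl tensor. -/
def weylR (x : Fin n → R) (h : Fin n → Fin n → R) (α β γ δ : Fin n) : R :=
  riemannR x h α β γ δ
    - algebraMap ℝ R (1 / ((n : ℝ) - 2)) * (etaR R α γ * ricciR x h δ β - etaR R α δ * ricciR x h γ β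
        - etaR R β γ * ricciR x h δ α + etaR R β δ * ricciR x h γ α)
    + algebraMap ℝ R (1 / (((n : ℝ) - 2) * ((n : ℝ) - 1))) *
        (etaR R α γ * etaR R δ β - etaR R α δ * etaR R γ β) * scalarR x h

variable (x : Fin n → R)

/-! #### Linearity, naturality and scaling -/

/-- Additivity and homogeneity in h are combined in one identity, the form required by
`IsConformalForm.mul_add`. -/
lemma riemannR_mul_add (c : R) (h h' : Fin n → Fin n → R) (α β μ ν : Fin n) :
    riemannR x (fun α β => c * h α β + h' α β) α β μ ν =
      c * riemannR x h α β μ ν + riemannR x h' α β μ ν := by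
  unfold riemannR; ring

lemma ricciR_mul_add (c : R) (h h' : Fin n → Fin n → R) (β ν : Fin n) :
    ricciR x (fun α β => c * h α β + h' α β) β ν = c * ricciR x h β ν + ricciR x h' β ν := by
  simp only [ricciR, riemannR_mul_add, Finset.mul_sum, ← Finset.sum_add_distrib]
  exact Finset.sum_congr rfl fun _ _ => by ring

lemma scalarR_mul_add (c : R) (h h' : Fin n → Fin n → R) :
    scalarR x (fun α β => c * h α β + h' α β) = c * scalarR x h + scalarR x h' := by
  simp only [scalarR, ricciR_mul_add, Finset.mul_sum, ← Finset.sum_add_distrib]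
  exact Finset.sum_congr rfl fun _ _ => by ring

lemma weylR_mul_add (c : R) (h h' : Fin n → Fin n → R) (α β γ δ : Fin n) :
    weylR x (fun α β => c * h α β + h' α β) α β γ δ =
      c * weylR x h α β γ δ + weylR x h' α β γ δ := by
  simp only [weylR, riemannR_mul_add, ricciR_mul_add, scalarR_mul_add]
  ring

variable {R' : Type*} [CommRing R'] [Algebra ℝ R'] (φ : R →ₐ[ℝ] R')

lemma map_etaR (α β : Fin n) : φ (etaR R α β) = etaR R' α β := φ.commutes _

lemma map_riemannR (h : Fin n → Fin n → R) (α β μ ν : Fin n) :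
    φ (riemannR x h α β μ ν) =
      riemannR (fun α => φ (x α)) (fun α β => φ (h α β)) α β μ ν := by
  simp only [riemannR, map_mul, map_sub, map_add, AlgHom.commutes]

lemma map_ricciR (h : Fin n → Fin n → R) (β ν : Fin n) :
    φ (ricciR x h β ν) = ricciR (fun α => φ (x α)) (fun α β => φ (h α β)) β ν := by
  simp only [ricciR, map_sum, map_mul, map_etaR, map_riemannR]

lemma map_scalarR (h : Fin n → Fin n → R) :
    φ (scalarR x h) = scalarR (fun α => φ (x α)) (fun α β => φ (h α β)) := by
  simp only [scalarR, map_sum, map_mul, map_etaR, map_ricciR]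

lemma map_weylR (h : Fin n → Fin n → R) (α β γ δ : Fin n) :
    φ (weylR x h α β γ δ) = weylR (fun α => φ (x α)) (fun α β => φ (h α β)) α β γ δ := by
  simp only [weylR, map_mul, map_sub, map_add, AlgHom.commutes, map_etaR, map_riemannR,
    map_ricciR, map_scalarR]

lemma map_boxR : φ (boxR x) = boxR (fun α => φ (x α)) := by
  simp only [boxR, map_sum, map_mul, map_etaR]

variable (c : R) (h : Fin n → Fin n → R)

lemma riemannR_scale (α β μ ν : Fin n) :
    riemannR (fun α => c * x α) h α β μ ν = c ^ 2 * riemannR x h α β μ ν := by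
  unfold riemannR; ring

lemma ricciR_scale (β ν : Fin n) :
    ricciR (fun α => c * x α) h β ν = c ^ 2 * ricciR x h β ν := by
  simp only [ricciR, riemannR_scale, Finset.mul_sum]
  exact Finset.sum_congr rfl fun _ _ => by ring

lemma scalarR_scale : scalarR (fun α => c * x α) h = c ^ 2 * scalarR x h := by
  simp only [scalarR, ricciR_scale, Finset.mul_sum]
  exact Finset.sum_congr rfl fun _ _ => by ring

lemma weylR_scale (α β γ δ : Fin n) :
    weylR (fun α => c * x α) h α β γ δ = c ^ 2 * weylR x h α β γ δ := by
  simp only [weylR, riemannR_scale, ricciR_scale, scalarR_scale]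
  ring

lemma boxR_scale : boxR (fun α => c * x α) = c ^ 2 * boxR x := by
  simp only [boxR, Finset.mul_sum]
  exact Finset.sum_congr rfl fun _ _ => by ring

/-! #### Ricci tensor and gauge invariance -/

variable {h}

lemma ricciR_eq (hh : ∀ α β, h α β = h β α) (β ν : Fin n) :
    ricciR x h β ν = algebraMap ℝ R (-(1 / 2)) * (boxR x * h β ν +
      x β * x ν * (∑ α, etaR R α α * h α α) - x ν * (∑ α, etaR R α α * (x α * h α β)) -
      x β * ∑ α, etaR R α α * (x α * h α ν)) := by
  simp only [ricciR, riemannR, boxR, Finset.mul_sum, Finset.sum_mul, ← Finset.sum_add_distrib,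
    ← Finset.sum_sub_distrib]
  refine Finset.sum_congr rfl fun α _ => ?_
  rw [hh β α]
  ring

lemma ricciR_comm (hh : ∀ α β, h α β = h β α) (β ν : Fin n) :
    ricciR x h β ν = ricciR x h ν β := by
  rw [ricciR_eq x hh, ricciR_eq x hh, hh β ν]
  ring

/-- Linearized diffeomorphisms and Weyl rescalings. -/
def gaugeR (v : Fin n → R) (σ : R) (α β : Fin n) : R := x α * v β + x β * v α + etaR R α β * σ

lemma gaugeR_comm (v : Fin n → R) (σ : R) (α β : Fin n) :
    gaugeR x v σ α β = gaugeR x v σ β α := by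
  rw [gaugeR, gaugeR, etaR_comm α β]; ring

lemma riemannR_gaugeR (v : Fin n → R) (σ : R) (α β μ ν : Fin n) :
    riemannR x (gaugeR x v σ) α β μ ν = riemannR x (etaR R) α β μ ν * σ := by
  unfold riemannR gaugeR; ring

lemma ricciR_etaR (β ν : Fin n) : ricciR x (etaR R) β ν =
    algebraMap ℝ R (-(1 / 2)) * (boxR x * etaR R β ν + ((n : R) - 2) * (x β * x ν)) := by
  rw [ricciR_eq x etaR_comm]
  have h1 : ∀ β, ∑ α, etaR R α α * (x α * etaR R α β) = x β := fun β => by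
    rw [← sum_etaR_mul_etaR β x]
    exact Finset.sum_congr rfl fun _ _ => by ring
  rw [h1, h1, sum_etaR_mul_self]
  ring

lemma scalarR_etaR : scalarR x (etaR R) = -(((n : R) - 1) * boxR x) := by
  have h1 : ∑ β, etaR R β β * (x β * x β) = boxR x := rfl
  have h2 : algebraMap ℝ R (-(1 / 2)) * 2 = -1 := by
    rw [← map_ofNat (algebraMap ℝ R) 2, ← map_mul, ← map_one (algebraMap ℝ R), ← map_neg]
    norm_num
  have h3 : scalarR x (etaR R) = algebraMap ℝ R (-(1 / 2)) * (boxR x *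
      (∑ β : Fin n, etaR R β β * etaR R β β) + ((n : R) - 2) * ∑ β, etaR R β β * (x β * x β)) := by
    simp only [scalarR, ricciR_etaR, Finset.mul_sum, ← Finset.sum_add_distrib]
    exact Finset.sum_congr rfl fun _ _ => by ring
  rw [h3, h1, sum_etaR_mul_self]
  linear_combination ((n : R) - 1) * boxR x * h2

/-- The diffeomorphism part already cancels in the Riemann tensor. The Weyl rescaling leaves the
curvature of σ times the metric, which consists of trace terms only and is removed by the
subtractions in the Weyl tensor. -/
lemma weylR_gaugeR (hn : 3 ≤ n) (v : Fin n → R) (σ : R) (α β γ δ : Fin n) :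
    weylR x (gaugeR x v σ) α β γ δ = 0 := by
  have hR : ∀ β ν, ricciR x (gaugeR x v σ) β ν = ricciR x (etaR R) β ν * σ := fun β ν => by
    simp only [ricciR, riemannR_gaugeR, Finset.sum_mul, mul_assoc]
  have hS : scalarR x (gaugeR x v σ) = scalarR x (etaR R) * σ := by
    simp only [scalarR, hR, Finset.sum_mul, mul_assoc]
  have h3 : (3 : ℝ) ≤ n := by exact_mod_cast hn
  have h4 : (n : ℝ) - 2 ≠ 0 := by linarith
  have h5 : (n : ℝ) - 1 ≠ 0 := by linarith
  -- The only facts about the coefficients a and b of the Weyl tensor that matter are a(n - 2) = 1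
  -- and b(n - 1) = a.
  have ha : algebraMap ℝ R (1 / ((n : ℝ) - 2)) * ((n : R) - 2) = 1 := by
    rw [← map_natCast (algebraMap ℝ R) n, ← map_ofNat (algebraMap ℝ R) 2, ← map_sub, ← map_mul,
      one_div, inv_mul_cancel₀ h4, map_one]
  have hb : algebraMap ℝ R (1 / (((n : ℝ) - 2) * ((n : ℝ) - 1))) * ((n : R) - 1) =
      algebraMap ℝ R (1 / ((n : ℝ) - 2)) := by
    rw [← map_natCast (algebraMap ℝ R) n, ← map_one (algebraMap ℝ R), ← map_sub, ← map_mul]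
    congr 1
    field_simp
  have h2 : algebraMap ℝ R (-(1 / 2)) * 2 = -1 := by
    rw [← map_ofNat (algebraMap ℝ R) 2, ← map_mul, ← map_one (algebraMap ℝ R), ← map_neg]
    norm_num
  simp only [weylR, hR, hS, ricciR_etaR, scalarR_etaR, riemannR_gaugeR]
  simp only [riemannR]
  rw [etaR_comm δ β, etaR_comm γ β, etaR_comm δ α, etaR_comm γ α]
  set a := algebraMap ℝ R (1 / ((n : ℝ) - 2))
  set b := algebraMap ℝ R (1 / (((n : ℝ) - 2) * ((n : ℝ) - 1)))
  set k := algebraMap ℝ R (-(1 / 2))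
  linear_combination (-σ * k * (etaR R α γ * (x δ * x β) - etaR R α δ * (x γ * x β) -
    etaR R β γ * (x δ * x α) + etaR R β δ * (x γ * x α))) * ha -
    (etaR R α γ * etaR R β δ - etaR R α δ * etaR R β γ) * boxR x * σ * hb -
    a * (etaR R α γ * etaR R β δ - etaR R α δ * etaR R β γ) * boxR x * σ * h2

/-! #### Contractions of the Weyl tensor -/

lemma weylR_swap_left (h : Fin n → Fin n → R) (α β γ δ : Fin n) :
    weylR x h β α γ δ = -weylR x h α β γ δ := by
  simp only [weylR, riemannR]
  rw [etaR_comm δ β, etaR_comm γ β, etaR_comm δ α, etaR_comm γ α]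
  ring

lemma weylR_swap_right (h : Fin n → Fin n → R) (α β γ δ : Fin n) :
    weylR x h α β δ γ = -weylR x h α β γ δ := by
  simp only [weylR, riemannR]
  ring

/-- The same two relations between the coefficients make the Ricci and scalar terms cancel in the
trace. -/
lemma weylR_trace (hn : 3 ≤ n) (hh : ∀ α β, h α β = h β α) (β δ : Fin n) :
    ∑ α, etaR R α α * weylR x h α β α δ = 0 := by
  have h3 : (3 : ℝ) ≤ n := by exact_mod_cast hn
  have h4 : (n : ℝ) - 2 ≠ 0 := by linarith
  have h5 : (n : ℝ) - 1 ≠ 0 := by linarith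
  have ha : algebraMap ℝ R (1 / ((n : ℝ) - 2)) * ((n : R) - 2) = 1 := by
    rw [← map_natCast (algebraMap ℝ R) n, ← map_ofNat (algebraMap ℝ R) 2, ← map_sub, ← map_mul,
      one_div, inv_mul_cancel₀ h4, map_one]
  have hb : algebraMap ℝ R (1 / (((n : ℝ) - 2) * ((n : ℝ) - 1))) * ((n : R) - 1) =
      algebraMap ℝ R (1 / ((n : ℝ) - 2)) := by
    rw [← map_natCast (algebraMap ℝ R) n, ← map_one (algebraMap ℝ R), ← map_sub, ← map_mul]
    congr 1
    field_simp
  have e1 : ∑ α, etaR R α α * weylR x h α β α δ = (∑ α, etaR R α α * riemannR x h α β α δ) -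
      algebraMap ℝ R (1 / ((n : ℝ) - 2)) * ((∑ α : Fin n, etaR R α α * etaR R α α) * ricciR x h δ β
        - (∑ α, etaR R α α * (etaR R α δ * ricciR x h α β))
        - (∑ α, etaR R α α * (etaR R α β * ricciR x h δ α))
        + etaR R β δ * ∑ α, etaR R α α * ricciR x h α α) +
      algebraMap ℝ R (1 / (((n : ℝ) - 2) * ((n : ℝ) - 1))) *
        ((∑ α : Fin n, etaR R α α * etaR R α α) * etaR R δ β -
          ∑ α, etaR R α α * (etaR R α δ * etaR R α β)) * scalarR x h := by
    simp only [Finset.mul_sum, Finset.sum_mul, ← Finset.sum_add_distrib,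
      ← Finset.sum_sub_distrib]
    refine Finset.sum_congr rfl fun α _ => ?_
    rw [weylR, etaR_comm β α]
    ring
  have e2 : ∑ α, etaR R α α * riemannR x h α β α δ = ricciR x h β δ := rfl
  have e3 : ∑ α, etaR R α α * ricciR x h α α = scalarR x h := rfl
  rw [e1, e2, e3, sum_etaR_mul_self, sum_etaR_mul_etaR, sum_etaR_mul_etaR, sum_etaR_mul_etaR,
    ricciR_comm x hh δ β,
    etaR_comm δ β]
  linear_combination (-ricciR x h β δ) * ha + etaR R β δ * scalarR x h * hb

/-- The pairing of two tensors of rank four. -/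
def pairR (W F : Fin n → Fin n → Fin n → Fin n → R) : R :=
  ∑ α, ∑ β, ∑ γ, ∑ δ, etaR R α α * etaR R β β * etaR R γ γ * etaR R δ δ *
    (W α β γ δ * F α β γ δ)

lemma pairR_add (W F G : Fin n → Fin n → Fin n → Fin n → R) :
    pairR W (fun α β γ δ => F α β γ δ + G α β γ δ) = pairR W F + pairR W G := by
  simp only [pairR, mul_add, Finset.sum_add_distrib]

lemma pairR_neg (W F : Fin n → Fin n → Fin n → Fin n → R) :
    pairR W (fun α β γ δ => -F α β γ δ) = -pairR W F := by
  simp only [pairR, mul_neg, Finset.sum_neg_distrib]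

lemma pairR_swap_left {W : Fin n → Fin n → Fin n → Fin n → R}
    (hW : ∀ α β γ δ, W β α γ δ = -W α β γ δ) (F : Fin n → Fin n → Fin n → Fin n → R) :
    pairR W (fun α β γ δ => F β α γ δ) = -pairR W F := by
  rw [pairR, Finset.sum_comm, pairR]
  simp only [← Finset.sum_neg_distrib]
  refine Finset.sum_congr rfl fun α _ => Finset.sum_congr rfl fun β _ =>
    Finset.sum_congr rfl fun γ _ => Finset.sum_congr rfl fun δ _ => ?_
  rw [hW α β γ δ]
  ring

lemma pairR_swap_right {W : Fin n → Fin n → Fin n → Fin n → R}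
    (hW : ∀ α β γ δ, W α β δ γ = -W α β γ δ) (F : Fin n → Fin n → Fin n → Fin n → R) :
    pairR W (fun α β γ δ => F α β δ γ) = -pairR W F := by
  simp only [pairR, ← Finset.sum_neg_distrib]
  refine Finset.sum_congr rfl fun α _ => Finset.sum_congr rfl fun β _ => ?_
  rw [Finset.sum_comm]
  refine Finset.sum_congr rfl fun γ _ => Finset.sum_congr rfl fun δ _ => ?_
  rw [hW α β γ δ]
  ring

/-- Pairing with a tensor antisymmetric in both pairs makes each of the four terms of the
antisymmetrization contribute equally. -/
lemma pairR_antisymm {W : Fin n → Fin n → Fin n → Fin n → R}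
    (hl : ∀ α β γ δ, W β α γ δ = -W α β γ δ) (hr : ∀ α β γ δ, W α β δ γ = -W α β γ δ)
    (F : Fin n → Fin n → Fin n → Fin n → R) :
    pairR W (fun α β γ δ => F α β γ δ + F β α δ γ + -F α β δ γ + -F β α γ δ) =
      4 * pairR W F := by
  have h1 := pairR_swap_left hl (fun α β γ δ => F α β δ γ)
  rw [pairR_add, pairR_add, pairR_add, pairR_neg, pairR_neg, pairR_swap_left hl F, h1,
    pairR_swap_right hr F]
  ring

/-- The double divergence of the Weyl tensor. -/
def bachR (x : Fin n → R) (h : Fin n → Fin n → R) (β δ : Fin n) : R :=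
  ∑ α, ∑ γ, etaR R α α * etaR R γ γ * (x α * x γ * weylR x h α β γ δ)

/-- The Weyl tensor of k is the antisymmetrization of a double derivative of k plus terms
proportional to the metric. The latter drop out because the Weyl tensor of h is traceless, and the
former transposes to the double divergence. The factor -2 is four times -1/2. -/
lemma pairR_weylR (hn : 3 ≤ n) (hh : ∀ α β, h α β = h β α) {k : Fin n → Fin n → R}
    (hk : ∀ α β, k α β = k β α) : pairR (weylR x h) (weylR x k) =
      -2 * ∑ β, ∑ δ, etaR R β β * etaR R δ δ * (bachR x h β δ * k β δ) := by
  set a := algebraMap ℝ R (1 / ((n : ℝ) - 2)) with ha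
  set b := algebraMap ℝ R (1 / (((n : ℝ) - 2) * ((n : ℝ) - 1))) with hb
  set c := algebraMap ℝ R (-(1 / 2)) with hc
  have h2 : c * 2 = -1 := by
    rw [hc, ← map_ofNat (algebraMap ℝ R) 2, ← map_mul, ← map_one (algebraMap ℝ R), ← map_neg]
    norm_num
  -- The scalar term appears twice in the antisymmetrization, hence the additional factor -c = 1/2.
  let F : Fin n → Fin n → Fin n → Fin n → R := fun α β γ δ => c * (x α * x γ * k β δ) +
    etaR R α γ * (-a * ricciR x k δ β - c * b * scalarR x k * etaR R β δ)
  have e1 : weylR x k = fun α β γ δ => F α β γ δ + F β α δ γ + -F α β δ γ + -F β α γ δ := by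
    funext α β γ δ
    simp only [F, weylR, riemannR, ← ha, ← hb, ← hc]
    rw [etaR_comm δ β, etaR_comm γ β, ricciR_comm x hk γ α, ricciR_comm x hk δ β,
      ricciR_comm x hk γ β, ricciR_comm x hk δ α]
    linear_combination (b * (etaR R α γ * etaR R β δ - etaR R α δ * etaR R β γ) * scalarR x k) * h2
  rw [e1, pairR_antisymm (weylR_swap_left x h) (weylR_swap_right x h)]
  have e2 : pairR (weylR x h) (fun α β γ δ => etaR R α γ *
      (-a * ricciR x k δ β - c * b * scalarR x k * etaR R β δ)) = 0 := by
    have e3 : ∀ G : Fin n → Fin n → R,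
        pairR (weylR x h) (fun α β γ δ => etaR R α γ * G β δ) = 0 := by
      intro G
      have e4 : pairR (weylR x h) (fun α β γ δ => etaR R α γ * G β δ) =
          ∑ β, ∑ δ, etaR R β β * etaR R δ δ * G β δ * ∑ α, etaR R α α * weylR x h α β α δ := by
        simp only [pairR]
        rw [Finset.sum_comm]
        refine Finset.sum_congr rfl fun β _ => ?_
        simp only [Finset.mul_sum]
        have : ∀ α, ∑ γ, ∑ δ, etaR R α α * etaR R β β * etaR R γ γ * etaR R δ δ *
            (weylR x h α β γ δ * (etaR R α γ * G β δ)) =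
            ∑ δ, etaR R β β * etaR R δ δ * G β δ * (etaR R α α * weylR x h α β α δ) := by
          intro α
          rw [Finset.sum_comm]
          refine Finset.sum_congr rfl fun δ _ => ?_
          rw [Finset.sum_eq_single α (fun γ _ hγ => by rw [etaR_of_ne hγ.symm]; ring) (by simp)]
          linear_combination (etaR R α α * etaR R β β * etaR R δ δ * weylR x h α β α δ * G β δ) *
            etaR_mul_self (R := R) α
        rw [Finset.sum_congr rfl fun α _ => this α, Finset.sum_comm]
      rw [e4]
      refine Finset.sum_eq_zero fun β _ => Finset.sum_eq_zero fun δ _ => ?_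
      rw [weylR_trace x hn hh, mul_zero]
    exact e3 (fun β δ => -a * ricciR x k δ β - c * b * scalarR x k * etaR R β δ)
  have e5 : pairR (weylR x h) (fun α β γ δ => c * (x α * x γ * k β δ)) =
      c * ∑ β, ∑ δ, etaR R β β * etaR R δ δ * (bachR x h β δ * k β δ) := by
    simp only [pairR, bachR]
    rw [Finset.sum_comm, Finset.mul_sum]
    refine Finset.sum_congr rfl fun β _ => ?_
    simp only [Finset.mul_sum, Finset.sum_mul]
    refine ((Finset.sum_congr rfl fun α _ => Finset.sum_comm).trans Finset.sum_comm).trans ?_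
    refine Finset.sum_congr rfl fun δ _ => Finset.sum_congr rfl fun α _ =>
      Finset.sum_congr rfl fun γ _ => ?_
    ring
  rw [pairR_add, e2, e5, add_zero]
  linear_combination (2 * ∑ β, ∑ δ, etaR R β β * etaR R δ δ * (bachR x h β δ * k β δ)) * h2

/-- On the symbols, the Bach operator is the square of the d'Alembertian up to gauge
transformations. -/
lemma exists_gaugeR_of_bachR (hh : ∀ α β, h α β = h β α) : ∃ (u : Fin n → R) (σ : R),
    ∀ β δ, bachR x h β δ = algebraMap ℝ R (-(1 / 2) * (1 - 1 / ((n : ℝ) - 2))) *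
      (boxR x * boxR x * h β δ) + gaugeR x u σ β δ := by
  set a := algebraMap ℝ R (1 / ((n : ℝ) - 2)) with ha
  set b := algebraMap ℝ R (1 / (((n : ℝ) - 2) * ((n : ℝ) - 1))) with hb
  set c := algebraMap ℝ R (-(1 / 2)) with hc
  have h2 : c * 2 = -1 := by
    rw [hc, ← map_ofNat (algebraMap ℝ R) 2, ← map_mul, ← map_one (algebraMap ℝ R), ← map_neg]
    norm_num
  set y : Fin n → R := fun β => ∑ α, etaR R α α * (x α * h α β) with hy
  set r : Fin n → R := fun β => ∑ α, etaR R α α * (x α * ricciR x h α β) with hr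
  set t : R := ∑ α, etaR R α α * h α α with ht
  set Y : R := ∑ α, etaR R α α * (x α * y α) with hY
  set ρ : R := ∑ α, etaR R α α * (x α * r α) with hρ
  set S := scalarR x h with hS
  -- The double divergence is computed one contraction at a time: here over the third index, in
  -- `outer` over the first.
  have inner : ∀ α β δ, ∑ γ, etaR R γ γ * (x γ * weylR x h α β γ δ) =
      c * (x α * boxR x * h β δ + x β * x δ * y α - x α * x δ * y β - x β * boxR x * h α δ) -
        a * (x α * ricciR x h δ β - etaR R α δ * r β - x β * ricciR x h δ α + etaR R β δ * r α) +
        b * (x α * etaR R δ β - etaR R α δ * x β) * S := by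
    intro α β δ
    have e1 : ∑ γ, etaR R γ γ * (x γ * weylR x h α β γ δ) =
        c * (x α * (∑ γ, etaR R γ γ * (x γ * x γ)) * h β δ +
          x β * x δ * (∑ γ, etaR R γ γ * (x γ * h γ α)) -
          x α * x δ * (∑ γ, etaR R γ γ * (x γ * h γ β)) -
          x β * (∑ γ, etaR R γ γ * (x γ * x γ)) * h α δ) -
        a * ((∑ γ, etaR R γ γ * (etaR R γ α * x γ)) * ricciR x h δ β -
          etaR R α δ * (∑ γ, etaR R γ γ * (x γ * ricciR x h γ β)) -
          (∑ γ, etaR R γ γ * (etaR R γ β * x γ)) * ricciR x h δ α +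
          etaR R β δ * (∑ γ, etaR R γ γ * (x γ * ricciR x h γ α))) +
        b * ((∑ γ, etaR R γ γ * (etaR R γ α * x γ)) * etaR R δ β -
          etaR R α δ * (∑ γ, etaR R γ γ * (etaR R γ β * x γ))) * S := by
      simp only [Finset.mul_sum, Finset.sum_mul, ← Finset.sum_add_distrib,
        ← Finset.sum_sub_distrib]
      refine Finset.sum_congr rfl fun γ _ => ?_
      rw [weylR, riemannR, hh γ α, hh γ β, etaR_comm α γ, etaR_comm β γ]
      ring
    rw [e1, sum_etaR_mul_etaR, sum_etaR_mul_etaR]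
    rfl
  have outer : ∀ β δ, bachR x h β δ =
      c * (boxR x * boxR x * h β δ + x β * x δ * Y - boxR x * x δ * y β - x β * boxR x * y δ) -
        a * (boxR x * ricciR x h δ β - x δ * r β - x β * r δ + etaR R β δ * ρ) +
        b * (boxR x * etaR R δ β - x δ * x β) * S := by
    intro β δ
    have e1 : bachR x h β δ = c * ((∑ α, etaR R α α * (x α * x α)) * boxR x * h β δ +
          x β * x δ * (∑ α, etaR R α α * (x α * y α)) -
          (∑ α, etaR R α α * (x α * x α)) * x δ * y β -
          x β * boxR x * (∑ α, etaR R α α * (x α * h α δ))) -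
        a * ((∑ α, etaR R α α * (x α * x α)) * ricciR x h δ β -
          (∑ α, etaR R α α * (etaR R α δ * x α)) * r β -
          x β * (∑ α, etaR R α α * (x α * ricciR x h α δ)) +
          etaR R β δ * (∑ α, etaR R α α * (x α * r α))) +
        b * ((∑ α, etaR R α α * (x α * x α)) * etaR R δ β -
          (∑ α, etaR R α α * (etaR R α δ * x α)) * x β) * S := by
      have e2 : bachR x h β δ = ∑ α, etaR R α α * (x α *
          ∑ γ, etaR R γ γ * (x γ * weylR x h α β γ δ)) := by
        simp only [bachR, Finset.mul_sum]
        exact Finset.sum_congr rfl fun α _ => Finset.sum_congr rfl fun γ _ => by ring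
      rw [e2]
      simp only [inner]
      simp only [Finset.mul_sum, Finset.sum_mul, ← Finset.sum_add_distrib,
        ← Finset.sum_sub_distrib]
      refine Finset.sum_congr rfl fun α _ => ?_
      rw [ricciR_comm x hh δ α]
      ring
    rw [e1, sum_etaR_mul_etaR]
    rfl
  -- Everything except □²h has a factor x_β, x_δ or η_βδ. The terms proportional to x_β x_δ are
  -- shared equally between the two symmetric positions, which explains the factor -c = 1/2. The
  -- trace term of the Ricci tensor contributes the remaining -ca to the coefficient c(1 - a) of
  -- □²h.
  refine ⟨fun β => -c * boxR x * y β + a * c * boxR x * y β + a * r β -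
    c * (c * Y - a * c * boxR x * t - b * S) * x β, -a * ρ + b * S * boxR x, fun β δ => ?_⟩
  have e : algebraMap ℝ R (-(1 / 2) * (1 - 1 / ((n : ℝ) - 2))) = c * (1 - a) := by
    rw [map_mul, map_sub, map_one]
  have e2 : ricciR x h δ β = c * (boxR x * h β δ + x δ * x β * t - x β * y δ - x δ * y β) := by
    rw [ricciR_eq x hh, hh δ β]
  rw [outer, e, gaugeR, e2, etaR_comm δ β]
  linear_combination (x β * x δ * (c * Y - a * c * boxR x * t - b * S)) * h2

end curvature

/-! ### Bilinear forms on symmetric tensors of symbols -/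

/-- The weight of an independent component of a symmetric tensor. -/
def symWeight (s : Sym2 (Fin n)) : ℝ := open Classical in if s.IsDiag then 1 else 1 / 2

lemma symWeight_mk (α β : Fin n) : symWeight s(α, β) = if α = β then 1 else 1 / 2 := by
  simp [symWeight, Sym2.mk_isDiag_iff]

lemma symWeight_ne_zero (s : Sym2 (Fin n)) : symWeight s ≠ 0 := by
  unfold symWeight
  split_ifs <;> norm_num

/-- The symmetric tensor with given independent components, where an off-diagonal component is
shared between its two positions. -/
def symTensor (y : Sym2 (Fin n) → Symbol n) (α β : Fin n) : Symbol n :=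
  symWeight s(α, β) • y s(α, β)

lemma symTensor_comm (y : Sym2 (Fin n) → Symbol n) (α β : Fin n) :
    symTensor y α β = symTensor y β α := by
  rw [symTensor, symTensor, Sym2.eq_swap]

lemma symTensor_injective {y z : Sym2 (Fin n) → Symbol n}
    (h : ∀ α β, symTensor y α β = symTensor z α β) : y = z := by
  funext s
  induction s using Sym2.inductionOn with
  | _ α β => exact smul_right_injective _ (symWeight_ne_zero s(α, β)) (h α β)

/-- The symmetric tensor with one independent component. -/
def symUnit (s : Sym2 (Fin n)) (α β : Fin n) : Symbol n := if s(α, β) = s then 1 else 0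

lemma symUnit_comm (s : Sym2 (Fin n)) (α β : Fin n) : symUnit s α β = symUnit s β α := by
  rw [symUnit, symUnit, Sym2.eq_swap]

lemma map_symUnit (φ : Symbol n →ₐ[ℝ] Symbol n) (s : Sym2 (Fin n)) (α β : Fin n) :
    φ (symUnit s α β) = symUnit s α β := by
  rw [symUnit]; split_ifs <;> simp

lemma symTensor_single (s : Sym2 (Fin n)) (α β : Fin n) :
    symTensor (Pi.single s 1) α β = algebraMap ℝ _ (symWeight s) * symUnit s α β := by
  rw [symTensor, symUnit, ← Algebra.smul_def]
  by_cases h : s(α, β) = s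
  · subst h; simp
  · simp [h]

lemma map_symTensor (φ : Symbol n →ₐ[ℝ] Symbol n) (y : Sym2 (Fin n) → Symbol n) (α β : Fin n) :
    φ (symTensor y α β) = symTensor (fun s => φ (y s)) α β := by
  rw [symTensor, map_smul]; rfl

lemma symTensor_smul_add (c : Symbol n) (y z : Sym2 (Fin n) → Symbol n) (α β : Fin n) :
    symTensor (c • y + z) α β = c * symTensor y α β + symTensor z α β := by
  simp only [symTensor, Pi.add_apply, Pi.smul_apply, smul_add, smul_eq_mul, mul_smul_comm]

/-- The properties of the quadratic form of a conformally invariant Lagrangian of order `N`. -/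
structure IsConformalForm (N : ℕ)
    (Z : (Fin n → Symbol n) → (Fin n → Fin n → Symbol n) → (Fin n → Fin n → Symbol n) → Symbol n) :
    Prop where
  mul_add : ∀ x c T T' h, Z x (fun α β => c * T α β + T' α β) h = c * Z x T h + Z x T' h
  map : ∀ (φ : Symbol n →ₐ[ℝ] Symbol n) x T h, φ (Z x T h) =
    Z (fun α => φ (x α)) (fun α β => φ (T α β)) (fun α β => φ (h α β))
  scale : ∀ c x T h, Z (fun α => c * x α) T h = c ^ N * Z x T h
  pos : 0 < N
  gauge : ∀ x v σ h, (∀ α β, h α β = h β α) → Z x (gaugeR x v σ) h = 0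
  kernel : ∀ x T, (∀ α β, T α β = T β α) → (∀ s, Z x T (symUnit s) = 0) →
    ∃ (k : ℕ) (v : Fin n → Symbol n) (σ : Symbol n),
      ∀ α β, boxR x ^ k * T α β = gaugeR x v σ α β
  variation : ∀ s, componentEL (freeLagrangian n) s =
    hSymbol (fun t => Z MvPolynomial.X (symUnit s) (symUnit t))

/-! ### Field equations of a conformally invariant quadratic form. -/

section

variable {N : ℕ}
  {Z : (Fin n → Symbol n) → (Fin n → Fin n → Symbol n) → (Fin n → Fin n → Symbol n) → Symbol n}

/-- The field equations of the Lagrangian with a given quadratic form. -/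
def formOperator (hZ : IsConformalForm N Z) :
    (Sym2 (Fin n) → Symbol n) →ₗ[Symbol n] (Sym2 (Fin n) → Symbol n) where
  toFun y s := Z MvPolynomial.X (symTensor y) (symUnit s)
  map_add' y z := by
    funext s
    have h : symTensor (y + z) = fun α β => 1 * symTensor y α β + symTensor z α β := by
      funext α β
      rw [← symTensor_smul_add, one_smul]
    rw [h, hZ.mul_add, one_mul]
    rfl
  map_smul' c y := by
    funext s
    have h0 : Z MvPolynomial.X (fun _ _ => 0) (symUnit s) = 0 := by
      simpa using hZ.mul_add MvPolynomial.X (-1) (fun _ _ => 0) (fun _ _ => 0) (symUnit s)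
    have h : symTensor (c • y) = fun α β => c * symTensor y α β + 0 := by
      funext α β
      have := symTensor_smul_add c y 0 α β
      rw [add_zero] at this
      rw [this]
      simp [symTensor]
    rw [h, hZ.mul_add, h0, add_zero]
    rfl

lemma formOperator_apply (hZ : IsConformalForm N Z) (y : Sym2 (Fin n) → Symbol n)
    (s : Sym2 (Fin n)) :
    formOperator hZ y s = Z MvPolynomial.X (symTensor y) (symUnit s) := rfl

/-- The weight 1/2 of off-diagonal components in `tensorEL` is the weight that `symTensor` gives to
a unit vector, so the two conventions match. -/
lemma tensorEL_eq_formOperator (hZ : IsConformalForm N Z) (s : Sym2 (Fin n)) :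
    tensorEL (freeLagrangian n) s = hSymbol (formOperator hZ (Pi.single s 1)) := by
  have h0 : ∀ t, Z MvPolynomial.X (fun _ _ => 0) (symUnit t) = 0 := fun t => by
    simpa using hZ.mul_add MvPolynomial.X (-1) (fun _ _ => 0) (fun _ _ => 0) (symUnit t)
  have h1 : formOperator hZ (Pi.single s 1) =
      symWeight s • fun t => Z MvPolynomial.X (symUnit s) (symUnit t) := by
    funext t
    have h : symTensor (Pi.single s 1) = fun α β =>
        algebraMap ℝ (Symbol n) (symWeight s) * symUnit s α β + 0 := by
      funext α β
      rw [symTensor_single, add_zero]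
    rw [formOperator_apply, h, hZ.mul_add, h0, add_zero, Pi.smul_apply, Algebra.smul_def]
  rw [h1, map_smul, ← hZ.variation]
  rfl

/-! ### The Noether operator on symbols -/

lemma jetPoly_noetherMap (g : JetSpace n (Option (Fin n))) (s : Sym2 (Fin n)) :
    jetPoly (noetherMap g) s = -2 * (∑ μ, ∑ ν, if s(μ, ν) = s then
      MvPolynomial.X ν * jetPoly g (some μ) else 0) +
      2 * ∑ μ, ∑ ν, if s(μ, ν) = s then etaR (Symbol n) μ ν * jetPoly g none else 0 := by
  classical
  have hadd : ∀ (p : Prop) [Decidable p] (a b c : Symbol n),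
      (if p then a * (b + c) else 0) = (if p then a * b else 0) + if p then a * c else 0 := by
    intro p _ a b c
    split_ifs
    · ring
    · ring
  induction g using jet_induction with
  | zero => simp
  | add f g hf hg =>
    simp only [map_add, Pi.add_apply, hf, hg, hadd, Finset.sum_add_distrib]
    ring
  | smul c x hx =>
    simp only [map_smul, Pi.smul_apply, hx, mul_smul_comm, ← smul_ite_zero, ← Finset.smul_sum,
      smul_add]
  | single i J =>
    have hP : ∀ (t : Sym2 (Fin n)) (f : Symbol n), (Pi.single t f : Sym2 (Fin n) → Symbol n) s =
        if t = s then f else 0 := by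
      intro t f
      rw [Pi.single_apply]
      simp only [eq_comm]
    cases i with
    | none =>
      simp only [noetherMap, Finsupp.linearCombination_single, one_smul, map_smul, map_sum,
        Pi.smul_apply, Finset.sum_apply, jetPoly_single, hP, Pi.single_eq_same]
      simp [Algebra.smul_def, etaR]
      exact Or.inl (map_ofNat MvPolynomial.C 2)
    | some μ =>
      have h0 : ∀ μ', μ' ≠ μ → (Pi.single (some μ)
          (MvPolynomial.monomial (Finsupp.equivFunOnFinite.symm J) (1 : ℝ)) :
          Option (Fin n) → Symbol n) (some μ') = 0 := fun μ' h =>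
        Pi.single_eq_of_ne (fun h' => h (Option.some_injective _ h')) _
      simp only [noetherMap, Finsupp.linearCombination_single, one_smul, map_smul, map_sum,
        Pi.smul_apply, Finset.sum_apply, jetPoly_single, hP]
      conv_rhs => rw [Fintype.sum_eq_single μ (fun μ' h => by simp [h0 μ' h])]
      simp [Algebra.smul_def, monomial_raise]
      exact Or.inl (map_ofNat MvPolynomial.C 2)

/-- On symbols the Noether operator is a linearized diffeomorphism combined with a Weyl rescaling.
The weight 1/2 of `symTensor` compensates for off-diagonal components occurring twice. -/
lemma symTensor_noetherMap (g : JetSpace n (Option (Fin n))) (α β : Fin n) :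
    symTensor (jetPoly (noetherMap g)) α β =
      gaugeR MvPolynomial.X (fun μ => -jetPoly g (some μ)) (2 * jetPoly g none) α β := by
  have h2 := algebraMap_half_mul_two (Symbol n)
  rw [symTensor, jetPoly_noetherMap, Algebra.smul_def,
    sum_sym2_ite (fun μ ν => MvPolynomial.X ν * jetPoly g (some μ)),
    sum_sym2_ite (fun μ ν => etaR (Symbol n) μ ν * jetPoly g none), gaugeR, symWeight_mk]
  split_ifs with h
  · subst h
    rw [map_one]
    ring
  · rw [etaR_of_ne h, etaR_of_ne (Ne.symm h)]
    linear_combination (-(MvPolynomial.X β * jetPoly g (some α)) -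
      MvPolynomial.X α * jetPoly g (some β)) * h2

/-- The gauge parameters with given symbols. -/
def gaugeParam (v : Fin n → Symbol n) (σ : Symbol n) : JetSpace n (Option (Fin n)) :=
  jetPoly.symm (fun i => i.elim ((1 / 2 : ℝ) • σ) (fun μ => -v μ))

lemma symTensor_noetherMap_gaugeParam (v : Fin n → Symbol n) (σ : Symbol n) (α β : Fin n) :
    symTensor (jetPoly (noetherMap (gaugeParam v σ))) α β = gaugeR MvPolynomial.X v σ α β := by
  have h2 := algebraMap_half_mul_two (Symbol n)
  rw [symTensor_noetherMap, gaugeParam, LinearEquiv.apply_symm_apply]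
  simp only [Option.elim, neg_neg, Algebra.smul_def, gaugeR]
  linear_combination etaR (Symbol n) α β * σ * h2

/-! ### Divisibility -/

/-- A variable is prime, so if it does not divide f it must divide the cofactor and can be
cancelled. -/
lemma dvd_of_dvd_X_mul {a : Fin n} {f w : Symbol n} (hf : ¬ MvPolynomial.X a ∣ f)
    (h : f ∣ MvPolynomial.X a * w) : f ∣ w := by
  obtain ⟨g, hg⟩ := h
  have hp : Prime (MvPolynomial.X a : Symbol n) := MvPolynomial.X_prime
  obtain ⟨g', rfl⟩ := (hp.dvd_or_dvd ⟨w, hg.symm⟩).resolve_left hf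
  exact ⟨g', mul_left_cancel₀ hp.ne_zero (by rw [hg]; ring)⟩

lemma dvd_of_dvd_two_mul {f w : Symbol n} (h : f ∣ 2 * w) : f ∣ w := by
  have h2 := algebraMap_half_mul_two (Symbol n)
  have := h.mul_left (algebraMap ℝ (Symbol n) (1 / 2))
  rwa [← mul_assoc, h2, one_mul] at this

lemma dvd_of_dvd_etaR_mul {μ : Fin n} {f w : Symbol n} (h : f ∣ etaR (Symbol n) μ μ * w) :
    f ∣ w := by
  have := h.mul_left (etaR (Symbol n) μ μ)
  rwa [← mul_assoc, etaR_mul_self, one_mul] at this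

/-- At the unit vector in a direction b ≠ a the variable X_a vanishes, whereas □ takes the value ±1.
-/
lemma not_X_dvd_boxR_pow {x : Fin n → Symbol n} {a b : Fin n} (hab : b ≠ a)
    (hx : ∀ i, MvPolynomial.eval (Pi.single b (1 : ℝ)) (x i) = (Pi.single b 1 : Fin n → ℝ) i)
    (k : ℕ) : ¬ MvPolynomial.X a ∣ boxR x ^ k := by
  rintro ⟨g, hg⟩
  have h := congrArg (MvPolynomial.eval (Pi.single b (1 : ℝ))) hg
  have h1 : MvPolynomial.eval (Pi.single b (1 : ℝ)) (boxR x) = eta b b := by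
    simp only [boxR, map_sum, map_mul, hx, etaR, MvPolynomial.algebraMap_eq, MvPolynomial.eval_C]
    rw [Finset.sum_eq_single b] <;> simp +contextual
  rw [map_pow, h1, map_mul, MvPolynomial.eval_X, Pi.single_eq_of_ne hab.symm, zero_mul] at h
  have h3 := eta_self_mul_self b
  rw [eq_zero_of_pow_eq_zero h] at h3
  simp at h3

/-- For distinct indices the metric terms are absent and x_a g_bc + x_b g_ac - x_c g_ab = 2 x_a x_b
v_c for the transformed tensor g. This needs three indices. Once v is known, a diagonal component
gives σ. -/
lemma dvd_of_dvd_gaugeR (hn : 3 ≤ n) {r : Symbol n}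
    (hr : ∀ (a : Fin n) (w : Symbol n), r ∣ MvPolynomial.X a * w → r ∣ w)
    {v : Fin n → Symbol n} {σ : Symbol n}
    (h : ∀ α β, r ∣ gaugeR MvPolynomial.X v σ α β) : (∀ c, r ∣ v c) ∧ r ∣ σ := by
  have hv : ∀ c, r ∣ v c := by
    intro c
    obtain ⟨a, hac, -⟩ := exists_ne_ne hn c c
    obtain ⟨b, hbc, hba⟩ := exists_ne_ne hn c a
    refine hr a _ (hr b _ (dvd_of_dvd_two_mul ?_))
    have h1 := ((h b c).mul_left (MvPolynomial.X a)).add ((h a c).mul_left (MvPolynomial.X b))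
    have h2 := h1.sub ((h a b).mul_left (MvPolynomial.X c))
    rw [gaugeR, gaugeR, gaugeR, etaR_of_ne hbc, etaR_of_ne hac, etaR_of_ne hba.symm] at h2
    convert h2 using 1
    ring
  obtain ⟨c, -⟩ : ∃ c : Fin n, c = c := ⟨⟨0, by omega⟩, rfl⟩
  refine ⟨hv, dvd_of_dvd_etaR_mul (μ := c) ?_⟩
  have h1 := (h c c).sub ((hv c).mul_left (2 * MvPolynomial.X c))
  rw [gaugeR] at h1
  convert h1 using 1
  ring

/-- With x_{μ₀} = 0 the formula with three indices may involve the vanishing variable, so another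
route is taken. The component (μ₀, μ₀) is σ up to sign, the mixed components give v_{μ₀}, and the
other diagonal components give the rest. -/
lemma dvd_of_dvd_gaugeR_of_eq_zero (hn : 3 ≤ n) {r : Symbol n} {μ₀ : Fin n}
    (hr : ∀ (a : Fin n) (w : Symbol n), a ≠ μ₀ → r ∣ MvPolynomial.X a * w → r ∣ w)
    {x : Fin n → Symbol n} (hx0 : x μ₀ = 0) (hx : ∀ a, a ≠ μ₀ → x a = MvPolynomial.X a)
    {v : Fin n → Symbol n} {σ : Symbol n}
    (h : ∀ α β, r ∣ gaugeR x v σ α β) : (∀ c, r ∣ v c) ∧ r ∣ σ := by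
  have hσ : r ∣ σ := by
    have h1 := h μ₀ μ₀
    rw [gaugeR, hx0, zero_mul, zero_add, zero_add] at h1
    exact dvd_of_dvd_etaR_mul h1
  refine ⟨fun c => ?_, hσ⟩
  by_cases hc : c = μ₀
  · subst hc
    obtain ⟨b, hb, -⟩ := exists_ne_ne hn c c
    have h1 := h c b
    rw [gaugeR, hx0, hx b hb, etaR_of_ne hb.symm, zero_mul, zero_mul, add_zero, zero_add] at h1
    exact hr b _ hb h1
  · refine hr c _ hc (dvd_of_dvd_two_mul ?_)
    have h1 := (h c c).sub (hσ.mul_left (etaR (Symbol n) c c))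
    rw [gaugeR, hx c hc] at h1
    convert h1 using 1
    ring

lemma eq_gaugeR_of_mul_eq {r : Symbol n} (hr : r ≠ 0) {x : Fin n → Symbol n}
    {T : Fin n → Fin n → Symbol n} {v : Fin n → Symbol n} {σ : Symbol n}
    (hv : (∀ c, r ∣ v c) ∧ r ∣ σ) (h : ∀ α β, r * T α β = gaugeR x v σ α β) :
    ∃ v' σ', ∀ α β, T α β = gaugeR x v' σ' α β := by
  obtain ⟨h1, σ', rfl⟩ := hv
  choose v' hv' using h1
  refine ⟨v', σ', fun α β => mul_left_cancel₀ hr ?_⟩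
  rw [h, gaugeR, gaugeR, hv', hv']
  ring

/-! ### Regularity of the field equations -/

/-- Setting one derivative to zero. -/
def killX (μ₀ : Fin n) : Symbol n →ₐ[ℝ] Symbol n :=
  MvPolynomial.aeval (fun μ => if μ = μ₀ then 0 else MvPolynomial.X μ)

lemma X_dvd_sub_killX (μ₀ : Fin n) (f : Symbol n) : MvPolynomial.X μ₀ ∣ f - killX μ₀ f := by
  induction f using MvPolynomial.induction_on with
  | C c => simp [killX]
  | add f g hf hg =>
    rw [map_add, add_sub_add_comm]
    exact hf.add hg
  | mul_X f μ hf =>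
    have h1 : MvPolynomial.X μ₀ ∣ (MvPolynomial.X μ - killX μ₀ (MvPolynomial.X μ) : Symbol n) := by
      rw [killX, MvPolynomial.aeval_X]
      split_ifs with h
      · rw [h, sub_zero]
      · simp
    rw [map_mul]
    have := (hf.mul_right (MvPolynomial.X μ)).add (h1.mul_left (killX μ₀ f))
    convert this using 1
    ring

lemma formOperator_noetherMap (hZ : IsConformalForm N Z) (g : JetSpace n (Option (Fin n))) :
    formOperator hZ (jetPoly (noetherMap g)) = 0 := by
  funext s
  rw [formOperator_apply, show symTensor (jetPoly (noetherMap g)) = _ from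
    funext fun α => funext fun β => symTensor_noetherMap g α β]
  exact hZ.gauge _ _ _ _ (symUnit_comm s)

/-- The substitution X ↦ 2X commutes with the form by naturality and multiplies it by 2ᴺ by
homogeneity. -/
lemma jetScale_formOperator (hZ : IsConformalForm N Z) (w : JetSpace n (Sym2 (Fin n))) :
    jetScale (ofSymbolMap (formOperator hZ) w) =
      (2 : ℝ) ^ N • ofSymbolMap (formOperator hZ) (jetScale w) := by
  apply jetPoly.injective
  funext s
  rw [jetPoly_jetScale, map_smul, Pi.smul_apply, jetPoly_ofSymbolMap, jetPoly_ofSymbolMap,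
    formOperator_apply, formOperator_apply, hZ.map]
  simp only [map_symTensor, map_symUnit, MvPolynomial.aeval_X, hZ.scale]
  rw [Algebra.smul_def, map_pow, map_ofNat]
  congr 3
  funext α β
  simp only [symTensor, jetPoly_jetScale]

/-- For exactness, a solution is pure gauge after multiplication by a power of □. That power divides
the gauge parameters, because it is prime to every variable, and can be cancelled. -/
theorem isRegularSystem_formOperator (hn : 3 ≤ n) (hZ : IsConformalForm N Z) :
    IsRegularSystem (ofSymbolMap (formOperator hZ)) := by
  have hX : ∀ (k : ℕ) (a : Fin n), ¬ MvPolynomial.X a ∣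
      boxR (MvPolynomial.X : Fin n → Symbol n) ^ k := fun k a => by
    obtain ⟨b, hb, -⟩ := exists_ne_ne hn a a
    exact not_X_dvd_boxR_pow hb (fun i => by simp) k
  refine ⟨ofSymbolMap_jetShift _, apply_zero_of_jetScale hZ.pos
    (jetScale_formOperator hZ), fun g => ?_, fun y hy => ?_,
    fun g hg => ?_⟩
  · apply jetPoly.injective
    rw [jetPoly_ofSymbolMap, map_zero, formOperator_noetherMap]
  · have h1 : formOperator hZ (jetPoly y) = 0 := by
      rw [← jetPoly_ofSymbolMap, hy, map_zero]
    obtain ⟨k, v, σ, h2⟩ := hZ.kernel MvPolynomial.X (symTensor (jetPoly y))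
      (symTensor_comm _) (fun s => congrFun h1 s)
    obtain ⟨v', σ', h3⟩ := eq_gaugeR_of_mul_eq
      (fun h0 => hX k ⟨0, by omega⟩ (h0 ▸ dvd_zero _))
      (dvd_of_dvd_gaugeR hn (fun a w => dvd_of_dvd_X_mul (hX k a))
        (fun α β => ⟨_, (h2 α β).symm⟩)) h2
    refine ⟨gaugeParam v' σ', jetPoly.injective (symTensor_injective fun α β => ?_)⟩
    rw [symTensor_noetherMap_gaugeParam, h3]
  -- Injectivity of the gauge transformations is the same divisibility statement with divisor zero,
  -- since 0 divides only 0.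
  · have h1 : ∀ α β, (0 : Symbol n) ∣
        gaugeR MvPolynomial.X (fun μ => -jetPoly g (some μ)) (2 * jetPoly g none) α β := by
      intro α β
      rw [← symTensor_noetherMap, hg, map_zero]
      simp [symTensor]
    obtain ⟨h2, h3⟩ := dvd_of_dvd_gaugeR hn (fun a w h => by
      rw [zero_dvd_iff] at h ⊢
      exact (mul_eq_zero.1 h).resolve_left (MvPolynomial.X_ne_zero a)) h1
    apply jetPoly.injective
    funext i
    rw [map_zero]
    cases i with
    | none => exact zero_dvd_iff.1 (dvd_of_dvd_two_mul h3)
    | some μ => exact neg_eq_zero.1 (zero_dvd_iff.1 (h2 μ))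

theorem isHomogeneousSystem_formOperator (hZ : IsConformalForm N Z) :
    IsHomogeneousSystem (ofSymbolMap (formOperator hZ)) :=
  isHomogeneousSystem_of_jetScale (jetScale_formOperator hZ)

/-- If X_{μ₀} w = Dy, then y restricted to X_{μ₀} = 0 is a solution of the restricted equations,
hence pure gauge there. Subtracting a lift of this gauge transformation makes y divisible by X_{μ₀}
without changing Dy, and X_{μ₀} can be cancelled. -/
theorem isTorsionFree_formOperator (hn : 3 ≤ n) (hZ : IsConformalForm N Z) (μ₀ : Fin n) :
    IsTorsionFree (ofSymbolMap (formOperator hZ)) μ₀ := by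
  rintro w ⟨y, hy⟩
  set φ := killX μ₀ with hφ
  have hφX : ∀ μ, φ (MvPolynomial.X μ) = if μ = μ₀ then 0 else MvPolynomial.X μ := fun μ => by
    rw [hφ, killX, MvPolynomial.aeval_X]
  have h1 : formOperator hZ (jetPoly y) = (MvPolynomial.X μ₀ : Symbol n) • jetPoly w := by
    rw [← jetPoly_ofSymbolMap, hy, jetPoly_jetShift]
  -- Setting X_{μ₀} = 0 commutes with the form by naturality; it kills the right side and leaves the
  -- test tensors unchanged.
  have h2 : ∀ s, Z (fun α => φ (MvPolynomial.X α)) (fun α β => φ (symTensor (jetPoly y) α β))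
      (symUnit s) = 0 := by
    intro s
    have h3 := congrArg φ (congrFun h1 s)
    rw [formOperator_apply, hZ.map, Pi.smul_apply, smul_eq_mul, map_mul, hφX, if_pos rfl,
      zero_mul] at h3
    simpa only [map_symUnit] using h3
  obtain ⟨k, v, σ, h3⟩ := hZ.kernel _ _ (fun α β => by rw [symTensor_comm]) h2
  -- A third direction b, different from a and μ₀, is needed because □ has lost the variable X_{μ₀}.
  have hX : ∀ a, a ≠ μ₀ → ¬ MvPolynomial.X a ∣ boxR (fun α => φ (MvPolynomial.X α)) ^ k := by
    intro a _
    obtain ⟨b, hb, hb0⟩ := exists_ne_ne hn a μ₀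
    refine not_X_dvd_boxR_pow hb (fun i => ?_) k
    rw [hφX]
    split_ifs with h
    · subst h; rw [map_zero, Pi.single_eq_of_ne hb0.symm]
    · simp
  obtain ⟨a, ha, -⟩ := exists_ne_ne hn μ₀ μ₀
  obtain ⟨v', σ', h4⟩ := eq_gaugeR_of_mul_eq (fun h0 => hX a ha (by rw [h0]; exact dvd_zero _))
    (dvd_of_dvd_gaugeR_of_eq_zero hn (fun a w ha => dvd_of_dvd_X_mul (hX a ha))
      (by rw [hφX, if_pos rfl]) (fun a ha => by rw [hφX, if_neg ha])
      (fun α β => ⟨_, (h3 α β).symm⟩)) h3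
  have hφφ : ∀ f, φ (φ f) = φ f := by
    intro f
    have : (φ.comp φ) = φ := by
      refine MvPolynomial.algHom_ext fun μ => ?_
      rw [AlgHom.comp_apply, hφX]
      split_ifs with h
      · rw [map_zero]
      · rw [hφX, if_neg h]
    exact DFunLike.congr_fun this f
  -- The parameters found at X_{μ₀} = 0 are used as parameters of a full gauge transformation; it
  -- agrees with y only after the restriction, which is what `hφV` says.
  set V := jetPoly y - jetPoly (noetherMap (gaugeParam v' σ')) with hV
  have hφV : ∀ s, φ (V s) = 0 := by
    have h5 : (fun s => φ (V s)) = 0 := by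
      refine symTensor_injective fun α β => ?_
      have h6 : symTensor V α β = symTensor (jetPoly y) α β - gaugeR MvPolynomial.X v' σ' α β := by
        rw [← symTensor_noetherMap_gaugeParam, hV]
        simp only [symTensor, Pi.sub_apply, smul_sub]
      have h7 := congrArg φ (h4 α β)
      rw [hφφ] at h7
      rw [← map_symTensor, h6, map_sub, h7, gaugeR, gaugeR]
      simp only [map_add, map_mul, hφφ, map_etaR, sub_self]
      simp [symTensor]
    exact fun s => congrFun h5 s
  have hV' : ∀ s, ∃ g, V s = MvPolynomial.X μ₀ * g := fun s => by
    have := X_dvd_sub_killX μ₀ (V s)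
    rwa [← hφ, hφV, sub_zero] at this
  choose V' hV' using hV'
  refine ⟨jetPoly.symm V', jetPoly.injective ?_⟩
  rw [jetPoly_ofSymbolMap, LinearEquiv.apply_symm_apply]
  have h5 : formOperator hZ V = formOperator hZ (jetPoly y) := by
    rw [hV, map_sub, formOperator_noetherMap, sub_zero]
  have h6 : V = (MvPolynomial.X μ₀ : Symbol n) • V' := funext hV'
  rw [h1, h6, map_smul] at h5
  funext s
  exact mul_left_cancel₀ (MvPolynomial.X_ne_zero μ₀) (congrFun h5 s)

end

/-! ### The curvatures as linear functions of the jets -/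

lemma hJet_eq_hSymbol (s : Sym2 (Fin n)) (J : MultiIndex n) : hJet s J = hSymbol (Pi.single s
    (MvPolynomial.monomial (Finsupp.equivFunOnFinite.symm J) (1 : ℝ) : Symbol n)) := by
  rw [← jetPoly_single, hSymbol_jetPoly, hlinEven_single, one_smul]

lemma dh_eq_hSymbol (μ α β : Fin n) : hJet s(α, β) (raise 0 μ) =
    hSymbol (fun s => MvPolynomial.X μ * symUnit s α β) := by
  rw [hJet_eq_hSymbol, monomial_raise, monomial_zero_eq_one]
  congr 1
  funext s
  simp only [symUnit, Pi.single_apply, eq_comm, mul_ite, mul_one, mul_zero]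

lemma ddh_eq_hSymbol (μ ν α β : Fin n) : ddh μ ν α β =
    hSymbol (fun s => MvPolynomial.X μ * MvPolynomial.X ν * symUnit s α β) := by
  rw [ddh, hJet_eq_hSymbol, monomial_raise, monomial_raise, monomial_zero_eq_one]
  congr 1
  funext s
  simp only [symUnit, Pi.single_apply, eq_comm, mul_ite, mul_one, mul_zero]
  rw [mul_comm]

lemma riemann_eq_hSymbol (α β μ ν : Fin n) : riemann α β μ ν =
    hSymbol (fun s => riemannR MvPolynomial.X (symUnit s) α β μ ν) := by
  simp only [riemann, ddh_eq_hSymbol, ← map_add, ← map_sub, ← map_smul]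
  congr 1
  funext s
  simp only [Pi.smul_apply, Pi.add_apply, Pi.sub_apply]
  simp only [Algebra.smul_def, riemannR]

lemma ricci_eq_hSymbol (β ν : Fin n) : ricci β ν =
    hSymbol (fun s => ricciR MvPolynomial.X (symUnit s) β ν) := by
  have h : ∀ α, ∑ μ, eta α μ • riemann α β μ ν = eta α α • riemann α β α ν := fun α =>
    Finset.sum_eq_single α (fun μ _ h => by rw [eta_of_ne h.symm, zero_smul]) (by simp)
  simp only [ricci, h]
  simp only [riemann_eq_hSymbol, ← map_smul, ← map_sum]
  congr 1
  funext s
  simp only [Finset.sum_apply, Pi.smul_apply]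
  simp only [Algebra.smul_def, ricciR, etaR]

lemma scalarCurv_eq_hSymbol : scalarCurv n =
    hSymbol (fun s => scalarR MvPolynomial.X (symUnit s)) := by
  have h : ∀ μ : Fin n, ∑ ν, eta μ ν • ricci μ ν = eta μ μ • ricci μ μ := fun μ =>
    Finset.sum_eq_single μ (fun ν _ h => by rw [eta_of_ne h.symm, zero_smul]) (by simp)
  simp only [scalarCurv, h]
  simp only [ricci_eq_hSymbol, ← map_smul, ← map_sum]
  congr 1
  funext s
  simp only [Finset.sum_apply, Pi.smul_apply]
  simp only [Algebra.smul_def, scalarR, etaR]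

lemma weyl_eq_hSymbol (α β γ δ : Fin n) : weyl α β γ δ =
    hSymbol (fun s => weylR MvPolynomial.X (symUnit s) α β γ δ) := by
  simp only [weyl, riemann_eq_hSymbol, ricci_eq_hSymbol, scalarCurv_eq_hSymbol, ← map_add,
    ← map_sub, ← map_smul]
  congr 1
  funext s
  simp only [Pi.smul_apply, Pi.add_apply, Pi.sub_apply]
  simp only [Algebra.smul_def, weylR, etaR, map_mul, map_sub]

lemma box_pow_hSymbol (k : ℕ) (u : Sym2 (Fin n) → Symbol n) :
    (box n ^ k) (hSymbol u) = hSymbol (boxR (MvPolynomial.X : Fin n → Symbol n) ^ k • u) := by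
  have h : ∀ u : Sym2 (Fin n) → Symbol n,
      box n (hSymbol u) = hSymbol (boxR (MvPolynomial.X : Fin n → Symbol n) • u) := by
    intro u
    simp only [box, LinearMap.sum_apply, LinearMap.smul_apply, pow_two, Module.End.mul_apply,
      evenTotalDeriv_hSymbol, ← map_smul, ← map_sum]
    congr 1
    funext s
    simp only [Finset.sum_apply, Pi.smul_apply, boxR, smul_eq_mul, Finset.sum_mul]
    simp only [Algebra.smul_def, etaR, mul_assoc]
  induction k generalizing u with
  | zero => simp
  | succ k ih => rw [pow_succ, Module.End.mul_apply, h, ih, smul_smul, pow_succ]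

/-! ### The quadratic form of the Weyl Lagrangian -/

lemma symbolConj_boxR : symbolConj (boxR (MvPolynomial.X : Fin n → Symbol n)) =
    boxR MvPolynomial.X := by
  rw [map_boxR, show (fun α => symbolConj (MvPolynomial.X α)) =
    fun α : Fin n => (-1 : Symbol n) * MvPolynomial.X α from funext fun α => by simp, boxR_scale]
  ring

/-- The Weyl tensor has second order, and reversing the sign of all derivatives does not affect even
order. -/
lemma symbolConj_weylR (s : Sym2 (Fin n)) (α β γ δ : Fin n) :
    symbolConj (weylR MvPolynomial.X (symUnit s) α β γ δ) =
      weylR MvPolynomial.X (symUnit s) α β γ δ := by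
  rw [map_weylR, show (fun α => symbolConj (MvPolynomial.X α)) =
    fun α : Fin n => (-1 : Symbol n) * MvPolynomial.X α from funext fun α => by simp, weylR_scale]
  simp only [map_symUnit]
  ring

/-- The quadratic form of the Lagrangian `½ W □^m W`. -/
def weylForm (m : ℕ) (x : Fin n → Symbol n) (T h : Fin n → Fin n → Symbol n) : Symbol n :=
  boxR x ^ m * pairR (weylR x T) (weylR x h)

/-- Both factors of the Lagrangian have self-conjugate symbols, so they contribute equally to the
variation; this cancels the prefactor 1/2. -/
lemma componentEL_weylLagrangian (s : Sym2 (Fin n)) : componentEL (weylLagrangian n) s =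
    hSymbol (fun t => weylForm ((n - 4) / 2) MvPolynomial.X (symUnit s) (symUnit t)) := by
  set m := (n - 4) / 2 with hm
  set w : Fin n → Fin n → Fin n → Fin n → Sym2 (Fin n) → Symbol n := fun α β γ δ t =>
    weylR MvPolynomial.X (symUnit t) α β γ δ with hw
  have h : HasVariation s (weylLagrangian n) ((1 / 2 : ℝ) • ∑ α, ∑ β, ∑ γ, ∑ δ,
      (eta α α * eta β β * eta γ γ * eta δ δ) • hSymbol (symbolConj (w α β γ δ s) •
        (boxR (MvPolynomial.X : Fin n → Symbol n) ^ m • w α β γ δ) +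
        symbolConj ((boxR (MvPolynomial.X : Fin n → Symbol n) ^ m • w α β γ δ) s) • w α β γ δ)) := by
    refine HasVariation.smul _ (HasVariation.sum _ fun α _ => HasVariation.sum _ fun β _ =>
      HasVariation.sum _ fun γ _ => HasVariation.sum _ fun δ _ => HasVariation.smul _ ?_)
    rw [weyl_eq_hSymbol, box_pow_hSymbol]
    exact HasVariation.hSymbol_mul s _ _
  rw [h.eq]
  simp only [← map_smul, ← map_sum]
  congr 1
  funext t
  have h2 := algebraMap_half_mul_two (Symbol n)
  simp only [Finset.sum_apply, Pi.smul_apply, Pi.add_apply, smul_eq_mul]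
  simp only [Algebra.smul_def, map_mul, map_pow, symbolConj_boxR, hw, symbolConj_weylR,
    weylForm, pairR, Finset.mul_sum, etaR]
  refine Finset.sum_congr rfl fun α _ => Finset.sum_congr rfl fun β _ =>
    Finset.sum_congr rfl fun γ _ => Finset.sum_congr rfl fun δ _ => ?_
  linear_combination (algebraMap ℝ (Symbol n) (eta α α) * algebraMap ℝ (Symbol n) (eta β β) *
    algebraMap ℝ (Symbol n) (eta γ γ) * algebraMap ℝ (Symbol n) (eta δ δ) *
    boxR MvPolynomial.X ^ m * weylR MvPolynomial.X (symUnit s) α β γ δ *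
    weylR MvPolynomial.X (symUnit t) α β γ δ) * h2

lemma pairR_mul_add (c : Symbol n) (W W' F : Fin n → Fin n → Fin n → Fin n → Symbol n) :
    pairR (fun α β γ δ => c * W α β γ δ + W' α β γ δ) F = c * pairR W F + pairR W' F := by
  simp only [pairR, Finset.mul_sum, ← Finset.sum_add_distrib]
  refine Finset.sum_congr rfl fun α _ => Finset.sum_congr rfl fun β _ =>
    Finset.sum_congr rfl fun γ _ => Finset.sum_congr rfl fun δ _ => ?_
  ring

/-- Testing with a unit symmetric tensor extracts a component of the double divergence, twice if it
is off-diagonal, because the double divergence is symmetric. -/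
lemma bachR_eq_zero_of_weylForm (hn : 3 ≤ n) {m : ℕ} {x : Fin n → Symbol n}
    {T : Fin n → Fin n → Symbol n} (hT : ∀ α β, T α β = T β α)
    (h : ∀ s, weylForm m x T (symUnit s) = 0) (β δ : Fin n) : boxR x ^ m * bachR x T β δ = 0 := by
  obtain ⟨u, σ, hB⟩ := exists_gaugeR_of_bachR x hT
  have hsymm : bachR x T δ β = bachR x T β δ := by
    rw [hB, hB, hT δ β, gaugeR_comm]
  have h1 := h s(β, δ)
  rw [weylForm, pairR_weylR x hn hT (symUnit_comm _)] at h1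
  simp only [symUnit, mul_ite, mul_one, mul_zero] at h1
  rw [sum_sym2_ite (fun β δ => etaR (Symbol n) β β * etaR (Symbol n) δ δ * bachR x T β δ)] at h1
  have h2 : ∀ α : Fin n, etaR (Symbol n) α α ≠ 0 := fun α h0 => by
    have := etaR_mul_self (R := Symbol n) α
    rw [h0, zero_mul] at this
    exact zero_ne_one this
  -- The values x are arbitrary, so the power of □ may itself be zero; the product vanishes in that
  -- case as well.
  rcases mul_eq_zero.1 h1 with h3 | h3
  · rw [h3, zero_mul]
  · split_ifs at h3 with hβ
    · subst hβ
      simp only [mul_eq_zero, h2, false_or] at h3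
      rw [(by simpa using h3 : bachR x T β β = 0), mul_zero]
    · rw [hsymm] at h3
      have h4 : -2 * (2 * (etaR (Symbol n) β β * etaR (Symbol n) δ δ * bachR x T β δ)) = 0 := by
        rw [← h3]; ring
      simp only [mul_eq_zero, h2, false_or] at h4
      rw [(by simpa using h4 : bachR x T β δ = 0), mul_zero]

/-- The order is 2 for each Weyl tensor and 2 for each d'Alembertian. The kernel property combines
the vanishing of `□^m` times the double divergence with its expression as □²T plus gauge, whence the
exponent m + 2. -/
theorem isConformalForm_weylForm (h3 : n ≠ 3) (h4 : 4 ≤ n) :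
    IsConformalForm (n := n) (2 * ((n - 4) / 2) + 4) (weylForm ((n - 4) / 2)) where
  mul_add x c T T' h := by
    rw [weylForm, show weylR x (fun α β => c * T α β + T' α β) =
      fun α β γ δ => c * weylR x T α β γ δ + weylR x T' α β γ δ by
        funext α β γ δ; exact weylR_mul_add x c T T' α β γ δ, pairR_mul_add, weylForm, weylForm]
    ring
  map φ x T h := by
    simp only [weylForm, map_mul, map_pow, map_boxR, pairR, map_sum, map_etaR, map_weylR]
  scale c x T h := by
    simp only [weylForm, weylR_scale, boxR_scale, pairR, Finset.mul_sum]
    refine Finset.sum_congr rfl fun α _ => Finset.sum_congr rfl fun β _ =>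
      Finset.sum_congr rfl fun γ _ => Finset.sum_congr rfl fun δ _ => ?_
    ring
  pos := by omega
  gauge x v σ h hh := by
    simp [weylForm, weylR_gaugeR x (by omega : 3 ≤ n), pairR]
  kernel x T hT h := by
    obtain ⟨u, σ, hB⟩ := exists_gaugeR_of_bachR x hT
    -- c is -(n - 3)/(2(n - 2)). It vanishes exactly in dimension three, where the Weyl tensor
    -- carries no information and a different Lagrangian is used.
    set c : ℝ := -(1 / 2) * (1 - 1 / ((n : ℝ) - 2)) with hc
    have hc0 : c ≠ 0 := by
      have h5 : (4 : ℝ) ≤ n := by exact_mod_cast h4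
      have h6 : (n : ℝ) - 2 ≠ 0 := by linarith
      have h7 : (n : ℝ) - 3 ≠ 0 := by linarith
      have h8 : c = -(1 / 2) * (((n : ℝ) - 3) / ((n : ℝ) - 2)) := by
        rw [hc]; field_simp; ring
      rw [h8]
      exact mul_ne_zero (by norm_num) (div_ne_zero h7 h6)
    have hc1 : algebraMap ℝ (Symbol n) c⁻¹ * algebraMap ℝ (Symbol n) c = 1 := by
      rw [← map_mul, inv_mul_cancel₀ hc0, map_one]
    set q := boxR x ^ ((n - 4) / 2) with hq
    refine ⟨(n - 4) / 2 + 2, fun α => -(algebraMap ℝ (Symbol n) c⁻¹ * (q * u α)),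
      -(algebraMap ℝ (Symbol n) c⁻¹ * (q * σ)), fun α β => ?_⟩
    have h5 := bachR_eq_zero_of_weylForm (by omega) hT h α β
    rw [hB, ← hq] at h5
    rw [pow_add, ← hq]
    unfold gaugeR at h5 ⊢
    linear_combination algebraMap ℝ (Symbol n) c⁻¹ * h5 - q * boxR x ^ 2 * T α β * hc1
  variation s := by
    rw [freeLagrangian, if_neg h3, componentEL_weylLagrangian]

/-! ### The quadratic form of the Chern-Simons Lagrangian -/

section

variable {R : Type*} [CommRing R] [Algebra ℝ R]

/-- The linearized Einstein tensor. -/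
def einsteinR (x : Fin n → R) (h : Fin n → Fin n → R) (α β : Fin n) : R :=
  ricciR x h α β - algebraMap ℝ R (1 / 2) * etaR R α β * scalarR x h

/-- The contraction `ε_{μαβ} x^μ A^{αν} B^β_ν`. -/
def curlPair (x : Fin n → R) (A B : Fin n → Fin n → R) : R :=
  ∑ μ, ∑ α, ∑ β, ∑ ν, algebraMap ℝ R (epsilon3 μ α β * (eta α α * eta ν ν * eta μ μ * eta β β)) *
    (x μ * (A α ν * B β ν))

/-- The quadratic form of the Lagrangian `½ ε_{μαβ} G^{αν} ∂^μ h^β_ν`. -/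
def csForm (x : Fin n → R) (T h : Fin n → Fin n → R) : R :=
  algebraMap ℝ R (1 / 2) * (curlPair x (einsteinR x T) h - curlPair x (einsteinR x h) T)

lemma einsteinR_mul_add (x : Fin n → R) (c : R) (h h' : Fin n → Fin n → R) (α β : Fin n) :
    einsteinR x (fun α β => c * h α β + h' α β) α β =
      c * einsteinR x h α β + einsteinR x h' α β := by
  simp only [einsteinR, ricciR_mul_add, scalarR_mul_add]
  ring

lemma einsteinR_scale (x : Fin n → R) (c : R) (h : Fin n → Fin n → R) (α β : Fin n) :
    einsteinR (fun α => c * x α) h α β = c ^ 2 * einsteinR x h α β := by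
  simp only [einsteinR, ricciR_scale, scalarR_scale]
  ring

lemma curlPair_mul_add_left (x : Fin n → R) (c : R) (A A' B : Fin n → Fin n → R) :
    curlPair x (fun α β => c * A α β + A' α β) B = c * curlPair x A B + curlPair x A' B := by
  simp only [curlPair, Finset.mul_sum, ← Finset.sum_add_distrib]
  refine Finset.sum_congr rfl fun α _ => Finset.sum_congr rfl fun β _ =>
    Finset.sum_congr rfl fun γ _ => Finset.sum_congr rfl fun δ _ => ?_
  ring

lemma curlPair_mul_add_right (x : Fin n → R) (c : R) (A B B' : Fin n → Fin n → R) :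
    curlPair x A (fun α β => c * B α β + B' α β) = c * curlPair x A B + curlPair x A B' := by
  simp only [curlPair, Finset.mul_sum, ← Finset.sum_add_distrib]
  refine Finset.sum_congr rfl fun α _ => Finset.sum_congr rfl fun β _ =>
    Finset.sum_congr rfl fun γ _ => Finset.sum_congr rfl fun δ _ => ?_
  ring

lemma einsteinR_comm (x : Fin n → R) {h : Fin n → Fin n → R} (hh : ∀ α β, h α β = h β α)
    (α β : Fin n) : einsteinR x h α β = einsteinR x h β α := by
  rw [einsteinR, einsteinR, ricciR_comm x hh, etaR_comm]

end

lemma einstein_eq_hSymbol (α β : Fin n) : einstein α β =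
    hSymbol (fun s => einsteinR MvPolynomial.X (symUnit s) α β) := by
  simp only [einstein, ricci_eq_hSymbol, scalarCurv_eq_hSymbol, ← map_sub, ← map_smul]
  congr 1
  funext s
  simp only [Pi.smul_apply, Pi.sub_apply]
  simp only [Algebra.smul_def, einsteinR, etaR, map_mul]

lemma symbolConj_einsteinR (s : Sym2 (Fin n)) (α β : Fin n) :
    symbolConj (einsteinR MvPolynomial.X (symUnit s) α β) =
      einsteinR MvPolynomial.X (symUnit s) α β := by
  rw [einsteinR, map_sub, map_mul, map_mul, map_ricciR, map_scalarR, AlgHom.commutes, map_etaR,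
    show (fun α => symbolConj (MvPolynomial.X α)) =
    fun α : Fin n => (-1 : Symbol n) * MvPolynomial.X α from funext fun α => by simp,
    ricciR_scale, scalarR_scale]
  simp only [map_symUnit]
  ring

/-- The Einstein factor has even order and the other factor first order, so conjugation changes the
sign of only one of the two terms of the variation. -/
lemma componentEL_chernSimonsLagrangian (s : Sym2 (Fin n)) :
    componentEL (chernSimonsLagrangian n) s =
      hSymbol (fun t => csForm MvPolynomial.X (symUnit s) (symUnit t)) := by
  set u : Fin n → Fin n → Sym2 (Fin n) → Symbol n := fun α ν t =>
    einsteinR MvPolynomial.X (symUnit t) α ν with hu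
  set v : Fin n → Fin n → Fin n → Sym2 (Fin n) → Symbol n := fun μ β ν t =>
    MvPolynomial.X μ * symUnit t β ν with hv
  have h : HasVariation s (chernSimonsLagrangian n) ((1 / 2 : ℝ) • ∑ μ, ∑ α, ∑ β, ∑ ν,
      (epsilon3 μ α β * (eta α α * eta ν ν * eta μ μ * eta β β)) •
        hSymbol (symbolConj (u α ν s) • v μ β ν + symbolConj (v μ β ν s) • u α ν)) := by
    refine HasVariation.smul _ (HasVariation.sum _ fun α _ => HasVariation.sum _ fun β _ =>
      HasVariation.sum _ fun γ _ => HasVariation.sum _ fun δ _ => HasVariation.smul _ ?_)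
    rw [einstein_eq_hSymbol, dh_eq_hSymbol]
    exact HasVariation.hSymbol_mul s (u β δ) (v α γ δ)
  rw [h.eq]
  simp only [← map_smul, ← map_sum]
  congr 1
  funext t
  simp only [Finset.sum_apply, Pi.smul_apply, Pi.add_apply, smul_eq_mul]
  simp only [Algebra.smul_def, hu, hv, symbolConj_einsteinR, map_mul symbolConj, symbolConj_X,
    map_symUnit, csForm, curlPair, ← Finset.sum_sub_distrib]
  refine congrArg (algebraMap ℝ (Symbol n) (1 / 2) * ·) ?_
  refine Finset.sum_congr rfl fun α _ => Finset.sum_congr rfl fun β _ =>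
    Finset.sum_congr rfl fun γ _ => Finset.sum_congr rfl fun δ _ => ?_
  ring

/-! ### Three dimensions: explicit components and the Cotton tensor. -/

section

variable {R : Type*} [CommRing R] [Algebra ℝ R] (x : Fin 3 → R) {T h : Fin 3 → Fin 3 → R}

lemma curlPair_three (A B : Fin 3 → Fin 3 → R) : curlPair x A B =
    (x 0 * (A 1 0 * B 2 0 - A 2 0 * B 1 0) + x 1 * (A 2 0 * B 0 0 - A 0 0 * B 2 0) +
      x 2 * (A 0 0 * B 1 0 - A 1 0 * B 0 0)) -
    (x 0 * (A 1 1 * B 2 1 - A 2 1 * B 1 1) + x 1 * (A 2 1 * B 0 1 - A 0 1 * B 2 1) +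
      x 2 * (A 0 1 * B 1 1 - A 1 1 * B 0 1)) -
    (x 0 * (A 1 2 * B 2 2 - A 2 2 * B 1 2) + x 1 * (A 2 2 * B 0 2 - A 0 2 * B 2 2) +
      x 2 * (A 0 2 * B 1 2 - A 1 2 * B 0 2)) := by
  simp only [curlPair, Fin.sum_univ_three, epsilon3, eta]
  norm_num
  ring

lemma boxR_three : boxR x = -(x 0 * x 0) + x 1 * x 1 + x 2 * x 2 := by
  simp [boxR, Fin.sum_univ_three, etaR, eta]

/-- Fully expanded components turn every identity below, including the divergence-freeness of the
Einstein tensor, into a polynomial identity. -/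
lemma einsteinR_three (hT : ∀ α β, T α β = T β α) :
    einsteinR x T 0 0 = algebraMap ℝ R (1 / 2) *
      (2 * (T 1 2 * x 1 * x 2) - T 1 1 * x 2 * x 2 - T 2 2 * x 1 * x 1) ∧
    einsteinR x T 1 1 = algebraMap ℝ R (1 / 2) *
      (2 * (T 0 2 * x 0 * x 2) - T 0 0 * x 2 * x 2 - T 2 2 * x 0 * x 0) ∧
    einsteinR x T 2 2 = algebraMap ℝ R (1 / 2) *
      (2 * (T 0 1 * x 0 * x 1) - T 0 0 * x 1 * x 1 - T 1 1 * x 0 * x 0) ∧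
    einsteinR x T 0 1 = algebraMap ℝ R (1 / 2) * (-(T 0 1 * x 2 * x 2) + T 0 2 * x 1 * x 2 +
      T 1 2 * x 0 * x 2 - T 2 2 * x 0 * x 1) ∧
    einsteinR x T 0 2 = algebraMap ℝ R (1 / 2) * (T 0 1 * x 1 * x 2 - T 0 2 * x 1 * x 1 -
      T 1 1 * x 0 * x 2 + T 1 2 * x 0 * x 1) ∧
    einsteinR x T 1 2 = algebraMap ℝ R (1 / 2) * (T 0 0 * x 1 * x 2 - T 0 1 * x 0 * x 2 -
      T 0 2 * x 0 * x 1 + T 1 2 * x 0 * x 0) := by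
  have h2 := algebraMap_half_mul_two R
  set a := algebraMap ℝ R (1 / 2) with ha
  have hr : ∀ β ν, ricciR x T β ν = -a * (boxR x * T β ν +
      x β * x ν * (-T 0 0 + T 1 1 + T 2 2) -
      x ν * (-(x 0 * T 0 β) + x 1 * T 1 β + x 2 * T 2 β) -
      x β * (-(x 0 * T 0 ν) + x 1 * T 1 ν + x 2 * T 2 ν)) := fun β ν => by
    rw [ricciR_eq x hT, map_neg, ← ha]
    simp [Fin.sum_univ_three, etaR, eta]
  have hs : scalarR x T = -ricciR x T 0 0 + ricciR x T 1 1 + ricciR x T 2 2 := by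
    simp [scalarR, Fin.sum_univ_three, etaR, eta]
  have e0 : etaR R (0 : Fin 3) 0 = -1 := by simp [etaR, eta]
  have e1 : etaR R (1 : Fin 3) 1 = 1 := by simp [etaR, eta]
  have e2 : etaR R (2 : Fin 3) 2 = 1 := by simp [etaR, eta]
  have e3 : etaR R (0 : Fin 3) 1 = 0 := etaR_of_ne (by decide)
  have e4 : etaR R (0 : Fin 3) 2 = 0 := etaR_of_ne (by decide)
  have e5 : etaR R (1 : Fin 3) 2 = 0 := etaR_of_ne (by decide)
  simp only [einsteinR, hs, hr, e0, e1, e2, e3, e4, e5, boxR_three, hT 1 0, hT 2 0, hT 2 1, ← ha]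
  refine ⟨?_, ?_, ?_, ?_, ?_, ?_⟩
  · linear_combination (a * ((-(x 0 * x 0) + x 1 * x 1 + x 2 * x 2) * T 0 0 +
        x 0 * x 0 * (-T 0 0 + T 1 1 + T 2 2) -
        2 * x 0 * (-(x 0 * T 0 0) + x 1 * T 0 1 + x 2 * T 0 2) +
        (2 * (T 1 2 * x 1 * x 2) - T 1 1 * x 2 * x 2 - T 2 2 * x 1 * x 1))) * h2
  · linear_combination (a * ((-(x 0 * x 0) + x 1 * x 1 + x 2 * x 2) * T 1 1 +
        x 1 * x 1 * (-T 0 0 + T 1 1 + T 2 2) -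
        2 * x 1 * (-(x 0 * T 0 1) + x 1 * T 1 1 + x 2 * T 1 2) +
        (2 * (T 0 2 * x 0 * x 2) - T 0 0 * x 2 * x 2 - T 2 2 * x 0 * x 0))) * h2
  · linear_combination (a * ((-(x 0 * x 0) + x 1 * x 1 + x 2 * x 2) * T 2 2 +
        x 2 * x 2 * (-T 0 0 + T 1 1 + T 2 2) -
        2 * x 2 * (-(x 0 * T 0 2) + x 1 * T 1 2 + x 2 * T 2 2) +
        (2 * (T 0 1 * x 0 * x 1) - T 0 0 * x 1 * x 1 - T 1 1 * x 0 * x 0))) * h2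
  · ring
  · ring
  · ring

/-- This is the self-adjointness of the third-order Cotton operator; the sign reflects its odd
order. It makes the two terms of `csForm` equal. -/
lemma curlPair_einsteinR_comm (hT : ∀ α β, T α β = T β α) (hh : ∀ α β, h α β = h β α) :
    curlPair x (einsteinR x h) T = -curlPair x (einsteinR x T) h := by
  obtain ⟨t1, t2, t3, t4, t5, t6⟩ := einsteinR_three x hT
  obtain ⟨h1, h2, h3, h4, h5, h6⟩ := einsteinR_three x hh
  rw [curlPair_three, curlPair_three]
  simp only [einsteinR_comm x hT 1 0, einsteinR_comm x hT 2 0, einsteinR_comm x hT 2 1,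
    einsteinR_comm x hh 1 0, einsteinR_comm x hh 2 0, einsteinR_comm x hh 2 1, t1, t2, t3, t4, t5,
    t6, h1, h2, h3, h4, h5, h6, hT 1 0, hT 2 0, hT 2 1, hh 1 0, hh 2 0, hh 2 1]
  ring

lemma csForm_eq (hT : ∀ α β, T α β = T β α) (hh : ∀ α β, h α β = h β α) :
    csForm x T h = curlPair x (einsteinR x T) h := by
  have h2 := algebraMap_half_mul_two R
  rw [csForm, curlPair_einsteinR_comm x hT hh]
  linear_combination curlPair x (einsteinR x T) h * h2

lemma csForm_gaugeR (hh : ∀ α β, h α β = h β α) (v : Fin 3 → R) (σ : R) :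
    csForm x (gaugeR x v σ) h = 0 := by
  rw [csForm_eq x (gaugeR_comm x v σ) hh]
  obtain ⟨t1, t2, t3, t4, t5, t6⟩ := einsteinR_three x (gaugeR_comm x v σ)
  have e0 : etaR R (0 : Fin 3) 0 = -1 := by simp [etaR, eta]
  have e1 : etaR R (1 : Fin 3) 1 = 1 := by simp [etaR, eta]
  have e2 : etaR R (2 : Fin 3) 2 = 1 := by simp [etaR, eta]
  have e3 : etaR R (0 : Fin 3) 1 = 0 := etaR_of_ne (by decide)
  have e4 : etaR R (0 : Fin 3) 2 = 0 := etaR_of_ne (by decide)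
  have e5 : etaR R (1 : Fin 3) 2 = 0 := etaR_of_ne (by decide)
  rw [curlPair_three]
  simp only [einsteinR_comm x (gaugeR_comm x v σ) 1 0, einsteinR_comm x (gaugeR_comm x v σ) 2 0,
    einsteinR_comm x (gaugeR_comm x v σ) 2 1, t1, t2, t3, t4, t5, t6, hh 1 0, hh 2 0, hh 2 1]
  simp only [gaugeR, e0, e1, e2, e3, e4, e5]
  ring

/-- The Schouten tensor in three dimensions, as a function of the Einstein tensor. -/
def schoutenR (T : Fin 3 → Fin 3 → R) (β ν : Fin 3) : R :=
  einsteinR x T β ν - algebraMap ℝ R (1 / 2) * etaR R β ν *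
    (-einsteinR x T 0 0 + einsteinR x T 1 1 + einsteinR x T 2 2)

/-- Contracting the hypothesis with x gives □S_βν = x_β W_ν. A second contraction, using the
symmetry of S, gives □W_ν = x_ν Y. Thus □²S_βν = x_β x_ν Y. On the other hand S is -½□T up to
derivative and metric terms, so □³T is pure gauge. -/
lemma exists_gaugeR_of_schoutenR (hT : ∀ α β, T α β = T β α)
    (hA : ∀ α β ν, x α * schoutenR x T β ν = x β * schoutenR x T α ν) : ∃ (v : Fin 3 → R) (σ : R),
      ∀ α β, boxR x ^ 3 * T α β = gaugeR x v σ α β := by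
  have h2 := algebraMap_half_mul_two R
  set S := schoutenR x T with hS
  have hSc : ∀ β ν, S β ν = S ν β := fun β ν => by
    rw [hS, schoutenR, schoutenR, einsteinR_comm x hT, etaR_comm]
  set W : Fin 3 → R := fun ν => -(x 0 * S 0 ν) + x 1 * S 1 ν + x 2 * S 2 ν with hW
  have h3 : ∀ β ν, boxR x * S β ν = x β * W ν := fun β ν => by
    rw [boxR_three]
    linear_combination -x 0 * hA 0 β ν + x 1 * hA 1 β ν + x 2 * hA 2 β ν
  set Y : R := -(x 0 * W 0) + x 1 * W 1 + x 2 * W 2 with hY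
  have h4 : ∀ ν, boxR x * W ν = x ν * Y := fun ν => by
    have h5 : W ν = -(x 0 * S ν 0) + x 1 * S ν 1 + x 2 * S ν 2 := by
      rw [hSc ν 0, hSc ν 1, hSc ν 2]
    rw [h5]
    linear_combination -x 0 * h3 ν 0 + x 1 * h3 ν 1 + x 2 * h3 ν 2
  have h5 : ∀ β ν, boxR x ^ 2 * S β ν = x β * x ν * Y := fun β ν => by
    linear_combination boxR x * h3 β ν + x β * h4 ν
  set t : R := ∑ α, etaR R α α * T α α with ht
  set w : Fin 3 → R := fun β => ∑ α, etaR R α α * (x α * T α β) with hw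
  -- The terms with w and t come from the Ricci tensor, the term with Y from □²S, and σ collects the
  -- metric terms in the Einstein and Schouten tensors.
  refine ⟨fun ν => boxR x ^ 2 * (w ν - algebraMap ℝ R (1 / 2) * (x ν * t)) - x ν * Y,
    -2 * (boxR x ^ 2 * (algebraMap ℝ R (1 / 2) * (scalarR x T +
      (-einsteinR x T 0 0 + einsteinR x T 1 1 + einsteinR x T 2 2)))), fun β ν => ?_⟩
  have hR := ricciR_eq x hT β ν
  rw [map_neg, ← ht, show ∑ α, etaR R α α * (x α * T α β) = w β from rfl,
    show ∑ α, etaR R α α * (x α * T α ν) = w ν from rfl] at hR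
  have hS' := h5 β ν
  rw [show S β ν = einsteinR x T β ν - algebraMap ℝ R (1 / 2) * etaR R β ν *
    (-einsteinR x T 0 0 + einsteinR x T 1 1 + einsteinR x T 2 2) from rfl,
    show einsteinR x T β ν = ricciR x T β ν - algebraMap ℝ R (1 / 2) * etaR R β ν * scalarR x T
      from rfl] at hS'
  rw [gaugeR]
  linear_combination 2 * boxR x ^ 2 * hR - boxR x ^ 2 * (boxR x * T β ν + x β * x ν * t -
    x ν * w β - x β * w ν) * h2 + boxR x ^ 2 * x β * x ν * t * h2 - 2 * hS'

end

/-- The field equations are the symmetric part of the curl of the Einstein tensor G. Its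
antisymmetric part involves only the divergence of G and vanishes identically. Together they say
that the curl of the Schouten tensor is zero. -/
lemma schoutenR_of_csForm {x : Fin 3 → Symbol 3} {T : Fin 3 → Fin 3 → Symbol 3}
    (hT : ∀ α β, T α β = T β α) (h : ∀ s, csForm x T (symUnit s) = 0) (α β ν : Fin 3) :
    x α * schoutenR x T β ν = x β * schoutenR x T α ν := by
  have h2 := algebraMap_half_mul_two (Symbol 3)
  set G := einsteinR x T with hG
  have hGc : ∀ α β, G α β = G β α := einsteinR_comm x hT
  obtain ⟨t1, t2, t3, t4, t5, t6⟩ := einsteinR_three x hT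
  rw [← hG] at t1 t2 t3 t4 t5 t6
  have hC : ∀ s, curlPair x G (symUnit s) = 0 := fun s => by
    rw [hG, ← csForm_eq x hT (symUnit_comm s), h]
  have c00 : x 1 * G 0 2 - x 2 * G 0 1 = 0 := by
    rw [← hC s(0, 0), curlPair_three]
    simp [symUnit, hGc 1 0, hGc 2 0, hGc 2 1]
    ring
  have c01 : -(x 0 * G 0 2) + x 2 * G 0 0 - (x 1 * G 1 2 - x 2 * G 1 1) = 0 := by
    rw [← hC s(0, 1), curlPair_three]
    simp [symUnit, hGc 1 0, hGc 2 0, hGc 2 1]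
    ring
  have c02 : x 0 * G 0 1 - x 1 * G 0 0 - (x 1 * G 2 2 - x 2 * G 1 2) = 0 := by
    rw [← hC s(0, 2), curlPair_three]
    simp [symUnit, hGc 1 0, hGc 2 0, hGc 2 1]
    ring
  have c11 : x 0 * G 1 2 - x 2 * G 0 1 = 0 := by
    rw [← hC s(1, 1), curlPair_three]
    simp [symUnit, hGc 1 0, hGc 2 0, hGc 2 1]
    ring
  have c12 : -(x 0 * G 1 1 - x 1 * G 0 1) - (-(x 0 * G 2 2) + x 2 * G 0 2) = 0 := by
    rw [← hC s(1, 2), curlPair_three]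
    simp [symUnit, hGc 1 0, hGc 2 0, hGc 2 1]
    ring
  have c22 : -(x 0 * G 1 2 - x 1 * G 0 2) = 0 := by
    rw [← hC s(2, 2), curlPair_three]
    simp [symUnit, hGc 1 0, hGc 2 0, hGc 2 1]
    ring
  set a := algebraMap ℝ (Symbol 3) (1 / 2) with ha
  have hd : ∀ β, schoutenR x T β β = G β β - a * etaR _ β β * (-G 0 0 + G 1 1 + G 2 2) := fun _ => rfl
  have ho : ∀ {β ν}, β ≠ ν → schoutenR x T β ν = G β ν := fun hβ => by
    rw [schoutenR, etaR_of_ne hβ, mul_zero, zero_mul, sub_zero]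
  have e0 : etaR (Symbol 3) (0 : Fin 3) 0 = -1 := by simp [etaR, eta]
  have e1 : etaR (Symbol 3) (1 : Fin 3) 1 = 1 := by simp [etaR, eta]
  have e2 : etaR (Symbol 3) (2 : Fin 3) 2 = 1 := by simp [etaR, eta]
  have s00 := hd 0
  have s11 := hd 1
  have s22 := hd 2
  rw [e0] at s00
  rw [e1] at s11
  rw [e2] at s22
  have s01 : schoutenR x T 0 1 = G 0 1 := ho (by decide)
  have s10 : schoutenR x T 1 0 = G 0 1 := (ho (by decide)).trans (hGc 1 0)
  have s02 : schoutenR x T 0 2 = G 0 2 := ho (by decide)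
  have s20 : schoutenR x T 2 0 = G 0 2 := (ho (by decide)).trans (hGc 2 0)
  have s12 : schoutenR x T 1 2 = G 1 2 := ho (by decide)
  have s21 : schoutenR x T 2 1 = G 1 2 := (ho (by decide)).trans (hGc 2 1)
  have h01 : ∀ ν, x 0 * schoutenR x T 1 ν = x 1 * schoutenR x T 0 ν := fun ν => by
    match ν with
    | 0 =>
      rw [s10, s00]
      simp only [t1, t2, t3, t4, t5, t6] at c02 ⊢
      -- Up to the field equation and the relation 2a = 1, the difference of both sides is a
      -- multiple of the divergence of the Einstein tensor. It disappears once the components are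
      -- substituted. The other diagonal cases work in the same way.
      linear_combination (norm := (simp only [t1, t2, t3, t4, t5, t6]; ring)) a * c02 -
        (x 0 * G 0 1 - x 1 * G 0 0) * h2
    | 1 =>
      rw [s11, s01]
      simp only [t1, t2, t3, t4, t5, t6] at c12 ⊢
      linear_combination (norm := (simp only [t1, t2, t3, t4, t5, t6]; ring)) -a * c12 -
        (x 0 * G 1 1 - x 1 * G 0 1) * h2
    | 2 => linear_combination x 0 * s12 - x 1 * s02 + (-1) * c22
  have h02 : ∀ ν, x 0 * schoutenR x T 2 ν = x 2 * schoutenR x T 0 ν := fun ν => by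
    match ν with
    | 0 =>
      rw [s20, s00]
      simp only [t1, t2, t3, t4, t5, t6] at c01 ⊢
      linear_combination (norm := (simp only [t1, t2, t3, t4, t5, t6]; ring)) -a * c01 -
        (x 0 * G 0 2 - x 2 * G 0 0) * h2
    | 1 => linear_combination x 0 * s21 - x 2 * s01 + c11
    | 2 =>
      rw [s22, s02]
      simp only [t1, t2, t3, t4, t5, t6] at c12 ⊢
      linear_combination (norm := (simp only [t1, t2, t3, t4, t5, t6]; ring)) a * c12 -
        (x 0 * G 2 2 - x 2 * G 0 2) * h2
  have h12 : ∀ ν, x 1 * schoutenR x T 2 ν = x 2 * schoutenR x T 1 ν := fun ν => by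
    match ν with
    | 0 => linear_combination x 1 * s20 - x 2 * s10 + c00
    | 1 =>
      rw [s21, s11]
      simp only [t1, t2, t3, t4, t5, t6] at c01 ⊢
      linear_combination (norm := (simp only [t1, t2, t3, t4, t5, t6]; ring)) -a * c01 -
        (x 1 * G 1 2 - x 2 * G 1 1) * h2
    | 2 =>
      rw [s22, s12]
      simp only [t1, t2, t3, t4, t5, t6] at c02 ⊢
      linear_combination (norm := (simp only [t1, t2, t3, t4, t5, t6]; ring)) -a * c02 -
        (x 1 * G 2 2 - x 2 * G 1 2) * h2
  fin_cases α <;> fin_cases β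
  · rfl
  · exact h01 ν
  · exact h02 ν
  · exact (h01 ν).symm
  · rfl
  · exact h12 ν
  · exact (h02 ν).symm
  · exact (h12 ν).symm
  · rfl

theorem isConformalForm_csForm : IsConformalForm (n := 3) 3 csForm where
  mul_add x c T T' h := by
    have h1 : einsteinR x (fun α β => c * T α β + T' α β) =
        fun α β => c * einsteinR x T α β + einsteinR x T' α β := by
      funext α β; exact einsteinR_mul_add x c T T' α β
    rw [csForm, h1, curlPair_mul_add_left, curlPair_mul_add_right, csForm, csForm]
    ring
  map φ x T h := by
    simp only [csForm, curlPair, einsteinR, map_mul, map_sub, map_sum, AlgHom.commutes, map_etaR,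
      map_ricciR, map_scalarR]
  scale c x T h := by
    simp only [csForm, curlPair, einsteinR_scale, ← Finset.sum_sub_distrib, Finset.mul_sum]
    refine Finset.sum_congr rfl fun α _ => Finset.sum_congr rfl fun β _ =>
      Finset.sum_congr rfl fun γ _ => Finset.sum_congr rfl fun δ _ => ?_
    ring
  pos := by norm_num
  gauge x v σ h hh := csForm_gaugeR x hh v σ
  kernel x T hT h := ⟨3, exists_gaugeR_of_schoutenR x hT (schoutenR_of_csForm hT h)⟩
  variation s := by
    rw [freeLagrangian, if_pos rfl, componentEL_chernSimonsLagrangian]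

/-- The interface between the Lagrangians and the cohomological argument: from here on only these
properties of D are used. -/
theorem exists_koszulTate_eq_linKT (hn : n = 3 ∨ (4 ≤ n ∧ Even n)) :
    ∃ D : JetSpace n (Sym2 (Fin n)) →ₗ[ℝ] JetSpace n (Sym2 (Fin n)), koszulTate = linKT D ∧
      IsRegularSystem D ∧ IsHomogeneousSystem D ∧ ∀ μ, IsTorsionFree D μ := by
  have h3 : 3 ≤ n := by omega
  have key : ∀ {N : ℕ} {Z : (Fin n → Symbol n) → (Fin n → Fin n → Symbol n) →
      (Fin n → Fin n → Symbol n) → Symbol n}, IsConformalForm N Z →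
      ∃ D : JetSpace n (Sym2 (Fin n)) →ₗ[ℝ] JetSpace n (Sym2 (Fin n)), koszulTate = linKT D ∧
        IsRegularSystem D ∧ IsHomogeneousSystem D ∧ ∀ μ, IsTorsionFree D μ := fun hZ =>
    ⟨ofSymbolMap (formOperator hZ), koszulTate_eq_linKT (tensorEL_eq_formOperator hZ),
      isRegularSystem_formOperator h3 hZ, isHomogeneousSystem_formOperator hZ,
      isTorsionFree_formOperator h3 hZ⟩
  rcases hn with rfl | ⟨h4, -⟩
  · exact key isConformalForm_csForm
  · exact key (isConformalForm_weylForm (by omega) h4)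

variable {m : ℕ}

/-! ### Top forms and currents -/

lemma alternatingMap_sum_apply {M N ι κ : Type*} [AddCommMonoid M] [Module ℝ M] [AddCommMonoid N]
    [Module ℝ N] (t : Finset κ) (f : κ → M [⋀^ι]→ₗ[ℝ] N) (v : ι → M) :
    (∑ i ∈ t, f i) v = ∑ i ∈ t, f i v := by
  classical
  induction t using Finset.induction_on with
  | empty => simp
  | insert i t hi ih => rw [Finset.sum_insert hi, Finset.sum_insert hi, AlternatingMap.add_apply, ih]

lemma topForm_apply_basis (f : LocalFun n) : topForm f (Pi.basisFun ℝ (Fin n)) = f := by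
  rw [topForm, LinearMap.compAlternatingMap_apply, Module.Basis.det_self,
    LinearMap.toSpanSingleton_apply, one_smul]

lemma ext_topForm {v w : LocalForm n n}
    (h : v (Pi.basisFun ℝ (Fin n)) = w (Pi.basisFun ℝ (Fin n))) : v = w := by
  refine Module.Basis.ext_alternating (Pi.basisFun ℝ (Fin n)) fun σ hσ => ?_
  have h1 : ∀ w : LocalForm n n, w (fun i => Pi.basisFun ℝ (Fin n) (σ i)) =
      Equiv.Perm.sign (Equiv.ofBijective σ (Finite.injective_iff_bijective.1 hσ)) •
        w (Pi.basisFun ℝ (Fin n)) := fun w => by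
    rw [← AlternatingMap.map_perm]
    rfl
  rw [h1, h1, h]

lemma eq_topForm (w : LocalForm n n) : w = topForm (w (Pi.basisFun ℝ (Fin n))) :=
  ext_topForm (topForm_apply_basis _).symm

lemma formDelta_topForm (f : LocalFun n) : formDelta (topForm f) = topForm (koszulTate f) :=
  ext_topForm (by
    rw [topForm_apply_basis, formDelta, LinearMap.compAlternatingMap_apply, topForm_apply_basis])

lemma topForm_add (f g : LocalFun n) : topForm (f + g) = topForm f + topForm g :=
  ext_topForm (by rw [AlternatingMap.add_apply]; simp only [topForm_apply_basis])

lemma topForm_injective {f g : LocalFun n} (h : topForm f = topForm g) : f = g := by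
  rw [← topForm_apply_basis f, h, topForm_apply_basis]

lemma hasAntifieldNumber_topForm {k : ℕ} {f : LocalFun n} :
    HasAntifieldNumber k (topForm f) ↔ f ∈ afSpace n k := by
  rw [mem_afSpace, ← antifieldCount_eq, HasAntifieldNumber]
  constructor
  · intro h
    have := DFunLike.congr_fun h (⇑(Pi.basisFun ℝ (Fin n)))
    rwa [LinearMap.compAlternatingMap_apply, AlternatingMap.smul_apply, topForm_apply_basis] at this
  · intro h
    refine ext_topForm ?_
    rw [LinearMap.compAlternatingMap_apply, AlternatingMap.smul_apply, topForm_apply_basis, h]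

/-- The components of the current dual to a form of degree one below the top. -/
def currentOf (V : LocalForm (m + 1) m) (μ : Fin (m + 1)) : LocalFun (m + 1) :=
  (-1 : ℤ) ^ (μ : ℕ) • V (μ.removeNth (Pi.basisFun ℝ (Fin (m + 1))))

/-- The signs of the alternating sum are absorbed in `currentOf`, so d becomes the divergence of the
dual current and the problem becomes one about functions. -/
lemma horizontalD_eq_topForm (V : LocalForm (m + 1) m) :
    horizontalD V = topForm (divergence (currentOf V)) := by
  refine ext_topForm ?_
  rw [topForm_apply_basis, horizontalD, AlternatingMap.alternatizeUncurryFin_apply,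
    divergence_apply]
  refine Finset.sum_congr rfl fun μ _ => ?_
  rw [currentOf, map_zsmul, LinearMap.sum_apply, alternatingMap_sum_apply]
  rw [Finset.sum_eq_single μ]
  · simp
  · intro ν _ hν
    simp [hν]
  · simp

/-- The form dual to a current. -/
def formOf (j : Fin (m + 1) → LocalFun (m + 1)) : LocalForm (m + 1) m :=
  ∑ μ : Fin (m + 1), (LinearMap.toSpanSingleton ℝ (LocalFun (m + 1))
    ((-1 : ℤ) ^ (μ : ℕ) • j μ)).compAlternatingMap
      ((Pi.basisFun ℝ (Fin m)).det.compLinearMap (LinearMap.funLeft ℝ ℝ μ.succAbove))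

lemma hasAntifieldNumber_formOf {k : ℕ} {j : Fin (m + 1) → LocalFun (m + 1)}
    (hj : ∀ μ, j μ ∈ afSpace (m + 1) k) : HasAntifieldNumber k (formOf j) := by
  refine AlternatingMap.ext fun v => ?_
  rw [LinearMap.compAlternatingMap_apply, AlternatingMap.smul_apply, antifieldCount_eq,
    ← mem_afSpace, formOf, alternatingMap_sum_apply]
  refine sum_mem fun μ _ => ?_
  rw [LinearMap.compAlternatingMap_apply, LinearMap.toSpanSingleton_apply]
  exact Submodule.smul_mem _ _ (zsmul_mem (hj μ) _)

lemma currentOf_formOf (j : Fin (m + 1) → LocalFun (m + 1)) : currentOf (formOf j) = j := by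
  funext μ
  rw [currentOf, formOf, alternatingMap_sum_apply, Finset.sum_eq_single μ]
  · rw [LinearMap.compAlternatingMap_apply, AlternatingMap.compLinearMap_apply]
    have h : (fun i => LinearMap.funLeft ℝ ℝ μ.succAbove
        (μ.removeNth (Pi.basisFun ℝ (Fin (m + 1))) i)) = Pi.basisFun ℝ (Fin m) := by
      funext i k
      simp [Fin.removeNth, LinearMap.funLeft_apply, Pi.single_apply]
    rw [h, Module.Basis.det_self, LinearMap.toSpanSingleton_apply, one_smul, smul_smul, ← mul_pow]
    simp
  · intro ν _ hν
    rw [LinearMap.compAlternatingMap_apply, AlternatingMap.compLinearMap_apply]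
    -- For ν ≠ μ the vector e_ν is among the arguments, and it becomes zero after its coordinate ν
    -- is dropped.
    obtain ⟨k, hk⟩ := Fin.exists_succAbove_eq hν
    rw [AlternatingMap.map_coord_zero _ k, map_zero]
    funext i
    simp [Fin.removeNth, LinearMap.funLeft_apply, hk, Fin.succAbove_ne]
  · simp

lemma horizontalD_formOf (j : Fin (m + 1) → LocalFun (m + 1)) :
    horizontalD (formOf j) = topForm (divergence j) := by
  rw [horizontalD_eq_topForm, currentOf_formOf]

/-! ### The characteristic cohomology of linearized conformal gravity -/

lemma Cstar_mem_afSpace (μ : Fin n) : Cstar μ ∈ afSpace n 2 := by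
  have := gs_mul_mem_afSpace (Finsupp.single (some μ, 0) 1) (one_mem_afSpace (n := n))
  rwa [mul_one, gs_single, one_smul] at this

lemma hs_mem_afSpace (y : JetSpace n (Sym2 (Fin n))) : hs y ∈ afSpace n 1 := by
  have := hs_mul_mem_afSpace y (one_mem_afSpace (n := n))
  rwa [mul_one] at this

lemma linKT_Cstar (D : JetSpace n (Sym2 (Fin n)) →ₗ[ℝ] JetSpace n (Sym2 (Fin n))) (μ : Fin n) :
    linKT D (Cstar μ) = (-2 : ℝ) • divergence (fun ν => hs (Finsupp.single (s(μ, ν), 0) 1)) := by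
  have h := linKT_gs_mul (D := D) (Finsupp.single (some μ, 0) 1) 1
  rw [mul_one, mul_one, gs_single, one_smul, linKT_one, mul_zero, add_zero] at h
  have h1 : ∀ ν, totalDeriv ν (hs (Finsupp.single (s(μ, ν), 0) 1)) =
      hs (Finsupp.single (s(μ, ν), raise 0 ν) 1) := fun ν => by
    have := totalDeriv_hs_mul ν (Finsupp.single (s(μ, ν), 0) 1) (1 : LocalFun n)
    rwa [mul_one, mul_one, totalDeriv_one, mul_zero, add_zero, jetShift_single] at this
  rw [divergence_apply]
  simp only [h1]
  refine h.trans ?_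
  simp [noetherMap, Finsupp.linearCombination_single]

end ConformalGravity

end

/-! ### The theorem for local forms. -/

theorem mainTheorem7 (m : ℕ) (hm : m + 1 = 3 ∨ (4 ≤ m + 1 ∧ Even (m + 1))) :
    (∀ lam : Fin (m + 1) → ℝ,
      ConformalGravity.IsCocycle2
        (ConformalGravity.topForm (∑ μ, lam μ • ConformalGravity.Cstar μ))) ∧
    (∀ a : ConformalGravity.LocalForm (m + 1) (m + 1), ConformalGravity.IsCocycle2 a →
      ∃ lam : Fin (m + 1) → ℝ,
        ConformalGravity.IsCoboundary2
          (a - ConformalGravity.topForm (∑ μ, lam μ • ConformalGravity.Cstar μ))) ∧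
    (∀ lam : Fin (m + 1) → ℝ,
      ConformalGravity.IsCoboundary2
        (ConformalGravity.topForm (∑ μ, lam μ • ConformalGravity.Cstar μ)) → lam = 0) := by
  open ConformalGravity in
  obtain ⟨D, hKT, hD, hh, hμ⟩ := exists_koszulTate_eq_linKT hm
  refine ⟨fun lam => ⟨?_, ?_⟩, fun a ha => ?_, fun lam hlam => ?_⟩
  · exact hasAntifieldNumber_topForm.2 (sum_mem fun μ _ =>
      Submodule.smul_mem _ _ (Cstar_mem_afSpace μ))
  -- The current 2 λ_μ h^{*μν} cancels the factor -2 in δC^{*μ}.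
  · refine ⟨formOf (∑ μ, (2 * lam μ) • fun ν => hs (Finsupp.single (s(μ, ν), 0) 1)),
      hasAntifieldNumber_formOf fun ν => ?_, ?_⟩
    · rw [Finset.sum_apply]
      exact sum_mem fun μ _ => Submodule.smul_mem _ _ (hs_mem_afSpace _)
    · rw [formDelta_topForm, horizontalD_formOf, ← topForm_add, hKT, map_sum, map_sum,
        ← Finset.sum_add_distrib, Finset.sum_eq_zero]
      · exact ext_topForm (topForm_apply_basis _)
      · intro μ _
        rw [map_smul, map_smul, linKT_Cstar, smul_smul, ← add_smul,
          show lam μ * -2 + 2 * lam μ = 0 by ring, zero_smul]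
  · obtain ⟨ha2, V, hV, h⟩ := ha
    rw [eq_topForm a] at ha2 h ⊢
    rw [formDelta_topForm, horizontalD_eq_topForm, ← topForm_add, hKT] at h
    have h' : linKT D (a (Pi.basisFun ℝ (Fin (m + 1)))) + divergence (currentOf V) = 0 := by
      rw [← topForm_apply_basis (_ + _), h, AlternatingMap.zero_apply]
    -- Torsion-freeness is needed in one direction only; the time direction 0 is chosen.
    obtain ⟨c, b, hb, j, hj, hab⟩ := exists_eq_add_linKT_add_divergence (by omega) hD hh (hμ 0)
      (hasAntifieldNumber_topForm.1 ha2) h'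
    refine ⟨c, topForm b, formOf j, hasAntifieldNumber_topForm.2 hb, hasAntifieldNumber_formOf hj, ?_⟩
    rw [hab, formDelta_topForm, horizontalD_formOf, hKT, topForm_add, topForm_add]
    abel
  -- The antifield numbers of b and c are not needed for independence, since the Euler–Lagrange
  -- derivative treats all of them at once.
  · obtain ⟨b, c, -, -, h⟩ := hlam
    rw [eq_topForm b, formDelta_topForm, horizontalD_eq_topForm, ← topForm_add, hKT] at h
    exact eq_zero_of_sum_Cstar_eq hD.shift (topForm_injective h)
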